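/- **Setting.** Let $q_a=e^{\varepsilon_a}$ ($a\in\{1,2,3,4\}$) satisfy $q_1q_2q_3q_4=1$ and no other multiplicative relation, let $K=e^{\kappa}$ not be a monomial in the $q_a$, and let $x=e^{\xi}$. Put $\mathbf P_a=1-q_a$, $\mathbf P_a^{\vee}=1-q_a^{-1}$, $\mathbf P_S=\prod_{a\in S}\mathbf P_a$, $\bar a=\{1,2,3,4\}\setminus\{a\}$, and let $X^{[n]}$ denote the substitution $q_a\mapsto q_a^n$. For a virtual character, $\mathbb I[\sum_w n_w w]=\prod_w(1-w^{-1})^{n_w}$ (after collecting equal weights), and $^\vee$ inverts all weights. Consider oscillators with $[\mathsf a_n,\mathsf a_m]=-\frac1n\mathbf P_{1234}^{[n]}\delta_{n+m,0}$ and zero modes with $[\partial_{\mathsf t},\mathsf t_0]=1$ and $\tilde{\mathsf t}_0$ central, acting on the Fock space with basis $e^{m\mathsf t_0}\prod_n \mathsf a_{-n}^{k_n}|0\rangle$ ($m\in\mathbb Z$), on which $\tilde{\mathsf t}_0$ is a scalar. The vertex operators are $$\mathsf A(y)=e^{\mathsf t_0}{:}e^{\sum_{n\ne0}\mathsf a_ny^{-n}}{:},\qquad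 \mathsf W_{\bar a}(y)=y^{-\log q_a\tilde{\mathsf t}_0}e^{-\log q_a\log(-q_a)\tilde{\mathsf t}_0}e^{-\log q_a\partial_{\mathsf t}}{:}e^{\sum_{n\neq 0}\mathsf a_ny^{-n}/\mathbf P_{\bar a}^{[-n]}}{:},$$ $$\mathsf Z(K,y)=y^{-\log K\tilde{\mathsf t}_0}e^{-\log K\log(-K)\tilde{\mathsf t}_0}e^{-\log K\partial_{\mathsf t}}{:}e^{\sum_{n\ne0}(1-K^{-n})\mathsf a_ny^{-n}/\mathbf P_{1234}^{[-n]}}{:},$$ with $\log q_a=\varepsilon_a$, $\log K=\kappa$, $\log(-q_a)=\varepsilon_a+\pi i$, $\log(-K)=\kappa+\pi i$, and logarithms of spectral parameters obtained by adding these to $\log x=\xi$. A box with coordinates $(i_1,\dots,i_4)$, $i_c\ge1$, has weight $\chi_x=x\prod_c q_c^{i_c-1}$; plane partitions $\pi$ for $\bar a$ consist of boxes with $i_a=1$. With $\mathbf\Pi,\boldsymbol\rho$ the sums of the weights of the boxes of a finite plane partition $\pi$, resp. solid partition $\rho$, define for $b\in\{1,2,3,4\}$ $$\widetilde{\mathcal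 Z}_{\bar a}[\pi,K]=\mathbb I\big[-\mathbf P_a^\vee(1-K^{-1})x^{-1}\mathbf\Pi+\mathbf P_{\bar a}^\vee\mathbf\Pi^\vee\mathbf\Pi\big],\quad \mathcal Z_{b}[\rho,K]=\mathbb I\big[-(1-K^{-1})x^{-1}\boldsymbol\rho+\mathbf P_{\bar b}^\vee\boldsymbol\rho^\vee\boldsymbol\rho\big],$$ $$\sigma_b(\rho)=\#\{(i_1,\dots,i_4)\in\rho:\ \text{the }i_c,\ c\ne b,\ \text{are all equal and smaller than } i_b\},$$ $$\Lambda^K_{\bar a,\pi}(x)={:}\tfrac{\mathsf W_{\bar a}(x)}{\mathsf W_{\bar a}(Kx)}\prod_{\square\in\pi}\mathsf A^{-1}(\chi_x(\square)){:},\quad \Lambda^K_\rho(x)={:}\mathsf Z(K,x)\prod_{\square\in\rho}\mathsf A^{-1}(\chi_x(\square)){:},$$ $$\mathsf T_{\bar a}(x\mid Kx)=\sum_\pi\mathfrak q^{|\pi|}\widetilde{\mathcal Z}_{\bar a}[\pi,K]\Lambda^K_{\bar a,\pi}(x),\qquad \mathsf T^K_{4}(x)=\sum_\rho\mathfrak q^{|\rho|}(-1)^{\sigma_b(\rho)}\mathcal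 Z_b[\rho,K]\Lambda^K_\rho(x).$$ **The product.** Fix a direction $a$, put $x_i=xq_a^{i-1}$, and for $N\ge0$ consider the radially ordered product $$\mathsf T_{\bar a}(x_N|Kx_N)\,r_N^{L_0}\cdots \mathsf T_{\bar a}(x_2|Kx_2)\,r_2^{L_0}\,\mathsf T_{\bar a}(x_1|Kx_1)\,r_1^{L_0},$$ where $L_0$ is the energy grading and the $r_i$ are formal variables (which makes the spectral parameters generic). Its one-loop factor is $\prod_{i<j\le N}f\big(\tfrac{x_i}{x_j}r_{i+1}\cdots r_j\big)$ with $$f(y)=\exp\Big(-\sum_{n>0}\frac1n\frac{\mathbf P_a^{[n]}\mathbf P_a^{[-n]}}{\mathbf P_{1234}^{[n]}}(1-K^n)(1-K^{-n})y^n\Big).$$ For a sequence $s_N$ such that $s_N=R(q_a^N)$ for all large $N$, with a rational function $R$ that is regular at $0$, call $R(0)$ its regularized limit (it is the ordinary limit if $|q_a|<1$). **Theorem.** For all $a,b\in\{1,2,3,4\}$: 1. For each $N$, each matrix element of each $\mathfrak q$-coefficient of the product, a power series in the $r_i$, is the one-loop factor times the expansion of a rational function of the $r_i$ that is regular at $r_1=\dots=r_N=1$.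 Let $M_N$ be the operator-valued power series in $\mathfrak q$ formed by the values there. 2. $M_N=\sum_\rho\mathfrak q^{|\rho|}c_N(\rho)\,{:}\prod_{i=1}^N\Lambda^K_{\bar a,\Pi^{(i)}}(x_i){:}$, the sum being over the solid partitions $\rho$ with at most $N$ layers $\Pi^{(1)}\succeq\Pi^{(2)}\succeq\cdots$ in direction $a$, and for each finite solid partition $\rho$ the coefficients $c_N(\rho)$ have, for $N\to\infty$, the regularized limit $(-1)^{\sigma_b(\rho)}\mathcal Z_b[\rho,K]$. Thus the product reproduces the magnificent four coefficients with their signs. 3. $\overleftarrow{\prod}_{i=1}^{\infty}\mathsf T_{\bar a}(xq_a^{i-1}\mid xq_a^{i-1}K)\simeq\mathsf T_4^K(x)$ in the following sense. The highest weights multiply to ${:}\prod_{i=1}^N\mathsf W_{\bar a}(x_i)/\mathsf W_{\bar a}(Kx_i){:}$, which equals ${:}\mathsf Z(K,x)/\mathsf Z(K,q_a^Nx){:}$; let $\mathsf Z_+(K,q_a^Nx)$ be the part of $\mathsf Z(K,q_a^Nx)$ made of its annihilation modes and zero modes. Then each matrix element of each $\mathfrak q$-coefficient of $M_N\,\mathsf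 Z_+(K,q_a^Nx)$ has, for $N\to\infty$, the corresponding matrix element of $\mathsf T_4^K(x)$ as its regularized limit. In particular the right-hand sides do not depend on the choice of $b$ (for instance $b=4$). -/

import Mathlib

noncomputable section

namespace QQ

/-! ## Parameters

`ε : Fin 4 → ℂ` are logarithms of the deformation parameters `q_a = exp (ε a)`, `κ` is a logarithm
of `K`, and `ξ` a logarithm of a spectral parameter `x = exp ξ`. Logarithms are carried along since
the zero modes of the vertex operators involve `log q_a`, `log K` and `log x`. The four directions
are `0, 1, 2, 3`, and boxes have coordinates starting at `0`. -/

/-- `exp z` as a unit. -/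
def expU (z : ℂ) : ℂˣ := Units.mk0 (Complex.exp z) (Complex.exp_ne_zero z)

/-- `log (q_1 ^ (n 1) ⋯ q_4 ^ (n 4))` for a box `n`. -/
def logBox (ε : Fin 4 → ℂ) (n : Fin 4 → ℕ) : ℂ := ∑ i, (n i : ℂ) * ε i

/-! ## Partitions -/

/-- A solid partition, as the finite set of its boxes. -/
def IsSolid (ρ : Finset (Fin 4 → ℕ)) : Prop := IsLowerSet (ρ : Set (Fin 4 → ℕ))

/-- A plane partition extending in the three directions other than `a`. -/
def IsPlane (a : Fin 4) (π : Finset (Fin 4 → ℕ)) : Prop :=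
  IsSolid π ∧ ∀ p ∈ π, p a = 0

open Classical in
/-- The solid partitions with `k` boxes (all coordinates of such boxes are smaller than `k`). -/
def solids (k : ℕ) : Finset (Finset (Fin 4 → ℕ)) :=
  ((Fintype.piFinset fun _ : Fin 4 => Finset.range k).powersetCard k).filter IsSolid

open Classical in
/-- The plane partitions with `k` boxes in the directions other than `a`. -/
def planes (a : Fin 4) (k : ℕ) : Finset (Finset (Fin 4 → ℕ)) :=
  (solids k).filter (IsPlane a)

/-- The `i`-th layer of `ρ` in direction `a`, moved to the hyperplane `p a = 0`. -/
def layer (a : Fin 4) (i : ℕ) (ρ : Finset (Fin 4 → ℕ)) : Finset (Fin 4 → ℕ) :=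
  (ρ.filter fun p => p a = i).image fun p => Function.update p a 0

open Classical in
/-- The sign exponent `σ_b(ρ)`: the number of boxes of `ρ` whose three coordinates other than the
`b`-th agree and are smaller than the `b`-th one. -/
def signExp (b : Fin 4) (ρ : Finset (Fin 4 → ℕ)) : ℕ :=
  (ρ.filter fun p => ∃ i : ℕ, (∀ c, c ≠ b → p c = i) ∧ i < p b).card

/-! ## Characters, their index, and the partition functions -/

/-- Virtual characters `∑ n_w [w]` with weights `w ∈ ℂˣ`. -/
abbrev Character := MonoidAlgebra ℤ ℂˣ

/-- The character `[w]`. -/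
def wt (w : ℂˣ) : Character := MonoidAlgebra.single w 1

/-- The index `𝕀[∑ n_w [w]] = ∏ (1 - w⁻¹) ^ n_w`; the product runs over the weights that survive
the cancellations in the character. -/
def index (X : Character) : ℂ := X.coeff.prod fun w n => (1 - (w : ℂ)⁻¹) ^ n

/-- `P_S^∨ = ∏_{a ∈ S} (1 - q_a⁻¹)`. -/
def PDual (ε : Fin 4 → ℂ) (S : Finset (Fin 4)) : Character := ∏ a ∈ S, (1 - wt (expU (-(ε a))))

/-- The character of a set of boxes, with the corner box at `1`. -/
def boxChar (ε : Fin 4 → ℂ) (ρ : Finset (Fin 4 → ℕ)) : Character :=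
  ∑ p ∈ ρ, wt (expU (logBox ε p))

/-- The dual of `boxChar`. -/
def boxCharDual (ε : Fin 4 → ℂ) (ρ : Finset (Fin 4 → ℕ)) : Character :=
  ∑ p ∈ ρ, wt (expU (-(logBox ε p)))

/-- The supergroup D6 coefficient `Z̃^{D6}_{ā}[π, K]`, the index of
`-P_a^∨ (1 - K⁻¹) x⁻¹ 𝚷 + P_ā^∨ 𝚷^∨ 𝚷`; it does not depend on `x`, which is put to `1`. -/
def ZD6 (ε : Fin 4 → ℂ) (κ : ℂ) (a : Fin 4) (π : Finset (Fin 4 → ℕ)) : ℂ :=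
  index (-(PDual ε {a} * (1 - wt (expU (-κ))) * boxChar ε π)
    + PDual ε (Finset.univ.erase a) * boxCharDual ε π * boxChar ε π)

/-- The `U(1|1)` magnificent four coefficient `Z^{D8}_{4;b}[ρ, K]`, the index of
`-(1 - K⁻¹) x⁻¹ 𝛒 + P_b̄^∨ 𝛒^∨ 𝛒`, again at `x = 1`. -/
def ZD8 (ε : Fin 4 → ℂ) (κ : ℂ) (b : Fin 4) (ρ : Finset (Fin 4 → ℕ)) : ℂ :=
  index (-((1 - wt (expU (-κ))) * boxChar ε ρ)
    + PDual ε (Finset.univ.erase b) * boxCharDual ε ρ * boxChar ε ρ)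

/-! ## Vertex operators -/

/-- The exponent of a normal ordered vertex operator
`:exp (t 𝗍₀ + d ∂_𝗍 + u 𝗍̃₀ + ∑_{n ≠ 0} c_n 𝖺_n):`, stored as `(c, t, d, u)` (the value `c 0` is never
used). The normal ordered product of operators is the sum of their exponents, and the normal ordered
inverse is the negative. -/
abbrev VExp := (ℤ → ℂ) × ℤ × ℂ × ℂ

/-- `𝖠(x)`. -/
def opA (ξ : ℂ) : VExp := (fun n => Complex.exp (-(n * ξ)), 1, 0, 0)

/-- `𝖶_ā(x)`, with modes `𝗐_n = 𝖺_n / P_ā^{[-n]}`; the logarithm chosen for `-q_a` is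
`log q_a + π i`. -/
def opW (ε : Fin 4 → ℂ) (a : Fin 4) (ξ : ℂ) : VExp :=
  (fun n => Complex.exp (-(n * ξ)) / ∏ b ∈ Finset.univ.erase a, (1 - Complex.exp (-(n * ε b))),
    0, -(ε a), -(ε a * ξ) - ε a * (ε a + Real.pi * Complex.I))

/-- `𝖹(K, x)`, with modes `(1 - K^{-n}) 𝗓_n`, `𝗓_n = 𝖺_n / P_4^{[-n]}`; the logarithm chosen for `-K`
is `log K + π i`. -/
def opZ (ε : Fin 4 → ℂ) (κ ξ : ℂ) : VExp :=
  (fun n => (1 - Complex.exp (-(n * κ))) * Complex.exp (-(n * ξ)) /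
      ∏ b, (1 - Complex.exp (-(n * ε b))),
    0, -κ, -(κ * ξ) - κ * (κ + Real.pi * Complex.I))

/-- The annihilation half of `𝖹(K, x)`: its modes with `n > 0` and its zero modes. -/
def opZPlus (ε : Fin 4 → ℂ) (κ ξ : ℂ) : VExp :=
  (fun n => if 0 < n then (opZ ε κ ξ).1 n else 0, (opZ ε κ ξ).2)

/-- `Λ^K_{ā,π}(x) = :𝖶_ā(x) 𝖶_ā(Kx)⁻¹ ∏_{□ ∈ π} 𝖠(χ_{ā,x}(□))⁻¹:`. -/
def LambdaD6 (ε : Fin 4 → ℂ) (κ : ℂ) (a : Fin 4) (π : Finset (Fin 4 → ℕ)) (ξ : ℂ) : VExp :=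
  opW ε a ξ - opW ε a (ξ + κ) - ∑ p ∈ π, opA (ξ + logBox ε p)

/-- `Λ^K_{4,ρ}(x) = :𝖹(K,x) ∏_{□ ∈ ρ} 𝖠(χ_{4,x}(□))⁻¹:`. -/
def LambdaD8 (ε : Fin 4 → ℂ) (κ : ℂ) (ρ : Finset (Fin 4 → ℕ)) (ξ : ℂ) : VExp :=
  opZ ε κ ξ - ∑ p ∈ ρ, opA (ξ + logBox ε p)

/-! ## The Fock space

The Fock space has the basis `e^{m 𝗍₀} ⊗ X^δ`, `m ∈ ℤ`, where `X^δ` is a monomial in the variables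
`X_n` (`n ≥ 1`). The oscillator `𝖺_{-n}` is the multiplication by `X_n`, the oscillator `𝖺_n` is
`[𝖺_n, 𝖺_{-n}] ∂/∂X_n`, and `∂_𝗍` acts on `e^{m 𝗍₀}` as `m`. The mode `𝗍̃₀` commutes with all operators
that occur and is represented by a scalar `τ`. The vacuum is `(0, 0)`. Operators from the Fock space
to its completion are written as matrices in this basis. -/

/-- Labels of the basis vectors. -/
abbrev State := ℤ × (ℕ+ →₀ ℕ)

/-- The energy of a basis vector, i.e. its eigenvalue under the grading operator `L₀`. -/
def energy (e : State) : ℕ := e.2.sum fun n k => (n : ℕ) * k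

/-- Operators: the entry `A e d` is the coefficient of `e` in the image of `d`. -/
abbrev Op := State → State → ℂ

/-- `[𝖺_n, 𝖺_{-n}] = -(1/n) P_4^{[n]}` for `n ≥ 1`. -/
def heis (ε : Fin 4 → ℂ) (n : ℕ+) : ℂ :=
  -(1 / ((n : ℕ) : ℂ)) * ∏ a, (1 - Complex.exp (((n : ℕ) : ℂ) * ε a))

/-- `exp (∑_{n > 0} c_n 𝖺_n)`: as `𝖺_n` is a multiple of `∂/∂X_n`, this is a translation. -/
def annihExp (ε : Fin 4 → ℂ) (c : ℤ → ℂ) : MvPolynomial ℕ+ ℂ →ₐ[ℂ] MvPolynomial ℕ+ ℂ :=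
  MvPolynomial.aeval fun n => MvPolynomial.X n + MvPolynomial.C (c ((n : ℕ) : ℤ) * heis ε n)

/-- `exp (∑_{n > 0} c_{-n} X_n)`. -/
def creatExp (c : ℤ → ℂ) : MvPowerSeries ℕ+ ℂ :=
  fun δ => δ.prod fun n k => c (-((n : ℕ) : ℤ)) ^ k / (k.factorial : ℂ)

/-- The normal ordered vertex operator with exponent `V`: creation operators and `𝗍₀` stand to the
left of annihilation operators and `∂_𝗍`. -/
def vertexOp (ε : Fin 4 → ℂ) (τ : ℂ) (V : VExp) : Op := fun e d =>
  if e.1 = d.1 + V.2.1 then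
    Complex.exp (V.2.2.2 * τ) * Complex.exp (V.2.2.1 * d.1) *
      MvPowerSeries.coeff e.2 (creatExp V.1 *
        ((annihExp ε V.1 (MvPolynomial.monomial d.2 1) : MvPolynomial ℕ+ ℂ) : MvPowerSeries ℕ+ ℂ))
  else 0

/-! ## The `qq`-characters

They are power series in the counting parameter `𝔮` with operators as coefficients; the first
argument after the parameters is the exponent of `𝔮`. -/

/-- The coefficient of `𝔮^k` in the supergroup D6 `qq`-character `𝖳_ā(x | Kx)`. -/
def TD6 (ε : Fin 4 → ℂ) (κ τ : ℂ) (a : Fin 4) (ξ : ℂ) (k : ℕ) : Op := fun e d =>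
  ∑ π ∈ planes a k, ZD6 ε κ a π * vertexOp ε τ (LambdaD6 ε κ a π ξ) e d

/-- The coefficient of `𝔮^k` in the D8 `qq`-character `𝖳_4^K(x)`, formed with the direction `b` as
the special one. -/
def TD8 (ε : Fin 4 → ℂ) (κ τ : ℂ) (b : Fin 4) (ξ : ℂ) (k : ℕ) : Op := fun e d =>
  ∑ ρ ∈ solids k, (-1) ^ signExp b ρ * ZD8 ε κ b ρ * vertexOp ε τ (LambdaD8 ε κ ρ ξ) e d

/-! ## Ordered products

A product of vertex operators has to be radially ordered. We put `r_i^{L₀}`, with a formal variable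
`r_i`, to the right of the `i`-th factor (`i = 0, 1, …`). As `r^{L₀} 𝖳(x) = 𝖳(r x) r^{L₀}`, this gives
the factors independent generic spectral parameters, and the product is expanded in the ratios of
these. The actual product is at `r = 1`. -/

/-- The matrix element, between `e` and the initial vector `d`, of the coefficient of `𝔮^k` in
`𝖳_ā(x_{N-1} | K x_{N-1}) r_{N-1}^{L₀} ⋯ 𝖳_ā(x_1 | K x_1) r_1^{L₀} 𝖳_ā(x_0 | K x_0) r_0^{L₀}`,
`x_i = x q_a^i`, as a power series in the variables `r_i`. The sum over the intermediate states `m`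
is finite in each degree `g`, as only states of energy at most `g N` contribute. -/
def prodSeries (ε : Fin 4 → ℂ) (κ τ : ℂ) (a : Fin 4) (ξ : ℂ) (d : State) :
    ℕ → ℕ → State → MvPowerSeries ℕ ℂ
  | 0 => fun k e => if k = 0 ∧ e = d then 1 else 0
  | N + 1 => fun k e => fun g => ∑ l ∈ Finset.HasAntidiagonal.antidiagonal k, ∑ᶠ m : State,
      TD6 ε κ τ a (ξ + N * ε a) l.1 e m *
        MvPowerSeries.coeff g
          (MvPowerSeries.X N ^ energy m * prodSeries ε κ τ a ξ d N l.2 m)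

/-- The one-loop factor between two highest weights,
`exp (-∑_{n>0} (1/n) P_a^{[n]} P_a^{[-n]} / P_4^{[n]} (1 - K^n) (1 - K^{-n}) y^n)`,
as a power series in the ratio `y` of their spectral parameters. -/
def oneLoop (ε : Fin 4 → ℂ) (κ : ℂ) (a : Fin 4) : PowerSeries ℂ :=
  (PowerSeries.exp ℂ).subst (PowerSeries.mk fun n : ℕ => if n = 0 then 0 else
    -(1 / (n : ℂ)) * ((1 - Complex.exp (n * ε a)) * (1 - Complex.exp (-(n * ε a))) /
      (∏ b, (1 - Complex.exp (n * ε b)))) * (1 - Complex.exp (n * κ)) * (1 - Complex.exp (-(n * κ))))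

/-- The product of the one-loop factors over all pairs `i < j < N` of factors of the ordered
product; the ratio of spectral parameters is `(x_i / x_j) r_{i+1} ⋯ r_j`. -/
def oneLoopProd (ε : Fin 4 → ℂ) (κ : ℂ) (a : Fin 4) (N : ℕ) : MvPowerSeries ℕ ℂ :=
  ∏ j ∈ Finset.range N, ∏ i ∈ Finset.range j,
    (oneLoop ε κ a).subst
      (MvPowerSeries.C (Complex.exp (((i : ℂ) - (j : ℂ)) * ε a)) *
        ∏ l ∈ Finset.Ioc i j, MvPowerSeries.X l : MvPowerSeries ℕ ℂ)

/-- `v` is the value at `r = 1` of the series `G`, after division by the invertible series `L` and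
rational continuation: `G / L` is the expansion of a rational function `P / Q` which is regular at
`r = 1`, with value `v`. -/
def IsStrippedValue (G L : MvPowerSeries ℕ ℂ) (v : ℂ) : Prop :=
  ∃ P Q : MvPolynomial ℕ ℂ, MvPolynomial.eval (fun _ => 1) Q ≠ 0 ∧
    (Q : MvPowerSeries ℕ ℂ) * G = L * (P : MvPowerSeries ℕ ℂ) ∧
    v = MvPolynomial.eval (fun _ => 1) P / MvPolynomial.eval (fun _ => 1) Q

/-- `v` is the regularized limit of the sequence `s`: for large `N`, the term `s N` is a rational
function of `q^N`, this function is regular at `0`, and `v` is its value there. This is the usual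
limit if `|q| < 1`, and its continuation to all `q` that are not roots of unity. -/
def IsRegLimit (q : ℂ) (s : ℕ → ℂ) (v : ℂ) : Prop :=
  ∃ P Q : Polynomial ℂ, Q.eval 0 ≠ 0 ∧
    (∀ᶠ N in Filter.atTop, Q.eval (q ^ N) ≠ 0 ∧ s N = P.eval (q ^ N) / Q.eval (q ^ N)) ∧
    v = P.eval 0 / Q.eval 0

theorem IsRegLimit.tendsto {q : ℂ} {s : ℕ → ℂ} {v : ℂ} (h : IsRegLimit q s v) (hq : ‖q‖ < 1) :
    Filter.Tendsto s Filter.atTop (nhds v) := by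
  obtain ⟨P, Q, hQ, hs, rfl⟩ := h
  have hq0 := tendsto_pow_atTop_nhds_zero_of_norm_lt_one hq
  have hP := (P.continuous.tendsto 0).comp hq0
  have hQ' := (Q.continuous.tendsto 0).comp hq0
  refine (hP.div hQ' hQ).congr' ?_
  filter_upwards [hs] with N hN
  exact hN.2.symm

end QQ

end

noncomputable section

namespace QQ
open Finset

/-- The points of the triangular lattice. -/
abbrev Pt := ℤ × ℤ

/-! ## Euler characteristics in the triangular lattice -/

/-- The neighbours of a lattice point in the three positive directions. -/
def nb (d : Fin 3) (p : Pt) : Pt := (p.1 + ![1, 0, 1] d, p.2 + ![0, 1, 1] d)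

theorem nb_zero (p : Pt) : nb 0 p = (p.1 + 1, p.2) := by simp [nb]
theorem nb_one (p : Pt) : nb 1 p = (p.1, p.2 + 1) := by simp [nb]
theorem nb_two (p : Pt) : nb 2 p = (p.1 + 1, p.2 + 1) := by simp [nb]

/-- Adjacency in the triangular lattice. -/
def TriAdj (u v : Pt) : Prop := ∃ d, v = nb d u ∨ u = nb d v

theorem TriAdj.symm {u v : Pt} (h : TriAdj u v) : TriAdj v u := by
  obtain ⟨d, h | h⟩ := h
  exacts [⟨d, Or.inr h⟩, ⟨d, Or.inl h⟩]

theorem triAdj_nb (d : Fin 3) (u : Pt) : TriAdj u (nb d u) := ⟨d, Or.inl rfl⟩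

theorem triAdj_iff {u v : Pt} : TriAdj u v ↔
    (v = (u.1 + 1, u.2) ∨ v = (u.1, u.2 + 1) ∨ v = (u.1 + 1, u.2 + 1) ∨
      u = (v.1 + 1, v.2) ∨ u = (v.1, v.2 + 1) ∨ u = (v.1 + 1, v.2 + 1)) := by
  simp only [TriAdj, Fin.exists_fin_succ, nb]
  simp
  tauto

/-- The integer indicator of a proposition. -/
def ind (P : Prop) : ℤ := open Classical in if P then 1 else 0

theorem ind_true {P : Prop} (h : P) : ind P = 1 := if_pos h
theorem ind_false {P : Prop} (h : ¬ P) : ind P = 0 := if_neg h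
theorem ind_congr {P Q : Prop} (h : P ↔ Q) : ind P = ind Q := by rw [propext h]
/-- The contribution of the cells based at `p` to the Euler characteristic of the cells inside `A`
which touch `W`. -/
def eulerTerm (A W : Pt → Prop) (p : Pt) : ℤ :=
  ind (A p ∧ W p) - ∑ d : Fin 3, ind (A p ∧ A (nb d p) ∧ (W p ∨ W (nb d p)))
    + ∑ t : Fin 2, ind (A p ∧ A (nb t.castSucc p) ∧ A (nb 2 p) ∧
        (W p ∨ W (nb t.castSucc p) ∨ W (nb 2 p)))

theorem eulerTerm_eq_zero {A W : Pt → Prop} {p : Pt} (h : ¬ A p) : eulerTerm A W p = 0 := by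
  simp [eulerTerm, ind, h]

/-- The Euler characteristic of the induced complex on a finite set of lattice points. -/
def chi (K : Finset Pt) : ℤ := ∑ p ∈ K, eulerTerm (· ∈ K) (· ∈ K) p

theorem chi_eq_sum {K S : Finset Pt} (h : K ⊆ S) :
    chi K = ∑ p ∈ S, eulerTerm (· ∈ K) (· ∈ K) p :=
  sum_subset h fun _ _ hp => eulerTerm_eq_zero hp

theorem sum_shift {M : Type*} [AddCommMonoid M] {S : Finset Pt} {F : Pt → M} (d : Fin 3)
    (h1 : ∀ p, F p ≠ 0 → p ∈ S) (h2 : ∀ p, F (nb d p) ≠ 0 → p ∈ S) :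
    ∑ p ∈ S, F (nb d p) = ∑ p ∈ S, F p := by
  rw [← finsum_eq_sum_of_support_subset F (s := S) (fun p hp => h1 p hp),
    ← finsum_eq_sum_of_support_subset (fun p => F (nb d p)) (s := S) (fun p hp => h2 p hp)]
  exact finsum_comp_equiv (Equiv.addRight ((![1, 0, 1] d, ![0, 1, 1] d) : Pt)) (f := F)

/-! ### Relative Euler characteristics -/

section Relative
open Classical

/-- Connectedness inside a finite set. -/
def ConnIn (W : Finset Pt) : Pt → Pt → Prop :=
  Relation.ReflTransGen fun u v => u ∈ W ∧ v ∈ W ∧ TriAdj u v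

variable (A : Pt → Prop) (W S : Finset Pt)

/-- The edges inside `A` which touch `W`. -/
def touchEdges : Finset (Pt × Fin 3) :=
  (S ×ˢ univ).filter fun e => A e.1 ∧ A (nb e.2 e.1) ∧ (e.1 ∈ W ∨ nb e.2 e.1 ∈ W)

/-- The triangles inside `A` which touch `W`. -/
def touchTris : Finset (Pt × Fin 2) :=
  (S ×ˢ univ).filter fun t => A t.1 ∧ A (nb t.2.castSucc t.1) ∧ A (nb 2 t.1) ∧
    (t.1 ∈ W ∨ nb t.2.castSucc t.1 ∈ W ∨ nb 2 t.1 ∈ W)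

variable {A W S}

theorem sum_eulerTerm_eq_card (hWA : ∀ w ∈ W, A w) (hWS : W ⊆ S) :
    ∑ p ∈ S, eulerTerm A (· ∈ W) p
      = W.card - (touchEdges A W S).card + (touchTris A W S).card := by
  have h0 : (W.card : ℤ) = ∑ p ∈ S, ind (A p ∧ p ∈ W) := by
    have hW : W.card = (S.filter (· ∈ W)).card := by
      rw [filter_mem_eq_inter, inter_eq_right.2 hWS]
    rw [hW, card_filter]
    push_cast
    refine sum_congr rfl fun p _ => ?_
    by_cases h : p ∈ W <;> simp [ind, h]
    exact hWA p h
  have h1 : ((touchEdges A W S).card : ℤ) =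
      ∑ p ∈ S, ∑ d : Fin 3, ind (A p ∧ A (nb d p) ∧ (p ∈ W ∨ nb d p ∈ W)) := by
    rw [touchEdges, card_filter]
    push_cast
    rw [sum_product]
    refine sum_congr rfl fun p _ => sum_congr rfl fun d _ => ?_
    unfold ind
    congr
  have h2 : ((touchTris A W S).card : ℤ) =
      ∑ p ∈ S, ∑ t : Fin 2, ind (A p ∧ A (nb t.castSucc p) ∧ A (nb 2 p) ∧
        (p ∈ W ∨ nb t.castSucc p ∈ W ∨ nb 2 p ∈ W)) := by
    rw [touchTris, card_filter]
    push_cast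
    rw [sum_product]
    refine sum_congr rfl fun p _ => sum_congr rfl fun d _ => ?_
    unfold ind
    congr
  simp only [eulerTerm, sum_add_distrib, sum_sub_distrib, h0, h1, h2]

/-- The edge opposite to the base edge and the hypotenuse of a triangle. -/
def sideEdge (t : Pt × Fin 2) : Pt × Fin 3 := (nb t.2.castSucc t.1, (1 - t.2).castSucc)

/-- Incidence of edges and vertices, modulo two. -/
def vinc (w : Pt) (e : Pt × Fin 3) : ZMod 2 :=
  (if e.1 = w then 1 else 0) + if nb e.2 e.1 = w then 1 else 0

/-- Incidence of edges and triangles, modulo two. -/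
def tinc (e : Pt × Fin 3) (t : Pt × Fin 2) : ZMod 2 :=
  (if e = (t.1, t.2.castSucc) then 1 else 0) + (if e = sideEdge t then 1 else 0)
    + if e = (t.1, 2) then 1 else 0

theorem nb_sideEdge (t : Pt × Fin 2) : nb (sideEdge t).2 (sideEdge t).1 = nb 2 t.1 := by
  obtain ⟨p, t⟩ := t
  fin_cases t <;> simp [sideEdge, nb]

theorem vinc_mul_tinc (hS : ∀ w ∈ W, ∀ p, (p = w ∨ ∃ d, nb d p = w) → p ∈ S)
    (w : Pt) (hw : w ∈ W) (t : Pt × Fin 2) (ht : t ∈ touchTris A W S) :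
    ∑ e ∈ touchEdges A W S, vinc w e * tinc e t = 0 := by
  have key : ∀ e0 : Pt × Fin 3, A e0.1 → A (nb e0.2 e0.1) →
      ∑ e ∈ touchEdges A W S, vinc w e * (if e = e0 then 1 else 0) = vinc w e0 := by
    intro e0 h1 h2
    simp only [mul_ite, mul_one, mul_zero, sum_ite_eq']
    split_ifs with h
    · rfl
    · by_contra hne
      apply h
      have h3 : e0.1 = w ∨ nb e0.2 e0.1 = w := by
        by_contra hc
        push Not at hc
        exact hne (by simp [vinc, hc.1, hc.2])
      simp only [touchEdges, mem_filter, mem_product, mem_univ, and_true]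
      grind
  simp only [touchTris, mem_filter] at ht
  obtain ⟨-, a1, a2, a3, -⟩ := ht
  simp only [tinc, mul_add, sum_add_distrib]
  rw [key _ a1 a2, key _ (by exact a2) (by rw [nb_sideEdge]; exact a3), key _ a1 a3]
  have h : ∀ x y z : ZMod 2, x + y + (y + z) + (x + z) = 0 := by decide
  simp only [vinc, nb_sideEdge]
  exact h _ _ _

theorem card_add_card_le (hWA : ∀ w ∈ W, A w)
    (hM : ∀ w ∈ W, ∃ u ∈ W, ConnIn W w u ∧ ∃ v, TriAdj u v ∧ ¬ A v)
    (hP : ∀ w ∈ W, ∃ u ∈ W, ConnIn W w u ∧ ∃ v, TriAdj u v ∧ A v ∧ v ∉ W)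
    (hS : ∀ w ∈ W, ∀ p, (p = w ∨ ∃ d, nb d p = w) → p ∈ S) :
    W.card + (touchTris A W S).card ≤ (touchEdges A W S).card := by
  let D1 : Matrix W (touchEdges A W S) (ZMod 2) := fun w e => vinc w e
  let D2 : Matrix (touchEdges A W S) (touchTris A W S) (ZMod 2) := fun e t => tinc e t
  have h0 : D1 * D2 = 0 := by
    ext w t
    rw [Matrix.mul_apply, Matrix.zero_apply]
    rw [← vinc_mul_tinc (A := A) hS w w.2 t t.2]
    exact sum_coe_sort (touchEdges A W S) fun e => vinc w e * tinc e t
  have hr := Matrix.rank_add_rank_le_card_of_mul_eq_zero h0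
  have e1 : D1.rank = W.card := by
    rw [← Fintype.card_coe W]
    refine LinearIndependent.rank_matrix (Fintype.linearIndependent_iff.2 fun φ hφ => ?_)
    set ψ : Pt → ZMod 2 := fun v => if h : v ∈ W then φ ⟨v, h⟩ else 0 with hψ
    have hsum : ∀ v : Pt, ∑ w : W, φ w * (if v = w then 1 else 0) = ψ v := by
      intro v
      simp only [hψ]
      split_ifs with h
      · rw [sum_eq_single ⟨v, h⟩]
        · simp
        · grind
        · simp
      · refine sum_eq_zero fun w _ => ?_
        grind
    have hedge : ∀ e ∈ touchEdges A W S, ψ e.1 = ψ (nb e.2 e.1) := by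
      intro e he
      have := congrFun hφ ⟨e, he⟩
      simp only [Finset.sum_apply, Pi.smul_apply, smul_eq_mul, Pi.zero_apply, Matrix.row, D1,
        vinc, mul_add, sum_add_distrib, hsum] at this
      grind
    have hadj : ∀ u ∈ W, ∀ v, A v → TriAdj u v → ψ u = ψ v := by
      rintro u hu v hv ⟨d, rfl | rfl⟩
      · exact hedge (u, d) (by
          simp only [touchEdges, mem_filter, mem_product, mem_univ, and_true]
          exact ⟨hS u hu _ (Or.inl rfl), hWA u hu, hv, Or.inl hu⟩)
      · exact (hedge (v, d) (by
          simp only [touchEdges, mem_filter, mem_product, mem_univ, and_true]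
          exact ⟨hS _ hu _ (Or.inr ⟨d, rfl⟩), hv, hWA _ hu, Or.inr hu⟩)).symm
    have hconn : ∀ w u, ConnIn W w u → ψ w = ψ u := by
      intro w u hwu
      induction hwu with
      | refl => rfl
      | tail _ hbc ih => rw [ih]; exact hadj _ hbc.1 _ (hWA _ hbc.2.1) hbc.2.2
    grind
  have e2 : D2.rank = (touchTris A W S).card := by
    rw [← Fintype.card_coe (touchTris A W S), ← Matrix.rank_transpose]
    refine LinearIndependent.rank_matrix (Fintype.linearIndependent_iff.2 fun φ hφ => ?_)
    set c : Pt × Fin 2 → ZMod 2 :=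
      fun v => if h : v ∈ touchTris A W S then φ ⟨v, h⟩ else 0 with hc
    have hsum : ∀ v : Pt × Fin 2, ∑ t : touchTris A W S, φ t * (if v = t then 1 else 0) = c v := by
      intro v
      simp only [hc]
      split_ifs with h
      · rw [sum_eq_single ⟨v, h⟩]
        · simp
        · grind
        · simp
      · refine sum_eq_zero fun w _ => ?_
        grind
    have hE : ∀ e ∈ touchEdges A W S, ∑ t : touchTris A W S, φ t * tinc e t = 0 := by
      intro e he
      have := congrFun hφ ⟨e, he⟩
      simp only [Finset.sum_apply, Pi.smul_apply, smul_eq_mul, Pi.zero_apply, Matrix.row] at this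
      exact this
    have hnot : ∀ t : Pt × Fin 2,
        (¬ A t.1 ∨ ¬ A (nb t.2.castSucc t.1) ∨ ¬ A (nb 2 t.1)) → c t = 0 := by
      intro t ht
      simp only [hc]
      rw [dif_neg]
      simp only [touchTris, mem_filter]
      tauto
    have hmemE : ∀ p d, A p → A (nb d p) → (p ∈ W ∨ nb d p ∈ W) → (p, d) ∈ touchEdges A W S := by
      intro p d h1 h2 h3
      simp only [touchEdges, mem_filter, mem_product, mem_univ, and_true]
      grind
    have hd2 : ∀ p, (p ∈ W ∨ nb 2 p ∈ W) → c (p, 0) = c (p, 1) := by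
      intro p hp
      by_cases h1 : A p
      swap
      · grind
      by_cases h2 : A (nb 2 p)
      swap
      · grind
      have := hE _ (hmemE p 2 h1 h2 hp)
      have h3 : ∀ t : Pt × Fin 2, tinc (p, 2) t =
          (if (p, (0 : Fin 2)) = t then 1 else 0) + if (p, (1 : Fin 2)) = t then 1 else 0 := by
        rintro ⟨q, t⟩
        fin_cases t <;> simp [tinc, sideEdge, Prod.ext_iff]
      simp only [h3, mul_add, sum_add_distrib, hsum] at this
      grind
    have hd0 : ∀ p : Pt, (p ∈ W ∨ nb 0 p ∈ W) → c (p, 0) = c ((p.1, p.2 - 1), 1) := by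
      intro p hp
      have q1 : nb (Fin.castSucc 1) (p.1, p.2 - 1) = p := by simp [nb]
      have q2 : nb 2 (p.1, p.2 - 1) = nb 0 p := by simp [nb]
      by_cases h1 : A p
      swap
      · rw [hnot (p, 0) (Or.inl h1), hnot (_, 1) (Or.inr (Or.inl (by rw [q1]; exact h1)))]
      by_cases h2 : A (nb 0 p)
      swap
      · rw [hnot (p, 0) (Or.inr (Or.inl h2)), hnot (_, 1) (Or.inr (Or.inr (by rw [q2]; exact h2)))]
      have := hE _ (hmemE p 0 h1 h2 hp)
      have h3 : ∀ t : Pt × Fin 2, tinc (p, 0) t =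
          (if (p, (0 : Fin 2)) = t then 1 else 0)
            + if ((p.1, p.2 - 1), (1 : Fin 2)) = t then 1 else 0 := by
        rintro ⟨q, t⟩
        fin_cases t <;> simp [tinc, sideEdge, Prod.ext_iff, nb, sub_eq_iff_eq_add]
      simp only [h3, mul_add, sum_add_distrib, hsum] at this
      rwa [add_eq_zero_iff_eq_neg, ZMod.neg_eq_self_mod_two] at this
    have hd1 : ∀ p : Pt, (p ∈ W ∨ nb 1 p ∈ W) → c (p, 1) = c ((p.1 - 1, p.2), 0) := by
      intro p hp
      have q1 : nb (Fin.castSucc 0) (p.1 - 1, p.2) = p := by simp [nb]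
      have q2 : nb 2 (p.1 - 1, p.2) = nb 1 p := by simp [nb]
      by_cases h1 : A p
      swap
      · rw [hnot (p, 1) (Or.inl h1), hnot (_, 0) (Or.inr (Or.inl (by rw [q1]; exact h1)))]
      by_cases h2 : A (nb 1 p)
      swap
      · rw [hnot (p, 1) (Or.inr (Or.inl h2)), hnot (_, 0) (Or.inr (Or.inr (by rw [q2]; exact h2)))]
      have := hE _ (hmemE p 1 h1 h2 hp)
      have h3 : ∀ t : Pt × Fin 2, tinc (p, 1) t =
          (if (p, (1 : Fin 2)) = t then 1 else 0)
            + if ((p.1 - 1, p.2), (0 : Fin 2)) = t then 1 else 0 := by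
        rintro ⟨q, t⟩
        fin_cases t <;> simp [tinc, sideEdge, Prod.ext_iff, nb, sub_eq_iff_eq_add]
      simp only [h3, mul_add, sum_add_distrib, hsum] at this
      rwa [add_eq_zero_iff_eq_neg, ZMod.neg_eq_self_mod_two] at this
    have hstar : ∀ w ∈ W, c (w, 1) = c (w, 0) ∧ c ((w.1 - 1, w.2), 0) = c (w, 0) ∧
        c ((w.1, w.2 - 1), 1) = c (w, 0) ∧ c ((w.1 - 1, w.2 - 1), 0) = c (w, 0) ∧
        c ((w.1 - 1, w.2 - 1), 1) = c (w, 0) := by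
      intro w hw
      have a1 := hd2 w (Or.inl hw)
      have a2 := hd0 w (Or.inl hw)
      have a3 := hd1 w (Or.inl hw)
      have a4 := hd0 (w.1 - 1, w.2) (Or.inr (by simpa [nb] using hw))
      have a5 := hd1 (w.1, w.2 - 1) (Or.inr (by simpa [nb] using hw))
      simp only at a4 a5
      exact ⟨a1.symm, by rw [← a3, ← a1], a2.symm, by rw [← a5, ← a2], by rw [← a4, ← a3, ← a1]⟩
    have hshare : ∀ u ∈ W, ∀ v, TriAdj u v → ∃ t : Pt × Fin 2, c t = c (u, 0) ∧
        (¬ A v → c t = 0) ∧ (v ∈ W → c t = c (v, 0)) := by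
      intro u hu v huv
      obtain ⟨s1, s2, s3, s4, s5⟩ := hstar u hu
      rcases triAdj_iff.1 huv with h | h | h | h | h | h
      · refine ⟨(u, 0), rfl, fun hA => hnot _ (Or.inr (Or.inl ?_)), fun hv => ?_⟩
        · simpa [nb, h] using hA
        · obtain ⟨t1, t2, t3, t4, t5⟩ := hstar v hv
          rw [← t2]; simp [h]
      · refine ⟨(u, 1), s1, fun hA => hnot _ (Or.inr (Or.inl ?_)), fun hv => ?_⟩
        · simpa [nb, h] using hA
        · obtain ⟨t1, t2, t3, t4, t5⟩ := hstar v hv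
          rw [← t3]; simp [h]
      · refine ⟨(u, 0), rfl, fun hA => hnot _ (Or.inr (Or.inr ?_)), fun hv => ?_⟩
        · simpa [nb, h] using hA
        · obtain ⟨t1, t2, t3, t4, t5⟩ := hstar v hv
          rw [← t4]; simp [h]
      · have hv' : v = (u.1 - 1, u.2) := by rw [h]; simp
        refine ⟨((u.1 - 1, u.2), 0), s2, fun hA => hnot _ (Or.inl ?_), fun hv => ?_⟩
        · simpa [hv'] using hA
        · rw [← hv']
      · have hv' : v = (u.1, u.2 - 1) := by rw [h]; simp
        refine ⟨((u.1, u.2 - 1), 1), s3, fun hA => hnot _ (Or.inl ?_), fun hv => ?_⟩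
        · simpa [hv'] using hA
        · rw [← hv']; exact (hstar v hv).1
      · have hv' : v = (u.1 - 1, u.2 - 1) := by rw [h]; simp
        refine ⟨((u.1 - 1, u.2 - 1), 0), s4, fun hA => hnot _ (Or.inl ?_), fun hv => ?_⟩
        · simpa [hv'] using hA
        · rw [← hv']
    have hconn : ∀ w u, ConnIn W w u → c (w, 0) = c (u, 0) := by
      intro w u hwu
      induction hwu with
      | refl => rfl
      | tail _ hbc ih =>
        obtain ⟨t, ht, -, ht'⟩ := hshare _ hbc.1 _ hbc.2.2
        rw [ih, ← ht, ht' hbc.2.1]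
    have hzero : ∀ w ∈ W, c (w, 0) = 0 := by
      intro w hw
      obtain ⟨u, hu, hwu, v, huv, hAv⟩ := hM w hw
      obtain ⟨t, ht, ht', -⟩ := hshare u hu v huv
      rw [hconn _ _ hwu, ← ht, ht' hAv]
    intro t
    have ht : c t = 0 := by
      obtain ⟨⟨p, τ⟩, ht⟩ := t
      have ht' := ht
      simp only [touchTris, mem_filter] at ht'
      obtain ⟨-, -, -, -, h⟩ := ht'
      rcases h with h | h | h
      · have := hstar p h
        have h0 := hzero p h
        fin_cases τ
        · exact h0
        · exact this.1.trans h0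
      · have := hstar _ h
        have h0 := hzero _ h
        fin_cases τ
        · simpa [nb, h0] using this.2.1.trans h0
        · simpa [nb, h0] using this.2.2.1.trans h0
      · have := hstar _ h
        have h0 := hzero _ h
        fin_cases τ
        · simpa [nb, h0] using this.2.2.2.1.trans h0
        · simpa [nb, h0] using this.2.2.2.2.trans h0
    simpa [hc] using ht
  rw [e1, e2, Fintype.card_coe] at hr
  exact hr

theorem sum_eulerTerm_nonpos (hWA : ∀ w ∈ W, A w)
    (hM : ∀ w ∈ W, ∃ u ∈ W, ConnIn W w u ∧ ∃ v, TriAdj u v ∧ ¬ A v)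
    (hP : ∀ w ∈ W, ∃ u ∈ W, ConnIn W w u ∧ ∃ v, TriAdj u v ∧ A v ∧ v ∉ W)
    (hS : ∀ w ∈ W, ∀ p, (p = w ∨ ∃ d, nb d p = w) → p ∈ S) :
    ∑ p ∈ S, eulerTerm A (· ∈ W) p ≤ 0 := by
  rw [sum_eulerTerm_eq_card hWA fun w hw => hS w hw w (Or.inl rfl)]
  have := card_add_card_le hWA hM hP hS
  omega

end Relative
end QQ

namespace QQ
open Finset

section Planar
open Classical

theorem ConnIn.mono {V W : Finset Pt} (h : V ⊆ W) {u v : Pt} (huv : ConnIn V u v) :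
    ConnIn W u v :=
  Relation.ReflTransGen.mono (fun _ _ a => ⟨h a.1, h a.2.1, a.2.2⟩) _ _ huv

theorem ConnIn.symm {W : Finset Pt} {u v : Pt} (h : ConnIn W u v) : ConnIn W v u := by
  induction h with
  | refl => exact Relation.ReflTransGen.refl
  | tail _ h ih => exact Relation.ReflTransGen.head ⟨h.2.1, h.1, h.2.2.symm⟩ ih

/-- A box in the lattice. -/
def box (m : ℕ) : Finset Pt := Icc (-(m : ℤ)) m ×ˢ Icc (-(m : ℤ)) m

theorem mem_box {m : ℕ} {p : Pt} :
    p ∈ box m ↔ (-(m : ℤ) ≤ p.1 ∧ p.1 ≤ m) ∧ (-(m : ℤ) ≤ p.2 ∧ p.2 ≤ m) := by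
  simp [box, mem_product]

theorem exists_box (K : Finset Pt) : ∃ m, K ⊆ box m := by
  refine ⟨∑ p ∈ K, (p.1.natAbs + p.2.natAbs), fun p hp => ?_⟩
  have := single_le_sum (f := fun p : Pt => p.1.natAbs + p.2.natAbs)
    (fun _ _ => Nat.zero_le _) hp
  rw [mem_box]
  omega

theorem box_mono {m n : ℕ} (h : m ≤ n) : box m ⊆ box n := by
  intro p
  simp only [mem_box]
  omega

theorem box_star {m : ℕ} {w : Pt} (hw : w ∈ box m) (p : Pt) (h : p = w ∨ ∃ d, nb d p = w) :
    p ∈ box (m + 1) := by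
  rw [mem_box] at hw ⊢
  rcases h with rfl | ⟨d, rfl⟩
  · push_cast; omega
  · fin_cases d <;> simp [nb] at hw ⊢ <;> omega

theorem TriAdj.mem_box {m : ℕ} {u v : Pt} (h : TriAdj u v) (hu : u ∈ box m) :
    v ∈ box (m + 1) := by
  rw [QQ.mem_box] at hu ⊢
  rcases triAdj_iff.1 h with h | h | h | h | h | h <;> simp [Prod.ext_iff] at h ⊢ <;> omega

theorem box_connected {m : ℕ} {K : Pt → Prop}
    (hK : ∀ u, K u → ∀ v ∈ box m, TriAdj u v → K v) {u v : Pt} (hu : K u) (hub : u ∈ box m)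
    (hv : v ∈ box m) : K v := by
  have key : ∀ n : ℕ, ∀ u, K u → u ∈ box m → (u.1 - v.1).natAbs + (u.2 - v.2).natAbs = n → K v := by
    intro n
    induction n with
    | zero => grind
    | succ n ih =>
      intro u hu hub h
      have step : ∀ w ∈ box m, TriAdj u w → (w.1 - v.1).natAbs + (w.2 - v.2).natAbs = n → K v :=
        fun w hw ha hn => ih w (hK u hu w hw ha) hw hn
      rw [mem_box] at hub hv
      by_cases h1 : u.1 < v.1
      · exact step (u.1 + 1, u.2) (mem_box.2 (by simp only; omega)) (triAdj_iff.2 (by simp)) (by simp only; omega)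
      by_cases h2 : v.1 < u.1
      · exact step (u.1 - 1, u.2) (mem_box.2 (by simp only; omega))
          (triAdj_iff.2 (by simp)) (by simp only; omega)
      by_cases h3 : u.2 < v.2
      · exact step (u.1, u.2 + 1) (mem_box.2 (by simp only; omega)) (triAdj_iff.2 (by simp)) (by simp only; omega)
      · exact step (u.1, u.2 - 1) (mem_box.2 (by simp only; omega))
          (triAdj_iff.2 (by simp)) (by simp only; omega)
  grind

theorem chi_le_one {K : Finset Pt} {w₀ : Pt} (h₀ : w₀ ∈ K)
    (hK : ∀ w ∈ K, ConnIn K w w₀) : chi K ≤ 1 := by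
  obtain ⟨m, hm⟩ := exists_box K
  have h1 : ∑ p ∈ box (m + 1), eulerTerm (· ∈ K) (· ∈ K.erase w₀) p ≤ 0 := by
    refine sum_eulerTerm_nonpos (fun w hw => mem_of_mem_erase hw) ?_ ?_
      (fun w hw p hp => box_star (hm (mem_of_mem_erase hw)) p hp)
    · intro w hw
      obtain ⟨u, hu, hmax⟩ := exists_max_image
        ((K.erase w₀).filter fun u => ConnIn (K.erase w₀) w u) (fun u => u.1)
        ⟨w, mem_filter.2 ⟨hw, Relation.ReflTransGen.refl⟩⟩
      rw [mem_filter] at hu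
      refine ⟨u, hu.1, hu.2, ?_⟩
      have hout : ∀ v, TriAdj u v → v.1 = u.1 + 1 → v ∉ K.erase w₀ := by
        intro v huv hv hvK
        have := hmax v (mem_filter.2 ⟨hvK, hu.2.tail ⟨hu.1, hvK, huv⟩⟩)
        omega
      have o1 := hout (u.1 + 1, u.2) (triAdj_iff.2 (by simp)) rfl
      have o2 := hout (u.1 + 1, u.2 + 1) (triAdj_iff.2 (by simp)) rfl
      by_cases h : (u.1 + 1, u.2) ∈ K
      · refine ⟨(u.1 + 1, u.2 + 1), triAdj_iff.2 (by simp), fun h' => ?_⟩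
        grind
      · exact ⟨_, triAdj_iff.2 (by simp), h⟩
    · intro w hw
      have key : ∀ x, ConnIn K w x → (x ∈ K.erase w₀ ∧ ConnIn (K.erase w₀) w x) ∨
          ∃ u ∈ K.erase w₀, ConnIn (K.erase w₀) w u ∧ TriAdj u w₀ := by
        intro x hx
        induction hx with
        | refl => exact Or.inl ⟨hw, Relation.ReflTransGen.refl⟩
        | tail _ hbc ih =>
          rename_i b c _
          rcases ih with ⟨hb, ih⟩ | ih
          · by_cases hc : c = w₀
            · grind
            · have hc' := mem_erase.2 ⟨hc, hbc.2.1⟩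
              exact Or.inl ⟨hc', ih.tail ⟨hb, hc', hbc.2.2⟩⟩
          · exact Or.inr ih
      grind
  have h2 : ∀ p, eulerTerm (· ∈ K) (· ∈ K) p
      = eulerTerm (· ∈ K) (· ∈ K.erase w₀) p + ind (p = w₀) := by
    intro p
    have e1 : ∀ d, ind (p ∈ K ∧ nb d p ∈ K ∧ (p ∈ K ∨ nb d p ∈ K)) =
        ind (p ∈ K ∧ nb d p ∈ K ∧ (p ∈ K.erase w₀ ∨ nb d p ∈ K.erase w₀)) := by
      intro d
      refine ind_congr ?_
      simp only [mem_erase]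
      have : nb d p ≠ p := by
        fin_cases d <;> simp [nb, Prod.ext_iff]
      grind
    have e2 : ∀ t : Fin 2, ind (p ∈ K ∧ nb t.castSucc p ∈ K ∧ nb 2 p ∈ K ∧
          (p ∈ K ∨ nb t.castSucc p ∈ K ∨ nb 2 p ∈ K)) =
        ind (p ∈ K ∧ nb t.castSucc p ∈ K ∧ nb 2 p ∈ K ∧
          (p ∈ K.erase w₀ ∨ nb t.castSucc p ∈ K.erase w₀ ∨ nb 2 p ∈ K.erase w₀)) := by grind
    simp only [eulerTerm, e1, e2]
    have e3 : ind (p ∈ K ∧ p ∈ K) = ind (p ∈ K ∧ p ∈ K.erase w₀) + ind (p = w₀) := by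
      by_cases h : p = w₀
      · subst h; simp [ind, h₀]
      · simp [ind, h]
    rw [e3]
    ring
  rw [chi_eq_sum (hm.trans (box_mono (Nat.le_succ m))), sum_congr rfl fun p _ => h2 p,
    sum_add_distrib]
  have : ∑ p ∈ box (m + 1), ind (p = w₀) ≤ 1 := by
    rw [sum_eq_single w₀ (fun p _ hp => ind_false hp)]
    · rw [ind_true rfl]
    · exact fun h => absurd (box_mono (Nat.le_succ m) (hm h₀)) h
  linarith

theorem sum_eulerTerm_box (m : ℕ) :
    ∑ p ∈ box (m + 1), eulerTerm (fun _ => True) (· ∈ box m) p = 1 := by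
  have h : ∀ p : Pt, eulerTerm (fun _ => True) (· ∈ box m) p
      = ind (p = (-(m : ℤ) - 1, -(m : ℤ) - 1)) := by
    rintro ⟨x, y⟩
    have key : ∀ X₀ X₁ Y₀ Y₁ : Prop, ind (X₀ ∧ Y₀) - (ind ((X₀ ∧ Y₀) ∨ (X₁ ∧ Y₀))
        + ind ((X₀ ∧ Y₀) ∨ (X₀ ∧ Y₁)) + ind ((X₀ ∧ Y₀) ∨ (X₁ ∧ Y₁)))
        + (ind ((X₀ ∧ Y₀) ∨ (X₁ ∧ Y₀) ∨ (X₁ ∧ Y₁)) + ind ((X₀ ∧ Y₀) ∨ (X₀ ∧ Y₁) ∨ (X₁ ∧ Y₁)))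
        = ind (¬ X₀ ∧ X₁ ∧ ¬ Y₀ ∧ Y₁) := by
      intro X₀ X₁ Y₀ Y₁
      by_cases h1 : X₀ <;> by_cases h2 : X₁ <;> by_cases h3 : Y₀ <;> by_cases h4 : Y₁ <;>
        simp [ind, h1, h2, h3, h4]
    have := key (-(m : ℤ) ≤ x ∧ x ≤ m) (-(m : ℤ) ≤ x + 1 ∧ x + 1 ≤ m) (-(m : ℤ) ≤ y ∧ y ≤ m)
      (-(m : ℤ) ≤ y + 1 ∧ y + 1 ≤ m)
    have hiff : (¬ (-(m : ℤ) ≤ x ∧ x ≤ m) ∧ (-(m : ℤ) ≤ x + 1 ∧ x + 1 ≤ m) ∧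
        ¬ (-(m : ℤ) ≤ y ∧ y ≤ m) ∧ (-(m : ℤ) ≤ y + 1 ∧ y + 1 ≤ m))
        ↔ (x, y) = (-(m : ℤ) - 1, -(m : ℤ) - 1) := by grind
    rw [← ind_congr hiff, ← this]
    simp only [eulerTerm, Fin.sum_univ_three, Fin.sum_univ_two, true_and, Fin.castSucc_zero,
      Fin.castSucc_one, nb_zero, nb_one, nb_two, mem_box]
  rw [sum_congr rfl fun p _ => h p,
    sum_eq_single (-(m : ℤ) - 1, -(m : ℤ) - 1) (fun p _ hp => ind_false hp), ind_true rfl]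
  intro h
  exact absurd (mem_box.2 (by push_cast; omega)) h

theorem sum_colour {C : Type*} (m : ℕ) (col : Pt → C) (Γ : Finset C)
    (hΓ : ∀ p ∈ box (m + 1), col p ∈ Γ)
    (hout : ∀ p q, p ∉ box m → q ∉ box m → TriAdj p q → col p = col q)
    (htri : ∀ p t, col p = col (nb (Fin.castSucc t) p) ∨ col p = col (nb 2 p) ∨
      col (nb (Fin.castSucc t) p) = col (nb 2 p)) :
    ∑ γ ∈ Γ, ∑ p ∈ box (m + 1), eulerTerm (fun q => col q = γ) (· ∈ box m) p = 1 := by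
  have hcol : ∀ p ∈ box (m + 1), ∑ γ ∈ Γ, eulerTerm (fun q => col q = γ) (· ∈ box m) p =
      eulerTerm (fun _ => True) (· ∈ box m) p + ∑ d : Fin 3, ind (col p ≠ col (nb d p))
        - ∑ t : Fin 2, ind (¬ (col p = col (nb t.castSucc p) ∧ col p = col (nb 2 p))) := by
    intro p hp
    have e0 : ∀ P : Prop, ∑ γ ∈ Γ, ind (col p = γ ∧ P) = ind P := by
      intro P
      rw [sum_eq_single (col p)]
      · simp
      · intro γ _ h; rw [ind_false]; exact fun h' => h h'.1.symm
      · grind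
    have e1 : ∀ d : Fin 3, ∑ γ ∈ Γ, ind (col p = γ ∧ col (nb d p) = γ ∧
        (p ∈ box m ∨ nb d p ∈ box m)) = ind (p ∈ box m ∨ nb d p ∈ box m)
          - ind (col p ≠ col (nb d p)) := by
      intro d
      rw [← sum_congr rfl fun γ _ => ind_congr (P := col p = γ ∧ (col p = col (nb d p) ∧
        (p ∈ box m ∨ nb d p ∈ box m))) (by constructor <;> (rintro ⟨rfl, h⟩; simp_all)), e0]
      by_cases h : col p = col (nb d p)
      · simp [h, ind]
      · have : p ∈ box m ∨ nb d p ∈ box m := by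
          by_contra hc
          push Not at hc
          exact h (hout _ _ hc.1 hc.2 (triAdj_nb d p))
        simp [h, ind, this]
    have e2 : ∀ t : Fin 2, ∑ γ ∈ Γ, ind (col p = γ ∧ col (nb t.castSucc p) = γ ∧ col (nb 2 p) = γ ∧
        (p ∈ box m ∨ nb t.castSucc p ∈ box m ∨ nb 2 p ∈ box m)) =
          ind (p ∈ box m ∨ nb t.castSucc p ∈ box m ∨ nb 2 p ∈ box m)
          - ind (¬ (col p = col (nb t.castSucc p) ∧ col p = col (nb 2 p))) := by
      intro t
      rw [← sum_congr rfl fun γ _ => ind_congr (P := col p = γ ∧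
        ((col p = col (nb t.castSucc p) ∧ col p = col (nb 2 p)) ∧
        (p ∈ box m ∨ nb t.castSucc p ∈ box m ∨ nb 2 p ∈ box m)))
        (by constructor
            · grind
            · rintro ⟨rfl, h⟩; exact ⟨rfl, ⟨h.1.symm, h.2.1.symm⟩, h.2.2⟩), e0]
      by_cases h : col p = col (nb t.castSucc p) ∧ col p = col (nb 2 p)
      · rw [ind_congr (and_iff_right h), ind_false (not_not.2 h), sub_zero]
      · have : p ∈ box m ∨ nb t.castSucc p ∈ box m ∨ nb 2 p ∈ box m := by
          by_contra hc
          push Not at hc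
          exact h ⟨hout _ _ hc.1 hc.2.1 (triAdj_nb _ p), hout _ _ hc.1 hc.2.2 (triAdj_nb _ p)⟩
        rw [ind_true this, ind_true h, ind_false (fun h' => h h'.1)]
        rfl
    simp only [eulerTerm, sum_add_distrib, sum_sub_distrib, e0]
    rw [sum_comm, sum_congr rfl fun d _ => e1 d, sum_comm (s := Γ),
      sum_congr rfl fun t _ => e2 t]
    simp only [sum_sub_distrib, true_and]
    ring
  rw [sum_comm, sum_congr rfl hcol]
  have hbi : ∑ p ∈ box (m + 1), ∑ d : Fin 3, ind (col p ≠ col (nb d p))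
      = ∑ p ∈ box (m + 1),
        ∑ t : Fin 2, ind (¬ (col p = col (nb t.castSucc p) ∧ col p = col (nb 2 p))) := by
    have hs : ∀ d e : Fin 3, e.val + d.val = 1 →
        ∑ p ∈ box (m + 1), ind (col (nb e p) ≠ col (nb d (nb e p)))
        = ∑ p ∈ box (m + 1), ind (col p ≠ col (nb d p)) := by
      intro d e hde
      have hne : ∀ p q, TriAdj p q → ind (col p ≠ col q) ≠ 0 → p ∈ box m ∨ q ∈ box m := by
        intro p q hpq h
        by_contra hc
        push Not at hc
        exact h (ind_false (fun h' => h' (hout _ _ hc.1 hc.2 hpq)))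
      refine sum_shift (F := fun p => ind (col p ≠ col (nb d p))) e (fun p hp => ?_) (fun p hp => ?_)
      · rcases hne _ _ (triAdj_nb d p) hp with h | h
        · exact box_mono (Nat.le_succ m) h
        · exact (triAdj_nb d p).symm.mem_box h
      · have e3 : nb d (nb e p) = nb 2 p := by
          fin_cases d <;> fin_cases e <;> simp [nb] at hde ⊢
        rcases hne _ _ (triAdj_nb d _) hp with h | h
        · exact (triAdj_nb e p).symm.mem_box h
        · rw [e3] at h
          exact (triAdj_nb 2 p).symm.mem_box h
    have h01 := hs 1 0 rfl
    have h10 := hs 0 1 rfl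
    have n01 : ∀ p, nb 1 (nb 0 p) = nb 2 p := fun p => by simp [nb]
    have n10 : ∀ p, nb 0 (nb 1 p) = nb 2 p := fun p => by simp [nb]
    simp only [n01, n10] at h01 h10
    have key : ∀ p, 2 * ∑ t : Fin 2, ind (¬ (col p = col (nb t.castSucc p) ∧ col p = col (nb 2 p)))
        = ind (col p ≠ col (nb 0 p)) + ind (col (nb 0 p) ≠ col (nb 2 p))
          + ind (col p ≠ col (nb 1 p)) + ind (col (nb 1 p) ≠ col (nb 2 p))
          + 2 * ind (col p ≠ col (nb 2 p)) := by
      intro p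
      have h0 := htri p 0
      have h1 := htri p 1
      simp only [Fin.sum_univ_two, Fin.castSucc_zero, Fin.castSucc_one] at h0 h1 ⊢
      have aux : ∀ a b c : C, (a = b ∨ a = c ∨ b = c) → 2 * ind (¬ (a = b ∧ a = c)) =
          ind (a ≠ b) + ind (b ≠ c) + ind (a ≠ c) := by
        intro a b c h
        by_cases hab : a = b
        · subst hab
          by_cases hac : a = c <;> simp [ind, hac]
        · by_cases hac : a = c
          · subst hac
            simp [ind, hab, Ne.symm hab]
          · have hbc : b = c := by tauto
            subst hbc
            simp [ind, hab]
      have a0 := aux _ _ _ h0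
      have a1 := aux _ _ _ h1
      linarith
    have h2 : 2 * ∑ p ∈ box (m + 1), ∑ d : Fin 3, ind (col p ≠ col (nb d p))
        = 2 * ∑ p ∈ box (m + 1),
          ∑ t : Fin 2, ind (¬ (col p = col (nb t.castSucc p) ∧ col p = col (nb 2 p))) := by
      rw [mul_sum _ (fun p => ∑ t : Fin 2,
        ind (¬ (col p = col (nb t.castSucc p) ∧ col p = col (nb 2 p)))),
        sum_congr rfl fun p _ => key p]
      simp only [sum_add_distrib, ← mul_sum, h01, h10, Fin.sum_univ_three]
      ring
    linarith
  rw [sum_sub_distrib, sum_add_distrib, hbi, sum_eulerTerm_box]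
  ring

end Planar
end QQ

namespace QQ
open Finset

section Islands
open Classical

/-- The contribution at `p` to the sum of the Euler characteristics of the odd level sets of `c`. -/
def oddTerm (c : Pt → ℤ) (p : Pt) : ℤ :=
  if Odd (c p) then eulerTerm (fun q => c q = c p) (fun q => c q = c p) p else 0

/-- A connected set of Euler characteristic one on which `c` is even, and all of whose outer
neighbours have the same odd value of `c`. -/
structure IsIsland (c : Pt → ℤ) (K : Finset Pt) : Prop where
  nonempty : K.Nonempty
  conn : ∀ u ∈ K, ∀ v ∈ K, ConnIn K u v
  even : ∀ u ∈ K, Even (c u)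
  nbr : ∃ ℓ, Odd ℓ ∧ ∀ u ∈ K, ∀ w, TriAdj u w → w ∉ K → c w = ℓ
  chi_eq : chi K = 1

variable {c : Pt → ℤ} {n : ℤ} {m : ℕ}

variable (c m) in
/-- The even points of the box. -/
def evens : Finset Pt := (box m).filter fun p => Even (c p)

variable (c m) in
/-- The component of an even point. -/
def evComp (v : Pt) : Finset Pt := (evens c m).filter (ConnIn (evens c m) v)

theorem mem_evens {p : Pt} : p ∈ evens c m ↔ p ∈ box m ∧ Even (c p) := mem_filter

theorem mem_evComp_self {v : Pt} (hv : v ∈ evens c m) : v ∈ evComp c m v :=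
  mem_filter.2 ⟨hv, Relation.ReflTransGen.refl⟩

theorem evComp_eq {u v : Pt} (h : u ∈ evComp c m v) : evComp c m u = evComp c m v := by
  rw [evComp, mem_filter] at h
  ext x
  simp only [evComp, mem_filter]
  exact and_congr_right fun _ => ⟨h.2.trans, h.2.symm.trans⟩

theorem evComp_adj {u v w : Pt} (h : u ∈ evComp c m v) (hw : w ∈ evens c m) (ha : TriAdj u w) :
    w ∈ evComp c m v := by
  rw [evComp, mem_filter] at h ⊢
  exact ⟨hw, h.2.tail ⟨h.1, hw, ha⟩⟩

theorem connIn_evComp {u v : Pt} (hv : v ∈ evens c m) (h : u ∈ evComp c m v) :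
    ConnIn (evComp c m v) v u := by
  rw [evComp, mem_filter] at h
  replace h := h.2
  have : u ∈ evComp c m v ∧ ConnIn (evComp c m v) v u := by
    induction h with
    | refl => exact ⟨mem_evComp_self hv, Relation.ReflTransGen.refl⟩
    | tail _ hbc ih =>
      have := evComp_adj ih.1 hbc.2.1 hbc.2.2
      exact ⟨this, ih.2.tail ⟨ih.1, this, hbc.2.2⟩⟩
  exact this.2

variable (c m) in
/-- The component of `v` has a lower neighbour, and it has a higher one or leaves the box. -/
def IsBound (v : Pt) : Prop :=
  (∃ u ∈ evComp c m v, ∃ w, TriAdj u w ∧ c w = c u - 1) ∧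
    ∃ u ∈ evComp c m v, ∃ w, TriAdj u w ∧ (c w = c u + 1 ∨ w ∉ box m)

theorem isBound_iff {u v : Pt} (h : u ∈ evComp c m v) : IsBound c m u ↔ IsBound c m v := by
  simp only [IsBound, evComp_eq h]

/-- Levels such that neighbouring levels differ by at most two, and agree if they are even. -/
structure IsLevel (c : Pt → ℤ) (n : ℤ) (m : ℕ) : Prop where
  le : ∀ p, c p ≤ 2 * n
  lip : ∀ u v, TriAdj u v → c u ≤ c v + 2
  even : ∀ u v, TriAdj u v → Even (c u) → Even (c v) → c u = c v
  out : ∀ p, p ∉ box m → c p = 2 * n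

theorem IsLevel.evComp_const (hc : IsLevel c n m) {u v : Pt} (h : u ∈ evComp c m v) :
    c u = c v := by
  rw [evComp, mem_filter] at h
  replace h := h.2
  induction h with
  | refl => rfl
  | tail _ hbc ih =>
    rw [← ih]
    exact (hc.even _ _ hbc.2.2 (mem_evens.1 hbc.1).2 (mem_evens.1 hbc.2.1).2).symm

theorem IsLevel.isBound_of_out (hc : IsLevel c n m) (hz : ∃ z, Odd (c z)) {v : Pt}
    (h : ∃ u ∈ evComp c m v, ∃ w, TriAdj u w ∧ w ∉ box m) : IsBound c m v := by
  obtain ⟨u, hu, w, huw, hw⟩ := h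
  refine ⟨?_, u, hu, w, huw, Or.inr hw⟩
  by_contra hlow
  push Not at hlow
  obtain ⟨z, hz⟩ := hz
  have hu' := mem_evens.1 (mem_filter.1 hu).1
  have hcu : c u = 2 * n := by
    rw [← hc.out w hw]
    exact hc.even _ _ huw hu'.2 (by rw [hc.out w hw]; exact even_two_mul n)
  have hzb : z ∈ box m := by
    by_contra h
    rw [hc.out z h] at hz
    grind
  have := box_connected (m := m) (K := (· ∈ evComp c m v)) (fun x hx y hy hxy => ?_) hu hu'.1 hzb
  · exact Int.not_odd_iff_even.2 (mem_evens.1 (mem_filter.1 this).1).2 hz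
  · refine evComp_adj hx (mem_evens.2 ⟨hy, ?_⟩) hxy
    by_contra hodd
    rw [Int.not_even_iff_odd] at hodd
    have h1 := hlow x hx y hxy
    have h2 : c x = 2 * n := by rw [hc.evComp_const hx, ← hc.evComp_const hu, hcu]
    have h3 := hc.le y
    have h4 := hc.lip _ _ hxy
    grind

variable (c n m) in
/-- The colour of a point: odd points and bound components are coloured by an odd level, and every
other component has a colour of its own. -/
def levelColour (p : Pt) : ℤ × Finset Pt :=
  if Odd (c p) then (c p, ∅) else if p ∉ box m then (2 * n + 1, ∅)
    else if IsBound c m p then (c p + 1, ∅) else (c p, evComp c m p)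

theorem levelColour_odd {p : Pt} (h : Odd (c p)) : levelColour c n m p = (c p, ∅) := if_pos h

theorem IsLevel.levelColour_out (hc : IsLevel c n m) {p : Pt} (h : p ∉ box m) :
    levelColour c n m p = (2 * n + 1, ∅) := by
  rw [levelColour, if_neg, if_pos h]
  rw [hc.out p h, Int.not_odd_iff_even]
  grind

theorem levelColour_bound {p : Pt} (h : p ∈ evens c m) (hb : IsBound c m p) :
    levelColour c n m p = (c p + 1, ∅) := by
  rw [mem_evens] at h
  rw [levelColour, if_neg (Int.not_odd_iff_even.2 h.2), if_neg (not_not.2 h.1), if_pos hb]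

theorem levelColour_free {p : Pt} (h : p ∈ evens c m) (hb : ¬ IsBound c m p) :
    levelColour c n m p = (c p, evComp c m p) := by
  rw [mem_evens] at h
  rw [levelColour, if_neg (Int.not_odd_iff_even.2 h.2), if_neg (not_not.2 h.1), if_neg hb]

theorem IsLevel.levelColour_even (hc : IsLevel c n m) (hz : ∃ z, Odd (c z)) {u v : Pt}
    (ha : TriAdj u v) (hu : Even (c u)) (hv : Even (c v)) :
    levelColour c n m u = levelColour c n m v := by
  have key : ∀ u v, TriAdj u v → Even (c u) → Even (c v) → u ∈ box m → v ∉ box m →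
      levelColour c n m u = levelColour c n m v := by
    intro u v ha hu hv hub hvb
    have he := mem_evens.2 ⟨hub, hu⟩
    rw [hc.levelColour_out hvb, levelColour_bound he
      (hc.isBound_of_out hz ⟨u, mem_evComp_self he, v, ha, hvb⟩), hc.even _ _ ha hu hv,
      hc.out v hvb]
  by_cases hub : u ∈ box m <;> by_cases hvb : v ∈ box m
  · have hue := mem_evens.2 ⟨hub, hu⟩
    have hve := mem_evens.2 ⟨hvb, hv⟩
    have hmem := evComp_adj (mem_evComp_self hue) hve ha
    by_cases hb : IsBound c m u
    · rw [levelColour_bound hue hb, levelColour_bound hve ((isBound_iff hmem).2 hb),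
        hc.even _ _ ha hu hv]
    · rw [levelColour_free hue hb, levelColour_free hve fun h => hb ((isBound_iff hmem).1 h),
        hc.even _ _ ha hu hv, evComp_eq hmem]
  · grind
  · exact (key _ _ ha.symm hv hu hvb hub).symm
  · rw [hc.levelColour_out hub, hc.levelColour_out hvb]

theorem IsLevel.levelColour_mid (hc : IsLevel c n m) {e x y : Pt} (hex : TriAdj e x)
    (hey : TriAdj e y) (he : Even (c e)) (hx : c x = c e - 1) (hy : c y = c e + 1) :
    levelColour c n m e = levelColour c n m y := by
  have heb : e ∈ box m := by
    by_contra h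
    have := hc.le y
    have := hc.out e h
    omega
  have h := mem_evens.2 ⟨heb, he⟩
  rw [levelColour_bound h ⟨⟨e, mem_evComp_self h, x, hex, hx⟩,
    ⟨e, mem_evComp_self h, y, hey, Or.inl hy⟩⟩, levelColour_odd, hy]
  grind

theorem IsLevel.levelColour_tri (hc : IsLevel c n m) (hz : ∃ z, Odd (c z)) {x y z : Pt}
    (hxy : TriAdj x y) (hxz : TriAdj x z) (hyz : TriAdj y z) :
    levelColour c n m x = levelColour c n m y ∨ levelColour c n m x = levelColour c n m z ∨
      levelColour c n m y = levelColour c n m z := by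
  have lip : ∀ u v, TriAdj u v → c u ≤ c v + 2 ∧ c v ≤ c u + 2 :=
    fun u v h => ⟨hc.lip _ _ h, hc.lip _ _ h.symm⟩
  have l1 := lip _ _ hxy
  have l2 := lip _ _ hxz
  have l3 := lip _ _ hyz
  have two : ∀ e x y, TriAdj e x → TriAdj e y → TriAdj x y → Even (c e) → Odd (c x) → Odd (c y) →
      levelColour c n m e = levelColour c n m x ∨ levelColour c n m e = levelColour c n m y ∨
      levelColour c n m x = levelColour c n m y := by
    intro e x y hex hey hxy he hx hy
    have l1 := lip _ _ hex
    have l2 := lip _ _ hey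
    have l3 := lip _ _ hxy
    rcases lt_trichotomy (c x) (c y) with h | h | h
    · have h1 : c x = c e - 1 := by grind
      have h2 : c y = c e + 1 := by grind
      exact Or.inr (Or.inl (hc.levelColour_mid hex hey he h1 h2))
    · exact Or.inr (Or.inr (by rw [levelColour_odd hx, levelColour_odd hy, h]))
    · have h1 : c y = c e - 1 := by grind
      have h2 : c x = c e + 1 := by grind
      exact Or.inl (hc.levelColour_mid hey hex he h1 h2)
  rcases Int.even_or_odd (c x) with ex | ex <;> rcases Int.even_or_odd (c y) with ey | ey <;>
    rcases Int.even_or_odd (c z) with ez | ez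
  · exact Or.inl (hc.levelColour_even hz hxy ex ey)
  · exact Or.inl (hc.levelColour_even hz hxy ex ey)
  · exact Or.inr (Or.inl (hc.levelColour_even hz hxz ex ez))
  · grind
  · exact Or.inr (Or.inr (hc.levelColour_even hz hyz ey ez))
  · rcases two _ _ _ hxy.symm hyz hxz ey ex ez with h | h | h
    exacts [Or.inl h.symm, Or.inr (Or.inr h), Or.inr (Or.inl h)]
  · rcases two _ _ _ hxz.symm hyz.symm hxy ez ex ey with h | h | h
    exacts [Or.inr (Or.inl h.symm), Or.inr (Or.inr h.symm), Or.inl h]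
  · rw [levelColour_odd ex, levelColour_odd ey, levelColour_odd ez]
    grind

theorem eulerTerm_of_subset {A B : Pt → Prop} (h : ∀ p, A p → B p) (p : Pt) :
    eulerTerm A B p = eulerTerm A A p := by
  have e0 : ind (A p ∧ B p) = ind (A p ∧ A p) :=
    ind_congr ⟨fun a => ⟨a.1, a.1⟩, fun a => ⟨a.1, h _ a.1⟩⟩
  have e1 : ∀ q, ind (A p ∧ A q ∧ (B p ∨ B q)) = ind (A p ∧ A q ∧ (A p ∨ A q)) := fun q =>
    ind_congr ⟨fun a => ⟨a.1, a.2.1, Or.inl a.1⟩, fun a => ⟨a.1, a.2.1, Or.inl (h _ a.1)⟩⟩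
  have e2 : ∀ q r, ind (A p ∧ A q ∧ A r ∧ (B p ∨ B q ∨ B r)) =
      ind (A p ∧ A q ∧ A r ∧ (A p ∨ A q ∨ A r)) := fun q r =>
    ind_congr ⟨fun a => ⟨a.1, a.2.1, a.2.2.1, Or.inl a.1⟩,
      fun a => ⟨a.1, a.2.1, a.2.2.1, Or.inl (h _ a.1)⟩⟩
  simp only [eulerTerm, e0, e1, e2]

theorem eulerTerm_split {A B Z W : Pt → Prop} (h1 : ∀ p, Z p → A p) (h2 : ∀ p, Z p → B p)
    (h3 : ∀ p, Z p → ¬ W p) (h4 : ∀ p, W p → B p) (h5 : ∀ p, A p → B p → ¬ W p → Z p)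
    (h6 : ∀ p q, A p → ¬ B p → ¬ Z q) (p : Pt) :
    eulerTerm A B p = eulerTerm Z Z p + eulerTerm A W p := by
  have key : ∀ q r, Z q → A r → ¬ W r → Z r := by grind
  have e0 : ind (A p ∧ B p) = ind (Z p ∧ Z p) + ind (A p ∧ W p) := by
    by_cases hw : W p
    · rw [ind_false (P := Z p ∧ Z p) (fun z => h3 _ z.1 hw), zero_add]
      grind
    · rw [ind_false (P := A p ∧ W p) (fun z => hw z.2), add_zero]
      exact ind_congr ⟨fun a => ⟨h5 _ a.1 a.2 hw, h5 _ a.1 a.2 hw⟩, fun z => ⟨h1 _ z.1, h2 _ z.1⟩⟩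
  have e1 : ∀ q, ind (A p ∧ A q ∧ (B p ∨ B q)) =
      ind (Z p ∧ Z q ∧ (Z p ∨ Z q)) + ind (A p ∧ A q ∧ (W p ∨ W q)) := by
    intro q
    by_cases hw : W p ∨ W q
    · rw [ind_false (P := Z p ∧ _) (fun z => hw.elim (h3 _ z.1) (h3 _ z.2.1)), zero_add]
      grind
    · rw [ind_false (P := A p ∧ A q ∧ (W p ∨ W q)) (fun z => hw z.2.2), add_zero]
      rw [not_or] at hw
      refine ind_congr ⟨?_, fun z => ⟨h1 _ z.1, h1 _ z.2.1, Or.inl (h2 _ z.1)⟩⟩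
      grind
  have e2 : ∀ q r, ind (A p ∧ A q ∧ A r ∧ (B p ∨ B q ∨ B r)) =
      ind (Z p ∧ Z q ∧ Z r ∧ (Z p ∨ Z q ∨ Z r)) + ind (A p ∧ A q ∧ A r ∧ (W p ∨ W q ∨ W r)) := by
    intro q r
    by_cases hw : W p ∨ W q ∨ W r
    · grind
    · rw [ind_false (P := A p ∧ A q ∧ A r ∧ (W p ∨ W q ∨ W r)) (fun z => hw z.2.2.2), add_zero]
      rw [not_or, not_or] at hw
      obtain ⟨w1, w2, w3⟩ := hw
      refine ind_congr ⟨?_, fun z => ⟨h1 _ z.1, h1 _ z.2.1, h1 _ z.2.2.1, Or.inl (h2 _ z.1)⟩⟩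
      grind
  simp only [eulerTerm, e0, e1, e2, sum_add_distrib]
  ring

theorem IsLevel.euler_odd (hc : IsLevel c n m) {ℓ : ℤ} (hℓ : Odd ℓ) :
    ∑ p ∈ box (m + 1), eulerTerm (fun q => levelColour c n m q = (ℓ, ∅)) (· ∈ box m) p
      ≤ ∑ p ∈ box (m + 1), eulerTerm (fun q => c q = ℓ) (fun q => c q = ℓ) p := by
  set A : Pt → Prop := fun q => levelColour c n m q = (ℓ, ∅) with hA
  set W := (evens c m).filter fun p => IsBound c m p ∧ c p + 1 = ℓ with hW
  have hmemW : ∀ p, p ∈ W ↔ p ∈ evens c m ∧ IsBound c m p ∧ c p + 1 = ℓ :=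
    fun p => mem_filter
  have hWb : ∀ p, p ∈ W → p ∈ box m := fun p hp => (mem_evens.1 ((hmemW p).1 hp).1).1
  have hzb : ∀ p, c p = ℓ → p ∈ box m ∧ ℓ ≠ 2 * n + 1 ∧ p ∉ W := by
    intro p hp
    refine ⟨?_, ?_, fun h => ?_⟩
    · by_contra h
      rw [← hp, hc.out p h] at hℓ
      grind
    · have := hc.le p
      omega
    · grind
  have hAiff : ∀ p, A p ↔ c p = ℓ ∨ p ∈ W ∨ (p ∉ box m ∧ ℓ = 2 * n + 1) := by
    intro p
    simp only [hA]
    rcases Int.even_or_odd (c p) with hp | hp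
    · by_cases hpb : p ∈ box m
      · have hpe := mem_evens.2 ⟨hpb, hp⟩
        have hne : c p ≠ ℓ := by grind
        by_cases hb : IsBound c m p
        · rw [levelColour_bound hpe hb, hmemW]
          grind
        · rw [levelColour_free hpe hb, hmemW]
          simp [hb, hpb, hne]
      · rw [hc.levelColour_out hpb]
        grind
    · rw [levelColour_odd hp, hmemW, mem_evens]
      have h1 : ¬ Even (c p) := Int.not_even_iff_odd.2 hp
      have h2 : p ∈ box m := by
        by_contra h
        rw [hc.out p h] at hp
        grind
      simp [h1, h2]
  have hsplit : ∀ p, eulerTerm A (· ∈ box m) p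
      = eulerTerm (fun q => c q = ℓ) (fun q => c q = ℓ) p + eulerTerm A (· ∈ W) p := by
    refine eulerTerm_split (fun p h => (hAiff p).2 (Or.inl h)) (fun p h => (hzb p h).1)
      (fun p h => (hzb p h).2.2) hWb (fun p a b w => ?_) (fun p q a b z => ?_)
    · grind
    · grind
  rw [sum_congr rfl fun p _ => hsplit p, sum_add_distrib]
  have hcompW : ∀ w ∈ W, evComp c m w ⊆ W := by
    intro w hw u hu
    rw [hmemW] at hw ⊢
    refine ⟨(mem_filter.1 hu).1, (isBound_iff hu).2 hw.2.1, ?_⟩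
    rw [hc.evComp_const hu]
    exact hw.2.2
  have : ∑ p ∈ box (m + 1), eulerTerm A (· ∈ W) p ≤ 0 := by
    refine sum_eulerTerm_nonpos (fun w hw => (hAiff w).2 (Or.inr (Or.inl hw))) ?_ ?_
      (fun w hw p hp => box_star (hWb w hw) p hp)
    · intro w hw
      obtain ⟨he, ⟨⟨u, hu, v, huv, hv⟩, -⟩, hl⟩ := (hmemW w).1 hw
      refine ⟨u, hcompW w hw hu, (connIn_evComp he hu).mono (hcompW w hw), v, huv, ?_⟩
      have huc := hc.evComp_const hu
      have : Odd (c v) := by grind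
      simp only [hA]
      rw [levelColour_odd this]
      grind
    · intro w hw
      obtain ⟨he, ⟨-, u, hu, v, huv, hv⟩, hl⟩ := (hmemW w).1 hw
      have huc := hc.evComp_const hu
      refine ⟨u, hcompW w hw hu, (connIn_evComp he hu).mono (hcompW w hw), v, huv, ?_⟩
      rcases hv with hv | hv
      · grind
      · refine ⟨(hAiff v).2 (Or.inr (Or.inr ⟨hv, ?_⟩)), fun h => hv (hWb v h)⟩
        have h1 := hc.even u v huv (mem_evens.1 (mem_filter.1 hu).1).2
          (by rw [hc.out v hv]; exact even_two_mul n)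
        rw [hc.out v hv] at h1
        omega
  linarith

theorem IsLevel.euler_free (hc : IsLevel c n m) {v : Pt} (hv : v ∈ evens c m)
    (hb : ¬ IsBound c m v) :
    ∑ p ∈ box (m + 1), eulerTerm (fun q => levelColour c n m q = (c v, evComp c m v)) (· ∈ box m) p
      = chi (evComp c m v) := by
  have hKb : evComp c m v ⊆ box m := fun u hu => (mem_evens.1 (mem_filter.1 hu).1).1
  have hA : ∀ q, levelColour c n m q = (c v, evComp c m v) ↔ q ∈ evComp c m v := by
    intro q
    constructor
    · intro h
      have hne : evComp c m v ≠ ∅ := ne_empty_of_mem (mem_evComp_self hv)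
      have h2 := congrArg Prod.snd h
      rcases Int.even_or_odd (c q) with hq | hq
      · by_cases hqb : q ∈ box m
        · have hqe := mem_evens.2 ⟨hqb, hq⟩
          by_cases hb' : IsBound c m q
          · rw [levelColour_bound hqe hb'] at h2
            grind
          · rw [levelColour_free hqe hb'] at h2
            rw [← show evComp c m q = evComp c m v from h2]
            exact mem_evComp_self hqe
        · rw [hc.levelColour_out hqb] at h2
          grind
      · rw [levelColour_odd hq] at h2
        grind
    · intro h
      rw [levelColour_free (mem_filter.1 h).1 fun h' => hb ((isBound_iff h).1 h'),
        hc.evComp_const h, evComp_eq h]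
  rw [chi_eq_sum (hKb.trans (box_mono (Nat.le_succ m))),
    show (fun q => levelColour c n m q = (c v, evComp c m v)) = (· ∈ evComp c m v) from
      funext fun q => propext (hA q)]
  exact sum_congr rfl fun p _ => eulerTerm_of_subset (fun _ h => hKb h) p

theorem IsLevel.isIsland (hc : IsLevel c n m) (hz : ∃ z, Odd (c z)) {v : Pt}
    (hv : v ∈ evens c m) (hb : ¬ IsBound c m v) (hchi : chi (evComp c m v) = 1) :
    IsIsland c (evComp c m v) := by
  have hnout : ∀ u ∈ evComp c m v, ∀ w, TriAdj u w → w ∈ box m := by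
    intro u hu w huw
    by_contra h
    exact hb (hc.isBound_of_out hz ⟨u, hu, w, huw, h⟩)
  have hodd : ∀ u ∈ evComp c m v, ∀ w, TriAdj u w → w ∉ evComp c m v → Odd (c w) := by
    intro u hu w huw hw
    by_contra h
    exact hw (evComp_adj hu (mem_evens.2 ⟨hnout u hu w huw, Int.not_odd_iff_even.1 h⟩) huw)
  have hev := (mem_evens.1 hv).2
  refine ⟨⟨v, mem_evComp_self hv⟩, fun u hu w hw => ?_,
    fun u hu => (mem_evens.1 (mem_filter.1 hu).1).2, ?_, hchi⟩
  · exact (connIn_evComp hv hu).symm.trans (connIn_evComp hv hw)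
  · have hpm : ∀ u ∈ evComp c m v, ∀ w, TriAdj u w → w ∉ evComp c m v →
        c w = c v - 1 ∨ c w = c v + 1 := by
      intro u hu w huw hw
      have h1 := hc.lip _ _ huw
      have h2 := hc.lip _ _ huw.symm
      have h3 := hodd u hu w huw hw
      have h4 := hc.evComp_const hu
      grind
    by_cases hlow : ∃ u ∈ evComp c m v, ∃ w, TriAdj u w ∧ c w = c u - 1
    · refine ⟨c v - 1, hev.sub_odd odd_one, fun u hu w huw hw => ?_⟩
      refine (hpm u hu w huw hw).resolve_right fun h => hb ⟨hlow, u, hu, w, huw, Or.inl ?_⟩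
      rw [h, hc.evComp_const hu]
    · refine ⟨c v + 1, hev.add_one, fun u hu w huw hw => ?_⟩
      refine (hpm u hu w huw hw).resolve_left fun h => hlow ⟨u, hu, w, huw, ?_⟩
      rw [h, hc.evComp_const hu]

variable (c m) in
/-- The islands in a box. -/
def islands : Finset (Finset Pt) := (box m).powerset.filter (IsIsland c)

theorem IsLevel.one_le (hc : IsLevel c n m) (hz : ∃ z, Odd (c z)) :
    1 ≤ ∑ p ∈ box (m + 1), oddTerm c p + (islands c m).card := by
  set Γ := (box (m + 1)).image (levelColour c n m) with hΓ
  have h1 := sum_colour m (levelColour c n m) Γ (fun p hp => mem_image_of_mem _ hp)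
    (fun p q hp hq _ => by rw [hc.levelColour_out hp, hc.levelColour_out hq])
    (fun p t => hc.levelColour_tri hz (triAdj_nb _ p) (triAdj_nb _ p) (by
      fin_cases t
      · exact ⟨1, Or.inl (by simp [nb])⟩
      · exact ⟨0, Or.inl (by simp [nb])⟩))
  have hcase : ∀ γ ∈ Γ, (Odd γ.1 ∧ γ.2 = ∅) ∨
      (∃ v ∈ evens c m, ¬ IsBound c m v ∧ γ = (c v, evComp c m v)) := by
    intro γ hγ
    obtain ⟨p, -, rfl⟩ := mem_image.1 hγ
    rcases Int.even_or_odd (c p) with hp | hp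
    · by_cases hpb : p ∈ box m
      · have hpe := mem_evens.2 ⟨hpb, hp⟩
        by_cases hb : IsBound c m p
        · rw [levelColour_bound hpe hb]
          grind
        · exact Or.inr ⟨p, hpe, hb, levelColour_free hpe hb⟩
      · rw [hc.levelColour_out hpb]
        grind
    · rw [levelColour_odd hp]
      grind
  have hle : ∀ γ ∈ Γ, ∑ p ∈ box (m + 1), eulerTerm (fun q => levelColour c n m q = γ) (· ∈ box m) p
      ≤ (if γ.2 = ∅ then ∑ p ∈ box (m + 1), eulerTerm (fun q => c q = γ.1) (fun q => c q = γ.1) p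
          else 0) + if IsIsland c γ.2 ∧ γ.2 ⊆ box m then 1 else 0 := by
    intro γ hγ
    rcases hcase γ hγ with ⟨h, h'⟩ | ⟨v, hv, hb, rfl⟩
    · obtain ⟨ℓ, K⟩ := γ
      simp only at h h'
      subst h'
      rw [if_pos rfl, if_neg fun h => by simpa using h.1.nonempty, add_zero]
      exact hc.euler_odd h
    · rw [if_neg (ne_empty_of_mem (mem_evComp_self hv)), hc.euler_free hv hb, zero_add]
      have hKb : evComp c m v ⊆ box m := fun u hu => (mem_evens.1 (mem_filter.1 hu).1).1
      have hchi := chi_le_one (mem_evComp_self hv) fun w hw => (connIn_evComp hv hw).symm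
      split_ifs with h
      · exact hchi
      · rcases hchi.lt_or_eq with h' | h'
        · omega
        · exact absurd ⟨hc.isIsland hz hv hb h', hKb⟩ h
  rw [← h1]
  refine (sum_le_sum hle).trans ?_
  rw [sum_add_distrib]
  refine add_le_add (le_of_eq ?_) ?_
  · rw [← sum_filter, sum_comm]
    refine sum_congr rfl fun p hp => ?_
    rw [oddTerm]
    split_ifs with hodd
    · rw [sum_eq_single (c p, ∅)]
      · intro γ hγ hne
        refine eulerTerm_eq_zero fun h => hne ?_
        grind
      · intro h
        have hmem : (c p, ∅) ∈ Γ := by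
          rw [← levelColour_odd (n := n) (m := m) hodd]
          grind
        grind
    · refine sum_eq_zero fun γ hγ => eulerTerm_eq_zero fun h => hodd ?_
      rw [mem_filter] at hγ
      rcases hcase γ hγ.1 with ⟨h', -⟩ | ⟨v, hv, -, h'⟩
      · rw [h]; exact h'
      · rw [h'] at hγ
        exact absurd hγ.2 (ne_empty_of_mem (mem_evComp_self hv))
  · rw [← sum_filter, sum_const, nsmul_eq_mul, mul_one, Nat.cast_le]
    refine card_le_card_of_injOn Prod.snd (fun γ hγ => ?_) (fun γ hγ γ' hγ' h => ?_)
    · rw [mem_coe, mem_filter] at hγ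
      exact mem_coe.2 (mem_filter.2 ⟨mem_powerset.2 hγ.2.2, hγ.2.1⟩)
    · rw [mem_coe, mem_filter] at hγ hγ'
      rcases hcase γ hγ.1 with ⟨-, h1⟩ | ⟨v, hv, -, h1⟩
      · exact absurd h1 (nonempty_iff_ne_empty.1 hγ.2.1.nonempty)
      rcases hcase γ' hγ'.1 with ⟨-, h2⟩ | ⟨v', hv', -, h2⟩
      · exact absurd h2 (nonempty_iff_ne_empty.1 hγ'.2.1.nonempty)
      refine Prod.ext ?_ h
      rw [h1, h2] at h ⊢
      simp only at h ⊢
      exact hc.evComp_const (h ▸ mem_evComp_self hv)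

end Islands
end QQ

namespace QQ
open Finset

/-! ## Height functions of plane partitions -/

/-- The height function of the empty plane partition in the `k`-th layer. -/
def vac (k : ℕ) (p : Pt) : ℤ := max 0 (max (-p.1) (-p.2)) - k

/-- Height functions of plane partitions. -/
def IsHeight (f : Pt → ℤ) : Prop := ∀ p d, f (nb d p) ≤ f p ∧ f p ≤ f (nb d p) + 1

theorem isHeight_vac (k : ℕ) : IsHeight (vac k) := by
  intro p d
  fin_cases d <;> simp [nb, vac] <;> omega

/-- The signs of the three directions. -/
def eps (d : Fin 3) : ℤ := ![1, 1, -1] d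

/-- The local contribution to the number of coincidences of two sets of boxes. -/
def bform (f g : Pt → ℤ) (p : Pt) : ℤ :=
  min (f p) (g p) - min (f p) (g p + 1)
    - ∑ d : Fin 3, eps d * (min (f (nb d p)) (g p) - min (f p) (g (nb d p) + 1))

theorem bform_add_comm (f g : Pt → ℤ) (p : Pt) :
    bform f g p + bform g f p = ind (f p = g p) - 1
      + ∑ d : Fin 3, eps d * (ind (f (nb d p) < g p) + ind (g (nb d p) < f p)) := by
  have h1 : ∀ d, min (f (nb d p)) (g p) - min (g p) (f (nb d p) + 1) = -ind (f (nb d p) < g p) := by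
    intro d
    unfold ind
    split_ifs <;> omega
  have h2 : ∀ d, min (g (nb d p)) (f p) - min (f p) (g (nb d p) + 1) = -ind (g (nb d p) < f p) := by
    intro d
    unfold ind
    split_ifs <;> omega
  have h3 : min (f p) (g p) - min (f p) (g p + 1) + (min (g p) (f p) - min (g p) (f p + 1))
      = ind (f p = g p) - 1 := by
    unfold ind
    split_ifs <;> omega
  have h4 : ∀ d, eps d * (min (f (nb d p)) (g p) - min (f p) (g (nb d p) + 1))
      + eps d * (min (g (nb d p)) (f p) - min (g p) (f (nb d p) + 1))
      = -(eps d * (ind (f (nb d p) < g p) + ind (g (nb d p) < f p))) := by grind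
  have h5 := sum_congr rfl fun d (_ : d ∈ univ) => h4 d
  rw [sum_add_distrib, sum_neg_distrib] at h5
  rw [bform, bform, ← h3]
  omega

theorem ind_edge {f g : Pt → ℤ} (hf : IsHeight f) (hg : IsHeight g) (p : Pt) (d : Fin 3) :
    ind (f (nb d p) < g p) + ind (g (nb d p) < f p) = 1 - ind (f p = g p ∧ f (nb d p) = g (nb d p))
      + 2 * ind (f p = g p ∧ f (nb d p) = g (nb d p) ∧ f (nb d p) < f p) := by
  have h1 := hf p d
  have h2 := hg p d
  unfold ind
  split_ifs <;> omega

/-- A step of a height function in a positive direction, or the absence of a step in the diagonal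
direction: every triangle has exactly one such edge. -/
def Crease (f : Pt → ℤ) (p : Pt) (d : Fin 3) : Prop :=
  if d = 2 then f (nb d p) = f p else f (nb d p) < f p

theorem two_mul_crease {f : Pt → ℤ} (hf : IsHeight f) {K : Pt → Prop} {m : ℕ}
    (hK : ∀ p, K p → p ∈ box m)
    (h0 : ∀ p, K p → K (nb 0 p) → Crease f p 0 → K (nb 2 p) ∧ K (p.1, p.2 - 1))
    (h1 : ∀ p, K p → K (nb 1 p) → Crease f p 1 → K (nb 2 p) ∧ K (p.1 - 1, p.2))
    (h2 : ∀ p, K p → K (nb 2 p) → Crease f p 2 → K (nb 0 p) ∧ K (nb 1 p)) :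
    ∑ p ∈ box (m + 1), ∑ t : Fin 2, ind (K p ∧ K (nb t.castSucc p) ∧ K (nb 2 p))
      = 2 * ∑ p ∈ box (m + 1), ∑ d : Fin 3, ind (K p ∧ K (nb d p) ∧ Crease f p d) := by
  have n01 : ∀ p, nb 1 (nb 0 p) = nb 2 p := fun p => by simp [nb]
  have n10 : ∀ p, nb 0 (nb 1 p) = nb 2 p := fun p => by simp [nb]
  have r0 : ∀ p : Pt, ((nb 1 p).1, (nb 1 p).2 - 1) = p := fun p => by simp [nb]
  have r1 : ∀ p : Pt, ((nb 0 p).1 - 1, (nb 0 p).2) = p := fun p => by simp [nb]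
  have hne : ∀ P : Prop, ind P ≠ 0 → P := fun P h => by
    by_contra hc
    exact h (ind_false hc)
  have key : ∀ p, ∑ t : Fin 2, ind (K p ∧ K (nb t.castSucc p) ∧ K (nb 2 p)) =
      ind (K p ∧ K (nb 0 p) ∧ Crease f p 0) + ind (K p ∧ K (nb 1 p) ∧ Crease f p 1)
      + 2 * ind (K p ∧ K (nb 2 p) ∧ Crease f p 2)
      + ind (K (nb 1 p) ∧ K (nb 0 (nb 1 p)) ∧ Crease f (nb 1 p) 0)
      + ind (K (nb 0 p) ∧ K (nb 1 (nb 0 p)) ∧ Crease f (nb 0 p) 1) := by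
    intro p
    have a0 := hf p 0
    have a1 := hf p 1
    have a2 := hf p 2
    have b0 := hf (nb 1 p) 0
    have b1 := hf (nb 0 p) 1
    rw [n01] at b1
    rw [n10] at b0
    have c0 : Crease f p 0 ↔ f (nb 0 p) < f p := by simp [Crease]
    have c1 : Crease f p 1 ↔ f (nb 1 p) < f p := by simp [Crease]
    have c2 : Crease f p 2 ↔ f (nb 2 p) = f p := by simp [Crease]
    have c3 : Crease f (nb 1 p) 0 ↔ f (nb 2 p) < f (nb 1 p) := by simp [Crease, n10]
    have c4 : Crease f (nb 0 p) 1 ↔ f (nb 2 p) < f (nb 0 p) := by simp [Crease, n01]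
    have e0 := h0 p
    have e1 := h1 p
    have e2 := h2 p
    have e3 := h0 (nb 1 p)
    have e4 := h1 (nb 0 p)
    rw [n10, r0] at e3
    rw [n01, r1] at e4
    rw [n10, n01]
    rw [c0] at e0 ⊢
    rw [c1] at e1 ⊢
    rw [c2] at e2 ⊢
    rw [c3] at e3 ⊢
    rw [c4] at e4 ⊢
    rw [Fin.sum_univ_two, Fin.castSucc_zero, Fin.castSucc_one]
    have T0 : ind (K p ∧ K (nb 0 p) ∧ K (nb 2 p)) = ind (K p ∧ K (nb 0 p) ∧ f (nb 0 p) < f p)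
        + ind (K p ∧ K (nb 2 p) ∧ f (nb 2 p) = f p)
        + ind (K (nb 0 p) ∧ K (nb 2 p) ∧ f (nb 2 p) < f (nb 0 p)) := by
      by_cases hT : K p ∧ K (nb 0 p) ∧ K (nb 2 p)
      · obtain ⟨k1, k2, k3⟩ := hT
        simp only [k1, k2, k3, true_and]
        unfold ind
        split_ifs <;> omega
      · rw [ind_false hT, ind_false (fun h => hT ⟨h.1, h.2.1, (e0 h.1 h.2.1 h.2.2).1⟩),
          ind_false (fun h => hT ⟨h.1, (e2 h.1 h.2.1 h.2.2).1, h.2.1⟩),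
          ind_false (fun h => hT ⟨(e4 h.1 h.2.1 h.2.2).2, h.1, h.2.1⟩)]
        rfl
    have T1 : ind (K p ∧ K (nb 1 p) ∧ K (nb 2 p)) = ind (K p ∧ K (nb 1 p) ∧ f (nb 1 p) < f p)
        + ind (K p ∧ K (nb 2 p) ∧ f (nb 2 p) = f p)
        + ind (K (nb 1 p) ∧ K (nb 2 p) ∧ f (nb 2 p) < f (nb 1 p)) := by
      by_cases hT : K p ∧ K (nb 1 p) ∧ K (nb 2 p)
      · obtain ⟨k1, k2, k3⟩ := hT
        simp only [k1, k2, k3, true_and]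
        unfold ind
        split_ifs <;> omega
      · rw [ind_false hT, ind_false (fun h => hT ⟨h.1, h.2.1, (e1 h.1 h.2.1 h.2.2).1⟩),
          ind_false (fun h => hT ⟨h.1, (e2 h.1 h.2.1 h.2.2).2, h.2.1⟩),
          ind_false (fun h => hT ⟨(e3 h.1 h.2.1 h.2.2).2, h.1, h.2.1⟩)]
        rfl
    omega
  have hs : ∀ d e : Fin 3, ∑ p ∈ box (m + 1), ind (K (nb e p) ∧ K (nb d (nb e p)) ∧
      Crease f (nb e p) d) = ∑ p ∈ box (m + 1), ind (K p ∧ K (nb d p) ∧ Crease f p d) := by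
    intro d e
    refine sum_shift (F := fun p => ind (K p ∧ K (nb d p) ∧ Crease f p d)) e
      (fun p hp => box_mono (Nat.le_succ m) (hK _ (hne _ hp).1))
      (fun p hp => (triAdj_nb e p).symm.mem_box (hK _ (hne _ hp).1))
  rw [sum_congr rfl fun p _ => key p]
  simp only [sum_add_distrib, ← mul_sum, hs, Fin.sum_univ_three]
  ring

theorem sum_bform_add_comm {f g : Pt → ℤ} (hf : IsHeight f) (hg : IsHeight g) {m : ℕ}
    (hm : ∀ p, f p = g p → p ∈ box m) :
    ∑ p ∈ box (m + 1), (bform f g p + bform g f p) =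
      ∑ p ∈ box (m + 1), eulerTerm (fun q => f q = g q) (fun q => f q = g q) p := by
  have n01 : ∀ p, nb 1 (nb 0 p) = nb 2 p := fun p => by simp [nb]
  have n10 : ∀ p, nb 0 (nb 1 p) = nb 2 p := fun p => by simp [nb]
  have hT := two_mul_crease hf (K := fun p => f p = g p) hm ?_ ?_ ?_
  rotate_left
  · intro p k1 k2 k3
    simp only [Crease] at k3
    have a1 := hf p 0
    have a2 := hg p 0
    have b1 := hf (nb 0 p) 1
    have b2 := hg (nb 0 p) 1
    rw [n01] at b1 b2
    have d1 := hf p 2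
    have d2 := hg p 2
    have r0 : nb 1 (p.1, p.2 - 1) = p := by simp [nb]
    have r1 : nb 2 (p.1, p.2 - 1) = nb 0 p := by simp [nb]
    have e1 := hf (p.1, p.2 - 1) 1
    have e2 := hg (p.1, p.2 - 1) 1
    have e3 := hf (p.1, p.2 - 1) 2
    have e4 := hg (p.1, p.2 - 1) 2
    grind
  · intro p k1 k2 k3
    simp only [Crease] at k3
    have a1 := hf p 1
    have a2 := hg p 1
    have b1 := hf (nb 1 p) 0
    have b2 := hg (nb 1 p) 0
    rw [n10] at b1 b2
    have d1 := hf p 2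
    have d2 := hg p 2
    have r0 : nb 0 (p.1 - 1, p.2) = p := by simp [nb]
    have r1 : nb 2 (p.1 - 1, p.2) = nb 1 p := by simp [nb]
    have e1 := hf (p.1 - 1, p.2) 0
    have e2 := hg (p.1 - 1, p.2) 0
    have e3 := hf (p.1 - 1, p.2) 2
    have e4 := hg (p.1 - 1, p.2) 2
    grind
  · intro p k1 k2 k3
    simp only [Crease] at k3
    have a1 := hf p 0
    have a2 := hg p 0
    have b1 := hf (nb 0 p) 1
    have b2 := hg (nb 0 p) 1
    rw [n01] at b1 b2
    have a3 := hf p 1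
    have a4 := hg p 1
    have b3 := hf (nb 1 p) 0
    have b4 := hg (nb 1 p) 0
    grind
  have hterm : ∀ p, bform f g p + bform g f p
      = eulerTerm (fun q => f q = g q) (fun q => f q = g q) p
        + 2 * ∑ d : Fin 3, ind (f p = g p ∧ f (nb d p) = g (nb d p) ∧ Crease f p d)
        - ∑ t : Fin 2, ind (f p = g p ∧ f (nb t.castSucc p) = g (nb t.castSucc p) ∧
          f (nb 2 p) = g (nb 2 p)) := by
    intro p
    rw [bform_add_comm]
    simp only [ind_edge hf hg, eulerTerm]
    have e0 : ind (f p = g p ∧ f p = g p) = ind (f p = g p) := ind_congr and_self_iff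
    have e1 : ∀ d : Fin 3, ind (f p = g p ∧ f (nb d p) = g (nb d p) ∧
        (f p = g p ∨ f (nb d p) = g (nb d p))) = ind (f p = g p ∧ f (nb d p) = g (nb d p)) :=
      fun d => ind_congr ⟨fun h => ⟨h.1, h.2.1⟩, fun h => ⟨h.1, h.2, Or.inl h.1⟩⟩
    have e2 : ∀ t : Fin 2, ind (f p = g p ∧ f (nb t.castSucc p) = g (nb t.castSucc p) ∧
        f (nb 2 p) = g (nb 2 p) ∧
        (f p = g p ∨ f (nb t.castSucc p) = g (nb t.castSucc p) ∨ f (nb 2 p) = g (nb 2 p)))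
        = ind (f p = g p ∧ f (nb t.castSucc p) = g (nb t.castSucc p) ∧ f (nb 2 p) = g (nb 2 p)) :=
      fun d => ind_congr ⟨fun h => ⟨h.1, h.2.1, h.2.2.1⟩, fun h => ⟨h.1, h.2.1, h.2.2, Or.inl h.1⟩⟩
    simp only [e0, e1, e2, Fin.sum_univ_three]
    have c0 : Crease f p 0 ↔ f (nb 0 p) < f p := by simp [Crease]
    have c1 : Crease f p 1 ↔ f (nb 1 p) < f p := by simp [Crease]
    have c2 : ind (f p = g p ∧ f (nb 2 p) = g (nb 2 p) ∧ Crease f p 2) =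
        ind (f p = g p ∧ f (nb 2 p) = g (nb 2 p))
          - ind (f p = g p ∧ f (nb 2 p) = g (nb 2 p) ∧ f (nb 2 p) < f p) := by
      have := hf p 2
      simp only [Crease, if_true]
      unfold ind
      split_ifs <;> omega
    rw [c0, c1, c2]
    simp [eps]
    ring
  rw [sum_congr rfl fun p _ => hterm p]
  simp only [sum_sub_distrib, sum_add_distrib, ← mul_sum]
  rw [hT]
  ring

/-! ### Coincidences of boxes -/

/-- Positions of boxes: a line in the direction `(1, 1, 1)` and the position on it. -/
abbrev Pos := Pt × ℤ

/-- The displacements in the three coordinate directions. -/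
def dir (i : Fin 3) : Pos := ![((1, 0), 0), ((0, 1), 0), ((-1, -1), 1)] i

/-- The displacement by a corner of the unit cube. -/
def disp (S : Finset (Fin 3)) : Pos := ∑ i ∈ S, dir i

theorem sum_finset_fin_three {M : Type*} [AddCommMonoid M] (F : Finset (Fin 3) → M) :
    ∑ S, F S = F ∅ + F {0} + F {1} + F {0, 1} + F {2} + F {0, 2} + F {1, 2} + F {0, 1, 2} := by
  have : (univ : Finset (Finset (Fin 3)))
      = {∅, {0}, {1}, {0, 1}, {2}, {0, 2}, {1, 2}, {0, 1, 2}} := by decide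
  rw [this]
  rw [sum_insert (by decide), sum_insert (by decide), sum_insert (by decide),
    sum_insert (by decide), sum_insert (by decide), sum_insert (by decide),
    sum_insert (by decide), sum_singleton]
  grind

theorem disp_values : disp ∅ = ((0, 0), 0) ∧ disp {0} = ((1, 0), 0) ∧ disp {1} = ((0, 1), 0) ∧
    disp {0, 1} = ((1, 1), 0) ∧ disp {2} = ((-1, -1), 1) ∧ disp {0, 2} = ((0, -1), 1) ∧
    disp {1, 2} = ((-1, 0), 1) ∧ disp {0, 1, 2} = ((0, 0), 1) := by
  simp only [disp]
  refine ⟨?_, ?_, ?_, ?_, ?_, ?_, ?_, ?_⟩ <;> (simp [dir]; try rfl)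

theorem sum_sign_disp (F : Pos → ℤ) : ∑ S : Finset (Fin 3), (-1) ^ S.card * F (disp S) =
    F ((0, 0), 0) - F ((1, 0), 0) - F ((0, 1), 0) + F ((1, 1), 0) - F ((-1, -1), 1)
      + F ((0, -1), 1) + F ((-1, 0), 1) - F ((0, 0), 1) := by
  obtain ⟨h0, h1, h2, h3, h4, h5, h6, h7⟩ := disp_values
  rw [sum_finset_fin_three, h0, h1, h2, h3, h4, h5, h6, h7]
  grind

/-- The boxes below a height function. -/
def Below (f : Pt → ℤ) (x : Pos) : Prop := x.2 < f x.1

/-- `A` consists of the boxes between the vacuum `o` and the height function `f`. -/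
structure IsRegion (A : Finset Pos) (o f : Pt → ℤ) : Prop where
  le : ∀ p, o p ≤ f p
  mem : ∀ x, x ∈ A ↔ o x.1 ≤ x.2 ∧ x.2 < f x.1

theorem sum_ind {α : Type*} (s : Finset α) (P : α → Prop) [DecidablePred P] :
    ∑ p ∈ s, ind (P p) = ((s.filter P).card : ℤ) := by
  rw [card_filter]
  push_cast
  refine sum_congr rfl fun p _ => ?_
  unfold ind
  split_ifs <;> rfl

open Classical in
theorem sum_Ico_ind {a b : ℤ} (hab : a ≤ b) (M : ℤ) :
    ∑ p ∈ Ico a b, ind (p < M) = min M b - min M a := by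
  have : ∑ p ∈ Ico a b, ind (p < M) = ((Ico a (min M b)).card : ℤ) := by
    rw [sum_ind]
    congr 2
    grind
  rw [this, Int.card_Ico]
  omega

theorem IsRegion.sum_eq {A : Finset Pos} {o f : Pt → ℤ} (hA : IsRegion A o f) {m : ℕ}
    (hm : ∀ p, p ∉ box m → f p = o p) (F : Pos → ℤ) :
    ∑ x ∈ A, F x = ∑ p ∈ box (m + 1), ∑ t ∈ Ico (o p) (f p), F (p, t) := by
  refine sum_finset_product _ _ _ fun x => ?_
  rw [hA.mem, mem_Ico, iff_and_self]
  intro h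
  refine box_mono (Nat.le_succ m) ?_
  grind

theorem IsRegion.sum_above {A : Finset Pos} {o g : Pt → ℤ} (hA : IsRegion A o g) {m : ℕ}
    (hm : ∀ p, p ∉ box m → g p = o p) (F : Pt → ℤ) :
    ∑ y ∈ A, ∑ S : Finset (Fin 3), (-1) ^ S.card * ind (Below F (y + disp S))
      = ∑ p ∈ box (m + 1), (bform F g p - bform F o p) := by
  have hcol : ∀ (p q : Pt) (s : ℤ), ∑ t ∈ Ico (o p) (g p), ind (t + s < F q)
      = min (F q) (g p + s) - min (F q) (o p + s) := by
    intro p q s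
    have := sum_Ico_ind (hA.le p) (F q - s)
    grind
  have hcol' : ∀ p, ∑ t ∈ Ico (o p) (g p),
      ∑ S : Finset (Fin 3), (-1) ^ S.card * ind (Below F ((p, t) + disp S)) =
      (min (F p) (g p) - min (F p) (o p)) - (min (F (nb 0 p)) (g p) - min (F (nb 0 p)) (o p))
      - (min (F (nb 1 p)) (g p) - min (F (nb 1 p)) (o p))
      + (min (F (nb 2 p)) (g p) - min (F (nb 2 p)) (o p))
      - (min (F (p.1 + -1, p.2 + -1)) (g p + 1) - min (F (p.1 + -1, p.2 + -1)) (o p + 1))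
      + (min (F (p.1, p.2 + -1)) (g p + 1) - min (F (p.1, p.2 + -1)) (o p + 1))
      + (min (F (p.1 + -1, p.2)) (g p + 1) - min (F (p.1 + -1, p.2)) (o p + 1))
      - (min (F p) (g p + 1) - min (F p) (o p + 1)) := by
    rintro ⟨x, y⟩
    have h := fun t => sum_sign_disp fun z => ind (Below F (((x, y), t) + z))
    have hcol0 := fun q => hcol (x, y) q 0
    simp only [add_zero] at hcol0
    rw [sum_congr rfl fun t _ => h t]
    simp only [sum_sub_distrib, sum_add_distrib, Below,
      Prod.mk_add_mk, hcol, hcol0, nb_zero, nb_one, nb_two, add_zero]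
  rw [hA.sum_eq hm, sum_congr rfl fun p _ => hcol' p]
  have hshift : ∀ d : Fin 3, ∑ p ∈ box (m + 1), (min (F p) (g (nb d p) + 1) - min (F p) (o (nb d p) + 1))
      = ∑ p ∈ box (m + 1), (min (F (p.1 + -![1, 0, 1] d, p.2 + -![0, 1, 1] d)) (g p + 1)
        - min (F (p.1 + -![1, 0, 1] d, p.2 + -![0, 1, 1] d)) (o p + 1)) := by
    intro d
    have hb : ∀ p : Pt, ∀ x, min x (g p + 1) - min x (o p + 1) ≠ 0 → p ∈ box m := by grind
    rw [← sum_shift (S := box (m + 1)) (F := fun p => min (F (p.1 + -![1, 0, 1] d, p.2 + -![0, 1, 1] d))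
      (g p + 1) - min (F (p.1 + -![1, 0, 1] d, p.2 + -![0, 1, 1] d)) (o p + 1)) d
      (fun p h => box_mono (Nat.le_succ m) (hb p _ h))
      (fun p h => (triAdj_nb d p).symm.mem_box (hb _ _ h))]
    refine sum_congr rfl fun p _ => ?_
    have : ((nb d p).1 + -![1, 0, 1] d, (nb d p).2 + -![0, 1, 1] d) = p := by
      simp [nb]
    rw [this]
  have s0 := hshift 0
  have s1 := hshift 1
  have s2 := hshift 2
  simp at s0 s1 s2
  simp only [bform, Fin.sum_univ_three, eps]
  simp
  simp only [sum_sub_distrib, sum_add_distrib] at s0 s1 s2 ⊢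
  linarith

theorem IsRegion.sum_below {A : Finset Pos} {o f : Pt → ℤ} (hA : IsRegion A o f) {m : ℕ}
    (hm : ∀ p, p ∉ box m → f p = o p) (G : Pt → ℤ) :
    ∑ x ∈ A, ∑ S : Finset (Fin 3), (-1) ^ S.card * ind (Below G (x - disp S))
      = ∑ p ∈ box (m + 1), (bform f G p - bform o G p) := by
  have hcol : ∀ (p q : Pt) (s : ℤ), ∑ t ∈ Ico (o p) (f p), ind (t - s < G q)
      = min (f p) (G q + s) - min (o p) (G q + s) := by
    intro p q s
    have := sum_Ico_ind (hA.le p) (G q + s)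
    grind
  have hcol' : ∀ p, ∑ t ∈ Ico (o p) (f p),
      ∑ S : Finset (Fin 3), (-1) ^ S.card * ind (Below G ((p, t) - disp S)) =
      (min (f p) (G p) - min (o p) (G p))
      - (min (f p) (G (p.1 - 1, p.2)) - min (o p) (G (p.1 - 1, p.2)))
      - (min (f p) (G (p.1, p.2 - 1)) - min (o p) (G (p.1, p.2 - 1)))
      + (min (f p) (G (p.1 - 1, p.2 - 1)) - min (o p) (G (p.1 - 1, p.2 - 1)))
      - (min (f p) (G (nb 2 p) + 1) - min (o p) (G (nb 2 p) + 1))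
      + (min (f p) (G (nb 1 p) + 1) - min (o p) (G (nb 1 p) + 1))
      + (min (f p) (G (nb 0 p) + 1) - min (o p) (G (nb 0 p) + 1))
      - (min (f p) (G p + 1) - min (o p) (G p + 1)) := by
    rintro ⟨x, y⟩
    have h := fun t => sum_sign_disp fun z => ind (Below G (((x, y), t) - z))
    have hcol0 := fun q => hcol (x, y) q 0
    simp only [add_zero, sub_zero] at hcol0
    rw [sum_congr rfl fun t _ => h t]
    simp only [sum_sub_distrib, sum_add_distrib, Below,
      Prod.mk_sub_mk, hcol, hcol0, nb_zero, nb_one, nb_two, sub_zero, sub_neg_eq_add]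
  rw [hA.sum_eq hm, sum_congr rfl fun p _ => hcol' p]
  have hshift : ∀ d : Fin 3, ∑ p ∈ box (m + 1), (min (f (nb d p)) (G p) - min (o (nb d p)) (G p))
      = ∑ p ∈ box (m + 1), (min (f p) (G (p.1 - ![1, 0, 1] d, p.2 - ![0, 1, 1] d))
        - min (o p) (G (p.1 - ![1, 0, 1] d, p.2 - ![0, 1, 1] d))) := by
    intro d
    have hb : ∀ p : Pt, ∀ x, min (f p) x - min (o p) x ≠ 0 → p ∈ box m := by grind
    rw [← sum_shift (S := box (m + 1)) (F := fun p =>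
        min (f p) (G (p.1 - ![1, 0, 1] d, p.2 - ![0, 1, 1] d))
        - min (o p) (G (p.1 - ![1, 0, 1] d, p.2 - ![0, 1, 1] d))) d
      (fun p h => box_mono (Nat.le_succ m) (hb p _ h))
      (fun p h => (triAdj_nb d p).symm.mem_box (hb _ _ h))]
    refine sum_congr rfl fun p _ => ?_
    have : ((nb d p).1 - ![1, 0, 1] d, (nb d p).2 - ![0, 1, 1] d) = p := by
      simp [nb]
    rw [this]
  have s0 := hshift 0
  have s1 := hshift 1
  have s2 := hshift 2
  simp at s0 s1 s2
  simp only [bform, Fin.sum_univ_three, eps]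
  simp
  simp only [sum_sub_distrib, sum_add_distrib] at s0 s1 s2 ⊢
  linarith

theorem ind_mul_ind (P Q : Prop) : ind P * ind Q = ind (P ∧ Q) := by
  by_cases hP : P <;> by_cases hQ : Q <;> simp [ind, hP, hQ]

theorem sum_sign_vac_add (k : ℕ) (y : Pos) :
    ∑ S : Finset (Fin 3), (-1) ^ S.card * ind (Below (vac k) (y + disp S))
      = ind (y = ((0, 0), -(k : ℤ) - 1)) := by
  have h := sum_sign_disp fun z => ind (Below (vac k) (y + z))
  obtain ⟨⟨x, y⟩, t⟩ := y
  have key : ∀ a b s : ℤ, ind (Below (vac k) ((a, b), s)) =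
      1 - ind (-(k : ℤ) ≤ a + s) * ind (-(k : ℤ) ≤ b + s) * ind (-(k : ℤ) ≤ s) := by
    intro a b s
    rw [ind_mul_ind, ind_mul_ind]
    simp only [Below, vac, ind]
    split_ifs <;> omega
  rw [h]
  simp only [Prod.mk_add_mk, key]
  have e : ∀ a : ℤ, ind (-(k : ℤ) ≤ a + 1) = ind (-(k : ℤ) ≤ a) + ind (a = -(k : ℤ) - 1) := by
    intro a
    unfold ind
    split_ifs <;> omega
  have e' : ind (((x, y), t) = (((0, 0), -(k : ℤ) - 1) : Pos)) =
      ind (x + t = -(k : ℤ) - 1) * ind (y + t = -(k : ℤ) - 1) * ind (t = -(k : ℤ) - 1) := by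
    rw [ind_mul_ind, ind_mul_ind, Prod.mk.injEq, Prod.mk.injEq]
    exact ind_congr (by omega)
  have q1 : ∀ a : ℤ, a + -1 + (t + 1) = a + t := fun a => by ring
  have q2 : ∀ a : ℤ, a + (t + 1) = a + t + 1 := fun a => by ring
  have q3 : ∀ a : ℤ, a + 1 + t = a + t + 1 := fun a => by ring
  simp only [add_zero, q1, q2, q3, e, e']
  ring

theorem sum_sign_vac_sub (k : ℕ) (y : Pos) :
    ∑ S : Finset (Fin 3), (-1) ^ S.card * ind (Below (vac k) (y - disp S))
      = -ind (y = ((0, 0), -(k : ℤ))) := by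
  have h := sum_sign_disp fun z => ind (Below (vac k) (y - z))
  obtain ⟨⟨x, y⟩, t⟩ := y
  have key : ∀ a b s : ℤ, ind (Below (vac k) ((a, b), s)) =
      1 - ind (-(k : ℤ) ≤ a + s) * ind (-(k : ℤ) ≤ b + s) * ind (-(k : ℤ) ≤ s) := by
    intro a b s
    rw [ind_mul_ind, ind_mul_ind]
    simp only [Below, vac, ind]
    split_ifs <;> omega
  rw [h]
  simp only [Prod.mk_sub_mk, key]
  have e : ∀ a : ℤ, ind (-(k : ℤ) ≤ a - 1) = ind (-(k : ℤ) ≤ a) - ind (a = -(k : ℤ)) := by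
    intro a
    unfold ind
    split_ifs <;> omega
  have e' : ind (((x, y), t) = (((0, 0), -(k : ℤ)) : Pos)) =
      ind (x + t = -(k : ℤ)) * ind (y + t = -(k : ℤ)) * ind (t = -(k : ℤ)) := by
    rw [ind_mul_ind, ind_mul_ind, Prod.mk.injEq, Prod.mk.injEq]
    exact ind_congr (by omega)
  have q1 : ∀ a : ℤ, a - -1 + (t - 1) = a + t := fun a => by ring
  have q2 : ∀ a : ℤ, a + (t - 1) = a + t - 1 := fun a => by ring
  have q3 : ∀ a : ℤ, a - 1 + t = a + t - 1 := fun a => by ring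
  simp only [sub_zero, q1, q2, q3, e, e']
  ring

/-- The signed number of pairs of boxes which differ by a corner of the unit cube. -/
def pairing (A B : Finset Pos) : ℤ :=
  ∑ y ∈ B, ∑ S : Finset (Fin 3), (-1) ^ S.card * ind (y + disp S ∈ A)

theorem pairing_eq {A B : Finset Pos} {k l : ℕ} {f g : Pt → ℤ} (hA : IsRegion A (vac k) f)
    (hB : IsRegion B (vac l) g) {m : ℕ} (hf : ∀ p, p ∉ box m → f p = vac k p)
    (hg : ∀ p, p ∉ box m → g p = vac l p) :
    pairing A B = ∑ p ∈ box (m + 1), (bform f g p - bform (vac k) (vac l) p)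
      - ind (((0, 0), -(k : ℤ) - 1) ∈ B) + ind (((0, 0), -(l : ℤ)) ∈ A) := by
  have h1 := hB.sum_above hg f
  have h2 := hB.sum_above hg (vac k)
  have h3 := hA.sum_below hf (vac l)
  simp only [sum_sign_vac_add] at h2
  simp only [sum_sign_vac_sub] at h3
  have hmem : ∀ (C : Finset Pos) (z : Pos), ∑ y ∈ C, ind (y = z) = ind (z ∈ C) := by
    intro C z
    by_cases h : z ∈ C
    · rw [sum_eq_single z (fun b _ hb => ind_false hb) (fun h' => absurd h h'), ind_true rfl,
        ind_true h]
    · rw [ind_false h]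
      exact sum_eq_zero fun y hy => ind_false fun e => h (e ▸ hy)
  rw [hmem] at h2
  rw [sum_neg_distrib, hmem] at h3
  have h4 : pairing A B = ∑ y ∈ B, ∑ S : Finset (Fin 3), (-1) ^ S.card * ind (Below f (y + disp S))
      - ∑ y ∈ B, ∑ S : Finset (Fin 3), (-1) ^ S.card * ind (Below (vac k) (y + disp S)) := by
    rw [pairing, ← sum_sub_distrib]
    refine sum_congr rfl fun y _ => ?_
    rw [← sum_sub_distrib]
    refine sum_congr rfl fun S _ => ?_
    rw [← mul_sub]
    congr 1
    have := hA.le (y + disp S).1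
    have h := hA.mem (y + disp S)
    rw [ind_congr h]
    unfold Below ind
    split_ifs <;> omega
  simp only [sum_sign_vac_add] at h4
  rw [h4, h1, hmem]
  simp only [sum_sub_distrib] at *
  linarith

end QQ

namespace QQ
open Finset

section Chains
open Classical

/-- Height functions of layers which agree with the vacuum outside a box, strictly decreasing on a
set `S` of layers below the layer `j`. -/
structure IsChain (f : ℕ → Pt → ℤ) (S : Finset ℕ) (j m : ℕ) : Prop where
  height : ∀ k, IsHeight (f k)
  vac_le : ∀ k p, vac k p ≤ f k p
  out : ∀ k p, p ∉ box m → f k p = vac k p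
  lt : ∀ k ∈ S, k < j
  strict : ∀ k ∈ S, ∀ l ∈ S, k < l → ∀ p, f l p < f k p

/-- The position of an integer with respect to zero. -/
def tri (x : ℤ) : ℤ := if 0 < x then 2 else if x = 0 then 1 else 0

/-- The position of the height of layer `j` among the heights of the layers in `S`: even values stand
for the gaps between them, odd values for coincidences. -/
def lev (f : ℕ → Pt → ℤ) (S : Finset ℕ) (j : ℕ) (p : Pt) : ℤ :=
  ∑ k ∈ S, tri (f k p - f j p)

variable {f : ℕ → Pt → ℤ} {S : Finset ℕ} {j m : ℕ}

theorem vac_strict {k l : ℕ} (h : k < l) (p : Pt) : vac l p < vac k p := by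
  simp only [vac]
  omega

theorem IsChain.injOn (hf : IsChain f S j m) {k l : ℕ} (hk : k ∈ S) (hl : l ∈ S) {p : Pt}
    (h : f k p = f l p) : k = l := by
  rcases lt_trichotomy k l with h' | h' | h'
  · exact absurd h (hf.strict k hk l hl h' p).ne'
  · exact h'
  · exact absurd h (hf.strict l hl k hk h' p).ne

theorem IsChain.lev_of_eq (hf : IsChain f S j m) {i : ℕ} (hi : i ∈ S) {p : Pt}
    (h : f i p = f j p) : lev f S j p = 2 * (S.filter (· < i)).card + 1 := by
  have h1 : ∀ k ∈ S, tri (f k p - f j p) = 2 * ind (k < i) + ind (k = i) := by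
    intro k hk
    rcases lt_trichotomy k i with h' | h' | h'
    · have := hf.strict k hk i hi h' p
      rw [ind_true h', ind_false h'.ne, tri, if_pos (by omega)]; rfl
    · subst h'
      rw [ind_false (lt_irrefl k), ind_true rfl, tri, if_neg (by omega), if_pos (by omega)]; rfl
    · have := hf.strict i hi k hk h' p
      rw [ind_false h'.not_gt, ind_false h'.ne', tri, if_neg (by omega), if_neg (by omega)]; rfl
  rw [lev, sum_congr rfl h1, sum_add_distrib, ← mul_sum, sum_ind,
    sum_eq_single i (fun k _ hk => ind_false hk) (fun h => absurd hi h), ind_true rfl]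

theorem IsChain.lev_of_ne {p : Pt} (h : ∀ i ∈ S, f i p ≠ f j p) :
    lev f S j p = 2 * (S.filter (fun k => f j p < f k p)).card := by
  rw [← sum_ind, mul_sum]
  refine sum_congr rfl fun k hk => ?_
  have := h k hk
  unfold tri ind
  split_ifs <;> omega

theorem IsChain.odd_lev (hf : IsChain f S j m) (p : Pt) :
    Odd (lev f S j p) ↔ ∃ i ∈ S, f i p = f j p := by
  constructor
  · intro h
    by_contra hc
    push Not at hc
    rw [IsChain.lev_of_ne hc] at h
    grind
  · rintro ⟨i, hi, h⟩
    rw [hf.lev_of_eq hi h]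
    exact ⟨_, rfl⟩

theorem IsChain.rank_inj {i k : ℕ} (hi : i ∈ S) (hk : k ∈ S)
    (h : (S.filter (· < i)).card = (S.filter (· < k)).card) : i = k := by
  have key : ∀ i k : ℕ, i ∈ S → i < k → (S.filter (· < i)).card < (S.filter (· < k)).card := by
    intro i k hi hik
    refine card_lt_card ⟨fun x hx => ?_, fun hsub => ?_⟩
    · grind
    · have := hsub (mem_filter.2 ⟨hi, hik⟩)
      grind
  rcases lt_trichotomy i k with h' | h' | h'
  · grind
  · exact h'
  · grind

theorem IsChain.lev_eq_lev (hf : IsChain f S j m) {i : ℕ} (hi : i ∈ S) {p q : Pt}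
    (h : f i p = f j p) : lev f S j q = lev f S j p ↔ f i q = f j q := by
  constructor
  · intro hq
    have hodd : Odd (lev f S j q) := hq ▸ (hf.odd_lev p).2 ⟨i, hi, h⟩
    obtain ⟨k, hk, hkq⟩ := (hf.odd_lev q).1 hodd
    rw [hf.lev_of_eq hi h, hf.lev_of_eq hk hkq] at hq
    have := IsChain.rank_inj hk hi (by omega)
    exact this ▸ hkq
  · intro hq
    rw [hf.lev_of_eq hi h, hf.lev_of_eq hi hq]

theorem IsChain.isLevel (hf : IsChain f S j m) : IsLevel (lev f S j) S.card m := by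
  have hcount : ∀ (p : Pt) (x : ℤ), ∑ k ∈ S, ind (f k p - f j p = x) ≤ 1 := by
    intro p x
    rw [sum_ind]
    have : (S.filter fun k => f k p - f j p = x).card ≤ 1 := by
      refine card_le_one.2 fun a ha b hb => ?_
      rw [mem_filter] at ha hb
      exact hf.injOn ha.1 hb.1 (p := p) (by omega)
    exact_mod_cast this
  -- the change along an edge
  have hedge : ∀ p d, (0 ≤ lev f S j p - lev f S j (nb d p) ∧
      lev f S j p - lev f S j (nb d p) ≤
        ∑ k ∈ S, ind (f k p - f j p = 1) + ∑ k ∈ S, ind (f k p - f j p = 0)) ∨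
      (0 ≤ lev f S j (nb d p) - lev f S j p ∧ lev f S j (nb d p) - lev f S j p ≤
        ∑ k ∈ S, ind (f k (nb d p) - f j (nb d p) = 1)
          + ∑ k ∈ S, ind (f k (nb d p) - f j (nb d p) = 0)) := by
    intro p d
    have hg := hf.height j p d
    rcases eq_or_ne (f j (nb d p)) (f j p) with h | h
    · left
      simp only [lev, ← sum_sub_distrib, ← sum_add_distrib]
      refine ⟨sum_nonneg fun k _ => ?_, sum_le_sum fun k _ => ?_⟩ <;>
      · have hk := hf.height k p d
        unfold tri
        try unfold ind
        split_ifs <;> omega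
    · right
      simp only [lev, ← sum_sub_distrib, ← sum_add_distrib]
      refine ⟨sum_nonneg fun k _ => ?_, sum_le_sum fun k _ => ?_⟩ <;>
      · have hk := hf.height k p d
        unfold tri
        try unfold ind
        split_ifs <;> omega
  have hnozero : ∀ p, Even (lev f S j p) → ∑ k ∈ S, ind (f k p - f j p = 0) = 0 := by
    intro p hp
    refine sum_eq_zero fun k hk => ind_false fun h => ?_
    exact Int.not_odd_iff_even.2 hp ((hf.odd_lev p).2 ⟨k, hk, by omega⟩)
  refine ⟨fun p => ?_, fun u v huv => ?_, fun u v huv hu hv => ?_, fun p hp => ?_⟩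
  · have : ∀ k ∈ S, tri (f k p - f j p) ≤ 2 := by
      intro k _
      unfold tri
      split_ifs <;> omega
    have := sum_le_card_nsmul S _ 2 this
    rw [nsmul_eq_mul] at this
    rw [lev]
    linarith
  · obtain ⟨d, rfl | rfl⟩ := huv
    · have := hedge u d
      have := hcount u 1
      have := hcount u 0
      omega
    · have := hedge v d
      have := hcount (nb d v) 1
      have := hcount (nb d v) 0
      omega
  · have key : ∀ p d, Even (lev f S j p) → Even (lev f S j (nb d p)) →
        lev f S j p = lev f S j (nb d p) := by
      intro p d h1 h2
      have := hedge p d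
      have := hcount p 1
      have := hcount (nb d p) 1
      grind
    obtain ⟨d, rfl | rfl⟩ := huv
    · grind
    · grind
  · have : ∀ k ∈ S, tri (f k p - f j p) = 2 := by
      intro k hk
      rw [hf.out k p hp, hf.out j p hp]
      have := vac_strict (hf.lt k hk) p
      unfold tri
      omega
    rw [lev, sum_congr rfl this, sum_const, nsmul_eq_mul]
    ring

/-! ### Islands of a chain -/

variable (f S j) in
/-- `i` is the layer whose height agrees with that of the layer `j` around the island `K`. -/
structure IslandLayer (K : Finset Pt) (i : ℕ) : Prop where
  mem : i ∈ S
  nbr : ∀ u ∈ K, ∀ w, TriAdj u w → w ∉ K → f i w = f j w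

theorem IsIsland.eq_of_mem {c : Pt → ℤ} {K L : Finset Pt} (hK : IsIsland c K)
    (hL : IsIsland c L) {p : Pt} (h1 : p ∈ K) (h2 : p ∈ L) : K = L := by
  have key : ∀ K L : Finset Pt, IsIsland c K → IsIsland c L → p ∈ K → p ∈ L → L ⊆ K := by
    intro K L hK hL h1 h2 q hq
    have := hL.conn p h2 q hq
    induction this with
    | refl => exact h1
    | tail _ hbc ih =>
      by_contra hc
      obtain ⟨ℓ, hℓ, hn⟩ := hK.nbr
      have := hn _ (ih hbc.1) _ hbc.2.2 hc
      have h3 := hL.even _ hbc.2.1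
      grind
  grind

theorem exists_nbr {K : Finset Pt} (hK : K.Nonempty) : ∃ u ∈ K, ∃ w, TriAdj u w ∧ w ∉ K := by
  obtain ⟨u, hu, hmax⟩ := exists_max_image K (fun p => p.1) hK
  refine ⟨u, hu, nb 0 u, triAdj_nb 0 u, fun h => ?_⟩
  have := hmax _ h
  simp [nb] at this

theorem IsChain.exists_layer (hf : IsChain f S j m) {K : Finset Pt}
    (hK : IsIsland (lev f S j) K) : ∃ i, IslandLayer f S j K i := by
  obtain ⟨ℓ, hℓ, hn⟩ := hK.nbr
  obtain ⟨u, hu, w, huw, hw⟩ := exists_nbr hK.nonempty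
  have h1 := hn u hu w huw hw
  obtain ⟨i, hi, hiw⟩ := (hf.odd_lev w).1 (h1 ▸ hℓ)
  refine ⟨i, hi, fun u' hu' w' huw' hw' => ?_⟩
  rw [← hf.lev_eq_lev hi hiw, hn u' hu' w' huw' hw', h1]

theorem IslandLayer.unique (hf : IsChain f S j m) {K : Finset Pt} (hK : K.Nonempty)
    {i i' : ℕ} (h : IslandLayer f S j K i) (h' : IslandLayer f S j K i') : i = i' := by
  obtain ⟨u, hu, w, huw, hw⟩ := exists_nbr hK
  exact hf.injOn h.mem h'.mem ((h.nbr u hu w huw hw).trans (h'.nbr u hu w huw hw).symm)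

theorem IslandLayer.ne (hf : IsChain f S j m) {K : Finset Pt}
    (hK : IsIsland (lev f S j) K) {u : Pt} (hu : u ∈ K) (k : ℕ) (hk : k ∈ S) :
    f k u ≠ f j u := fun h =>
  Int.not_odd_iff_even.2 (hK.even u hu) ((hf.odd_lev u).2 ⟨k, hk, h⟩)

theorem IslandLayer.order (hf : IsChain f S j m) {K : Finset Pt}
    (hK : IsIsland (lev f S j) K) {i : ℕ} (h : IslandLayer f S j K i) {u : Pt} (hu : u ∈ K)
    (k : ℕ) (hk : k ∈ S) : (k < i → f j u < f k u) ∧ (i < k → f k u < f j u) := by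
  obtain ⟨u₀, hu₀, w, huw, hw⟩ := exists_nbr hK.nonempty
  have hlw := hf.lev_of_eq h.mem (h.nbr u₀ hu₀ w huw hw)
  have hL := hf.isLevel
  have hc : ∀ v, ConnIn K u v → lev f S j u = lev f S j v := by
    intro v huv
    induction huv with
    | refl => rfl
    | tail _ hbc ih =>
      exact ih.trans (hL.even _ _ hbc.2.2 (hK.even _ hbc.1) (hK.even _ hbc.2.1))
  have hconst : lev f S j u = lev f S j u₀ := hc u₀ (hK.conn u hu u₀ hu₀)
  have e1 := hL.lip _ _ huw
  have e2 := hL.lip _ _ huw.symm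
  have hne : ∀ k ∈ S, f k u ≠ f j u := fun k hk => IslandLayer.ne hf hK hu k hk
  have hlu := IsChain.lev_of_ne hne
  rw [← hconst] at e1 e2
  have hr := h.mem
  constructor
  · intro hki
    by_contra hc
    have hlt : f k u < f j u := lt_of_le_of_ne (not_lt.1 hc) (hne k hk)
    have hsub : S.filter (fun l => f j u < f l u) ⊆ S.filter (· < k) := by
      intro l hl
      rw [mem_filter] at hl ⊢
      refine ⟨hl.1, ?_⟩
      by_contra hkl
      rcases (not_lt.1 hkl).lt_or_eq with h' | h'
      · have := hf.strict k hk l hl.1 h' u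
        omega
      · subst h'; omega
    have hlt' : (S.filter (· < k)).card < (S.filter (· < i)).card := by
      refine card_lt_card ⟨fun x hx => ?_, fun hsub => ?_⟩
      · grind
      · exact lt_irrefl k (mem_filter.1 (hsub (mem_filter.2 ⟨hk, hki⟩))).2
    have := card_le_card hsub
    omega
  · intro hik
    by_contra hc
    have hlt : f j u < f k u := lt_of_le_of_ne (not_lt.1 hc) (hne k hk).symm
    have hsub : insert k (insert i (S.filter (· < i))) ⊆ S.filter (fun l => f j u < f l u) := by
      intro l hl
      rw [mem_insert, mem_insert, mem_filter] at hl
      have hlS : l ∈ S := by grind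
      have hlk : l ≤ k := by omega
      rw [mem_filter]
      refine ⟨hlS, ?_⟩
      rcases hlk.lt_or_eq with h' | h'
      · have := hf.strict l hlS k hk h' u
        omega
      · grind
    have hcard := card_le_card hsub
    grind

theorem IslandLayer.vac_le (hf : IsChain f S j m) {K : Finset Pt} {i : ℕ}
    (h : IslandLayer f S j K i) {u : Pt} (hu : u ∈ K) : vac i u ≤ f j u := by
  by_contra hc
  have hout : ∀ v ∈ K, ∀ w, TriAdj v w → f j w < vac i w → w ∈ K := by
    intro v hv w hvw hw
    by_contra hwK
    have := h.nbr v hv w hvw hwK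
    have := hf.vac_le i w
    omega
  have hcase : f j u < -i ∨ f j u < -u.1 - i ∨ f j u < -u.2 - i := by
    simp only [vac] at hc
    omega
  rcases hcase with hb | hb | hb
  · obtain ⟨v, hv, hmax⟩ := exists_max_image (K.filter fun v => f j v < -i) (fun p => p.1)
      ⟨u, mem_filter.2 ⟨hu, hb⟩⟩
    rw [mem_filter] at hv
    have h1 := hf.height j v 0
    have h2 : f j (nb 0 v) < -i := by omega
    have h3 := hout v hv.1 (nb 0 v) (triAdj_nb 0 v) (by simp only [vac]; omega)
    have := hmax _ (mem_filter.2 ⟨h3, h2⟩)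
    simp [nb] at this
  · obtain ⟨v, hv, hmax⟩ := exists_min_image (K.filter fun v => f j v < -v.1 - i)
      (fun p => p.1) ⟨u, mem_filter.2 ⟨hu, hb⟩⟩
    rw [mem_filter] at hv
    have e : nb 0 (v.1 - 1, v.2) = v := by simp [nb]
    have h1 := hf.height j (v.1 - 1, v.2) 0
    rw [e] at h1
    have h2 : f j (v.1 - 1, v.2) < -(v.1 - 1) - i := by omega
    have h3 := hout v hv.1 (v.1 - 1, v.2) ⟨0, Or.inr e.symm⟩ (by simp only [vac]; omega)
    have := hmax _ (mem_filter.2 ⟨h3, h2⟩)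
    simp at this
  · obtain ⟨v, hv, hmax⟩ := exists_min_image (K.filter fun v => f j v < -v.2 - i)
      (fun p => p.2) ⟨u, mem_filter.2 ⟨hu, hb⟩⟩
    rw [mem_filter] at hv
    have e : nb 1 (v.1, v.2 - 1) = v := by simp [nb]
    have h1 := hf.height j (v.1, v.2 - 1) 1
    rw [e] at h1
    have h2 : f j (v.1, v.2 - 1) < -(v.2 - 1) - i := by omega
    have h3 := hout v hv.1 (v.1, v.2 - 1) ⟨1, Or.inr e.symm⟩ (by simp only [vac]; omega)
    have := hmax _ (mem_filter.2 ⟨h3, h2⟩)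
    simp at this

/-! ### Swapping layers over islands -/

variable (f S j m) in
/-- The permutation of the layers over a point: the layer `j` is swapped with the layer of the island
in `T` which contains the point. -/
def islandPerm (T : Finset (Finset Pt)) (p : Pt) : Equiv.Perm ℕ :=
  if h : ∃ i, ∃ K ∈ T, p ∈ K ∧ IslandLayer f S j K i then Equiv.swap h.choose j else 1

/-- The heights after a permutation of the layers. -/
def permHeight (f : ℕ → Pt → ℤ) (E : Pt → Equiv.Perm ℕ) (k : ℕ) (p : Pt) : ℤ := f (E p k) p

notation "perm[" f "," S "," j "," T "]" => permHeight f (islandPerm f S j T)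

variable {T : Finset (Finset Pt)}

theorem mem_islands {c : Pt → ℤ} {K : Finset Pt} :
    K ∈ islands c m ↔ K ⊆ box m ∧ IsIsland c K := by
  rw [islands, mem_filter, mem_powerset]

theorem islandPerm_of_mem (hf : IsChain f S j m) (hT : T ⊆ islands (lev f S j) m)
    {K : Finset Pt} (hK : K ∈ T) {i : ℕ} (hi : IslandLayer f S j K i) {p : Pt}
    (hp : p ∈ K) : islandPerm f S j T p = Equiv.swap i j := by
  have h : ∃ i, ∃ K ∈ T, p ∈ K ∧ IslandLayer f S j K i := ⟨i, K, hK, hp, hi⟩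
  rw [islandPerm, dif_pos h]
  obtain ⟨L, hL, hpL, hiL⟩ := h.choose_spec
  have hKI := (mem_islands.1 (hT hK)).2
  have : L = K := (mem_islands.1 (hT hL)).2.eq_of_mem hKI hpL hp
  subst this
  rw [hiL.unique hf hKI.nonempty hi]

theorem islandPerm_of_notMem {p : Pt} (h : ∀ K ∈ T, p ∉ K) : islandPerm f S j T p = 1 := by
  rw [islandPerm, dif_neg]
  grind

theorem islandPerm_cases (hf : IsChain f S j m) (hT : T ⊆ islands (lev f S j) m) (p : Pt) :
    (∃ K ∈ T, p ∈ K ∧ ∃ i, IslandLayer f S j K i ∧ islandPerm f S j T p = Equiv.swap i j) ∨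
      ((∀ K ∈ T, p ∉ K) ∧ islandPerm f S j T p = 1) := by
  by_cases h : ∃ K ∈ T, p ∈ K
  · obtain ⟨K, hK, hp⟩ := h
    obtain ⟨i, hi⟩ := hf.exists_layer (mem_islands.1 (hT hK)).2
    exact Or.inl ⟨K, hK, hp, i, hi, islandPerm_of_mem hf hT hK hi hp⟩
  · push Not at h
    exact Or.inr ⟨h, islandPerm_of_notMem h⟩

theorem islandPerm_invol (hf : IsChain f S j m) (hT : T ⊆ islands (lev f S j) m) (p : Pt)
    (k : ℕ) : islandPerm f S j T p (islandPerm f S j T p k) = k := by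
  rcases islandPerm_cases hf hT p with ⟨K, hK, hp, i, hi, h⟩ | ⟨-, h⟩ <;> rw [h]
  · grind
  · rfl

theorem vac_islandPerm_le (hf : IsChain f S j m) (hT : T ⊆ islands (lev f S j) m) (p : Pt)
    (k : ℕ) : vac (islandPerm f S j T p k) p ≤ f k p := by
  rcases islandPerm_cases hf hT p with ⟨K, hK, hp, i, hi, h⟩ | ⟨-, h⟩ <;> rw [h]
  · rw [Equiv.swap_apply_def]
    split_ifs with h1 h2
    · exact (vac_strict (hf.lt i hi.mem) p).le.trans (h1 ▸ hf.vac_le k p)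
    · subst h2
      exact hi.vac_le hf hp
    · exact hf.vac_le k p
  · exact hf.vac_le k p

theorem permHeight_adj (hf : IsChain f S j m) (hT : T ⊆ islands (lev f S j) m) {p q : Pt}
    (hpq : TriAdj p q) : ∃ σ : Equiv.Perm ℕ, (∀ k, perm[f,S,j,T] k p = f (σ k) p)
      ∧ ∀ k, perm[f,S,j,T] k q = f (σ k) q := by
  have key : ∀ p q : Pt, TriAdj p q → (∃ K ∈ T, p ∈ K) → ∃ σ : Equiv.Perm ℕ,
      (∀ k, perm[f,S,j,T] k p = f (σ k) p)
        ∧ ∀ k, perm[f,S,j,T] k q = f (σ k) q := by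
    rintro p q hpq ⟨K, hK, hp⟩
    obtain ⟨i, hi⟩ := hf.exists_layer (mem_islands.1 (hT hK)).2
    have hKI := (mem_islands.1 (hT hK)).2
    refine ⟨Equiv.swap i j, fun k => by rw [permHeight, islandPerm_of_mem hf hT hK hi hp],
      fun k => ?_⟩
    by_cases hq : q ∈ K
    · rw [permHeight, islandPerm_of_mem hf hT hK hi hq]
    · have hqe := hi.nbr p hp q hpq hq
      rw [permHeight, islandPerm_of_notMem]
      · rw [Equiv.swap_apply_def]
        split_ifs with h1 h2
        · subst h1; exact hqe
        · subst h2; exact hqe.symm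
        · rfl
      · intro L hL hqL
        exact IslandLayer.ne hf (mem_islands.1 (hT hL)).2 hqL i hi.mem hqe
  by_cases h1 : ∃ K ∈ T, p ∈ K
  · exact key p q hpq h1
  by_cases h2 : ∃ K ∈ T, q ∈ K
  · obtain ⟨σ, h3, h4⟩ := key q p hpq.symm h2
    exact ⟨σ, h4, h3⟩
  · push Not at h1 h2
    exact ⟨1, fun k => by rw [permHeight, islandPerm_of_notMem h1],
      fun k => by rw [permHeight, islandPerm_of_notMem h2]⟩

theorem IsChain.perm (hf : IsChain f S j m) (hT : T ⊆ islands (lev f S j) m) :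
    IsChain perm[f,S,j,T] S j m := by
  refine ⟨fun k p d => ?_, fun k p => ?_, fun k p hp => ?_, hf.lt, fun k hk l hl hkl p => ?_⟩
  · obtain ⟨σ, h1, h2⟩ := permHeight_adj hf hT (triAdj_nb d p)
    rw [h1, h2]
    exact hf.height _ p d
  · have := vac_islandPerm_le hf hT p (islandPerm f S j T p k)
    rwa [islandPerm_invol hf hT] at this
  · rw [permHeight, islandPerm_of_notMem fun K hK hpK => hp ((mem_islands.1 (hT hK)).1 hpK)]
    exact hf.out k p hp
  · rw [permHeight, permHeight]
    have hkj := hf.lt k hk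
    have hlj := hf.lt l hl
    rcases islandPerm_cases hf hT p with ⟨K, hK, hp, i, hi, h⟩ | ⟨-, h⟩ <;> rw [h]
    · have o1 := hi.order hf (mem_islands.1 (hT hK)).2 hp k hk
      have o2 := hi.order hf (mem_islands.1 (hT hK)).2 hp l hl
      rw [Equiv.swap_apply_def, Equiv.swap_apply_def, if_neg hkj.ne, if_neg hlj.ne]
      split_ifs with h1 h2 h2
      · omega
      · omega
      · omega
      · exact hf.strict k hk l hl hkl p
    · exact hf.strict k hk l hl hkl p

theorem permHeight_eq_iff (hf : IsChain f S j m) (hT : T ⊆ islands (lev f S j) m) {k : ℕ}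
    (hk : k ∈ S) (p : Pt) : perm[f,S,j,T] k p
      = perm[f,S,j,T] j p ↔ f k p = f j p := by
  rw [permHeight, permHeight]
  rcases islandPerm_cases hf hT p with ⟨K, hK, hp, i, hi, h⟩ | ⟨-, h⟩ <;> rw [h]
  · rw [Equiv.swap_apply_right, Equiv.swap_apply_def, if_neg (hf.lt k hk).ne]
    split_ifs with h1
    · grind
    · refine ⟨fun h' => absurd (hf.injOn hk hi.mem h') h1, fun h' => ?_⟩
      exact absurd h' (IslandLayer.ne hf (mem_islands.1 (hT hK)).2 hp k hk)
  · rfl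

theorem lev_perm_of_odd (hf : IsChain f S j m) (hT : T ⊆ islands (lev f S j) m) (p : Pt) :
    (Odd (lev perm[f,S,j,T] S j p) ↔ Odd (lev f S j p)) ∧
      (Odd (lev f S j p) → lev perm[f,S,j,T] S j p = lev f S j p) := by
  constructor
  · rw [(hf.perm hT).odd_lev, hf.odd_lev]
    exact exists_congr fun i => and_congr_right fun hi => permHeight_eq_iff hf hT hi p
  · rw [hf.odd_lev]
    rintro ⟨i, hi, h⟩
    rw [hf.lev_of_eq hi h, (hf.perm hT).lev_of_eq hi ((permHeight_eq_iff hf hT hi p).2 h)]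

theorem isIsland_congr {c c' : Pt → ℤ} (h : ∀ p, (Odd (c' p) ↔ Odd (c p)) ∧
    (Odd (c p) → c' p = c p)) (K : Finset Pt) : IsIsland c' K ↔ IsIsland c K := by
  have key : ∀ c c' : Pt → ℤ, (∀ p, (Odd (c' p) ↔ Odd (c p)) ∧ (Odd (c p) → c' p = c p)) →
      IsIsland c K → IsIsland c' K := by
    rintro c c' h ⟨h1, h2, h3, ⟨ℓ, hℓ, h4⟩, h5⟩
    refine ⟨h1, h2, fun u hu => ?_, ⟨ℓ, hℓ, fun u hu w huw hw => ?_⟩, h5⟩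
    · grind
    · grind
  grind

theorem islands_perm (hf : IsChain f S j m) (hT : T ⊆ islands (lev f S j) m) :
    islands (lev perm[f,S,j,T] S j) m = islands (lev f S j) m := by
  ext K
  rw [mem_islands, mem_islands, isIsland_congr (lev_perm_of_odd hf hT)]

theorem islandLayer_perm (hf : IsChain f S j m) (hT : T ⊆ islands (lev f S j) m)
    (K : Finset Pt) (i : ℕ) :
    IslandLayer perm[f,S,j,T] S j K i ↔ IslandLayer f S j K i := by
  constructor <;> rintro ⟨h1, h2⟩ <;> refine ⟨h1, fun u hu w huw hw => ?_⟩
  · exact (permHeight_eq_iff hf hT h1 w).1 (h2 u hu w huw hw)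
  · exact (permHeight_eq_iff hf hT h1 w).2 (h2 u hu w huw hw)

theorem islandPerm_perm (hf : IsChain f S j m) (hT : T ⊆ islands (lev f S j) m)
    (T' : Finset (Finset Pt)) :
    islandPerm perm[f,S,j,T] S j T' = islandPerm f S j T' := by
  funext p
  have : ∀ K i, IslandLayer perm[f,S,j,T] S j K i = IslandLayer f S j K i :=
    fun K i => propext (islandLayer_perm hf hT K i)
  simp only [islandPerm, this]

end Chains
end QQ

namespace QQ
open Finset

section ChainSums
open Classical

/-- The sum of the local contributions over a box. -/
def bsum (m : ℕ) (f g : Pt → ℤ) : ℤ := ∑ p ∈ box (m + 1), bform f g p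

theorem bsum_of_lt {f g o o' : Pt → ℤ} (hf : IsHeight f) (hg : IsHeight g) (ho : IsHeight o)
    (ho' : IsHeight o') (h : ∀ p, g p < f p) (h' : ∀ p, o' p < o p) {m : ℕ}
    (hm : ∀ p, p ∉ box m → g p = o' p) : bsum m f g = bsum m o o' := by
  have key : ∀ {f g : Pt → ℤ}, IsHeight f → IsHeight g → (∀ p, g p < f p) → ∀ p,
      bform f g p = -1 - ∑ d : Fin 3, eps d * (g p - g (nb d p) - 1) := by
    intro f g hf hg h p
    have h0 := h p
    have : ∀ d, min (f (nb d p)) (g p) - min (f p) (g (nb d p) + 1) = g p - g (nb d p) - 1 := by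
      intro d
      have := hf p d
      grind
    simp only [bform, this]
    omega
  have hs : ∀ d, ∑ p ∈ box (m + 1), (g (nb d p) - o' (nb d p))
      = ∑ p ∈ box (m + 1), (g p - o' p) := by
    intro d
    have hb : ∀ p, g p - o' p ≠ 0 → p ∈ box m := fun p hp => by grind
    exact sum_shift (F := fun p => g p - o' p) d (fun p hp => box_mono (Nat.le_succ m) (hb p hp))
      (fun p hp => (triAdj_nb d p).symm.mem_box (hb _ hp))
  have e0 := hs 0
  have e1 := hs 1
  have e2 := hs 2
  rw [bsum, bsum, sum_congr rfl fun p _ => key hf hg h p,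
    sum_congr rfl fun p _ => key ho ho' h' p]
  simp only [Fin.sum_univ_three, eps]
  simp
  simp only [sum_sub_distrib, sum_add_distrib] at *
  linarith

theorem bform_swap (f g h : Pt → ℤ) (K : Finset Pt)
    (hK : ∀ u ∈ K, ∀ w, TriAdj u w → w ∉ K → f w = g w) (p : Pt) :
    bform h (K.piecewise g f) p + bform h (K.piecewise f g) p = bform h f p + bform h g p ∧
    bform (K.piecewise g f) h p + bform (K.piecewise f g) h p = bform f h p + bform g h p := by
  have key : ∀ F G : Pt → ℤ, (F = K.piecewise g f ∧ G = K.piecewise f g) → ∀ d,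
      (F p = f p ∧ F (nb d p) = f (nb d p) ∧ G p = g p ∧ G (nb d p) = g (nb d p)) ∨
      (F p = g p ∧ F (nb d p) = g (nb d p) ∧ G p = f p ∧ G (nb d p) = f (nb d p)) := by
    rintro F G ⟨rfl, rfl⟩ d
    by_cases h1 : p ∈ K <;> by_cases h2 : nb d p ∈ K
    · simp [h1, h2]
    · simp [h1, h2, hK p h1 _ (triAdj_nb d p) h2]
    · simp [h1, h2, hK _ h2 _ (triAdj_nb d p).symm h1]
    · simp [h1, h2]
  generalize K.piecewise g f = F at *
  generalize K.piecewise f g = G at *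
  have h0 := key F G ⟨rfl, rfl⟩ 0
  have h1 := key F G ⟨rfl, rfl⟩ 1
  have h2 := key F G ⟨rfl, rfl⟩ 2
  simp only [bform, Fin.sum_univ_three, eps]
  grind

theorem odd_bsum_swap {f g : Pt → ℤ} (hf : IsHeight f) (hg : IsHeight g) {m : ℕ}
    {K : Finset Pt} (hKm : K ⊆ box m) (hne : ∀ u ∈ K, f u ≠ g u)
    (hK : ∀ u ∈ K, ∀ w, TriAdj u w → w ∉ K → f w = g w) (hchi : chi K = 1) :
    Odd (bsum m (K.piecewise g f) (K.piecewise f g) + bsum m f g) := by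
  have n01 : ∀ p, nb 1 (nb 0 p) = nb 2 p := fun p => by simp [nb]
  have n10 : ∀ p, nb 0 (nb 1 p) = nb 2 p := fun p => by simp [nb]
  -- local parities
  have hedge : ∀ p d, Even (min (K.piecewise g f (nb d p)) (K.piecewise f g p)
      - min (K.piecewise g f p) (K.piecewise f g (nb d p) + 1)
      + (min (f (nb d p)) (g p) - min (f p) (g (nb d p) + 1)) + ind (p ∈ K ∨ nb d p ∈ K)) := by
    intro p d
    have a1 := hf p d
    have a2 := hg p d
    have a3 := hne p
    have a4 := hne (nb d p)
    have a5 := fun h => hK p h _ (triAdj_nb d p)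
    have a6 := fun h => hK _ h _ (triAdj_nb d p).symm
    by_cases h1 : p ∈ K <;> by_cases h2 : nb d p ∈ K <;>
      simp only [h1, h2, piecewise_eq_of_mem, piecewise_eq_of_notMem,
        not_false_eq_true, true_or, or_true, or_self, ind_true, ind_false, forall_const,
        false_imp_iff] at * <;> rw [Int.even_iff] <;> omega
  have hvert : ∀ p, Even (min (K.piecewise g f p) (K.piecewise f g p)
      - min (K.piecewise g f p) (K.piecewise f g p + 1)
      + (min (f p) (g p) - min (f p) (g p + 1)) + ind (p ∈ K)) := by
    intro p
    have a3 := hne p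
    by_cases h1 : p ∈ K <;>
      simp only [h1, piecewise_eq_of_mem, piecewise_eq_of_notMem,
        not_false_eq_true, ind_true, ind_false, forall_const] at * <;> rw [Int.even_iff] <;> omega
  have hpt : ∀ p, Even (bform (K.piecewise g f) (K.piecewise f g) p + bform f g p
      + (ind (p ∈ K) + ∑ d : Fin 3, ind (p ∈ K ∨ nb d p ∈ K))) := by
    intro p
    have e0 := hedge p 0
    have e1 := hedge p 1
    have e2 := hedge p 2
    have e3 := hvert p
    simp only [bform, Fin.sum_univ_three, eps]
    simp only [Matrix.cons_val_zero, Matrix.cons_val_one, Matrix.cons_val]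
    grind
  have hsum : Even (∑ p ∈ box (m + 1), (bform (K.piecewise g f) (K.piecewise f g) p + bform f g p
      + (ind (p ∈ K) + ∑ d : Fin 3, ind (p ∈ K ∨ nb d p ∈ K)))) :=
    even_sum _ fun p _ => hpt p
  -- the number of cells
  have hT := two_mul_crease hf (K := (· ∈ K)) (m := m) (fun p hp => hKm hp) ?_ ?_ ?_
  rotate_left
  · intro p k1 k2 k3
    simp only [Crease] at k3
    have r0 : nb 1 (p.1, p.2 - 1) = p := by simp [nb]
    have r1 : nb 2 (p.1, p.2 - 1) = nb 0 p := by simp [nb]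
    have t1 := fun h => hK p k1 (nb 2 p) (triAdj_nb 2 p) h
    have t2 := fun h => hK p k1 (p.1, p.2 - 1) ⟨1, Or.inr r0.symm⟩ h
    have := hne p k1
    have := hne _ k2
    have a1 := hf p 0
    have a2 := hg p 0
    have b1 := hf (nb 0 p) 1
    have b2 := hg (nb 0 p) 1
    rw [n01] at b1 b2
    have d1 := hf p 2
    have d2 := hg p 2
    have e1 := hf (p.1, p.2 - 1) 1
    have e2 := hg (p.1, p.2 - 1) 1
    have e3 := hf (p.1, p.2 - 1) 2
    have e4 := hg (p.1, p.2 - 1) 2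
    rw [r0] at e1 e2
    rw [r1] at e3 e4
    simp at k3
    constructor <;> by_contra hc
    · grind
    · grind
  · intro p k1 k2 k3
    simp only [Crease] at k3
    have r0 : nb 0 (p.1 - 1, p.2) = p := by simp [nb]
    have r1 : nb 2 (p.1 - 1, p.2) = nb 1 p := by simp [nb]
    have t1 := fun h => hK p k1 (nb 2 p) (triAdj_nb 2 p) h
    have t2 := fun h => hK p k1 (p.1 - 1, p.2) ⟨0, Or.inr r0.symm⟩ h
    have := hne p k1
    have := hne _ k2
    have a1 := hf p 1
    have a2 := hg p 1
    have b1 := hf (nb 1 p) 0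
    have b2 := hg (nb 1 p) 0
    rw [n10] at b1 b2
    have d1 := hf p 2
    have d2 := hg p 2
    have e1 := hf (p.1 - 1, p.2) 0
    have e2 := hg (p.1 - 1, p.2) 0
    have e3 := hf (p.1 - 1, p.2) 2
    have e4 := hg (p.1 - 1, p.2) 2
    rw [r0] at e1 e2
    rw [r1] at e3 e4
    simp at k3
    constructor <;> by_contra hc
    · grind
    · grind
  · intro p k1 k2 k3
    simp only [Crease] at k3
    have t1 := fun h => hK p k1 (nb 0 p) (triAdj_nb 0 p) h
    have t2 := fun h => hK p k1 (nb 1 p) (triAdj_nb 1 p) h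
    have := hne p k1
    have := hne _ k2
    have a1 := hf p 0
    have a2 := hg p 0
    have b1 := hf (nb 0 p) 1
    have b2 := hg (nb 0 p) 1
    rw [n01] at b1 b2
    have a3 := hf p 1
    have a4 := hg p 1
    have b3 := hf (nb 1 p) 0
    have b4 := hg (nb 1 p) 0
    rw [n10] at b3 b4
    have d1 := hf p 2
    have d2 := hg p 2
    simp at k3
    constructor <;> by_contra hc
    · grind
    · grind
  have hchi' := chi_eq_sum (S := box (m + 1)) (hKm.trans (box_mono (Nat.le_succ m)))
  have hterm : ∀ p, eulerTerm (· ∈ K) (· ∈ K) p = ind (p ∈ K)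
      - ∑ d : Fin 3, ind (p ∈ K ∧ nb d p ∈ K)
      + ∑ t : Fin 2, ind (p ∈ K ∧ nb t.castSucc p ∈ K ∧ nb 2 p ∈ K) := by
    intro p
    have e0 : ind (p ∈ K ∧ p ∈ K) = ind (p ∈ K) := ind_congr and_self_iff
    have e1 : ∀ d : Fin 3, ind (p ∈ K ∧ nb d p ∈ K ∧ (p ∈ K ∨ nb d p ∈ K))
        = ind (p ∈ K ∧ nb d p ∈ K) :=
      fun d => ind_congr ⟨fun h => ⟨h.1, h.2.1⟩, fun h => ⟨h.1, h.2, Or.inl h.1⟩⟩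
    have e2 : ∀ t : Fin 2, ind (p ∈ K ∧ nb t.castSucc p ∈ K ∧ nb 2 p ∈ K ∧
        (p ∈ K ∨ nb t.castSucc p ∈ K ∨ nb 2 p ∈ K))
        = ind (p ∈ K ∧ nb t.castSucc p ∈ K ∧ nb 2 p ∈ K) :=
      fun d => ind_congr ⟨fun h => ⟨h.1, h.2.1, h.2.2.1⟩, fun h => ⟨h.1, h.2.1, h.2.2, Or.inl h.1⟩⟩
    simp only [eulerTerm, e0, e1, e2]
  have hor : ∀ p d, ind (p ∈ K ∨ nb d p ∈ K)
      = ind (p ∈ K) + ind (nb d p ∈ K) - ind (p ∈ K ∧ nb d p ∈ K) := by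
    intro p d
    by_cases h1 : p ∈ K <;> by_cases h2 : nb d p ∈ K <;> simp [ind, h1, h2]
  have hs : ∀ d, ∑ p ∈ box (m + 1), ind (nb d p ∈ K) = ∑ p ∈ box (m + 1), ind (p ∈ K) := by
    intro d
    have hne' : ∀ P : Prop, ind P ≠ 0 → P := fun P h => by
      by_contra hc
      exact h (ind_false hc)
    exact sum_shift (F := fun p => ind (p ∈ K)) d
      (fun p hp => box_mono (Nat.le_succ m) (hKm (hne' _ hp)))
      (fun p hp => (triAdj_nb d p).symm.mem_box (hKm (hne' _ hp)))
  rw [sum_congr rfl fun p _ => hterm p, hchi] at hchi'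
  simp only [sum_add_distrib, sum_sub_distrib] at hchi'
  rw [hT] at hchi'
  simp only [hor, Fin.sum_univ_three, sum_add_distrib, sum_sub_distrib, hs]
    at hsum hchi'
  rw [bsum, bsum]
  grind

variable {f : ℕ → Pt → ℤ} {S : Finset ℕ} {j m : ℕ} {T : Finset (Finset Pt)}

theorem IsChain.sum_eulerTerm (hf : IsChain f S j m) (p : Pt) :
    ∑ k ∈ S, eulerTerm (fun q => f k q = f j q) (fun q => f k q = f j q) p
      = oddTerm (lev f S j) p := by
  rw [oddTerm]
  split_ifs with h
  · obtain ⟨i, hi, hip⟩ := (hf.odd_lev p).1 h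
    have : (fun q => lev f S j q = lev f S j p) = fun q => f i q = f j q :=
      funext fun q => propext (hf.lev_eq_lev hi hip)
    rw [this]
    refine sum_eq_single i (fun k hk hki => eulerTerm_eq_zero fun h' => hki ?_)
      (fun h' => absurd hi h')
    exact hf.injOn hk hi (h'.trans hip.symm)
  · refine sum_eq_zero fun k hk => eulerTerm_eq_zero fun h' => h ?_
    exact (hf.odd_lev p).2 ⟨k, hk, h'⟩

theorem IsChain.mem_box_of_eq (hf : IsChain f S j m) {k : ℕ} (hk : k ∈ S) (p : Pt)
    (h : f k p = f j p) : p ∈ box m := by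
  by_contra hp
  rw [hf.out k p hp, hf.out j p hp] at h
  exact (vac_strict (hf.lt k hk) p).ne' h

theorem IsChain.sum_bsum (hf : IsChain f S j m) :
    ∑ k ∈ S, (bsum m (f k) (f j) + bsum m (f j) (f k))
      = ∑ p ∈ box (m + 1), oddTerm (lev f S j) p := by
  rw [← sum_congr rfl fun p _ => hf.sum_eulerTerm p, sum_comm]
  refine sum_congr rfl fun k hk => ?_
  rw [← sum_bform_add_comm (hf.height k) (hf.height j) (hf.mem_box_of_eq hk),
    sum_add_distrib, bsum, bsum]

theorem bsum_vac {k j : ℕ} (h : k < j) (m : ℕ) :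
    bsum m (vac k) (vac j) + bsum m (vac j) (vac k) = 0 := by
  have hne : ∀ p, vac k p ≠ vac j p := fun p => (vac_strict h p).ne'
  rw [bsum, bsum, ← sum_add_distrib,
    sum_bform_add_comm (isHeight_vac k) (isHeight_vac j) (fun p hp => absurd hp (hne p))]
  exact sum_eq_zero fun p _ => eulerTerm_eq_zero (hne p)

/-! ### The sign of a swap -/

theorem permHeight_singleton (hf : IsChain f S j m) {K : Finset Pt}
    (hK : K ∈ islands (lev f S j) m) {i : ℕ} (hi : IslandLayer f S j K i) :
    permHeight f (islandPerm f S j {K}) i = K.piecewise (f j) (f i) ∧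
    permHeight f (islandPerm f S j {K}) j = K.piecewise (f i) (f j) ∧
    ∀ k, k ≠ i → k ≠ j → permHeight f (islandPerm f S j {K}) k = f k := by
  have hT : {K} ⊆ islands (lev f S j) m := singleton_subset_iff.2 hK
  have h1 : ∀ p ∈ K, islandPerm f S j {K} p = Equiv.swap i j := fun p hp =>
    islandPerm_of_mem hf hT (mem_singleton_self K) hi hp
  have h2 : ∀ p, p ∉ K → islandPerm f S j {K} p = 1 := fun p hp =>
    islandPerm_of_notMem fun L hL => by rwa [mem_singleton.1 hL]
  refine ⟨funext fun p => ?_, funext fun p => ?_, fun k hki hkj => funext fun p => ?_⟩ <;>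
    by_cases hp : p ∈ K <;>
    simp [permHeight, Equiv.swap_apply_of_ne_of_ne, *]

theorem odd_sum_bsum_singleton (hf : IsChain f S j m) {K : Finset Pt}
    (hK : K ∈ islands (lev f S j) m) :
    Odd (∑ k ∈ S, bsum m (permHeight f (islandPerm f S j {K}) k)
        (permHeight f (islandPerm f S j {K}) j) + ∑ k ∈ S, bsum m (f k) (f j)) := by
  have hKm := (mem_islands.1 hK).1
  have hKI := (mem_islands.1 hK).2
  have hT : {K} ⊆ islands (lev f S j) m := singleton_subset_iff.2 hK
  obtain ⟨i, hi⟩ := hf.exists_layer hKI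
  have hf' := hf.perm hT
  obtain ⟨e1, e2, e3⟩ := permHeight_singleton hf hK hi
  have heq := fun k (hk : k ∈ S) p => permHeight_eq_iff hf hT hk p
  generalize permHeight f (islandPerm f S j {K}) = f' at *
  have hconst : ∀ k l, k ∈ S → l ∈ S → k < l → bsum m (f' k) (f' l) = bsum m (f k) (f l) := by
    intro k l hk hl hkl
    exact bsum_of_lt (hf'.height k) (hf'.height l) (hf.height k) (hf.height l)
      (hf'.strict k hk l hl hkl) (hf.strict k hk l hl hkl)
      (fun p hp => by rw [hf'.out l p hp, hf.out l p hp])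
  have hsw := fun h => bform_swap (f i) (f j) h K hi.nbr
  have key : ∀ k ∈ S.erase i, bsum m (f' k) (f' j) = bsum m (f k) (f j) := by
    intro k hk
    rw [mem_erase] at hk
    have hkj := (hf.lt k hk.2).ne
    rcases hk.1.lt_or_gt with h | h
    · have h1 := sum_congr rfl fun p (_ : p ∈ box (m + 1)) => (hsw (f k) p).1
      rw [← e1, ← e2] at h1
      simp only [sum_add_distrib] at h1
      have h2 := hconst k i hk.2 hi.mem h
      rw [e3 k hk.1 hkj] at h2 ⊢
      simp only [bsum] at *
      linarith
    · have h1 := sum_congr rfl fun p (_ : p ∈ box (m + 1)) => (hsw (f k) p).2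
      rw [← e1, ← e2] at h1
      simp only [sum_add_distrib] at h1
      have h2 := hconst i k hi.mem hk.2 h
      have h3 := sum_bform_add_comm (hf.height k) (hf.height j) (hf.mem_box_of_eq hk.2)
      have h4 := sum_bform_add_comm (hf'.height k) (hf'.height j) (hf'.mem_box_of_eq hk.2)
      have h5 : (fun q => f' k q = f' j q) = fun q => f k q = f j q :=
        funext fun q => propext (heq k hk.2 q)
      rw [h5, ← h3] at h4
      simp only [sum_add_distrib] at h4
      rw [e3 k hk.1 hkj] at h2 h4 ⊢
      simp only [bsum] at *
      linarith
  rw [← add_sum_erase S _ hi.mem, ← add_sum_erase S (fun k => bsum m (f k) (f j)) hi.mem,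
    sum_congr rfl key]
  have h6 := odd_bsum_swap (hf.height i) (hf.height j) hKm
    (fun u hu => IslandLayer.ne hf hKI hu i hi.mem) hi.nbr hKI.chi_eq
  grind

/-- The number of pairs of layers in `S` such that the vacuum of the first one starts below the
second one. -/
def vacCount (f : ℕ → Pt → ℤ) (S : Finset ℕ) : ℤ :=
  ∑ l ∈ S, ∑ k ∈ S, ind (k < l ∧ -(k : ℤ) ≤ f l (0, 0))

theorem IsChain.vacCount_insert (hf : IsChain f S j m) :
    vacCount f (insert j S) = vacCount f S + ∑ k ∈ S, ind (-(k : ℤ) ≤ f j (0, 0)) := by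
  have hj : j ∉ S := fun h => lt_irrefl j (hf.lt j h)
  have h1 : ∀ l ∈ S, ∑ k ∈ insert j S, ind (k < l ∧ -(k : ℤ) ≤ f l (0, 0))
      = ∑ k ∈ S, ind (k < l ∧ -(k : ℤ) ≤ f l (0, 0)) := by
    intro l hl
    rw [sum_insert hj, ind_false (fun h => (hf.lt l hl).not_gt h.1), zero_add]
  rw [vacCount, sum_insert hj, sum_congr rfl h1, sum_insert hj,
    ind_false (fun h => lt_irrefl j h.1), zero_add, add_comm]
  congr 1
  exact sum_congr rfl fun k hk => ind_congr (and_iff_right (hf.lt k hk))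

theorem vacCount_perm (hf : IsChain f S j m) (hT : T ⊆ islands (lev f S j) m) :
    vacCount perm[f,S,j,T] (insert j S) = vacCount f (insert j S) := by
  rw [(hf.perm hT).vacCount_insert, hf.vacCount_insert, vacCount, vacCount]
  simp only [permHeight]
  rcases islandPerm_cases hf hT (0, 0) with ⟨K, hK, hp, i, hi, h⟩ | ⟨-, h⟩ <;> rw [h]
  swap
  · rfl
  have hij := (hf.lt i hi.mem).ne
  have hne : ∀ l ∈ S.erase i, Equiv.swap i j l = l := fun l hl =>
    Equiv.swap_apply_of_ne_of_ne (ne_of_mem_erase hl)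
      (hf.lt l (mem_of_mem_erase hl)).ne
  have v0 : ∀ k : ℕ, vac k (0, 0) = -(k : ℤ) := fun k => by simp [vac]
  have hvj := hi.vac_le hf hp
  have hvi := hf.vac_le i (0, 0)
  rw [v0] at hvi hvj
  rw [← add_sum_erase S _ hi.mem,
    ← add_sum_erase S (fun l => ∑ k ∈ S, ind (k < l ∧ -(k : ℤ) ≤ f l (0, 0))) hi.mem,
    Equiv.swap_apply_left, Equiv.swap_apply_right]
  have he : ∑ l ∈ S.erase i, ∑ k ∈ S, ind (k < l ∧ -(k : ℤ) ≤ f (Equiv.swap i j l) (0, 0))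
      = ∑ l ∈ S.erase i, ∑ k ∈ S, ind (k < l ∧ -(k : ℤ) ≤ f l (0, 0)) :=
    sum_congr rfl fun l hl => by rw [hne l hl]
  have : ∑ k ∈ S, ind (k < i ∧ -(k : ℤ) ≤ f j (0, 0)) + ∑ k ∈ S, ind (-(k : ℤ) ≤ f i (0, 0))
      = ∑ k ∈ S, ind (k < i ∧ -(k : ℤ) ≤ f i (0, 0)) + ∑ k ∈ S, ind (-(k : ℤ) ≤ f j (0, 0)) := by
    rw [← sum_add_distrib, ← sum_add_distrib]
    refine sum_congr rfl fun k _ => ?_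
    unfold ind
    split_ifs <;> omega
  linarith

theorem permHeight_insert (hf : IsChain f S j m) {K : Finset Pt} (hKT : K ∉ T)
    (hT : insert K T ⊆ islands (lev f S j) m) :
    permHeight f (islandPerm f S j (insert K T))
      = permHeight perm[f,S,j,T]
        (islandPerm perm[f,S,j,T] S j {K}) := by
  have hT' := (insert_subset_iff.1 hT).2
  have hK := (insert_subset_iff.1 hT).1
  rw [islandPerm_perm hf hT']
  funext k p
  simp only [permHeight]
  by_cases hp : p ∈ K
  · obtain ⟨i, hi⟩ := hf.exists_layer (mem_islands.1 hK).2
    rw [islandPerm_of_mem hf hT (mem_insert_self K T) hi hp,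
      islandPerm_of_mem hf (singleton_subset_iff.2 hK) (mem_singleton_self K) hi hp,
      islandPerm_of_notMem (T := T)]
    · rfl
    · intro L hL hpL
      have := (mem_islands.1 hK).2.eq_of_mem (mem_islands.1 (hT' hL)).2 hp hpL
      grind
  · rw [islandPerm_of_notMem (T := {K}) fun L hL => by rwa [mem_singleton.1 hL]]
    simp only [Equiv.Perm.coe_one, id]
    have : islandPerm f S j (insert K T) p = islandPerm f S j T p := by
      simp only [islandPerm, exists_mem_insert, hp, false_and, false_or]
    rw [this]

theorem even_sum_bsum_perm (hf : IsChain f S j m) (hT : T ⊆ islands (lev f S j) m) :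
    Even (∑ k ∈ S, bsum m (perm[f,S,j,T] k)
        (perm[f,S,j,T] j) + ∑ k ∈ S, bsum m (f k) (f j) + T.card) := by
  induction T using Finset.induction_on with
  | empty =>
    have : permHeight f (islandPerm f S j ∅) = f := by
      funext k p
      rw [permHeight, islandPerm_of_notMem (by simp)]
      rfl
    rw [this, card_empty]
    grind
  | insert K T hKT ih =>
    have hT' := (insert_subset_iff.1 hT).2
    have h1 := ih hT'
    have h2 := odd_sum_bsum_singleton (hf.perm hT') (K := K)
      (by rw [islands_perm hf hT']; exact (insert_subset_iff.1 hT).1)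
    rw [← permHeight_insert hf hKT hT] at h2
    grind

/-! ### Chains without coincidences -/

theorem IsChain.lt_of_even (hf : IsChain f S j m) (h : ∀ p, Even (lev f S j p)) {k : ℕ} (hk : k ∈ S)
    (p : Pt) : f j p < f k p := by
  have hL := hf.isLevel
  have hwalk : ∀ n : ℕ, lev f S j p = lev f S j (p.1 + n, p.2) := by
    intro n
    induction n with
    | zero => simp
    | succ n ih =>
      rw [ih]
      have := hL.even (p.1 + n, p.2) (nb 0 (p.1 + n, p.2)) (triAdj_nb 0 _) (h _) (h _)
      rw [this, nb_zero]
      grind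
  have hout : (p.1 + ((p.1.natAbs + m + 1 : ℕ) : ℤ), p.2) ∉ box m := by
    rw [mem_box]
    omega
  have h1 := (hwalk (p.1.natAbs + m + 1)).trans (hL.out _ hout)
  have h2 : ∀ k ∈ S, tri (f k p - f j p) ≤ 2 := by
    intro k _
    unfold tri
    split_ifs <;> omega
  have h3 := (sum_eq_sum_iff_of_le h2).1 (by
    rw [lev] at h1
    rw [h1, sum_const, nsmul_eq_mul, mul_comm]) k hk
  unfold tri at h3
  omega

end ChainSums
end QQ

namespace QQ
open Finset MvPolynomial

/-! ## Residues and smooth functions -/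

section Residue

variable {A 𝕂 L : Type*} [CommRing A] [Field 𝕂] [Algebra A 𝕂] [Field L]
local notation "𝔞" => algebraMap A 𝕂

/-- The element `x` of the field is regular at the homomorphism `e`, with value `y`. -/
def HasRes (e : A →+* L) (x : 𝕂) (y : L) : Prop :=
  ∃ a b : A, e b ≠ 0 ∧ x * 𝔞 b = 𝔞 a ∧ e a = y * e b

variable {e : A →+* L} {x x' : 𝕂} {y y' : L}

theorem hasRes_algebraMap (e : A →+* L) (a : A) : HasRes e (𝔞 a) (e a) :=
  ⟨a, 1, by simp, by simp, by simp⟩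

theorem hasRes_zero : HasRes e (0 : 𝕂) 0 := by simpa using hasRes_algebraMap (𝕂 := 𝕂) e 0

theorem hasRes_one : HasRes e (1 : 𝕂) 1 := by simpa using hasRes_algebraMap (𝕂 := 𝕂) e 1

theorem HasRes.add (h : HasRes e x y) (h' : HasRes e x' y') : HasRes e (x + x') (y + y') := by
  obtain ⟨a, b, hb, h1, h2⟩ := h
  obtain ⟨a', b', hb', h1', h2'⟩ := h'
  refine ⟨a * b' + a' * b, b * b', by rw [map_mul]; exact mul_ne_zero hb hb', ?_, ?_⟩
  · grind
  · grind

theorem HasRes.mul (h : HasRes e x y) (h' : HasRes e x' y') : HasRes e (x * x') (y * y') := by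
  obtain ⟨a, b, hb, h1, h2⟩ := h
  obtain ⟨a', b', hb', h1', h2'⟩ := h'
  refine ⟨a * a', b * b', by rw [map_mul]; exact mul_ne_zero hb hb', ?_, ?_⟩
  · grind
  · grind

theorem HasRes.neg (h : HasRes e x y) : HasRes e (-x) (-y) := by
  have := (hasRes_algebraMap (𝕂 := 𝕂) e (-1)).mul h
  simpa using this

theorem HasRes.sub (h : HasRes e x y) (h' : HasRes e x' y') : HasRes e (x - x') (y - y') := by
  rw [sub_eq_add_neg, sub_eq_add_neg]
  exact h.add h'.neg

theorem HasRes.pow (h : HasRes e x y) (n : ℕ) : HasRes e (x ^ n) (y ^ n) := by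
  induction n with
  | zero => simpa using hasRes_one
  | succ n ih =>
    rw [pow_succ, pow_succ]
    exact ih.mul h

theorem HasRes.sum {ι : Type*} {s : Finset ι} {f : ι → 𝕂} {g : ι → L}
    (h : ∀ i ∈ s, HasRes e (f i) (g i)) : HasRes e (∑ i ∈ s, f i) (∑ i ∈ s, g i) := by
  classical
  induction s using Finset.induction_on with
  | empty => simpa using hasRes_zero
  | insert i s hi ih =>
    rw [sum_insert hi, sum_insert hi]
    exact (h i (mem_insert_self i s)).add (ih fun k hk => h k (mem_insert_of_mem hk))

theorem HasRes.prod {ι : Type*} {s : Finset ι} {f : ι → 𝕂} {g : ι → L}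
    (h : ∀ i ∈ s, HasRes e (f i) (g i)) : HasRes e (∏ i ∈ s, f i) (∏ i ∈ s, g i) := by
  classical
  induction s using Finset.induction_on with
  | empty => simpa using hasRes_one
  | insert i s hi ih =>
    rw [prod_insert hi, prod_insert hi]
    exact (h i (mem_insert_self i s)).mul (ih fun k hk => h k (mem_insert_of_mem hk))

theorem HasRes.eval₂ {σ : Type*} {f : σ → 𝕂} {g : σ → L} (h : ∀ i, HasRes e (f i) (g i))
    (P : MvPolynomial σ A) :
    HasRes e (eval₂ 𝔞 f P) (eval₂ e g P) := by
  induction P using induction_on with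
  | C a => simpa using hasRes_algebraMap e a
  | add p q hp hq => simpa using hp.add hq
  | mul_X p n hp => simpa using hp.mul (h n)

theorem HasRes.ne_zero [FaithfulSMul A 𝕂] (h : HasRes e x y) (hy : y ≠ 0) : x ≠ 0 := by
  rintro rfl
  obtain ⟨a, b, hb, h1, h2⟩ := h
  rw [zero_mul] at h1
  have : a = 0 := FaithfulSMul.algebraMap_injective A 𝕂 (by rw [← h1, map_zero])
  grind

theorem HasRes.inv [FaithfulSMul A 𝕂] (h : HasRes e x y) (hy : y ≠ 0) : HasRes e x⁻¹ y⁻¹ := by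
  have hx := h.ne_zero hy
  obtain ⟨a, b, hb, h1, h2⟩ := h
  refine ⟨b, a, by rw [h2]; exact mul_ne_zero hy hb, ?_, ?_⟩
  · grind
  · grind

theorem HasRes.div [FaithfulSMul A 𝕂] (h : HasRes e x y) (h' : HasRes e x' y') (hy : y' ≠ 0) :
    HasRes e (x / x') (y / y') := by
  rw [div_eq_mul_inv, div_eq_mul_inv]
  exact h.mul (h'.inv hy)

theorem HasRes.zpow [FaithfulSMul A 𝕂] (h : HasRes e x y) (hy : y ≠ 0) (n : ℤ) : HasRes e (x ^ n) (y ^ n) := by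
  cases n with
  | ofNat n => simpa using h.pow n
  | negSucc n =>
    rw [zpow_negSucc, zpow_negSucc]
    exact (h.pow _).inv (pow_ne_zero _ hy)

variable (𝕂 e) in
/-- The regular elements. -/
def regular : Subring 𝕂 where
  carrier := {x | ∃ y, HasRes e x y}
  mul_mem' := fun ⟨_, h⟩ ⟨_, h'⟩ => ⟨_, h.mul h'⟩
  one_mem' := ⟨_, hasRes_one⟩
  add_mem' := fun ⟨_, h⟩ ⟨_, h'⟩ => ⟨_, h.add h'⟩
  zero_mem' := ⟨_, hasRes_zero⟩
  neg_mem' := fun ⟨_, h⟩ => ⟨_, h.neg⟩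

theorem HasRes.mem_regular (h : HasRes e x y) : x ∈ regular 𝕂 e := ⟨y, h⟩

/-! ### Smooth functions on subsets -/

variable {ι : Type*}

variable (e) in
/-- The functions on the subsets of `ι` whose `n`-th differences are divisible by `h ^ n`. -/
def IsSmooth (h : 𝕂) (φ : Finset ι → 𝕂) : Prop :=
  ∃ c : Finset ι → 𝕂, (∀ B, c B ∈ regular 𝕂 e) ∧ ∀ s, φ s = ∑ B ∈ s.powerset, c B * h ^ B.card

variable {h : 𝕂} {φ ψ : Finset ι → 𝕂}

theorem isSmooth_const {c : 𝕂} (hc : c ∈ regular 𝕂 e) : IsSmooth e h fun _ : Finset ι => c := by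
  classical
  refine ⟨fun B => if B = ∅ then c else 0, fun B => ?_, fun s => ?_⟩
  · dsimp only
    split_ifs
    exacts [hc, zero_mem _]
  · rw [sum_eq_single ∅]
    · simp
    · grind
    · simp

theorem isSmooth_bit [DecidableEq ι] {c : 𝕂} (hc : c ∈ regular 𝕂 e) (i : ι) :
    IsSmooth e h fun s => if i ∈ s then c * h else 0 := by
  refine ⟨fun B => if B = {i} then c else 0, fun B => ?_, fun s => ?_⟩
  · dsimp only
    split_ifs
    exacts [hc, zero_mem _]
  · by_cases hi : i ∈ s
    · rw [sum_eq_single {i}]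
      · simp [hi]
      · grind
      · simp [hi]
    · simp only [if_neg hi]
      refine (sum_eq_zero fun B hB => ?_).symm
      grind

theorem IsSmooth.add (hφ : IsSmooth e h φ) (hψ : IsSmooth e h ψ) : IsSmooth e h (φ + ψ) := by
  obtain ⟨c, hc, h1⟩ := hφ
  obtain ⟨d, hd, h2⟩ := hψ
  refine ⟨c + d, fun B => add_mem (hc B) (hd B), fun s => ?_⟩
  rw [Pi.add_apply, h1, h2, ← sum_add_distrib]
  exact sum_congr rfl fun B _ => by rw [Pi.add_apply, add_mul]

theorem IsSmooth.mul (hh : h ∈ regular 𝕂 e) (hφ : IsSmooth e h φ) (hψ : IsSmooth e h ψ) :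
    IsSmooth e h (φ * ψ) := by
  classical
  obtain ⟨c, hc, h1⟩ := hφ
  obtain ⟨d, hd, h2⟩ := hψ
  refine ⟨fun C => ∑ x ∈ (C.powerset ×ˢ C.powerset) with x.1 ∪ x.2 = C,
    c x.1 * d x.2 * h ^ (x.1 ∩ x.2).card, fun C => ?_, fun s => ?_⟩
  · exact sum_mem fun x _ => mul_mem (mul_mem (hc _) (hd _)) (pow_mem hh _)
  · rw [Pi.mul_apply, h1, h2, sum_mul_sum, ← sum_product',
      ← sum_fiberwise_of_maps_to (g := fun x : Finset ι × Finset ι => x.1 ∪ x.2)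
        (t := s.powerset)]
    · refine sum_congr rfl fun C hC => ?_
      rw [sum_mul]
      refine sum_congr ?_ fun x hx => ?_
      · grind
      · have hx := (mem_filter.1 hx).2
        have : h ^ x.1.card * h ^ x.2.card = h ^ (x.1 ∩ x.2).card * h ^ C.card := by
          rw [← pow_add, ← pow_add, ← hx, add_comm (x.1 ∩ x.2).card, card_union_add_card_inter]
        grind
    · grind

theorem IsSmooth.regular (hh : h ∈ regular 𝕂 e) (hφ : IsSmooth e h φ) (s : Finset ι) :
    φ s ∈ regular 𝕂 e := by
  obtain ⟨c, hc, h1⟩ := hφ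
  rw [h1]
  exact sum_mem fun B _ => mul_mem (hc B) (pow_mem hh _)

variable (ι) in
/-- The algebra of smooth functions. -/
def smooth (hh : h ∈ regular 𝕂 e) : Subalgebra (regular 𝕂 e) (Finset ι → 𝕂) where
  carrier := {φ | IsSmooth e h φ}
  mul_mem' := fun hφ hψ => IsSmooth.mul hh hφ hψ
  add_mem' := fun hφ hψ => IsSmooth.add hφ hψ
  algebraMap_mem' := fun r => isSmooth_const r.2

variable {hh : h ∈ regular 𝕂 e}

theorem mem_smooth : φ ∈ smooth ι hh ↔ IsSmooth e h φ := Iff.rfl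

theorem sum_neg_one_pow_smooth [Fintype ι] (hφ : φ ∈ smooth ι hh) :
    ∃ c ∈ regular 𝕂 e, ∑ s : Finset ι, (-1) ^ s.card * φ s = h ^ Fintype.card ι * c := by
  classical
  obtain ⟨c, hc, h1⟩ := hφ
  refine ⟨(-1) ^ Fintype.card ι * c univ,
    mul_mem (pow_mem (neg_mem (one_mem _)) _) (hc _), ?_⟩
  have key : ∀ B : Finset ι, ∑ s : Finset ι, (if B ⊆ s then (-1 : 𝕂) ^ s.card else 0)
      = if B = univ then (-1) ^ Fintype.card ι else 0 := by
    intro B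
    have := prod_add (fun _ : ι => (-1 : 𝕂)) (fun i => if i ∈ B then (0 : 𝕂) else 1) univ
    rw [powerset_univ] at this
    have h2 : ∀ s : Finset ι, (∏ _i ∈ s, (-1 : 𝕂)) * ∏ i ∈ univ \ s, (if i ∈ B then (0 : 𝕂) else 1)
        = if B ⊆ s then (-1 : 𝕂) ^ s.card else 0 := by
      intro s
      rw [prod_const]
      split_ifs with hs
      · rw [prod_eq_one, mul_one]
        grind
      · obtain ⟨i, hi, his⟩ := not_subset.1 hs
        have h0 : ∏ i ∈ univ \ s, (if i ∈ B then (0 : 𝕂) else 1) = 0 :=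
          prod_eq_zero (mem_sdiff.2 ⟨mem_univ i, his⟩) (if_pos hi)
        rw [h0, mul_zero]
    rw [← sum_congr rfl fun s _ => h2 s, ← this]
    split_ifs with hB
    · subst hB
      simp
    · obtain ⟨i, hi⟩ : ∃ i, i ∉ B := by grind
      exact prod_eq_zero (mem_univ i) (by simp [hi])
  have h3 : ∀ s : Finset ι, (-1) ^ s.card * φ s
      = ∑ B : Finset ι, c B * h ^ B.card * (if B ⊆ s then (-1 : 𝕂) ^ s.card else 0) := by
    intro s
    rw [h1, mul_sum, ← sum_filter_add_sum_filter_not univ (· ⊆ s)]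
    rw [sum_eq_zero (s := univ.filter fun x => ¬ x ⊆ s), add_zero]
    · refine sum_congr (by ext; simp) fun B hB => ?_
      grind
    · grind
  rw [sum_congr rfl fun s _ => h3 s, sum_comm]
  simp only [← mul_sum, key]
  simp
  ring

theorem smooth_inv [FaithfulSMul A 𝕂] [Fintype ι] (hφ : φ ∈ smooth ι hh)
    (hu : ∀ s, ∃ y, y ≠ 0 ∧ HasRes e (φ s) y) : φ⁻¹ ∈ smooth ι hh := by
  classical
  have hr : ∀ s, φ s ∈ regular 𝕂 e := fun s => IsSmooth.regular hh hφ s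
  set P : Polynomial (regular 𝕂 e) :=
    ∏ s : Finset ι, (Polynomial.X - Polynomial.C (⟨φ s, hr s⟩ : regular 𝕂 e)) with hP
  have hP0 : Polynomial.aeval φ P = 0 := by
    rw [hP, map_prod]
    funext s
    rw [prod_apply]
    refine prod_eq_zero (mem_univ s) ?_
    simp [Algebra.algebraMap_eq_smul_one, Subring.smul_def]
  rw [← Polynomial.divX_mul_X_add P, map_add, map_mul, Polynomial.aeval_X, Polynomial.aeval_C] at hP0
  have hc0 : ((P.coeff 0 : regular 𝕂 e) : 𝕂) = ∏ s : Finset ι, (-φ s) := by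
    rw [Polynomial.coeff_zero_eq_eval_zero, hP, Polynomial.eval_prod]
    simp
  have hc : (∏ s : Finset ι, (-φ s))⁻¹ ∈ regular 𝕂 e := by
    choose y hy hy' using hu
    exact ((HasRes.prod (s := univ) fun s _ => (hy' s).neg).inv
      (prod_ne_zero_iff.2 fun s _ => neg_ne_zero.2 (hy s))).mem_regular
  have hne : ∏ s : Finset ι, (-φ s) ≠ 0 :=
    prod_ne_zero_iff.2 fun s _ => neg_ne_zero.2 (by
      obtain ⟨y, hy, hy'⟩ := hu s
      exact hy'.ne_zero hy)
  have : φ⁻¹ = algebraMap (regular 𝕂 e) (Finset ι → 𝕂) ⟨-_, neg_mem hc⟩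
      * Polynomial.aeval φ P.divX := by
    funext s
    have h1 := congrFun hP0 s
    obtain ⟨y, hy, hy'⟩ := hu s
    have h2 := hy'.ne_zero hy
    simp only [Pi.add_apply, Pi.mul_apply, Pi.zero_apply, Algebra.algebraMap_eq_smul_one,
      Pi.smul_apply, Pi.one_apply, Subring.smul_def, smul_eq_mul, mul_one, hc0] at h1 ⊢
    rw [Pi.inv_apply]
    grind
  rw [this]
  refine mul_mem (Subalgebra.algebraMap_mem _ _) ?_
  exact Polynomial.aeval_mem_adjoin_singleton _ _ |> fun h' =>
    Algebra.adjoin_le (Set.singleton_subset_iff.2 hφ) h'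

/-! ### Affine exponents -/

/-- Affine integral functions on subsets. -/
def IsAffine (ν : Finset ι → ℤ) : Prop := ∃ (a : ℤ) (b : ι → ℤ), ∀ s, ν s = a + ∑ i ∈ s, b i

theorem isAffine_const (a : ℤ) : IsAffine fun _ : Finset ι => a := ⟨a, 0, fun s => by simp⟩

theorem isAffine_bit [DecidableEq ι] (i : ι) (a b : ℤ) :
    IsAffine fun s => if i ∈ s then a else b := by
  refine ⟨b, fun k => if k = i then a - b else 0, fun s => ?_⟩
  rw [sum_ite_eq' s i]
  grind

theorem IsAffine.add {ν ν' : Finset ι → ℤ} (h : IsAffine ν) (h' : IsAffine ν') :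
    IsAffine fun s => ν s + ν' s := by
  obtain ⟨a, b, h⟩ := h
  obtain ⟨a', b', h'⟩ := h'
  refine ⟨a + a', b + b', fun s => ?_⟩
  simp only [h, h', Pi.add_apply, sum_add_distrib]
  ring

theorem IsAffine.const_mul {ν : Finset ι → ℤ} (h : IsAffine ν) (c : ℤ) :
    IsAffine fun s => c * ν s := by
  obtain ⟨a, b, h⟩ := h
  refine ⟨c * a, fun i => c * b i, fun s => ?_⟩
  simp only [h, mul_add, mul_sum]

theorem IsAffine.sum {α : Type*} {t : Finset α} {ν : α → Finset ι → ℤ}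
    (h : ∀ x ∈ t, IsAffine (ν x)) : IsAffine fun s => ∑ x ∈ t, ν x s := by
  classical
  induction t using Finset.induction_on with
  | empty => simpa using isAffine_const 0
  | insert x t hx ih =>
    simp only [sum_insert hx]
    exact (h x (mem_insert_self x t)).add (ih fun y hy => h y (mem_insert_of_mem hy))

theorem IsAffine.of_two_mul {ν : Finset ι → ℤ} (h : IsAffine fun s => 2 * ν s) : IsAffine ν := by
  classical
  obtain ⟨a, b, h⟩ := h
  have h0 : 2 * ν ∅ = a := by simpa using h ∅
  have h1 : ∀ i, b i = 2 * (ν {i} - ν ∅) := by grind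
  refine ⟨ν ∅, fun i => ν {i} - ν ∅, fun s => ?_⟩
  have := h s
  simp only [h1, ← mul_sum] at this
  dsimp only
  omega

theorem smooth_zpow [FaithfulSMul A 𝕂] [Fintype ι] (hφ : φ ∈ smooth ι hh)
    (hu : ∀ s, ∃ y, y ≠ 0 ∧ HasRes e (φ s) y) (n : ℤ) : (fun s => φ s ^ n) ∈ smooth ι hh := by
  cases n with
  | ofNat n =>
    simp only [Int.ofNat_eq_natCast, zpow_natCast]
    exact pow_mem hφ n
  | negSucc n =>
    simp only [zpow_negSucc, ← inv_pow]
    exact pow_mem (smooth_inv hφ hu) (n + 1)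

theorem smooth_zpow_affine [FaithfulSMul A 𝕂] [Fintype ι] (hh0 : HasRes e h 0) {ν : Finset ι → ℤ} (hν : IsAffine ν) :
    (fun s => (1 - h) ^ ν s) ∈ smooth ι hh := by
  classical
  have hR : HasRes e (1 - h) 1 := by simpa using hasRes_one.sub hh0
  have hR0 := hR.ne_zero one_ne_zero
  obtain ⟨a, b, hν⟩ := hν
  have : (fun s => (1 - h) ^ ν s)
      = (fun _ => (1 - h) ^ a) * ∏ i, fun s => (1 + if i ∈ s then (-1) * h else 0) ^ b i := by
    funext s
    rw [Pi.mul_apply, prod_apply, hν, zpow_add₀ hR0]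
    congr 1
    rw [← prod_subset (subset_univ s)]
    · have : ∀ i ∈ s, (1 + if i ∈ s then (-1) * h else 0) ^ b i = (1 - h) ^ b i := by grind
      rw [prod_congr rfl this]
      clear this
      induction s using Finset.induction_on with
      | empty => simp
      | insert i s hi ih => rw [sum_insert hi, prod_insert hi, zpow_add₀ hR0, ih]
    · intro i _ hi
      rw [if_neg hi, add_zero, one_zpow]
  rw [this]
  refine mul_mem (isSmooth_const (hR.zpow one_ne_zero a).mem_regular) (prod_mem fun i _ => ?_)
  refine smooth_zpow (φ := fun s => 1 + if i ∈ s then (-1) * h else 0)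
    (add_mem (one_mem _) (isSmooth_bit (neg_mem (one_mem _)) i)) (fun s => ⟨1, one_ne_zero, ?_⟩) _
  split_ifs
  · grind
  · simpa using hasRes_one

theorem smooth_eval₂ {σ : Type*} {f : σ → Finset ι → 𝕂} (hf : ∀ i, f i ∈ smooth ι hh)
    (P : MvPolynomial σ A) :
    (fun s => eval₂ 𝔞 (fun i => f i s) P) ∈ smooth ι hh := by
  induction P using induction_on with
  | C a =>
    simp only [eval₂_C]
    exact isSmooth_const (hasRes_algebraMap e a).mem_regular
  | add p q hp hq =>
    simp only [eval₂_add]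
    exact add_mem hp hq
  | mul_X p n hp =>
    simp only [eval₂_mul, eval₂_X]
    exact mul_mem hp (hf n)

end Residue
end QQ

namespace QQ
open Finset

/-! ## Products of factors `1 - z` with the vanishing ones omitted -/

section Factors
open Classical

/-- The factor `1 - z`, replaced by one when it vanishes. -/
def dr {F : Type*} [Field F] (z : F) : F := if z = 1 then 1 else 1 - z

theorem dr_one {F : Type*} [Field F] : dr (1 : F) = 1 := if_pos rfl

theorem dr_of_ne {F : Type*} [Field F] {z : F} (h : z ≠ 1) : dr z = 1 - z := if_neg h

theorem dr_ne_zero {F : Type*} [Field F] (z : F) : dr z ≠ 0 := by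
  unfold dr
  grind

variable {α : Type*}

/-- A product of factors with constants `γ`, exponents `n`, and ratios of variables whose indices
are `τ` and `σ`. -/
def facProd {F : Type*} [Field F] [Algebra ℂ F] (u : ℕ → F) (Ω : Finset α) (γ : α → ℂ) (n : α → ℤ)
    (σ τ : α → ℕ) : F :=
  ∏ ω ∈ Ω, dr (algebraMap ℂ F (γ ω) * (u (τ ω) / u (σ ω))) ^ n ω

/-- The order of vanishing when the variables with indices in `S` merge with the `j`-th one. -/
def facOrd (S : Finset ℕ) (j : ℕ) (Ω : Finset α) (γ : α → ℂ) (n : α → ℤ) (σ τ : α → ℕ) : ℤ :=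
  ∑ ω ∈ Ω, n ω * ind (γ ω = 1 ∧ ((σ ω = j ∧ τ ω ∈ S) ∨ (σ ω ∈ S ∧ τ ω = j)))

/-- The part of the order which comes with a sign. -/
def facNeg (S : Finset ℕ) (j : ℕ) (Ω : Finset α) (γ : α → ℂ) (n : α → ℤ) (σ τ : α → ℕ) : ℤ :=
  ∑ ω ∈ Ω, n ω * ind (γ ω = 1 ∧ σ ω = j ∧ τ ω ∈ S)

/-- The factors which become one when the variables merge. -/
def FacCrit (S : Finset ℕ) (j : ℕ) (c : ℂ) (k l : ℕ) : Prop :=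
  c = 1 ∧ (k = l ∨ (k ∈ insert j S ∧ l ∈ insert j S))

variable {A 𝕂 L : Type*} [CommRing A] [Algebra ℂ A] [Field 𝕂] [Algebra ℂ 𝕂] [Algebra A 𝕂]
  [IsScalarTower ℂ A 𝕂] [Field L] [Algebra ℂ L]
local notation "𝔞" => algebraMap A 𝕂

/-- The homomorphism `e` merges the variables with indices in `S`, which are equal, with the `j`-th
one, and keeps the others generic. -/
structure IsMerge (e : A →ₐ[ℂ] L) (u : ℕ → A) (N : ℕ) (S : Finset ℕ) (j : ℕ) : Prop where
  lt : ∀ k ∈ S, k < j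
  lt_card : j < N
  nonempty : S.Nonempty
  eq : ∀ k ∈ S, ∀ l ∈ S, u k = u l
  ne : ∀ k ∈ S, u k ≠ u j
  map_ne : ∀ l, e (u l) ≠ 0
  map_eq : ∀ k ∈ S, e (u k) = e (u j)
  gen : ∀ (c : ℂ) (k l : ℕ), k < N → l < N → algebraMap ℂ L c * e (u l) = e (u k) →
    c = 1 ∧ (k = l ∨ (k ∈ insert j S ∧ l ∈ insert j S))

variable {e : A →ₐ[ℂ] L} {u : ℕ → A} {N : ℕ} {S : Finset ℕ} {j : ℕ}

variable (𝕂 u S j) in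
/-- The small parameter of a merge. -/
def mergePar (hS : S.Nonempty) : 𝕂 := 1 - 𝔞 (u j) / 𝔞 (u hS.choose)

variable [FaithfulSMul A 𝕂]

set_option linter.unusedSectionVars false

theorem IsMerge.res (_h : IsMerge e u N S j) (l : ℕ) :
    HasRes (𝕂 := 𝕂) (e : A →+* L) (𝔞 (u l)) (e (u l)) := hasRes_algebraMap _ _

theorem IsMerge.ne_zero (h : IsMerge e u N S j) (l : ℕ) : 𝔞 (u l) ≠ 0 :=
  (h.res l).ne_zero (h.map_ne l)

theorem IsMerge.one_sub (h : IsMerge e u N S j) {k : ℕ} (hk : k ∈ S) :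
    1 - mergePar 𝕂 u S j h.nonempty = 𝔞 (u j) / 𝔞 (u k) := by
  rw [mergePar, sub_sub_cancel, h.eq k hk _ h.nonempty.choose_spec]

theorem IsMerge.par_res (h : IsMerge e u N S j) :
    HasRes (e : A →+* L) (mergePar 𝕂 u S j h.nonempty) 0 := by
  have h1 := (hasRes_one (𝕂 := 𝕂)).sub (((h.res j).div (h.res h.nonempty.choose) (h.map_ne _)))
  rw [h.map_eq _ h.nonempty.choose_spec, div_self (h.map_ne j), sub_self] at h1
  exact h1

theorem IsMerge.par_ne (h : IsMerge e u N S j) : mergePar 𝕂 u S j h.nonempty ≠ 0 := by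
  rw [mergePar, sub_ne_zero]
  intro hc
  rw [eq_div_iff (h.ne_zero _), one_mul] at hc
  exact h.ne _ h.nonempty.choose_spec (FaithfulSMul.algebraMap_injective A 𝕂 hc)

theorem IsMerge.crit_iff (h : IsMerge e u N S j) {c : ℂ} {k l : ℕ} (hk : k < N) (hl : l < N) :
    algebraMap ℂ L c * (e (u l) / e (u k)) = 1 ↔ FacCrit S j c k l := by
  rw [← mul_div_assoc, div_eq_one_iff_eq (h.map_ne k)]
  refine ⟨h.gen c k l hk hl, ?_⟩
  rintro ⟨rfl, hkl⟩
  have key : ∀ k ∈ insert j S, e (u k) = e (u j) := by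
    intro k hk
    rcases mem_insert.1 hk with rfl | hk
    exacts [rfl, h.map_eq k hk]
  grind

theorem hasRes_const (c : ℂ) :
    HasRes (𝕂 := 𝕂) (e : A →+* L) (algebraMap ℂ 𝕂 c) (algebraMap ℂ L c) := by
  have := hasRes_algebraMap (𝕂 := 𝕂) (e : A →+* L) (algebraMap ℂ A c)
  rw [← IsScalarTower.algebraMap_apply] at this
  simpa using this

theorem IsMerge.dr_crit (h : IsMerge e u N S j) {c : ℂ} {k l : ℕ} (hc : FacCrit S j c k l) :
    dr (algebraMap ℂ 𝕂 c * (𝔞 (u l) / 𝔞 (u k)))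
      = mergePar 𝕂 u S j h.nonempty ^ ind (c = 1 ∧ ((k = j ∧ l ∈ S) ∨ (k ∈ S ∧ l = j)))
        * (-(1 - mergePar 𝕂 u S j h.nonempty)⁻¹) ^ ind (c = 1 ∧ k = j ∧ l ∈ S) := by
  obtain ⟨rfl, hkl⟩ := hc
  have hj : j ∉ S := fun hj => lt_irrefl j (h.lt j hj)
  have hp := h.par_ne (𝕂 := 𝕂)
  rw [map_one, one_mul]
  simp only [true_and]
  by_cases hk : k = j
  · subst hk
    by_cases hl : l ∈ S
    · have h1 := h.one_sub (𝕂 := 𝕂) hl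
      have h2 : (1 - mergePar 𝕂 u S k h.nonempty) ≠ 0 := by
        rw [h1]; exact div_ne_zero (h.ne_zero k) (h.ne_zero l)
      rw [ind_true (Or.inl ⟨rfl, hl⟩), ind_true ⟨rfl, hl⟩, ← inv_div, ← h1, zpow_one, zpow_one,
        dr_of_ne]
      · grind
      · grind
    · have : k = l := by grind
      subst this
      rw [ind_false (by simp [hl]), ind_false (by simp [hl]), div_self (h.ne_zero k), dr_one]
      simp
  · rw [ind_false (P := k = j ∧ l ∈ S) (by simp [hk]), zpow_zero, mul_one]
    by_cases hl : l = j
    · subst hl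
      have hkS : k ∈ S := by grind
      rw [ind_true (Or.inr ⟨hkS, rfl⟩), zpow_one, ← h.one_sub hkS, dr_of_ne]
      · ring
      · grind
    · rw [ind_false (by simp [hk, hl]), zpow_zero]
      have : u l = u k := by
        rcases hkl with rfl | ⟨h1, h2⟩
        · rfl
        · exact h.eq _ ((mem_insert.1 h2).resolve_left hl) _
            ((mem_insert.1 h1).resolve_left hk)
      rw [this, div_self (h.ne_zero k), dr_one]

variable {Ω : Finset α} {γ : α → ℂ} {n : α → ℤ} {σ τ : α → ℕ}

variable (𝕂 u S j) in
/-- The factors which stay different from one. -/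
def facReg (Ω : Finset α) (γ : α → ℂ) (n : α → ℤ) (σ τ : α → ℕ) : 𝕂 :=
  ∏ ω ∈ Ω.filter (fun ω => ¬ FacCrit S j (γ ω) (σ ω) (τ ω)),
    (1 - algebraMap ℂ 𝕂 (γ ω) * (𝔞 (u (τ ω)) / 𝔞 (u (σ ω)))) ^ n ω

theorem IsMerge.ratio_res (h : IsMerge e u N S j) (c : ℂ) (k l : ℕ) :
    HasRes (𝕂 := 𝕂) (e : A →+* L) (algebraMap ℂ 𝕂 c * (𝔞 (u l) / 𝔞 (u k)))
      (algebraMap ℂ L c * (e (u l) / e (u k))) :=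
  (hasRes_const c).mul ((h.res l).div (h.res k) (h.map_ne k))

theorem IsMerge.facReg_res (h : IsMerge e u N S j) (hσ : ∀ ω ∈ Ω, σ ω < N) (hτ : ∀ ω ∈ Ω, τ ω < N) :
    HasRes (e : A →+* L) (facReg 𝕂 u S j Ω γ n σ τ) (facProd (fun l => e (u l)) Ω γ n σ τ) := by
  have h1 : facProd (fun l => e (u l)) Ω γ n σ τ
      = ∏ ω ∈ Ω.filter (fun ω => ¬ FacCrit S j (γ ω) (σ ω) (τ ω)),
        (1 - algebraMap ℂ L (γ ω) * (e (u (τ ω)) / e (u (σ ω)))) ^ n ω := by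
    rw [facProd, ← prod_filter_mul_prod_filter_not Ω
      (fun ω => FacCrit S j (γ ω) (σ ω) (τ ω)), prod_eq_one, one_mul]
    · refine prod_congr rfl fun ω hω => ?_
      rw [mem_filter] at hω
      rw [← h.crit_iff (hσ ω hω.1) (hτ ω hω.1)] at hω
      rw [dr_of_ne hω.2]
    · intro ω hω
      rw [mem_filter] at hω
      rw [← h.crit_iff (hσ ω hω.1) (hτ ω hω.1)] at hω
      rw [hω.2, dr_one, one_zpow]
  rw [h1]
  refine HasRes.prod fun ω hω => ?_
  rw [mem_filter] at hω
  rw [← h.crit_iff (hσ ω hω.1) (hτ ω hω.1)] at hω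
  exact (hasRes_one.sub (h.ratio_res _ _ _)).zpow (sub_ne_zero.2 (Ne.symm hω.2)) _

theorem IsMerge.facProd_eq (h : IsMerge e u N S j) (hσ : ∀ ω ∈ Ω, σ ω < N) (hτ : ∀ ω ∈ Ω, τ ω < N) :
    facProd (fun l => 𝔞 (u l)) Ω γ n σ τ = facReg 𝕂 u S j Ω γ n σ τ
      * (mergePar 𝕂 u S j h.nonempty ^ facOrd S j Ω γ n σ τ
        * ((-1) ^ facNeg S j Ω γ n σ τ
          * (1 - mergePar 𝕂 u S j h.nonempty) ^ (-facNeg S j Ω γ n σ τ))) := by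
  have hp := h.par_ne (𝕂 := 𝕂)
  have hq : 1 - mergePar 𝕂 u S j h.nonempty ≠ 0 := by
    rw [h.one_sub h.nonempty.choose_spec]
    exact div_ne_zero (h.ne_zero _) (h.ne_zero _)
  have hsplit : ∀ x : 𝕂, x ≠ 0 → ∀ (s : Finset α) (g : α → ℤ),
      x ^ (∑ ω ∈ s, g ω) = ∏ ω ∈ s, x ^ g ω := by
    intro x hx s g
    induction s using Finset.induction_on with
    | empty => simp
    | insert ω s hω ih => rw [sum_insert hω, prod_insert hω, zpow_add₀ hx, ih]
  have h2 : ∀ m : ℤ, (-1 : 𝕂) ^ m * (1 - mergePar 𝕂 u S j h.nonempty) ^ (-m)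
      = (-(1 - mergePar 𝕂 u S j h.nonempty)⁻¹) ^ m := by
    intro m
    rw [zpow_neg, ← inv_zpow, ← mul_zpow, neg_one_mul]
  rw [h2, facOrd, facNeg, hsplit _ hp, hsplit _ (neg_ne_zero.2 (inv_ne_zero hq)),
    ← prod_mul_distrib, facProd, facReg,
    ← prod_filter_mul_prod_filter_not Ω (fun ω => FacCrit S j (γ ω) (σ ω) (τ ω)), mul_comm,
    ← prod_filter_mul_prod_filter_not Ω (fun ω => FacCrit S j (γ ω) (σ ω) (τ ω))
      (fun ω => _ * _)]
  have e1 : ∀ ω ∈ Ω.filter (fun ω => ¬ FacCrit S j (γ ω) (σ ω) (τ ω)),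
      mergePar 𝕂 u S j h.nonempty ^
          (n ω * ind (γ ω = 1 ∧ ((σ ω = j ∧ τ ω ∈ S) ∨ (σ ω ∈ S ∧ τ ω = j))))
        * (-(1 - mergePar 𝕂 u S j h.nonempty)⁻¹) ^ (n ω * ind (γ ω = 1 ∧ σ ω = j ∧ τ ω ∈ S)) = 1 := by
    intro ω hω
    have hω := (mem_filter.1 hω).2
    rw [ind_false, ind_false]
    · simp
    · rintro ⟨h1, h2, h3⟩
      exact hω ⟨h1, Or.inr ⟨by simp [h2], by simp [h3]⟩⟩
    · rintro ⟨h1, ⟨h2, h3⟩ | ⟨h2, h3⟩⟩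
      · exact hω ⟨h1, Or.inr ⟨by simp [h2], by simp [h3]⟩⟩
      · exact hω ⟨h1, Or.inr ⟨by simp [h2], by simp [h3]⟩⟩
  rw [prod_congr rfl e1, prod_const_one, mul_one]
  congr 1
  · refine prod_congr rfl fun ω hω => ?_
    rw [mem_filter] at hω
    rw [dr_of_ne]
    have h3 := hω.2
    rw [← h.crit_iff (hσ ω hω.1) (hτ ω hω.1)] at h3
    have h4 := hasRes_one.sub (h.ratio_res (𝕂 := 𝕂) (γ ω) (σ ω) (τ ω))
    have h5 := h4.ne_zero (sub_ne_zero.2 (Ne.symm h3))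
    grind
  · refine prod_congr rfl fun ω hω => ?_
    rw [h.dr_crit (mem_filter.1 hω).2, mul_zpow, ← zpow_mul, ← zpow_mul, mul_comm (n ω),
      mul_comm (n ω)]

/-! ### Families of indices -/

variable {ι : Type*}

variable (S j) in
/-- A family of indices which is constant, or changes between `S` and `j` with one bit. -/
def IsBit (k : Finset ι → ℕ) : Prop :=
  (∃ a, ∀ s, k s = a) ∨ ∃ (i : ι) (a b : ℕ), (∀ s, k s = if i ∈ s then a else b) ∧
    ((a ∈ S ∧ b = j) ∨ (a = j ∧ b ∈ S))

theorem IsBit.mem_iff {k : Finset ι → ℕ} (hk : IsBit S j k) (s : Finset ι) :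
    (k s ∈ insert j S ↔ k ∅ ∈ insert j S) ∧ (k s ∉ insert j S → k s = k ∅) := by
  rcases hk with ⟨a, ha⟩ | ⟨i, a, b, h1, h2⟩
  · simp [ha]
  · grind

theorem IsBit.isAffine (h : ∀ k ∈ S, k < j) {k : Finset ι → ℕ} (hk : IsBit S j k) :
    IsAffine fun s => ind (k s = j) := by
  have hj : j ∉ S := fun hj => lt_irrefl j (h j hj)
  rcases hk with ⟨a, ha⟩ | ⟨i, a, b, h1, -⟩
  · simp only [ha]
    exact isAffine_const _
  · have := isAffine_bit i (ind (a = j)) (ind (b = j))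
    grind

theorem IsBit.map_eq (h : IsMerge e u N S j) {k : Finset ι → ℕ} (hk : IsBit S j k) (s : Finset ι) :
    e (u (k s)) = e (u (k ∅)) := by
  have key : ∀ k ∈ insert j S, e (u k) = e (u j) := by
    intro k hk
    rcases mem_insert.1 hk with rfl | hk
    exacts [rfl, h.map_eq k hk]
  have := hk.mem_iff s
  grind

theorem IsBit.smooth_var (h : IsMerge e u N S j) {k : Finset ι → ℕ} (hk : IsBit S j k) :
    (fun s => 𝔞 (u (k s))) ∈ smooth ι h.par_res.mem_regular := by
  rcases hk with ⟨a, ha⟩ | ⟨i, a, b, h1, h2⟩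
  · simp only [ha]
    exact isSmooth_const (h.res a).mem_regular
  · obtain ⟨c, hc, hab⟩ : ∃ c ∈ regular 𝕂 (e : A →+* L),
        𝔞 (u a) = 𝔞 (u b) + c * mergePar 𝕂 u S j h.nonempty := by
      rcases h2 with ⟨h2, rfl⟩ | ⟨rfl, h2⟩
      · refine ⟨𝔞 (u a), (h.res a).mem_regular, ?_⟩
        have h3 := h.one_sub (𝕂 := 𝕂) h2
        rw [eq_div_iff (h.ne_zero a)] at h3
        grind
      · refine ⟨-𝔞 (u b), neg_mem (h.res b).mem_regular, ?_⟩
        have h3 := h.one_sub (𝕂 := 𝕂) h2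
        rw [eq_div_iff (h.ne_zero b)] at h3
        grind
    have := IsSmooth.add (isSmooth_const (h := mergePar 𝕂 u S j h.nonempty) (h.res b).mem_regular)
      (isSmooth_bit hc i)
    rw [mem_smooth]
    convert this using 1
    funext s
    rw [Pi.add_apply, h1]
    grind

theorem IsBit.smooth_div (h : IsMerge e u N S j) [Fintype ι] {k l : Finset ι → ℕ}
    (hk : IsBit S j k) (hl : IsBit S j l) :
    (fun s => 𝔞 (u (l s)) / 𝔞 (u (k s)))
      ∈ smooth ι h.par_res.mem_regular := by
  simp only [div_eq_mul_inv]
  exact mul_mem (hl.smooth_var h)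
    (smooth_inv (hk.smooth_var h) fun s => ⟨_, h.map_ne (k s), h.res (k s)⟩)

variable {σ τ : Finset ι → α → ℕ}

theorem IsMerge.facReg_smooth (h : IsMerge e u N S j) [Fintype ι]
    (hσ : ∀ ω ∈ Ω, IsBit S j fun s => σ s ω) (hτ : ∀ ω ∈ Ω, IsBit S j fun s => τ s ω)
    (hσN : ∀ ω ∈ Ω, ∀ s, σ s ω < N) (hτN : ∀ ω ∈ Ω, ∀ s, τ s ω < N) :
    (fun s => facReg 𝕂 u S j Ω γ n (σ s) (τ s)) ∈ smooth ι h.par_res.mem_regular := by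
  have hc : ∀ s, Ω.filter (fun ω => ¬ FacCrit S j (γ ω) (σ s ω) (τ s ω))
      = Ω.filter (fun ω => ¬ FacCrit S j (γ ω) (σ ∅ ω) (τ ∅ ω)) := by
    intro s
    refine filter_congr fun ω hω => not_congr ?_
    rw [← h.crit_iff (hσN ω hω s) (hτN ω hω s), ← h.crit_iff (hσN ω hω ∅) (hτN ω hω ∅),
      (hσ ω hω).map_eq h s, (hτ ω hω).map_eq h s]
  have heq : (fun s => facReg 𝕂 u S j Ω γ n (σ s) (τ s))
      = ∏ ω ∈ Ω.filter (fun ω => ¬ FacCrit S j (γ ω) (σ ∅ ω) (τ ∅ ω)), fun s =>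
        (1 - algebraMap ℂ 𝕂 (γ ω)
          * (𝔞 (u (τ s ω)) / 𝔞 (u (σ s ω)))) ^ n ω := by
    funext s
    rw [prod_apply, facReg, hc]
  rw [heq]
  refine prod_mem fun ω hω => ?_
  rw [mem_filter] at hω
  refine smooth_zpow (φ := fun s => 1 - algebraMap ℂ 𝕂 (γ ω)
    * (𝔞 (u (τ s ω)) / 𝔞 (u (σ s ω)))) ?_ (fun s => ?_) _
  · exact sub_mem (one_mem _) (mul_mem (isSmooth_const (hasRes_const (γ ω)).mem_regular)
      (IsBit.smooth_div h (hσ ω hω.1) (hτ ω hω.1)))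
  · refine ⟨_, ?_, hasRes_one.sub (h.ratio_res (γ ω) (σ s ω) (τ s ω))⟩
    have h2 : e (u (σ s ω)) = e (u (σ ∅ ω)) := (hσ ω hω.1).map_eq h s
    have h3 : e (u (τ s ω)) = e (u (τ ∅ ω)) := (hτ ω hω.1).map_eq h s
    rw [h2, h3, sub_ne_zero]
    have h4 := hω.2
    rw [← h.crit_iff (hσN ω hω.1 ∅) (hτN ω hω.1 ∅)] at h4
    exact Ne.symm h4

theorem facNeg_affine (hS : ∀ k ∈ S, k < j)
    (hσ : ∀ ω ∈ Ω, IsBit S j fun s => σ s ω) (hτ : ∀ ω ∈ Ω, IsBit S j fun s => τ s ω) {O : ℤ}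
    (hO : ∀ s, facOrd S j Ω γ n (σ s) (τ s) = O) :
    IsAffine fun s => facNeg S j Ω γ n (σ s) (τ s) := by
  have hj : j ∉ S := fun hj => lt_irrefl j (hS j hj)
  refine IsAffine.of_two_mul ?_
  have key : ∀ s, 2 * facNeg S j Ω γ n (σ s) (τ s) = O + ∑ ω ∈ Ω,
      n ω * ind (γ ω = 1 ∧ σ ∅ ω ∈ insert j S ∧ τ ∅ ω ∈ insert j S)
        * (ind (σ s ω = j) + (-1) * ind (τ s ω = j)) := by
    intro s
    rw [← hO s, facNeg, facOrd, mul_sum, ← sum_add_distrib]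
    refine sum_congr rfl fun ω hω => ?_
    have h1 : σ s ω ∈ insert j S ↔ σ ∅ ω ∈ insert j S := ((hσ ω hω).mem_iff s).1
    have h2 : τ s ω ∈ insert j S ↔ τ ∅ ω ∈ insert j S := ((hτ ω hω).mem_iff s).1
    rw [← h1, ← h2, mul_assoc (n ω), ← mul_add, mul_left_comm]
    congr 1
    simp only [mem_insert]
    by_cases g0 : γ ω = 1 <;> by_cases g1 : σ s ω = j <;> by_cases g2 : τ s ω = j <;>
      by_cases g3 : σ s ω ∈ S <;> by_cases g4 : τ s ω ∈ S <;> simp_all [ind]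
  simp only [key]
  refine (isAffine_const O).add (IsAffine.sum fun ω hω => IsAffine.const_mul ?_ _)
  exact ((hσ ω hω).isAffine hS).add (((hτ ω hω).isAffine hS).const_mul (-1))

theorem IsMerge.sum_family (h : IsMerge e u N S j) [Fintype ι]
    (hσ : ∀ ω ∈ Ω, IsBit S j fun s => σ s ω) (hτ : ∀ ω ∈ Ω, IsBit S j fun s => τ s ω)
    (hσN : ∀ ω ∈ Ω, ∀ s, σ s ω < N) (hτN : ∀ ω ∈ Ω, ∀ s, τ s ω < N) {O : ℤ}
    (hO : ∀ s, facOrd S j Ω γ n (σ s) (τ s) = O) (hO1 : 1 ≤ O + Fintype.card ι) {c : Finset ι → ℤ}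
    (hc : ∀ s, Even (c s + facNeg S j Ω γ n (σ s) (τ s)
      + (c ∅ + facNeg S j Ω γ n (σ ∅) (τ ∅)) + s.card))
    {φ : Finset ι → 𝕂} (hφ : φ ∈ smooth ι h.par_res.mem_regular) :
    HasRes (e : A →+* L) (∑ s : Finset ι, (-1) ^ c s
      * facProd (fun l => 𝔞 (u l)) Ω γ n (σ s) (τ s) * φ s) 0 := by
  have hp := h.par_ne (𝕂 := 𝕂)
  have hsm := mul_mem (mul_mem (h.facReg_smooth (𝕂 := 𝕂) (γ := γ) (n := n) hσ hτ hσN hτN)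
    (smooth_zpow_affine h.par_res (ι := ι)
      ((facNeg_affine h.lt hσ hτ hO).const_mul (-1)))) hφ
  obtain ⟨r, ⟨y, hr⟩, hs⟩ := sum_neg_one_pow_smooth hsm
  set C := c ∅ + facNeg S j Ω γ n (σ ∅) (τ ∅)
  have hterm : ∀ s, (-1) ^ c s * facProd (fun l => 𝔞 (u l)) Ω γ n (σ s) (τ s) * φ s
      = (-1) ^ C * mergePar 𝕂 u S j h.nonempty ^ O * ((-1) ^ s.card *
        (((fun s => facReg 𝕂 u S j Ω γ n (σ s) (τ s)) * (fun s => (1 - mergePar 𝕂 u S j h.nonempty) ^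
          (-1 * facNeg S j Ω γ n (σ s) (τ s))) * φ) s)) := by
    intro s
    rw [h.facProd_eq (fun ω hω => hσN ω hω s) (fun ω hω => hτN ω hω s), hO]
    have hsign : (-1 : 𝕂) ^ c s * (-1) ^ facNeg S j Ω γ n (σ s) (τ s)
        = (-1) ^ C * (-1) ^ s.card := by
      have h1 : (-1 : 𝕂) ^ (c s + facNeg S j Ω γ n (σ s) (τ s) + C + s.card) = 1 := (hc s).neg_one_zpow
      have hn : (-1 : 𝕂) ≠ 0 := by simp
      rw [zpow_add₀ hn, zpow_add₀ hn, zpow_add₀ hn, zpow_natCast] at h1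
      have h2 : ((-1 : 𝕂) ^ C) * (-1) ^ C = 1 := by
        rw [← zpow_add₀ hn]; exact Even.neg_one_zpow ⟨C, rfl⟩
      have h3 : ((-1 : 𝕂) ^ s.card) * (-1) ^ s.card = 1 := by
        rw [← pow_add]; exact Even.neg_one_pow ⟨_, rfl⟩
      grind
    simp only [Pi.mul_apply, neg_one_mul]
    grind
  rw [sum_congr rfl fun s _ => hterm s, ← mul_sum]
  simp only [neg_one_mul] at hs ⊢
  rw [hs, mul_assoc, ← mul_assoc (_ ^ O), ← zpow_natCast, ← zpow_add₀ hp]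
  obtain ⟨m, hm⟩ : ∃ m : ℕ, O + Fintype.card ι = (m + 1 : ℕ) :=
    ⟨(O + Fintype.card ι).toNat - 1, by omega⟩
  rw [hm, zpow_natCast]
  have h1 := ((hasRes_one (𝕂 := 𝕂) (e := (e : A →+* L))).neg.zpow (by simp) C).mul
    ((h.par_res.pow (m + 1)).mul hr)
  simpa using h1

end Factors
end QQ

namespace QQ
open Finset

section Stacks
open Classical

/-! ## Stacks of plane partitions -/

/-- Boxes of a stack of plane partitions: position and number of the layer. -/
abbrev Bx := Pos × ℕ

/-- The weight of a position. -/
def wt3 (q : Fin 3 → ℂ) (x : Pos) : ℂ := q 0 ^ x.1.1 * q 1 ^ x.1.2 * (q 0 * q 1 * q 2) ^ x.2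

/-- Heights of the layers of a stack of at most `N` plane partitions, inside a box. -/
structure IsStack (N m : ℕ) (f : ℕ → Pt → ℤ) : Prop where
  height : ∀ k, IsHeight (f k)
  vac_le : ∀ k p, vac k p ≤ f k p
  out : ∀ k p, p ∉ box m → f k p = vac k p
  top : ∀ k, N ≤ k → f k = vac k

/-- The boxes of a stack. -/
def boxes (N m : ℕ) (f : ℕ → Pt → ℤ) : Finset Bx :=
  (range N ×ˢ box m).biUnion fun kp =>
    (Ico (vac kp.1 kp.2) (f kp.1 kp.2)).image fun t => ((kp.2, t), kp.1)

variable {N m : ℕ} {f : ℕ → Pt → ℤ}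

theorem IsStack.mem_boxes (hf : IsStack N m f) {x : Bx} :
    x ∈ boxes N m f ↔ vac x.2 x.1.1 ≤ x.1.2 ∧ x.1.2 < f x.2 x.1.1 := by
  simp only [boxes, mem_biUnion, mem_product, mem_range, mem_image,
    mem_Ico]
  constructor
  · grind
  · intro h
    refine ⟨(x.2, x.1.1), ⟨?_, ?_⟩, x.1.2, h, rfl⟩
    · by_contra hc
      have := hf.top x.2 (not_lt.1 hc)
      rw [this] at h
      omega
    · by_contra hc
      have := hf.out x.2 _ hc
      grind

theorem IsStack.lt (hf : IsStack N m f) {x : Bx} (hx : x ∈ boxes N m f) : x.2 < N := by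
  rw [hf.mem_boxes] at hx
  by_contra hc
  rw [hf.top x.2 (not_lt.1 hc)] at hx
  omega

/-- The positions of the boxes in a layer. -/
def lay (B : Finset Bx) (k : ℕ) : Finset Pos := (B.filter fun x => x.2 = k).image Prod.fst

theorem mem_lay {B : Finset Bx} {k : ℕ} {p : Pos} : p ∈ lay B k ↔ (p, k) ∈ B := by
  simp only [lay, mem_image, mem_filter, Prod.exists, exists_and_right, exists_eq_right]

theorem IsStack.isRegion (hf : IsStack N m f) (k : ℕ) :
    IsRegion (lay (boxes N m f) k) (vac k) (f k) :=
  ⟨hf.vac_le k, fun x => by rw [mem_lay, hf.mem_boxes]⟩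

theorem sum_lay (B : Finset Bx) (k : ℕ) (F : Pos → ℤ) :
    ∑ x ∈ B, F x.1 * ind (x.2 = k) = ∑ p ∈ lay B k, F p := by
  rw [lay, sum_image, sum_filter]
  · refine sum_congr rfl fun x _ => ?_
    split_ifs with h
    · rw [ind_true h, mul_one]
    · rw [ind_false h, mul_zero]
  · intro x hx y hy hxy
    grind

/-! ### The factors of a stack -/

/-- The labels of the factors in the coefficient of a stack. -/
abbrev FacIdx := (Bx × Bx × Finset (Fin 3)) ⊕ (Bx × ℕ × Fin 4)

/-- The factors of a set of boxes, in the presence of `N` framings. -/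
def facIdx (B : Finset Bx) (N : ℕ) : Finset FacIdx :=
  (B ×ˢ B ×ˢ univ).disjSum (B ×ˢ range N ×ˢ univ)

variable (q : Fin 3 → ℂ) (K : ℂ)

/-- The constants in the factors. -/
def facConst : FacIdx → ℂ
  | .inl (x, y, T) => wt3 q (x.1 + disp T - y.1)
  | .inr (x, l, i) => ![1, 1, K, K] i * wt3 q (((0, 0), -(l : ℤ) - ![0, 1, 0, 1] i) - x.1)

/-- The exponents of the factors. -/
def facExp : FacIdx → ℤ
  | .inl (_, _, T) => (-1) ^ T.card
  | .inr (_, _, i) => ![-1, 1, 1, -1] i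

/-- The layers of the variables in the denominators. -/
def facSrc (lab : Bx → ℕ) : FacIdx → ℕ
  | .inl (x, _, _) => lab x
  | .inr (_, l, _) => l

/-- The layers of the variables in the numerators. -/
def facTgt (lab : Bx → ℕ) : FacIdx → ℕ
  | .inl (_, y, _) => lab y
  | .inr (x, _, _) => lab x

theorem facSrc_lt {B : Finset Bx} {lab : Bx → ℕ} (h : ∀ x ∈ B, lab x < N) :
    ∀ ω ∈ facIdx B N, facSrc lab ω < N := by
  rintro (⟨x, y, T⟩ | ⟨x, l, i⟩) hω
  · simp only [facIdx, inl_mem_disjSum, mem_product] at hω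
    exact h x hω.1
  · simp only [facIdx, inr_mem_disjSum, mem_product, mem_range] at hω
    exact hω.2.1

theorem facTgt_lt {B : Finset Bx} {lab : Bx → ℕ} (h : ∀ x ∈ B, lab x < N) :
    ∀ ω ∈ facIdx B N, facTgt lab ω < N := by
  rintro (⟨x, y, T⟩ | ⟨x, l, i⟩) hω
  · simp only [facIdx, inl_mem_disjSum, mem_product] at hω
    exact h y hω.2.1
  · simp only [facIdx, inr_mem_disjSum, mem_product, mem_range] at hω
    exact h x hω.1

/-- The parameters are generic. -/
structure IsGeneric : Prop where
  ne_zero : ∀ i, q i ≠ 0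
  wt_eq_one : ∀ x, wt3 q x = 1 → x = 0
  mul_wt_ne : ∀ x, K * wt3 q x ≠ 1

theorem wt3_zero : wt3 q 0 = 1 := by simp [wt3]

variable {q K}

theorem IsGeneric.wt_iff (hq : IsGeneric q K) (x : Pos) : wt3 q x = 1 ↔ x = 0 :=
  ⟨hq.wt_eq_one x, fun h => h ▸ wt3_zero q⟩

theorem sum_ind_eq_mem {α : Type*} (C : Finset α) (z : α) : ∑ y ∈ C, ind (y = z) = ind (z ∈ C) := by
  by_cases h : z ∈ C
  · rw [sum_eq_single z (fun b _ hb => ind_false hb) (fun h' => absurd h h'), ind_true rfl,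
      ind_true h]
  · rw [ind_false h]
    exact sum_eq_zero fun y hy => ind_false fun e => h (e ▸ hy)

theorem sum_facExp (hq : IsGeneric q K) (B : Finset Bx) {a : ℕ} (ha : a < N) (b : ℕ) :
    ∑ ω ∈ facIdx B N, facExp ω *
        ind (facConst q K ω = 1 ∧ facSrc Prod.snd ω = a ∧ facTgt Prod.snd ω = b)
      = pairing (lay B b) (lay B a) - ind (((0, 0), -(a : ℤ)) ∈ lay B b)
        + ind (((0, 0), -(a : ℤ) - 1) ∈ lay B b) := by
  have e1 : ∀ P Q R : Prop, ind (P ∧ Q ∧ R) = ind P * ind R * ind Q := by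
    intro P Q R
    rw [ind_mul_ind, ind_mul_ind]
    exact ind_congr (by tauto)
  rw [facIdx, sum_disjSum, sum_product, sum_product]
  rw [sub_add_eq_add_sub, add_sub_assoc]
  congr 1
  · rw [pairing, ← sum_lay B a fun y => ∑ T : Finset (Fin 3), (-1) ^ T.card * ind (y + disp T ∈ lay B b)]
    refine sum_congr rfl fun x _ => ?_
    rw [sum_product, sum_comm, sum_mul]
    refine sum_congr rfl fun T _ => ?_
    rw [← sum_ind_eq_mem, ← sum_lay B b fun p => ind (p = x.1 + disp T), mul_sum, sum_mul]
    refine sum_congr rfl fun y _ => ?_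
    have e2 : ind (x.1 + disp T - y.1 = 0) = ind (y.1 = x.1 + disp T) :=
      ind_congr (by rw [sub_eq_zero, eq_comm])
    simp only [facExp, facSrc, facTgt, facConst, e1, hq.wt_iff, e2]
    ring
  · rw [← sum_ind_eq_mem (lay B b), ← sum_ind_eq_mem (lay B b),
      ← sum_lay B b fun p => ind (p = ((0, 0), -(a : ℤ) - 1)),
      ← sum_lay B b fun p => ind (p = ((0, 0), -(a : ℤ))), ← sum_sub_distrib]
    refine sum_congr rfl fun x _ => ?_
    rw [sum_product, sum_eq_single a]
    · have e2 : ∀ z : Pos, ind (z - x.1 = 0) = ind (x.1 = z) := fun z =>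
        ind_congr (by rw [sub_eq_zero, eq_comm])
      have e3 : ∀ z : Pos, ind (K * wt3 q z = 1) = 0 := fun z => ind_false (hq.mul_wt_ne z)
      simp only [facExp, facSrc, facTgt, facConst, e1, Fin.sum_univ_four]
      simp [e2, e3, hq.wt_iff, ind_true]
      ring
    · intro l _ hl
      refine sum_eq_zero fun i _ => ?_
      rw [ind_false, mul_zero]
      rintro ⟨-, h, -⟩
      exact hl h
    · grind

theorem facNeg_eq {S : Finset ℕ} {j : ℕ} {Ω : Finset FacIdx} {γ : FacIdx → ℂ} {n : FacIdx → ℤ}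
    {σ τ : FacIdx → ℕ} : facNeg S j Ω γ n σ τ
      = ∑ k ∈ S, ∑ ω ∈ Ω, n ω * ind (γ ω = 1 ∧ σ ω = j ∧ τ ω = k) := by
  rw [facNeg, sum_comm]
  refine sum_congr rfl fun ω _ => ?_
  rw [← mul_sum]
  congr 1
  by_cases h : γ ω = 1 ∧ σ ω = j
  · rw [ind_congr (Q := τ ω ∈ S) (by tauto), ← sum_ind_eq_mem]
    grind
  · rw [ind_false (by tauto), sum_eq_zero]
    exact fun k _ => ind_false (by tauto)

theorem facOrd_eq {S : Finset ℕ} {j : ℕ} (hS : ∀ k ∈ S, k < j) {Ω : Finset FacIdx}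
    {γ : FacIdx → ℂ} {n : FacIdx → ℤ} {σ τ : FacIdx → ℕ} : facOrd S j Ω γ n σ τ
      = ∑ k ∈ S, (∑ ω ∈ Ω, n ω * ind (γ ω = 1 ∧ σ ω = j ∧ τ ω = k)
        + ∑ ω ∈ Ω, n ω * ind (γ ω = 1 ∧ σ ω = k ∧ τ ω = j)) := by
  have hj : j ∉ S := fun hj => lt_irrefl j (hS j hj)
  rw [sum_add_distrib, ← facNeg_eq, facNeg, facOrd, sum_comm, ← sum_add_distrib]
  refine sum_congr rfl fun ω _ => ?_
  rw [← mul_sum, ← mul_add]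
  congr 1
  have h1 : ∑ k ∈ S, ind (γ ω = 1 ∧ σ ω = k ∧ τ ω = j) = ind (γ ω = 1 ∧ σ ω ∈ S ∧ τ ω = j) := by
    by_cases h : γ ω = 1 ∧ τ ω = j
    · rw [ind_congr (Q := σ ω ∈ S) (by tauto), ← sum_ind_eq_mem]
      grind
    · rw [ind_false (by tauto), sum_eq_zero]
      exact fun k _ => ind_false (by tauto)
  rw [h1]
  by_cases g0 : γ ω = 1 <;> by_cases g1 : σ ω = j <;> by_cases g2 : τ ω = j <;>
    by_cases g3 : σ ω ∈ S <;> by_cases g4 : τ ω ∈ S <;> simp_all [ind]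

theorem IsStack.isChain (hf : IsStack N m f) {S : Finset ℕ} {j : ℕ} (hS : ∀ k ∈ S, k < j)
    (hs : ∀ k ∈ S, ∀ l ∈ S, k < l → ∀ p, f l p < f k p) : IsChain f S j m :=
  ⟨hf.height, hf.vac_le, hf.out, hS, hs⟩

theorem IsStack.facNeg_eq (hq : IsGeneric q K) (hf : IsStack N m f) {S : Finset ℕ} {j : ℕ}
    (hS : ∀ k ∈ S, k < j) (hj : j < N) :
    facNeg S j (facIdx (boxes N m f) N) (facConst q K) facExp (facSrc Prod.snd) (facTgt Prod.snd)
      = ∑ k ∈ S, bsum m (f k) (f j) - ∑ k ∈ S, bsum m (vac k) (vac j)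
        - ∑ k ∈ S, ind (-(k : ℤ) ≤ f j (0, 0)) := by
  rw [QQ.facNeg_eq, ← sum_sub_distrib, ← sum_sub_distrib]
  refine sum_congr rfl fun k hk => ?_
  have hkj := hS k hk
  rw [sum_facExp hq _ hj, pairing_eq (hf.isRegion k) (hf.isRegion j) (hf.out k) (hf.out j),
    sum_sub_distrib, bsum, bsum]
  have e1 : ind (((0, 0), -(j : ℤ) - 1) ∈ lay (boxes N m f) k) = 0 := ind_false fun h => by
    rw [mem_lay, hf.mem_boxes] at h
    simp [vac] at h
    omega
  have e2 : ind (((0, 0), -(k : ℤ) - 1) ∈ lay (boxes N m f) j) = ind (-(k : ℤ) ≤ f j (0, 0)) := by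
    refine ind_congr ?_
    rw [mem_lay, hf.mem_boxes]
    simp [vac]
    omega
  rw [e1, e2]
  ring

theorem IsStack.facOrd_eq (hq : IsGeneric q K) (hf : IsStack N m f) {S : Finset ℕ} {j : ℕ}
    (hj : j < N) (hc : IsChain f S j m) :
    facOrd S j (facIdx (boxes N m f) N) (facConst q K) facExp (facSrc Prod.snd) (facTgt Prod.snd)
      = ∑ p ∈ box (m + 1), oddTerm (lev f S j) p := by
  rw [QQ.facOrd_eq hc.lt, ← hc.sum_bsum]
  refine sum_congr rfl fun k hk => ?_
  have hkj := hc.lt k hk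
  rw [sum_facExp hq _ hj, sum_facExp hq _ (hkj.trans hj),
    pairing_eq (hf.isRegion k) (hf.isRegion j) (hf.out k) (hf.out j),
    pairing_eq (hf.isRegion j) (hf.isRegion k) (hf.out j) (hf.out k),
    sum_sub_distrib, sum_sub_distrib]
  have := bsum_vac hkj m
  simp only [bsum] at *
  linarith

/-! ### Changing the layers of boxes -/

theorem facIdx_image (B : Finset Bx) (N : ℕ) (ψ : Bx → Bx) : facIdx (B.image ψ) N
    = (facIdx B N).image (Sum.map (Prod.map ψ (Prod.map ψ id)) (Prod.map ψ id)) := by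
  have hl : ∀ (B : Finset Bx) x y T, Sum.inl (x, y, T) ∈ facIdx B N ↔ x ∈ B ∧ y ∈ B := by
    intro B x y T
    simp only [facIdx, inl_mem_disjSum, mem_product, mem_univ, and_true]
  have hr : ∀ (B : Finset Bx) x l i, Sum.inr (x, l, i) ∈ facIdx B N ↔ x ∈ B ∧ l < N := by
    intro B x l i
    simp only [facIdx, inr_mem_disjSum, mem_product, mem_univ, and_true,
      mem_range]
  ext (⟨x, y, T⟩ | ⟨x, l, i⟩)
  · rw [hl]
    constructor
    · rintro ⟨h1, h2⟩
      obtain ⟨a, ha, rfl⟩ := mem_image.1 h1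
      obtain ⟨b, hb, rfl⟩ := mem_image.1 h2
      exact mem_image.2 ⟨Sum.inl (a, b, T), (hl _ _ _ _).2 ⟨ha, hb⟩, rfl⟩
    · grind
  · rw [hr]
    constructor
    · rintro ⟨h1, h2⟩
      obtain ⟨a, ha, rfl⟩ := mem_image.1 h1
      exact mem_image.2 ⟨Sum.inr (a, l, i), (hr _ _ _ _).2 ⟨ha, h2⟩, rfl⟩
    · grind

theorem facIdx_injOn {B : Finset Bx} {N : ℕ} {ψ : Bx → Bx} (hψ : Set.InjOn ψ B) :
    Set.InjOn (Sum.map (Prod.map ψ (Prod.map ψ id)) (Prod.map ψ id) : FacIdx → FacIdx)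
      (facIdx B N) := by
  rintro (⟨x, y, T⟩ | ⟨x, l, i⟩) h1 (⟨x', y', T'⟩ | ⟨x', l', i'⟩) h2 h <;>
    simp only [facIdx, mem_coe, inl_mem_disjSum, inr_mem_disjSum,
      mem_product, Sum.map_inl, Sum.map_inr, Prod.map, id, Sum.inl.injEq, Sum.inr.injEq,
      Prod.mk.injEq, reduceCtorEq] at h1 h2 h ⊢
  · exact ⟨hψ h1.1 h2.1 h.1, hψ h1.2.1 h2.2.1 h.2.1, h.2.2⟩
  · exact ⟨hψ h1.1 h2.1 h.1, h.2⟩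

theorem facProd_image {F : Type*} [Field F] [Algebra ℂ F] (u : ℕ → F) {B : Finset Bx} {lab : Bx → ℕ}
    (h : Set.InjOn (fun x : Bx => (x.1, lab x)) B) :
    facProd u (facIdx (B.image fun x => (x.1, lab x)) N) (facConst q K) facExp (facSrc Prod.snd)
        (facTgt Prod.snd)
      = facProd u (facIdx B N) (facConst q K) facExp (facSrc lab) (facTgt lab) := by
  rw [facProd, facIdx_image, prod_image (facIdx_injOn h), facProd]
  refine prod_congr rfl ?_
  rintro (⟨x, y, T⟩ | ⟨x, l, i⟩) - <;> rfl

theorem facOrd_image (S : Finset ℕ) (j : ℕ) {B : Finset Bx} {lab : Bx → ℕ}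
    (h : Set.InjOn (fun x : Bx => (x.1, lab x)) B) :
    facOrd S j (facIdx (B.image fun x => (x.1, lab x)) N) (facConst q K) facExp (facSrc Prod.snd)
        (facTgt Prod.snd)
      = facOrd S j (facIdx B N) (facConst q K) facExp (facSrc lab) (facTgt lab) := by
  rw [facOrd, facIdx_image, sum_image (facIdx_injOn h), facOrd]
  refine sum_congr rfl ?_
  rintro (⟨x, y, T⟩ | ⟨x, l, i⟩) - <;> rfl

theorem facNeg_image (S : Finset ℕ) (j : ℕ) {B : Finset Bx} {lab : Bx → ℕ}
    (h : Set.InjOn (fun x : Bx => (x.1, lab x)) B) :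
    facNeg S j (facIdx (B.image fun x => (x.1, lab x)) N) (facConst q K) facExp (facSrc Prod.snd)
        (facTgt Prod.snd)
      = facNeg S j (facIdx B N) (facConst q K) facExp (facSrc lab) (facTgt lab) := by
  rw [facNeg, facIdx_image, sum_image (facIdx_injOn h), facNeg]
  refine sum_congr rfl ?_
  rintro (⟨x, y, T⟩ | ⟨x, l, i⟩) - <;> rfl

/-- The layer of a box after a permutation of the layers. -/
def permLayer (f : ℕ → Pt → ℤ) (E : Pt → Equiv.Perm ℕ) (x : Bx) : ℕ :=
  if f (E x.1.1 x.2) x.1.1 ≤ x.1.2 then E x.1.1 x.2 else x.2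

theorem boxes_perm {E : Pt → Equiv.Perm ℕ} (hE : ∀ p k, E p (E p k) = k) (hf : IsStack N m f)
    (hf' : IsStack N m (permHeight f E)) :
    boxes N m (permHeight f E) = (boxes N m f).image (fun x => (x.1, permLayer f E x)) ∧
      Set.InjOn (fun x => (x.1, permLayer f E x)) (boxes N m f : Set Bx) := by
  have key : ∀ f : ℕ → Pt → ℤ, IsStack N m f → IsStack N m (permHeight f E) →
      ∀ x ∈ boxes N m f, (x.1, permLayer f E x) ∈ boxes N m (permHeight f E) ∧
        permLayer (permHeight f E) E (x.1, permLayer f E x) = x.2 := by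
    intro f hf hf' x hx
    rw [hf.mem_boxes] at hx
    rw [hf'.mem_boxes]
    simp only [permLayer, permHeight, hE]
    have h1 := hf.vac_le (E x.1.1 x.2) x.1.1
    grind
  have hinv : permHeight (permHeight f E) E = f := by
    funext k p
    simp only [permHeight, hE]
  refine ⟨?_, fun x hx y hy hxy => ?_⟩
  · grind
  · grind

end Stacks
end QQ

namespace QQ
open Finset Function

local postfix:max "♯" => Finset.map (Embedding.subtype _)

section Merge
open Classical

/-! ## Merging layers -/

variable {N m : ℕ} {q : Fin 3 → ℂ} {K : ℂ} {f : ℕ → Pt → ℤ} {S : Finset ℕ} {j : ℕ}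
  {T : Finset (Finset Pt)}

/-- The `n`-th power sum of the weights of boxes. -/
def boxPow {F : Type*} [Field F] [Algebra ℂ F] (q : Fin 3 → ℂ) (u : ℕ → F) (B : Finset Bx)
    (lab : Bx → ℕ) (n : ℤ) : F :=
  ∑ x ∈ B, (algebraMap ℂ F (wt3 q x.1) / u (lab x)) ^ n

/-- The coefficient of a stack, times a polynomial in the power sums of the weights. -/
def stackVal {R F : Type*} [CommRing R] [Field F] [Algebra ℂ F] (q : Fin 3 → ℂ) (K : ℂ) (N : ℕ)
    (φ : R →+* F) (u : ℕ → F) (P : MvPolynomial ℤ R) (B : Finset Bx) (lab : Bx → ℕ) : F :=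
  facProd u (facIdx B N) (facConst q K) facExp (facSrc lab) (facTgt lab)
    * MvPolynomial.eval₂ φ (boxPow q u B lab) P

/-- The layers in `S` are strictly decreasing. -/
def StrictOn (S : Finset ℕ) (f : ℕ → Pt → ℤ) : Prop :=
  ∀ k ∈ S, ∀ l ∈ S, k < l → ∀ p, f l p < f k p

/-- The sum of the values of the stacks which are strictly decreasing on `S`. -/
def stackSum {R F : Type*} [CommRing R] [Field F] [Algebra ℂ F] (q : Fin 3 → ℂ) (K : ℂ) (N m : ℕ)
    (𝓕 : Finset (ℕ → Pt → ℤ)) (S : Finset ℕ) (φ : R →+* F) (u : ℕ → F) (P : MvPolynomial ℤ R) : F :=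
  ∑ f ∈ 𝓕.filter (StrictOn S),
    (-1) ^ vacCount f S * stackVal q K N φ u P (boxes N m f) Prod.snd

theorem IsStack.perm (hf : IsStack N m f) (hc : IsChain f S j m) (hj : j < N)
    (hT : T ⊆ islands (lev f S j) m) : IsStack N m perm[f,S,j,T] := by
  have h := hc.perm hT
  refine ⟨h.height, h.vac_le, h.out, fun k hk => ?_⟩
  funext p
  have hkj : k ≠ j := (hj.trans_le hk).ne'
  rw [permHeight]
  rcases islandPerm_cases hc hT p with ⟨K, -, -, i, hi, he⟩ | ⟨-, he⟩ <;> rw [he]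
  · have hki : k ≠ i := ((hc.lt i hi.mem).trans (hj.trans_le hk)).ne'
    rw [Equiv.swap_apply_of_ne_of_ne hki hkj, hf.top k hk]
  · exact congrFun (hf.top k hk) p

theorem stackVal_perm {R F : Type*} [CommRing R] [Field F] [Algebra ℂ F] (hf : IsStack N m f)
    (hc : IsChain f S j m) (hj : j < N) (hT : T ⊆ islands (lev f S j) m) (φ : R →+* F) (u : ℕ → F)
    (P : MvPolynomial ℤ R) :
    stackVal q K N φ u P (boxes N m perm[f,S,j,T]) Prod.snd
      = stackVal q K N φ u P (boxes N m f) (permLayer f (islandPerm f S j T)) := by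
  obtain ⟨h1, h2⟩ := boxes_perm (islandPerm_invol hc hT) hf (hf.perm hc hj hT)
  have h3 : boxPow q u (boxes N m perm[f,S,j,T]) Prod.snd
      = boxPow q u (boxes N m f) (permLayer f (islandPerm f S j T)) := by
    funext n
    rw [boxPow, h1, sum_image h2, boxPow]
  rw [stackVal, stackVal, h3, h1, facProd_image u h2]

theorem permLayer_isBit (hf : IsStack N m f) (hc : IsChain f S j m) {D : Finset (Finset Pt)}
    (hD : D ⊆ islands (lev f S j) m) (hj : j < N) {x : Bx} (hx : x ∈ boxes N m f) :
    IsBit S j (fun s : Finset D => permLayer f (islandPerm f S j s♯) x) ∧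
      ∀ s : Finset D, permLayer f (islandPerm f S j s♯) x < N := by
  have hxN := hf.lt hx
  rw [hf.mem_boxes] at hx
  have hsub : ∀ s : Finset D, s♯ ⊆ islands (lev f S j) m := by
    intro s K hK
    obtain ⟨K', -, rfl⟩ := mem_map.1 hK
    exact hD K'.2
  by_cases h : ∃ K ∈ D, x.1.1 ∈ K
  · obtain ⟨K, hK, hxK⟩ := h
    obtain ⟨i, hi⟩ := hc.exists_layer (mem_islands.1 (hD hK)).2
    have hij := hc.lt i hi.mem
    have key : ∀ s : Finset D, permLayer f (islandPerm f S j s♯) x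
        = if (⟨K, hK⟩ : D) ∈ s then permLayer f (fun _ => Equiv.swap i j) x else x.2 := by
      intro s
      have hmem : K ∈ s♯ ↔ (⟨K, hK⟩ : D) ∈ s := by
        rw [mem_map]
        constructor
        · rintro ⟨K', h1, rfl⟩
          exact h1
        · exact fun h => ⟨_, h, rfl⟩
      by_cases hs : (⟨K, hK⟩ : D) ∈ s
      · rw [if_pos hs, permLayer, islandPerm_of_mem hc (hsub s) (hmem.2 hs) hi hxK, permLayer]
      · rw [if_neg hs, permLayer, islandPerm_of_notMem]
        · exact ite_self _
        · intro L hL hxL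
          have := (mem_islands.1 (hD hK)).2.eq_of_mem (mem_islands.1 (hsub s hL)).2 hxK hxL
          grind
    have hval : permLayer f (fun _ => Equiv.swap i j) x = x.2 ∨
        (permLayer f (fun _ => Equiv.swap i j) x = j ∧ x.2 = i) ∨
        (permLayer f (fun _ => Equiv.swap i j) x = i ∧ x.2 = j) := by
      rw [permLayer]
      grind
    constructor
    · rcases hval with hv | hv | hv
      · exact Or.inl ⟨x.2, fun s => by simp only [key, hv, ite_self]⟩
      · refine Or.inr ⟨⟨K, hK⟩, j, i, fun s => ?_, Or.inr ⟨rfl, hi.mem⟩⟩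
        grind
      · refine Or.inr ⟨⟨K, hK⟩, i, j, fun s => ?_, Or.inl ⟨hi.mem, rfl⟩⟩
        grind
    · grind
  · have key : ∀ s : Finset D,
        permLayer f (islandPerm f S j s♯) x = x.2 := by
      intro s
      rw [permLayer, islandPerm_of_notMem]
      · exact ite_self _
      · intro L hL hxL
        obtain ⟨K', -, rfl⟩ := mem_map.1 hL
        exact h ⟨K', K'.2, hxL⟩
    exact ⟨Or.inl ⟨x.2, key⟩, fun s => (key s).symm ▸ hxN⟩

variable {A 𝕂 L : Type*} [CommRing A] [Algebra ℂ A] [Field 𝕂] [Algebra ℂ 𝕂] [Algebra A 𝕂]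
  [IsScalarTower ℂ A 𝕂] [Field L] [Algebra ℂ L] [FaithfulSMul A 𝕂] {e : A →ₐ[ℂ] L} {u : ℕ → A}
local notation "𝔞" => algebraMap A 𝕂

theorem IsGeneric.wt_ne_zero (hq : IsGeneric q K) (x : Pos) : wt3 q x ≠ 0 := by
  have h0 := hq.ne_zero 0
  have h1 := hq.ne_zero 1
  have h2 := hq.ne_zero 2
  rw [wt3]
  exact mul_ne_zero (mul_ne_zero (zpow_ne_zero _ h0) (zpow_ne_zero _ h1))
    (zpow_ne_zero _ (mul_ne_zero (mul_ne_zero h0 h1) h2))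

theorem IsMerge.stack_family (hq : IsGeneric q K) (h : IsMerge e u N S j) (hf : IsStack N m f)
    (hs : StrictOn S f) (hodd : ∃ p, Odd (lev f S j p)) (P : MvPolynomial ℤ A) :
    HasRes (e : A →+* L) (∑ T ∈ (islands (lev f S j) m).powerset,
      (-1) ^ vacCount perm[f,S,j,T] S
        * stackVal q K N 𝔞 (fun l => 𝔞 (u l)) P
          (boxes N m perm[f,S,j,T]) Prod.snd) 0 := by
  have hc := hf.isChain h.lt hs
  set D := islands (lev f S j) m with hD
  have hsub : ∀ s : Finset D, s♯ ⊆ islands (lev f S j) m := by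
    intro s K hK
    obtain ⟨K', -, rfl⟩ := mem_map.1 hK
    exact K'.2
  have hbit := fun x (hx : x ∈ boxes N m f) => permLayer_isBit hf hc (D := D) le_rfl h.lt_card hx
  have hsum : ∑ T ∈ D.powerset, (-1) ^ vacCount perm[f,S,j,T] S
        * stackVal q K N 𝔞 (fun l => 𝔞 (u l)) P
          (boxes N m perm[f,S,j,T]) Prod.snd
      = ∑ s : Finset D, (-1) ^ vacCount perm[f,S,j,s♯] S
        * stackVal q K N 𝔞 (fun l => 𝔞 (u l)) P
          (boxes N m f) (permLayer f (islandPerm f S j s♯)) := by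
    refine sum_bij' (fun T _ => T.subtype (· ∈ D))
      (fun s _ => s♯) (fun _ _ => mem_univ _)
      (fun s _ => mem_powerset.2 (hsub s)) (fun T hT => ?_) (fun s _ => ?_) (fun T hT => ?_)
    · exact subtype_map_of_mem fun x hx => mem_powerset.1 hT hx
    · ext x
      simp
    · have h1 : (T.subtype (· ∈ D)).map (Embedding.subtype _) = T :=
        subtype_map_of_mem fun x hx => mem_powerset.1 hT hx
      rw [h1, stackVal_perm hf hc h.lt_card (mem_powerset.1 hT)]
  rw [hsum]
  have himg := fun s => boxes_perm (islandPerm_invol hc (hsub s)) hf (hf.perm hc h.lt_card (hsub s))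
  have hord : ∀ s : Finset D, facOrd S j (facIdx (boxes N m f) N) (facConst q K) facExp
      (facSrc (permLayer f (islandPerm f S j s♯)))
      (facTgt (permLayer f (islandPerm f S j s♯)))
      = ∑ p ∈ box (m + 1), oddTerm (lev f S j) p := by
    intro s
    rw [← facOrd_image S j (himg s).2, ← (himg s).1,
      (hf.perm hc h.lt_card (hsub s)).facOrd_eq hq h.lt_card (hc.perm (hsub s))]
    refine sum_congr rfl fun p _ => ?_
    rw [← (hc.perm (hsub s)).sum_eulerTerm, ← hc.sum_eulerTerm]
    refine sum_congr rfl fun k hk => ?_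
    have : (fun q => perm[f,S,j,s♯] k q
        = perm[f,S,j,s♯] j q)
        = fun q => f k q = f j q := funext fun q => propext (permHeight_eq_iff hc (hsub s) hk q)
    rw [this]
  have hneg : ∀ s : Finset D, Even (vacCount perm[f,S,j,s♯] S
      + facNeg S j (facIdx (boxes N m f) N) (facConst q K) facExp
        (facSrc (permLayer f (islandPerm f S j s♯)))
        (facTgt (permLayer f (islandPerm f S j s♯)))
      - vacCount f (insert j S) - ∑ k ∈ S, bsum m (f k) (f j) + ∑ k ∈ S, bsum m (vac k) (vac j)
      + s.card) := by
    intro s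
    rw [← facNeg_image S j (himg s).2, ← (himg s).1,
      (hf.perm hc h.lt_card (hsub s)).facNeg_eq hq h.lt h.lt_card]
    have h1 := (hc.perm (hsub s)).vacCount_insert
    rw [vacCount_perm hc (hsub s)] at h1
    have h2 := even_sum_bsum_perm hc (hsub s)
    grind
  have hsm := smooth_eval₂ (ι := D) (hh := h.par_res.mem_regular) (σ := ℤ) (f := fun n s =>
      boxPow q (fun l => 𝔞 (u l)) (boxes N m f)
        (permLayer f (islandPerm f S j s♯)) n) (fun n => ?_) P
  · have hfam := h.sum_family (𝕂 := 𝕂) (ι := D) (Ω := facIdx (boxes N m f) N) (γ := facConst q K)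
      (n := facExp)
      (σ := fun s => facSrc (permLayer f (islandPerm f S j s♯)))
      (τ := fun s => facTgt (permLayer f (islandPerm f S j s♯)))
      ?_ ?_ (fun ω hω s => facSrc_lt (fun x hx => (hbit x hx).2 s) ω hω)
      (fun ω hω s => facTgt_lt (fun x hx => (hbit x hx).2 s) ω hω) hord ?_
      (c := fun s => vacCount perm[f,S,j,s♯] S) (fun s => ?_) hsm
    · simp only [stackVal, ← mul_assoc]
      exact hfam
    · rintro (⟨x, y, T⟩ | ⟨x, l, i⟩) hω
      · simp only [facIdx, inl_mem_disjSum, mem_product] at hω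
        exact (hbit x hω.1).1
      · exact Or.inl ⟨l, fun _ => rfl⟩
    · rintro (⟨x, y, T⟩ | ⟨x, l, i⟩) hω
      · simp only [facIdx, inl_mem_disjSum, mem_product] at hω
        exact (hbit y hω.2.1).1
      · simp only [facIdx, inr_mem_disjSum, mem_product] at hω
        exact (hbit x hω.1).1
    · have := hc.isLevel.one_le hodd
      simpa using this
    · have h1 := hneg s
      have h2 := hneg ∅
      rw [card_empty] at h2
      grind
  · have heq : (fun s : Finset D => boxPow q (fun l => 𝔞 (u l)) (boxes N m f)
        (permLayer f (islandPerm f S j s♯)) n)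
        = ∑ x ∈ boxes N m f, fun s : Finset D => (algebraMap ℂ 𝕂 (wt3 q x.1) / 𝔞 (u
          (permLayer f (islandPerm f S j s♯) x))) ^ n := by
      funext s
      rw [Finset.sum_apply, boxPow]
    rw [heq]
    refine sum_mem fun x hx => smooth_zpow (φ := fun s => _ / _) ?_ (fun s => ?_) n
    · simp only [div_eq_mul_inv]
      exact mul_mem (isSmooth_const (hasRes_const _).mem_regular)
        (smooth_inv ((hbit x hx).1.smooth_var h) fun s => ⟨_, h.map_ne _, h.res _⟩)
    · exact ⟨_, div_ne_zero (by simpa using hq.wt_ne_zero x.1) (h.map_ne _),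
        (hasRes_const _).div (h.res _) (h.map_ne _)⟩

theorem IsMerge.stack_even (hq : IsGeneric q K) (h : IsMerge e u N S j) (hf : IsStack N m f)
    (hs : StrictOn S f) (heven : ∀ p, Even (lev f S j p)) (P : MvPolynomial ℤ A) :
    HasRes (e : A →+* L) ((-1) ^ vacCount f S
        * stackVal q K N 𝔞 (fun l => 𝔞 (u l)) P (boxes N m f) Prod.snd)
      ((-1) ^ vacCount f (insert j S)
        * stackVal q K N (e : A →+* L) (fun l => e (u l)) P (boxes N m f) Prod.snd) := by
  have hc := hf.isChain h.lt hs
  have hlt : ∀ x ∈ boxes N m f, x.2 < N := fun x hx => hf.lt hx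
  rw [stackVal, stackVal, ← mul_assoc, ← mul_assoc]
  refine HasRes.mul ?_ (HasRes.eval₂ (fun n => HasRes.sum fun x _ => ?_) P)
  swap
  · exact ((hasRes_const _).div (h.res _) (h.map_ne _)).zpow
      (div_ne_zero (by simpa using hq.wt_ne_zero x.1) (h.map_ne _)) n
  have hord : facOrd S j (facIdx (boxes N m f) N) (facConst q K) facExp (facSrc Prod.snd)
      (facTgt Prod.snd) = 0 := by
    rw [hf.facOrd_eq hq h.lt_card hc]
    refine sum_eq_zero fun p _ => ?_
    rw [oddTerm, if_neg (Int.not_odd_iff_even.2 (heven p))]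
  have hneg : facNeg S j (facIdx (boxes N m f) N) (facConst q K) facExp (facSrc Prod.snd)
      (facTgt Prod.snd) = -∑ k ∈ S, ind (-(k : ℤ) ≤ f j (0, 0)) := by
    rw [hf.facNeg_eq hq h.lt h.lt_card, sub_eq_neg_self.2]
    rw [sub_eq_zero]
    refine sum_congr rfl fun k hk => ?_
    exact bsum_of_lt (hf.height k) (hf.height j) (isHeight_vac k) (isHeight_vac j)
      (fun p => hc.lt_of_even heven hk p) (fun p => vac_strict (h.lt k hk) p) (hf.out j)
  rw [h.facProd_eq (facSrc_lt hlt) (facTgt_lt hlt), hord, zpow_zero, one_mul, hneg,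
    hc.vacCount_insert]
  have hsign : ∀ (F : Type _) [Field F] (a b : ℤ), (-1 : F) ^ (a + b) = (-1) ^ a * (-1) ^ (-b) := by
    intro F _ a b
    rw [zpow_add₀ (by simp), zpow_neg, ← inv_zpow]
    norm_num
  rw [hsign]
  have h1 := (((hasRes_one (𝕂 := 𝕂) (e := (e : A →+* L))).neg).zpow (by simp)
    (vacCount f S)).mul (((h.facReg_res (𝕂 := 𝕂) (γ := facConst q K) (n := facExp) (facSrc_lt hlt)
    (facTgt_lt hlt))).mul ((((hasRes_one (𝕂 := 𝕂) (e := (e : A →+* L))).neg).zpow (by simp)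
    (-∑ k ∈ S, ind (-(k : ℤ) ≤ f j (0, 0)))).mul
      (((hasRes_one.sub h.par_res)).zpow (by simp) (∑ k ∈ S, ind (-(k : ℤ) ≤ f j (0, 0))))))
  rw [sub_zero, one_zpow, mul_one] at h1
  grind

theorem IsMerge.stackSum_res (hq : IsGeneric q K) (h : IsMerge e u N S j) {n : ℕ}
    {𝓕 : Finset (ℕ → Pt → ℤ)} (h𝓕 : ∀ f, f ∈ 𝓕 ↔ IsStack N m f ∧ (boxes N m f).card = n)
    (P : MvPolynomial ℤ A) :
    HasRes (e : A →+* L)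
      (stackSum q K N m 𝓕 S 𝔞 (fun l => 𝔞 (u l)) P)
      (stackSum q K N m 𝓕 (insert j S) (e : A →+* L) (fun l => e (u l)) P) := by
  have hj : j ∉ S := fun hj => lt_irrefl j (h.lt j hj)
  have hstrict : ∀ f ∈ 𝓕, StrictOn (insert j S) f ↔ StrictOn S f ∧ ∀ p, Even (lev f S j p) := by
    intro f hf
    have hf := ((h𝓕 f).1 hf).1
    constructor
    · intro hs
      have hs' : StrictOn S f := fun k hk l hl =>
        hs k (mem_insert_of_mem hk) l (mem_insert_of_mem hl)
      refine ⟨hs', fun p => ?_⟩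
      rw [← Int.not_odd_iff_even, (hf.isChain h.lt hs').odd_lev]
      rintro ⟨i, hi, hip⟩
      exact (hs i (mem_insert_of_mem hi) j (mem_insert_self _ _) (h.lt i hi) p).ne' hip
    · rintro ⟨hs, he⟩ k hk l hl hkl p
      have hc := hf.isChain h.lt hs
      rcases mem_insert.1 hk with hk | hk <;> rcases mem_insert.1 hl with hl | hl
      · omega
      · exact absurd hkl (hk ▸ (h.lt l hl).not_gt)
      · exact hl ▸ hc.lt_of_even he hk p
      · exact hs k hk l hl hkl p
  have hsplit : (𝓕.filter (StrictOn S)).filter (fun f => ∀ p, Even (lev f S j p))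
      = 𝓕.filter (StrictOn (insert j S)) := by grind
  rw [stackSum, ← sum_filter_add_sum_filter_not _ (fun f => ∀ p, Even (lev f S j p)), hsplit,
    ← add_zero (stackSum q K N m 𝓕 (insert j S) (e : A →+* L) (fun l => e (u l)) P)]
  refine HasRes.add (HasRes.sum fun f hf => ?_) ?_
  · rw [mem_filter] at hf
    have := (hstrict f hf.1).1 hf.2
    exact h.stack_even hq ((h𝓕 f).1 hf.1).1 this.1 this.2 P
  · set 𝓞 := (𝓕.filter (StrictOn S)).filter (fun f => ¬ ∀ p, Even (lev f S j p)) with h𝓞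
    set t : (ℕ → Pt → ℤ) → 𝕂 := fun f => (-1) ^ vacCount f S
      * stackVal q K N 𝔞 (fun l => 𝔞 (u l)) P (boxes N m f) Prod.snd
      with ht
    have hmem : ∀ f, f ∈ 𝓞 ↔ (IsStack N m f ∧ (boxes N m f).card = n) ∧ StrictOn S f ∧
        ∃ p, Odd (lev f S j p) := by grind
    have hperm : ∀ f ∈ 𝓞, ∀ T ⊆ islands (lev f S j) m,
        perm[f,S,j,T] ∈ 𝓞 := by
      intro f hf T hT
      rw [hmem] at hf ⊢
      obtain ⟨⟨h1, h2⟩, h3, p, hp⟩ := hf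
      have hc := h1.isChain h.lt h3
      have hb := boxes_perm (islandPerm_invol hc hT) h1 (h1.perm hc h.lt_card hT)
      refine ⟨⟨h1.perm hc h.lt_card hT, ?_⟩, (hc.perm hT).strict, p, ?_⟩
      · grind
      · exact (lev_perm_of_odd hc hT p).1.2 hp
    have hswap : ∑ f ∈ 𝓞, t f = ∑ f ∈ 𝓞, (2⁻¹ : 𝕂) ^ (islands (lev f S j) m).card *
        ∑ T ∈ (islands (lev f S j) m).powerset, t perm[f,S,j,T] := by
      have h1 : ∑ f ∈ 𝓞, t f = ∑ f ∈ 𝓞, ∑ T ∈ (islands (lev f S j) m).powerset,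
          (2⁻¹ : 𝕂) ^ (islands (lev f S j) m).card * t f := by
        refine sum_congr rfl fun f _ => ?_
        rw [sum_const, card_powerset, nsmul_eq_mul, ← mul_assoc]
        push_cast
        have : (2 : 𝕂) ≠ 0 := by
          have := (algebraMap ℂ 𝕂).injective.ne (two_ne_zero' ℂ)
          rwa [map_ofNat, map_zero] at this
        rw [← mul_pow, mul_inv_cancel₀ this, one_pow, one_mul]
      rw [h1]
      simp only [mul_sum]
      rw [sum_sigma', sum_sigma']
      have hinv : ∀ f ∈ 𝓞, ∀ T ⊆ islands (lev f S j) m,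
          permHeight perm[f,S,j,T]
            (islandPerm perm[f,S,j,T] S j T) = f ∧
          islands (lev perm[f,S,j,T] S j) m = islands (lev f S j) m := by
        intro f hf T hT
        obtain ⟨⟨h1, h2⟩, h3, -⟩ := (hmem f).1 hf
        have hc := h1.isChain h.lt h3
        refine ⟨?_, islands_perm hc hT⟩
        rw [islandPerm_perm hc hT]
        funext k p
        simp only [permHeight, islandPerm_invol hc hT]
      refine sum_bij' (fun x _ => ⟨permHeight x.1 (islandPerm x.1 S j x.2), x.2⟩)
        (fun x _ => ⟨permHeight x.1 (islandPerm x.1 S j x.2), x.2⟩) ?_ ?_ ?_ ?_ ?_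
      · grind
      · grind
      · grind
      · grind
      · grind
    have hgoal : HasRes (e : A →+* L) (∑ f ∈ 𝓞, t f) (∑ f ∈ 𝓞, (0 : L)) := by
      rw [hswap]
      refine HasRes.sum fun f hf => ?_
      obtain ⟨⟨h1, h2⟩, h3, h4⟩ := (hmem f).1 hf
      have h5 := (hasRes_const (𝕂 := 𝕂) (e := e) ((2⁻¹ : ℂ) ^ (islands (lev f S j) m).card)).mul
        (h.stack_family (𝕂 := 𝕂) hq h1 h3 h4 P)
      rw [mul_zero, map_pow, map_inv₀, map_ofNat] at h5
      exact h5
    simpa using hgoal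

end Merge
end QQ

namespace QQ
open Finset MvPolynomial

section Regularity
open Classical

/-! ## Regularity at coinciding parameters -/

/-- The polynomials in the parameters of an ordered product. -/
abbrev Poly := MvPolynomial ℕ ℂ

/-- The rational functions in the parameters of an ordered product. -/
abbrev Rat := FractionRing Poly

notation "𝔯" => algebraMap Poly Rat

/-- The evaluation at coinciding parameters. -/
def evOne : Poly →+* ℂ := eval fun _ => 1

/-- A squarefree monomial. -/
def sqMon (M : Finset ℕ) : Poly := ∏ i ∈ M, X i

theorem sqMon_ne_zero (M : Finset ℕ) : sqMon M ≠ 0 :=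
  prod_ne_zero_iff.2 fun i _ => X_ne_zero i

theorem evOne_sqMon (M : Finset ℕ) : evOne (sqMon M) = 1 := by
  rw [evOne, sqMon, map_prod]
  exact prod_eq_one fun i _ => by simp

theorem evOne_algebraMap (c : ℂ) : evOne (algebraMap ℂ Poly c) = c := by
  rw [evOne, algebraMap_eq, eval_C]

theorem sqMon_eq_monomial (M : Finset ℕ) :
    sqMon M = monomial (∑ i ∈ M, Finsupp.single i 1) 1 := by
  induction M using Finset.induction_on with
  | empty => simp [sqMon]
  | insert i M hi ih =>
    rw [sqMon, prod_insert hi, sum_insert hi]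
    rw [sqMon] at ih
    rw [ih, X, monomial_mul, one_mul]

theorem sqMon_gen {c : ℂ} {M M' : Finset ℕ} (h : algebraMap ℂ Poly c * sqMon M = sqMon M') :
    c = 1 ∧ M = M' := by
  rw [sqMon_eq_monomial, sqMon_eq_monomial, algebraMap_eq, C_mul_monomial,
    mul_one, monomial_eq_monomial_iff] at h
  rcases h with ⟨h1, h2⟩ | ⟨-, h2⟩
  · refine ⟨h2, ext fun i => ?_⟩
    have h3 := DFunLike.congr_fun h1 i
    rw [Finsupp.finsetSum_apply, Finsupp.finsetSum_apply] at h3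
    simp only [Finsupp.single_apply, sum_ite_eq'] at h3
    grind
  · grind

theorem sqMon_gen_rat {c : ℂ} {M M' : Finset ℕ}
    (h : algebraMap ℂ Rat c * 𝔯 (sqMon M) = 𝔯 (sqMon M')) :
    c = 1 ∧ M = M' := by
  rw [IsScalarTower.algebraMap_apply ℂ Poly Rat, ← map_mul] at h
  exact sqMon_gen (FaithfulSMul.algebraMap_injective Poly Rat h)

/-- The variable of the layer `l`, when the layers up to `t` are merged. -/
def layVar (t l : ℕ) : Poly := sqMon (Ioc t l)

/-- The difference of `1` and the ratio of the variables of two layers. -/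
def pairPoly (i j : ℕ) : Poly := 1 - sqMon (Ioc i j)

theorem pairPoly_prime {i j : ℕ} (h : i < j) : Prime (pairPoly i j) := by
  have h1 : Ioc i j = insert j (Ioo i j) := by grind
  have h2 : pairPoly i j = -sqMon (Ioo i j) * X j + 1 := by
    rw [pairPoly, h1, sqMon, prod_insert (by simp), sqMon]
    ring
  rw [h2]
  refine Irreducible.prime (irreducible_mul_X_add _ _ _
    (neg_ne_zero.2 (sqMon_ne_zero _)) ?_ (by simp) isRelPrime_one_right)
  rw [vars_neg]
  intro hj
  have h3 := vars_prod (R := ℂ) (s := Ioo i j) (fun k => X k) hj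
  simp only [vars_X, mem_biUnion, mem_singleton, mem_Ioo] at h3
  omega

/-! ### Partial evaluations -/

/-- The evaluation at the point where the layers `i < j` coincide. -/
def evPair (i j : ℕ) : Poly →ₐ[ℂ] Rat := aeval fun k =>
  if k = j then (𝔯 (sqMon (Ioo i j)))⁻¹
  else 𝔯 (X k)

theorem evPair_sqMon {i j : ℕ} (M : Finset ℕ) (hM : j ∉ M) :
    evPair i j (sqMon M) = 𝔯 (sqMon M) := by
  rw [sqMon, map_prod, map_prod]
  refine prod_congr rfl fun k hk => ?_
  rw [evPair, aeval_X, if_neg]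
  grind

theorem evPair_layVar {i j : ℕ} (hij : i < j) (l : ℕ) : evPair i j (layVar 0 l)
    = 𝔯 (sqMon (if l < j then Ioc 0 l else Ioc 0 i ∪ Ioc j l)) := by
  split_ifs with h
  · exact evPair_sqMon _ (by simp [h])
  · have h1 : Ioc 0 l = insert j (Ioo i j ∪ (Ioc 0 i ∪ Ioc j l)) := by grind
    have h2 : sqMon (Ioc 0 l) = X j *
        (sqMon (Ioo i j) * sqMon (Ioc 0 i ∪ Ioc j l)) := by
      rw [sqMon, h1, prod_insert, prod_union]
      · rfl
      · rw [disjoint_left]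
        grind
      · grind
    have h3 : 𝔯 (sqMon (Ioo i j)) ≠ 0 := by
      simpa [layVar] using sqMon_ne_zero _
    have h4 : j ∉ Ioc 0 i ∪ Ioc j l := by grind
    rw [layVar, h2, map_mul, map_mul, evPair_sqMon _ (by simp), evPair_sqMon _ h4]
    rw [evPair, aeval_X, if_pos rfl, inv_mul_cancel_left₀ h3]

theorem evPair_pairPoly {i j : ℕ} (hij : i < j) : evPair i j (pairPoly i j) = 0 := by
  have h1 : Ioc i j = insert j (Ioo i j) := by grind
  have h2 : sqMon (Ioc i j) = X j * sqMon (Ioo i j) := by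
    rw [sqMon, h1, prod_insert (by simp), sqMon]
  have h3 : 𝔯 (sqMon (Ioo i j)) ≠ 0 := by
    simpa [layVar] using sqMon_ne_zero _
  rw [pairPoly, h2, map_sub, map_mul, evPair_sqMon _ (by simp), evPair, aeval_X,
    if_pos rfl, inv_mul_cancel₀ h3, map_one, sub_self]

theorem isMerge_evPair {i j N : ℕ} (hij : i < j) (hj : j < N) :
    IsMerge (evPair i j) (layVar 0) N {i} j where
  lt := by simpa using hij
  lt_card := hj
  nonempty := singleton_nonempty i
  eq := by simp
  ne := by
    simp only [mem_singleton, forall_eq]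
    intro h
    have h1 := (sqMon_gen (M := Ioc 0 i) (M' := Ioc 0 j) (c := 1) (by rw [map_one, one_mul]; exact h)).2
    have h2 : j ∈ Ioc 0 i := h1 ▸ (mem_Ioc.2 ⟨by omega, le_rfl⟩ : j ∈ Ioc 0 j)
    grind
  map_ne := fun l => by
    rw [evPair_layVar hij]
    simpa [layVar] using sqMon_ne_zero _
  map_eq := by
    simp only [mem_singleton, forall_eq]
    rw [evPair_layVar hij, evPair_layVar hij, if_pos hij, if_neg (lt_irrefl j)]
    simp
  gen := by
    intro c k l _ _ h
    rw [evPair_layVar hij, evPair_layVar hij] at h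
    obtain ⟨h1, h2⟩ := sqMon_gen_rat h
    refine ⟨h1, ?_⟩
    have h3 := fun x => Finset.ext_iff.1 h2 x
    simp only [mem_insert, mem_singleton]
    split_ifs at h3 with h4 h5 h5 <;> simp only [mem_Ioc, mem_union] at h3
    · have := h3 l
      grind
    · have := h3 l
      grind
    · have := h3 l
      grind
    · have := h3 l
      grind

/-- The evaluation of the parameter `t + 1` at one. -/
def evStep (t : ℕ) : Poly →ₐ[ℂ] Poly := aeval fun k =>
  if k = t + 1 then 1 else X k

theorem evOne_evStep (t : ℕ) (p : Poly) : evOne (evStep t p) = evOne p := by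
  induction p using induction_on with
  | C a => simp [evOne, evStep]
  | add p q hp hq => rw [map_add, map_add, map_add, hp, hq]
  | mul_X p n hp =>
    rw [map_mul, map_mul, map_mul, hp]
    congr 1
    rw [evStep, aeval_X]
    split_ifs <;> simp [evOne]

theorem evStep_layVar (t l : ℕ) : evStep t (layVar t l) = layVar (t + 1) l := by
  rw [layVar, layVar, sqMon, map_prod, sqMon]
  by_cases h : t + 1 ≤ l
  · have h1 : Ioc t l = insert (t + 1) (Ioc (t + 1) l) := by grind
    rw [h1, prod_insert (by simp), evStep, aeval_X, if_pos rfl, one_mul]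
    refine prod_congr rfl fun k hk => ?_
    rw [aeval_X, if_neg]
    grind
  · rw [Ioc_eq_empty (by omega), Ioc_eq_empty (by omega)]
    simp

/-- The evaluation of the parameter `t + 1` at one, with values in the rational functions. -/
def evStepRat (t : ℕ) : Poly →ₐ[ℂ] Rat := (Algebra.algHom ℂ Poly Rat).comp (evStep t)

theorem evStepRat_apply (t : ℕ) (p : Poly) : evStepRat t p = 𝔯 (evStep t p) := rfl

theorem isMerge_evStep {t N : ℕ} (ht : t + 1 < N) :
    IsMerge (evStepRat t) (layVar t) N (range (t + 1)) (t + 1) where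
  lt := fun k hk => mem_range.1 hk
  lt_card := ht
  nonempty := ⟨0, by simp⟩
  eq := fun k hk l hl => by
    rw [mem_range] at hk hl
    rw [layVar, layVar, Ioc_eq_empty (by omega), Ioc_eq_empty (by omega)]
  ne := fun k hk h => by
    rw [mem_range] at hk
    have h1 := (sqMon_gen (M := Ioc t k) (M' := Ioc t (t + 1)) (c := 1) (by rw [map_one, one_mul]; exact h)).2
    have h2 : t + 1 ∈ Ioc t k := h1 ▸ (by simp : t + 1 ∈ Ioc t (t + 1))
    grind
  map_ne := fun l => by
    rw [evStepRat_apply, evStep_layVar]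
    simpa [layVar] using sqMon_ne_zero _
  map_eq := fun k hk => by
    rw [mem_range] at hk
    rw [evStepRat_apply, evStepRat_apply, evStep_layVar, evStep_layVar, layVar, layVar,
      Ioc_eq_empty (by omega), Ioc_self]
  gen := by
    intro c k l _ _ h
    rw [evStepRat_apply, evStepRat_apply, evStep_layVar, evStep_layVar] at h
    obtain ⟨h1, h2⟩ := sqMon_gen_rat h
    refine ⟨h1, ?_⟩
    have h3 := fun x => Finset.ext_iff.1 h2 x
    simp only [mem_Ioc] at h3
    have := h3 l
    grind

/-! ### Denominators -/

/-- The denominators which occur in the coefficients of stacks of `N` layers. -/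
def denoms (N : ℕ) : Submonoid Poly :=
  Submonoid.closure {p | evOne p ≠ 0 ∨ ∃ i j, i < j ∧ j < N ∧ p = pairPoly i j}

theorem mem_denoms_of_ne {N : ℕ} {p : Poly} (h : evOne p ≠ 0) : p ∈ denoms N :=
  Submonoid.subset_closure (Or.inl h)

theorem evOne_ne_of_dvd {N : ℕ} {D : Poly} (hD : D ∈ denoms N) : ∀ Q, Q ∣ D →
    (∀ i j, i < j → j < N → ¬ pairPoly i j ∣ Q) → evOne Q ≠ 0 := by
  induction hD using Submonoid.closure_induction with
  | mem p hp =>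
    intro Q hQ hpair
    rcases hp with hp | ⟨i, j, hij, hj, rfl⟩
    · obtain ⟨r, rfl⟩ := hQ
      grind
    · rcases (pairPoly_prime hij).irreducible.dvd_iff.1 hQ with h | h
      · exact (h.map evOne).ne_zero
      · exact absurd h.dvd (hpair i j hij hj)
  | one =>
    intro Q hQ _
    exact ((isUnit_of_dvd_one hQ).map evOne).ne_zero
  | mul x y _ _ hx hy =>
    intro Q hQ hpair
    obtain ⟨a, b, ha, hb, rfl⟩ := exists_dvd_and_dvd_of_dvd_mul hQ
    rw [map_mul]
    exact mul_ne_zero (hx a ha fun i j h1 h2 h3 => hpair i j h1 h2 (h3.mul_right b))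
      (hy b hb fun i j h1 h2 h3 => hpair i j h1 h2 (h3.mul_left a))

/-- The rational functions with such denominators. -/
def admissible (N : ℕ) : Subring Rat where
  carrier := {x | ∃ D ∈ denoms N, ∃ a, x * 𝔯 D = 𝔯 a}
  mul_mem' := by
    rintro x y ⟨D, hD, a, h⟩ ⟨D', hD', a', h'⟩
    refine ⟨D * D', mul_mem hD hD', a * a', ?_⟩
    grind
  one_mem' := ⟨1, one_mem _, 1, by simp⟩
  add_mem' := by
    rintro x y ⟨D, hD, a, h⟩ ⟨D', hD', a', h'⟩
    refine ⟨D * D', mul_mem hD hD', a * D' + a' * D, ?_⟩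
    grind
  zero_mem' := ⟨1, one_mem _, 0, by simp⟩
  neg_mem' := by
    rintro x ⟨D, hD, a, h⟩
    refine ⟨D, hD, -a, ?_⟩
    grind

theorem algebraMap_mem_admissible (N : ℕ) (a : Poly) : 𝔯 a ∈ admissible N :=
  ⟨1, one_mem _, a, by simp⟩

theorem inv_mem_admissible {N : ℕ} {D : Poly} (hD : D ∈ denoms N) (h : D ≠ 0) :
    (𝔯 D)⁻¹ ∈ admissible N :=
  ⟨D, hD, 1, by rw [map_one, inv_mul_cancel₀ (by simpa using h)]⟩

theorem hasRes_evOne {N : ℕ} {x : Rat} (hx : x ∈ admissible N)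
    (hp : ∀ i j, i < j → j < N → ∃ y : Rat, HasRes (evPair i j : Poly →+* Rat) x y) :
    ∃ v, HasRes evOne x v := by
  obtain ⟨D, hD, a, hDa⟩ := hx
  obtain ⟨P, ⟨Q, hQ0⟩, hrel, rfl⟩ := IsFractionRing.exists_reduced_fraction Poly x
  have hinj := FaithfulSMul.algebraMap_injective Poly Rat
  have hx : IsLocalization.mk' Rat P ⟨Q, hQ0⟩ * 𝔯 Q = 𝔯 P :=
    IsLocalization.mk'_spec Rat P ⟨Q, hQ0⟩
  generalize IsLocalization.mk' Rat P ⟨Q, hQ0⟩ = x at *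
  have key : ∀ a D : Poly, x * 𝔯 D = 𝔯 a → P * D = a * Q := by
    intro a D h
    apply hinj
    grind
  have hQD : Q ∣ D := by
    have h1 : Q ∣ P * D := ⟨a, by rw [key a D hDa, mul_comm]⟩
    exact hrel.symm.dvd_of_dvd_mul_left h1
  have hQ1 : evOne Q ≠ 0 := by
    refine evOne_ne_of_dvd hD Q hQD fun i j hij hj hdvd => ?_
    obtain ⟨y, a', b', hb', h1, h2⟩ := hp i j hij hj
    have h3 := key a' b' h1
    have h4 : pairPoly i j ∣ P * b' := h3 ▸ hdvd.mul_left a'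
    rcases (pairPoly_prime hij).dvd_or_dvd h4 with h5 | h5
    · exact (pairPoly_prime hij).not_isUnit (hrel h5 hdvd)
    · obtain ⟨r, rfl⟩ := h5
      apply hb'
      rw [map_mul]
      have := evPair_pairPoly hij
      rw [RingHom.coe_coe, this, zero_mul]
  refine ⟨evOne P / evOne Q, P, Q, hQ1, hx, ?_⟩
  grind

theorem HasRes.unique {A 𝕂 L : Type*} [CommRing A] [Field 𝕂] [Algebra A 𝕂] [Field L]
    [FaithfulSMul A 𝕂] {e : A →+* L} {x : 𝕂} {y y' : L} (h : HasRes e x y) (h' : HasRes e x y') :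
    y = y' := by
  obtain ⟨a, b, hb, h1, h2⟩ := h
  obtain ⟨a', b', hb', h1', h2'⟩ := h'
  have : a * b' = a' * b := by
    apply FaithfulSMul.algebraMap_injective A 𝕂
    grind
  have h3 := congrArg e this
  grind

theorem hasRes_step {t : ℕ} {x y : Rat} {v : ℂ} (h : HasRes evOne x v)
    (hy : HasRes (evStepRat t : Poly →+* Rat) x y) : HasRes evOne y v := by
  obtain ⟨P, Q, hQ, h1, h2⟩ := h
  have h3 : evStep t Q ≠ 0 := by
    intro hc
    apply hQ
    rw [← evOne_evStep t, hc, map_zero]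
  have h4 : 𝔯 (evStep t Q) ≠ 0 := by simpa using h3
  have h5 : HasRes (evStepRat t : Poly →+* Rat) x
      (𝔯 (evStep t P) / 𝔯 (evStep t Q)) :=
    ⟨P, Q, h4, h1, by rw [RingHom.coe_coe, evStepRat_apply, evStepRat_apply, div_mul_cancel₀ _ h4]⟩
  rw [hy.unique h5]
  refine ⟨evStep t P, evStep t Q, by rwa [evOne_evStep], by rw [div_mul_cancel₀ _ h4], ?_⟩
  rw [evOne_evStep, evOne_evStep, h2]

/-! ### The value of a sum over stacks -/

variable {N m n : ℕ} {q : Fin 3 → ℂ} {K : ℂ} {𝓕 : Finset (ℕ → Pt → ℤ)}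

theorem algebraMap_sub_layVar_mem {k l : ℕ} (hk : k < N) (hl : l < N) (c : ℂ)
    (h : algebraMap ℂ Poly c * layVar 0 l ≠ layVar 0 k) :
    (𝔯 (layVar 0 k - algebraMap ℂ Poly c * layVar 0 l))⁻¹ ∈ admissible N := by
  refine inv_mem_admissible ?_ (sub_ne_zero.2 h.symm)
  by_cases hc : c = 1
  · subst hc
    rw [map_one, one_mul] at h ⊢
    have hsplit : ∀ k l, k < l → layVar 0 k - layVar 0 l = layVar 0 k * pairPoly k l := by
      intro k l hkl
      have : Ioc 0 l = Ioc 0 k ∪ Ioc k l := by grind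
      rw [pairPoly, layVar, layVar, this, sqMon, sqMon, sqMon, prod_union]
      · ring
      · rw [disjoint_left]
        grind
    have hu : ∀ k, layVar 0 k ∈ denoms N := fun k =>
      mem_denoms_of_ne (by rw [layVar, evOne_sqMon]; exact one_ne_zero)
    rcases lt_trichotomy k l with hkl | rfl | hkl
    · rw [hsplit k l hkl]
      exact mul_mem (hu k) (Submonoid.subset_closure (Or.inr ⟨k, l, hkl, hl, rfl⟩))
    · grind
    · rw [← neg_sub, hsplit l k hkl, ← neg_one_mul]
      refine mul_mem (mem_denoms_of_ne (by rw [map_neg, map_one]; simp)) (mul_mem (hu l) ?_)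
      exact Submonoid.subset_closure (Or.inr ⟨l, k, hkl, hk, rfl⟩)
  · refine mem_denoms_of_ne ?_
    rw [map_sub, map_mul, layVar, layVar, evOne_sqMon, evOne_sqMon, mul_one, evOne_algebraMap]
    grind

theorem layVar_rat_ne (t l : ℕ) : 𝔯 (layVar t l) ≠ 0 := by
  simpa [layVar] using sqMon_ne_zero _

theorem inv_layVar_mem (l : ℕ) : (𝔯 (layVar 0 l))⁻¹ ∈ admissible N :=
  inv_mem_admissible (mem_denoms_of_ne (by rw [layVar, evOne_sqMon]; exact one_ne_zero))
    (sqMon_ne_zero _)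

theorem dr_mem_admissible {k l : ℕ} (hk : k < N) (hl : l < N) (c : ℂ) (n : ℤ) :
    dr (algebraMap ℂ Rat c * (𝔯 (layVar 0 l) / 𝔯 (layVar 0 k))) ^ n
      ∈ admissible N := by
  have hzpow : ∀ x : Rat, x ∈ admissible N → x⁻¹ ∈ admissible N → x ^ n ∈ admissible N := by
    intro x h1 h2
    cases n with
    | ofNat n => simpa using pow_mem h1 n
    | negSucc n => rw [zpow_negSucc, ← inv_pow]; exact pow_mem h2 _
  have h0 := layVar_rat_ne 0 k
  have hA : ∀ a : Poly, 𝔯 a ∈ admissible N := algebraMap_mem_admissible N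
  unfold dr
  split_ifs with h
  · rw [one_zpow]
    exact one_mem _
  · have h1 : algebraMap ℂ Poly c * layVar 0 l ≠ layVar 0 k := by
      intro hc
      apply h
      rw [IsScalarTower.algebraMap_apply ℂ Poly Rat, ← mul_div_assoc, ← map_mul, hc, div_self h0]
    have h2 : 1 - algebraMap ℂ Rat c * (𝔯 (layVar 0 l) / 𝔯 (layVar 0 k))
        = 𝔯 (layVar 0 k - algebraMap ℂ Poly c * layVar 0 l)
          * (𝔯 (layVar 0 k))⁻¹ := by
      rw [map_sub, map_mul, ← IsScalarTower.algebraMap_apply]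
      field_simp
    rw [h2]
    refine hzpow _ (mul_mem (hA _) (inv_layVar_mem k)) ?_
    rw [mul_inv, inv_inv]
    exact mul_mem (algebraMap_sub_layVar_mem hk hl c h1) (hA _)

theorem eval₂_mem_admissible {f : ℤ → Rat} (hf : ∀ n, f n ∈ admissible N) (P : MvPolynomial ℤ Poly) :
    eval₂ 𝔯 f P ∈ admissible N := by
  induction P using induction_on with
  | C a =>
    rw [eval₂_C]
    exact algebraMap_mem_admissible N a
  | add p q hp hq =>
    rw [eval₂_add]
    exact add_mem hp hq
  | mul_X p n hp =>
    rw [eval₂_mul, eval₂_X]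
    exact mul_mem hp (hf n)

theorem stackSum_mem_admissible
    (h𝓕 : ∀ f, f ∈ 𝓕 ↔ IsStack N m f ∧ (boxes N m f).card = n) (S : Finset ℕ)
    (P : MvPolynomial ℤ Poly) :
    stackSum q K N m 𝓕 S 𝔯 (fun l => 𝔯 (layVar 0 l)) P
      ∈ admissible N := by
  have hzpow : ∀ (x : Rat) (n : ℤ), x ∈ admissible N → x⁻¹ ∈ admissible N → x ^ n ∈ admissible N := by
    intro x n h1 h2
    cases n with
    | ofNat n => simpa using pow_mem h1 n
    | negSucc n => rw [zpow_negSucc, ← inv_pow]; exact pow_mem h2 _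
  have hA : ∀ a : Poly, 𝔯 a ∈ admissible N := algebraMap_mem_admissible N
  refine sum_mem fun f hf => mul_mem ?_ (mul_mem (prod_mem fun ω hω => ?_) ?_)
  · refine hzpow _ _ (neg_mem (one_mem _)) ?_
    rw [inv_neg_one]
    exact neg_mem (one_mem _)
  · have hlt := fun x (hx : x ∈ boxes N m f) => ((h𝓕 f).1 (mem_filter.1 hf).1).1.lt hx
    exact dr_mem_admissible (facSrc_lt hlt ω hω) (facTgt_lt hlt ω hω) _ _
  · refine eval₂_mem_admissible (fun n => sum_mem fun x hx => hzpow _ _ ?_ ?_) P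
    · rw [div_eq_mul_inv, IsScalarTower.algebraMap_apply ℂ Poly Rat]
      exact mul_mem (hA _) (inv_layVar_mem _)
    · rw [inv_div, div_eq_mul_inv, ← map_inv₀, IsScalarTower.algebraMap_apply ℂ Poly Rat]
      exact mul_mem (hA _) (hA _)

theorem strictOn_singleton (k : ℕ) (f : ℕ → Pt → ℤ) : StrictOn {k} f := by
  intro i hi j hj hij
  grind

theorem vacCount_singleton (k : ℕ) (f : ℕ → Pt → ℤ) : vacCount f {k} = 0 := by
  simp [vacCount, ind]

theorem stackSum_singleton {R F : Type*} [CommRing R] [Field F] [Algebra ℂ F] (k : ℕ) (φ : R →+* F)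
    (u : ℕ → F) (P : MvPolynomial ℤ R) : stackSum q K N m 𝓕 {k} φ u P
      = ∑ f ∈ 𝓕, stackVal q K N φ u P (boxes N m f) Prod.snd := by
  rw [stackSum, filter_true_of_mem fun f _ => strictOn_singleton k f]
  exact sum_congr rfl fun f _ => by rw [vacCount_singleton, zpow_zero, one_mul]

theorem stackVal_map {R R' F : Type*} [CommRing R] [CommRing R'] [Field F] [Algebra ℂ F] (g : R →+* R')
    (φ : R' →+* F) (u : ℕ → F) (P : MvPolynomial ℤ R) (B : Finset Bx) (lab : Bx → ℕ) :
    stackVal q K N φ u (map g P) B lab = stackVal q K N (φ.comp g) u P B lab := by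
  rw [stackVal, stackVal, eval₂_map]

theorem stackSum_value (hq : IsGeneric q K)
    (h𝓕 : ∀ f, f ∈ 𝓕 ↔ IsStack N m f ∧ (boxes N m f).card = n) (P : MvPolynomial ℤ Poly) :
    HasRes evOne
      (∑ f ∈ 𝓕, stackVal q K N 𝔯 (fun l => 𝔯 (layVar 0 l)) P
        (boxes N m f) Prod.snd)
      (stackSum q K N m 𝓕 (range (N - 1 + 1)) evOne (fun _ => 1) P) := by
  obtain ⟨v, hv⟩ := hasRes_evOne (stackSum_mem_admissible h𝓕 {0} P) (fun i j hij hj => ⟨_, by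
    have := (isMerge_evPair hij hj).stackSum_res (𝕂 := Rat) hq h𝓕 P
    rwa [stackSum_singleton, ← stackSum_singleton 0] at this⟩)
  have hstep : ∀ t, t + 1 ≤ N - 1 + 1 → ∃ P' : MvPolynomial ℤ Poly,
      map evOne P' = map evOne P ∧
      HasRes evOne (stackSum q K N m 𝓕 (range (t + 1)) 𝔯
        (fun l => 𝔯 (layVar t l)) P') v := by
    intro t
    induction t with
    | zero => exact fun _ => ⟨P, rfl, by simpa using hv⟩
    | succ t ih =>
      intro ht
      obtain ⟨P', h1, h2⟩ := ih (by omega)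
      refine ⟨map (evStep t : Poly →+* Poly) P', ?_, ?_⟩
      · rw [MvPolynomial.map_map, ← h1]
        have h3 : evOne.comp (evStep t : Poly →+* Poly) = evOne :=
          RingHom.ext fun p => evOne_evStep t p
        rw [h3]
      · have h3 := hasRes_step h2 ((isMerge_evStep (t := t) (N := N) (by omega)).stackSum_res
          (𝕂 := Rat) hq h𝓕 P')
        rw [range_add_one]
        convert h3 using 1
        refine sum_congr rfl fun f _ => ?_
        rw [stackVal_map]
        have h4 : (fun l => 𝔯 (layVar (t + 1) l))
            = fun l => evStepRat t (layVar t l) := by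
          funext l
          rw [evStepRat_apply, evStep_layVar]
        rw [h4]
        rfl
  obtain ⟨P', h1, h2⟩ := hstep (N - 1) le_rfl
  have h3 : HasRes evOne (stackSum q K N m 𝓕 (range (N - 1 + 1)) 𝔯
        (fun l => 𝔯 (layVar (N - 1) l)) P')
      (stackSum q K N m 𝓕 (range (N - 1 + 1)) evOne (fun _ => 1) P) := by
    have hone : ∀ l, l < N → layVar (N - 1) l = 1 := fun l hl => by
      rw [layVar, Ioc_eq_empty (by omega)]
      rfl
    have hcst : ∀ c : ℂ, HasRes evOne (algebraMap ℂ Rat c) c := fun c => by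
      have := hasRes_algebraMap (𝕂 := Rat) evOne (algebraMap ℂ Poly c)
      rwa [← IsScalarTower.algebraMap_apply, evOne_algebraMap] at this
    refine HasRes.sum fun f hf => ?_
    have hlt := fun x (hx : x ∈ boxes N m f) => ((h𝓕 f).1 (mem_filter.1 hf).1).1.lt hx
    refine (hasRes_one.neg.zpow (by simp) _).mul (HasRes.mul (HasRes.prod fun ω hω => ?_) ?_)
    · dsimp only
      rw [hone _ (facSrc_lt hlt ω hω), hone _ (facTgt_lt hlt ω hω)]
      simp only [map_one, div_one, mul_one]
      have : dr (algebraMap ℂ Rat (facConst q K ω)) = algebraMap ℂ Rat (dr (facConst q K ω)) := by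
        unfold dr
        grind
      rw [this]
      exact (hcst _).zpow (dr_ne_zero _) _
    · have h5 : eval₂ evOne (boxPow q (fun _ => (1 : ℂ)) (boxes N m f) Prod.snd) P
          = eval₂ evOne (boxPow q (fun _ => (1 : ℂ)) (boxes N m f) Prod.snd) P' := by
        rw [← eval_map, ← eval_map, h1]
      rw [h5]
      refine HasRes.eval₂ (fun k => HasRes.sum fun x hx => ?_) P'
      dsimp only
      rw [hone _ (hlt x hx)]
      simp only [map_one, div_one]
      exact (hcst _).zpow (hq.wt_ne_zero x.1) k
  rw [← h2.unique h3] at *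
  simpa [stackSum_singleton] using hv

end Regularity
end QQ

namespace QQ
open Finset Function MvPowerSeries

section Modes
open Finsupp

/-! ## Matrix elements of exponentials of oscillators -/

/-- Occupation numbers of the oscillators. -/
abbrev Mode := ℕ+ →₀ ℕ

theorem mode_induction {P : Mode → Prop} (e : Mode) (h0 : P 0) (hs : ∀ e n, P e → P (e + single n 1)) :
    P e := by
  induction e using Finsupp.induction₂ with
  | zero => exact h0
  | add_single n k f _ _ hf =>
    clear * - hf hs
    induction k with
    | zero => simpa using hf
    | succ k ih =>
      rw [single_add, ← add_assoc]
      exact hs _ _ ih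

theorem mode_sub_add {m : Mode} {n : ℕ+} (h : m n ≠ 0) : m - single n 1 + single n 1 = m :=
  tsub_add_cancel_of_le (Finsupp.single_le_iff.2 (Nat.one_le_iff_ne_zero.2 h))

section AffSub
variable {A : Type*} [CommRing A]

/-- The image of a monomial under an affine substitution. -/
def affSub (R z : ℕ+ → A) (d : Mode) : MvPowerSeries ℕ+ A :=
  d.prod fun n k => (C (R n) * X n + C (z n)) ^ k

theorem affSub_zero (R z : ℕ+ → A) : affSub R z 0 = 1 := Finsupp.prod_zero_index

theorem affSub_succ (R z : ℕ+ → A) (d : Mode) (n : ℕ+) : affSub R z (d + single n 1)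
    = affSub R z d * (C (R n) * X n + C (z n)) := by
  rw [affSub, Finsupp.prod_add_index' (fun _ => pow_zero _) (fun _ _ _ => pow_add _ _ _)]
  congr 1
  exact (Finsupp.prod_single_index (h := fun n k => (C (R n) * X n
    + C (z n)) ^ k) (pow_zero _)).trans (pow_one _)

theorem pderiv_affSub (R z : ℕ+ → A) (d : Mode) (n : ℕ+) : pderiv A n (affSub R z d)
    = (d n : MvPowerSeries ℕ+ A) * (C (R n) * affSub R z (d - single n 1)) := by
  induction d using mode_induction with
  | h0 => simp [affSub_zero]
  | hs d k ih =>
    rw [affSub_succ, Derivation.leibniz, map_add, Derivation.leibniz, ih, pderiv_C,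
      pderiv_C]
    simp only [smul_eq_mul]
    by_cases hk : n = k
    · subst hk
      rw [pderiv_X_self, add_tsub_cancel_right]
      rcases Nat.eq_zero_or_pos (d n) with h | h
      · simp [h]
        ring
      · have h1 : d = (d - single n 1) + single n 1 := by
          ext k
          by_cases hk : k = n
          · subst hk
            simp
            omega
          · simp [Finsupp.single_eq_of_ne hk]
        have h2 : affSub R z d = affSub R z (d - single n 1)
            * (C (R n) * X n + C (z n)) := by
          conv_lhs => rw [h1, affSub_succ]
        rw [h2]
        simp only [Finsupp.add_apply, single_eq_same]
        grind
    · rw [pderiv_X_of_ne (by tauto)]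
      have h1 : (d + single k 1 : Mode) n = d n := by simp [Finsupp.single_eq_of_ne hk]
      rw [h1]
      rcases Nat.eq_zero_or_pos (d n) with h | h
      · simp [h]
      · have h2 : d + single k 1 - single n 1 = (d - single n 1) + single k 1 := by
          ext l
          by_cases hl : l = n
          · subst hl
            simp [Finsupp.single_eq_of_ne hk]
          · simp [Finsupp.single_eq_of_ne hl]
        rw [h2, affSub_succ]
        ring
end AffSub

variable {A : Type*} [CommRing A] [Algebra ℂ A]

/-- The coefficients of the exponential of a sum of creation operators. -/
def creat (a : ℕ+ → A) (δ : Mode) : A :=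
  δ.prod fun n k => algebraMap ℂ A (1 / (k.factorial : ℂ)) * a n ^ k

/-- The exponential of a sum of creation operators. -/
def creatSer (a : ℕ+ → A) : MvPowerSeries ℕ+ A := creat a

theorem creat_zero (a : ℕ+ → A) : creat a 0 = 1 := Finsupp.prod_zero_index

theorem creat_succ (a : ℕ+ → A) (e : Mode) (n : ℕ+) :
    ((e n : A) + 1) * creat a (e + single n 1) = a n * creat a e := by
  have h1 : erase n (e + single n 1) = erase n e := by
    ext k
    by_cases hk : k = n
    · simp [hk]
    · simp [hk]
  have h2 : (algebraMap ℂ A ((e n : ℂ) + 1)) * algebraMap ℂ A (1 / ((e n + 1).factorial : ℂ))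
      = algebraMap ℂ A (1 / ((e n).factorial : ℂ)) := by
    rw [← map_mul]
    congr 1
    have h3 : ((e n : ℂ) + 1) ≠ 0 := Nat.cast_add_one_ne_zero _
    have h4 : ((e n).factorial : ℂ) ≠ 0 := Nat.cast_ne_zero.2 (Nat.factorial_ne_zero _)
    rw [Nat.factorial_succ]
    grind
  rw [creat, creat, ← Finsupp.mul_prod_erase' (e + single n 1) n _ (fun _ => by simp),
    ← Finsupp.mul_prod_erase' e n _ (fun _ => by simp), h1]
  simp only [Finsupp.add_apply, single_eq_same]
  rw [← h2, pow_succ, map_add, map_natCast, map_one]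
  ring

/-- Matrix elements of the operator which substitutes `R_n X_n + z_n` for `X_n` and then multiplies
by the exponential of `∑ a_n X_n`. -/
def fock (R z a : ℕ+ → A) (e d : Mode) : A := coeff e (creatSer a * affSub R z d)

/-- The recursions that characterize the matrix elements `fock R z a` up to a factor. -/
structure IsFock (R z a : ℕ+ → A) (E : Mode → Mode → A) : Prop where
  succ : ∀ e d n, E (e + single n 1) (d + single n 1) = R n * E e d + z n * E (e + single n 1) d
  zero : ∀ e d n, e n = 0 → E e (d + single n 1) = z n * E e d
  left : ∀ e n, ((e n : A) + 1) * E (e + single n 1) 0 = a n * E e 0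

theorem fock_isFock (R z a : ℕ+ → A) : IsFock R z a (fock R z a) where
  succ e d n := by
    rw [fock, affSub_succ, ← mul_assoc, mul_add, map_add, ← mul_assoc, coeff_mul_C,
      mul_comm _ (C (R n)), mul_assoc, coeff_C_mul, X,
      coeff_add_mul_monomial, mul_one, mul_comm _ (z n)]
    rfl
  zero e d n h := by
    rw [fock, affSub_succ, ← mul_assoc, mul_add, map_add, ← mul_assoc, coeff_mul_C,
      mul_comm _ (C (R n)), mul_assoc, coeff_C_mul, X,
      coeff_mul_monomial, if_neg, mul_zero, zero_add, mul_comm _ (z n)]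
    · rfl
    · intro h1
      have := h1 n
      simp [h] at this
  left e n := by
    simp only [fock, affSub_zero, mul_one]
    exact creat_succ a e n

theorem fock_zero_zero (R z a : ℕ+ → A) : fock R z a 0 0 = 1 := by
  rw [fock, affSub_zero, mul_one]
  exact creat_zero a

theorem fock_zero_right (R z a : ℕ+ → A) (e : Mode) : fock R z a e 0 = creat a e := by
  rw [fock, affSub_zero, mul_one]
  rfl

theorem isUnit_natCast_add_one (k : ℕ) : IsUnit ((k : A) + 1) := by
  have : ((k : A) + 1) = algebraMap ℂ A ((k : ℂ) + 1) := by simp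
  rw [this]
  exact (isUnit_iff_ne_zero.2 (Nat.cast_add_one_ne_zero k)).map _

theorem IsFock.eq {R z a : ℕ+ → A} {E : Mode → Mode → A} (h : IsFock R z a E) (e d : Mode) :
    E e d = fock R z a e d * E 0 0 := by
  have h' := fock_isFock R z a
  induction d using mode_induction generalizing e with
  | h0 =>
    induction e using mode_induction with
    | h0 => rw [fock_zero_zero, one_mul]
    | hs e n ih =>
      refine (isUnit_natCast_add_one (e n)).mul_left_cancel ?_
      rw [h.left, ih, ← mul_assoc, ← mul_assoc, h'.left]
  | hs d n ih =>
    by_cases hn : e n = 0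
    · rw [h.zero e d n hn, h'.zero e d n hn, ih, mul_assoc]
    · obtain ⟨e, rfl⟩ : ∃ e', e = e' + single n 1 :=
        ⟨e - single n 1, (mode_sub_add hn).symm⟩
      rw [h.succ, h'.succ, ih, ih]
      ring

theorem map_fock {B : Type*} [CommRing B] [Algebra ℂ B] (φ : A →+* B) (R z a : ℕ+ → A) (e d : Mode) :
    φ (fock R z a e d) = fock (fun n => φ (R n)) (fun n => φ (z n)) (fun n => φ (a n)) e d := by
  have h := fock_isFock R z a
  have h1 : IsFock (fun n => φ (R n)) (fun n => φ (z n)) (fun n => φ (a n))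
      (fun e d => φ (fock R z a e d)) :=
    ⟨fun e d n => by rw [h.succ, map_add, map_mul, map_mul],
      fun e d n hn => by rw [h.zero e d n hn, map_mul],
      fun e n => by rw [← map_mul, ← h.left, map_mul, map_add, map_natCast, map_one]⟩
  rw [h1.eq e d, fock_zero_zero, map_one, mul_one]

theorem pderiv_creat (a : ℕ+ → A) (n : ℕ+) :
    pderiv A n (creatSer a) = C (a n) * creatSer a := by
  ext e
  rw [coeff_pderiv, coeff_C_mul, mul_comm]
  exact creat_succ a e n

theorem fock_left (R z a : ℕ+ → A) (e d : Mode) (n : ℕ+) :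
    ((e n : A) + 1) * fock R z a (e + single n 1) d
      = a n * fock R z a e d + (d n : A) * (R n * fock R z a e (d - single n 1)) := by
  have h := congrArg (coeff e)
    (Derivation.leibniz (pderiv A n) (creatSer a) (affSub R z d))
  rw [coeff_pderiv, pderiv_creat, pderiv_affSub] at h
  rw [mul_comm, fock, h]
  have h1 : creatSer a • ((d n : MvPowerSeries ℕ+ A) * (C (R n) * affSub R z (d - single n 1)))
      + affSub R z d • (C (a n) * creatSer a)
      = C (a n) * (creatSer a * affSub R z d)
        + C (d n : A) * (C (R n) * (creatSer a * affSub R z (d - single n 1))) := by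
    rw [map_natCast, smul_eq_mul, smul_eq_mul]
    ring
  rw [h1, map_add, coeff_C_mul, coeff_C_mul, coeff_C_mul]
  rfl

/-! ### Sums over intermediate states -/

open scoped MvPowerSeries.WithPiTopology

/-- The energy of occupation numbers. -/
def en (m : Mode) : ℕ := m.sum fun n k => (n : ℕ) * k

theorem en_zero : en 0 = 0 := Finsupp.sum_zero_index

theorem en_succ (m : Mode) (n : ℕ+) : en (m + single n 1) = en m + n := by
  rw [en, Finsupp.sum_add_index' (by simp) (fun _ _ _ => by ring), Finsupp.sum_single_index (by simp),
    mul_one, en]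

theorem mul_le_en (m : Mode) (n : ℕ+) : (n : ℕ) * m n ≤ en m := by
  by_cases h : n ∈ m.support
  · exact single_le_sum (f := fun n : ℕ+ => (n : ℕ) * m n) (fun _ _ => Nat.zero_le _) h
  · grind

theorem en_le_finite (B : ℕ) : {m : Mode | en m ≤ B}.Finite := by
  have hfin : {n : ℕ+ | (n : ℕ) ≤ B}.Finite :=
    (Set.finite_Iic B).preimage PNat.coe_injective.injOn
  refine ((hfin.toFinset.finsupp fun _ => range (B + 1)).finite_toSet).subset fun m hm => ?_
  have h1 : ∀ n : ℕ+, (n : ℕ) * m n ≤ B := fun n => (mul_le_en m n).trans hm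
  rw [mem_coe, mem_finsupp_iff]
  constructor
  · intro n hn
    rw [Set.Finite.mem_toFinset]
    exact (Nat.le_mul_of_pos_right _ (Nat.pos_of_ne_zero (Finsupp.mem_support_iff.1 hn))).trans (h1 n)
  · intro n _
    exact mem_range.2 (Nat.lt_succ_of_le ((Nat.le_mul_of_pos_left _ n.pos).trans (h1 n)))

/-- Series in variables that mark the factors of an ordered product. -/
abbrev Ser := MvPowerSeries ℕ ℂ

theorem coeff_X_pow_mul (j k : ℕ) (F : Ser) (g : ℕ →₀ ℕ) :
    coeff g (X j ^ k * F)
      = if k ≤ g j then coeff (g - single j k) F else 0 := by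
  rw [X_pow_eq, coeff_monomial_mul, one_mul]
  simp only [Finsupp.single_le_iff]

/-- The sum of a family of series over the intermediate states, weighted with the energy. -/
def trSum (j : ℕ) (G : Mode → Ser) : Ser := ∑' m, X j ^ en m * G m

theorem coeff_trSum_support (j : ℕ) (G : Mode → Ser) (g : ℕ →₀ ℕ) :
    (support fun m => coeff g (X j ^ en m * G m)).Finite := by
  refine (en_le_finite (g j)).subset fun m hm => ?_
  rw [mem_support, coeff_X_pow_mul] at hm
  grind

theorem trSum_summable (j : ℕ) (G : Mode → Ser) :
    Summable fun m => X j ^ en m * G m :=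
  WithPiTopology.summable_iff_summable_coeff.2 fun g =>
    summable_of_hasFiniteSupport (coeff_trSum_support j G g)

theorem coeff_trSum (j : ℕ) (G : Mode → Ser) (g : ℕ →₀ ℕ) : coeff g (trSum j G)
    = ∑ᶠ m, coeff g (X j ^ en m * G m) := by
  have h := WithPiTopology.hasSum_iff_hasSum_coeff.1 (trSum_summable j G).hasSum g
  rw [trSum, ← h.tsum_eq, tsum_eq_finsum (coeff_trSum_support j G g)]

theorem trSum_add (j : ℕ) (G H : Mode → Ser) : trSum j (fun m => G m + H m) = trSum j G + trSum j H := by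
  simp only [trSum, mul_add]
  exact (trSum_summable j G).tsum_add (trSum_summable j H)

theorem trSum_mul_left (j : ℕ) (c : Ser) (G : Mode → Ser) :
    trSum j (fun m => c * G m) = c * trSum j G := by
  simp only [trSum, mul_left_comm]
  exact (trSum_summable j G).tsum_mul_left c

theorem trSum_shift (j : ℕ) (G : Mode → Ser) (n : ℕ+) (h : ∀ m, m n = 0 → G m = 0) :
    trSum j G = X j ^ (n : ℕ) * trSum j (fun m => G (m + single n 1)) := by
  rw [← trSum_mul_left, trSum, trSum]
  have hi : Injective fun m : Mode => m + single n 1 := add_left_injective _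
  rw [← hi.tsum_eq]
  · refine tsum_congr fun m => ?_
    rw [en_succ, pow_add, mul_assoc]
  · intro m hm
    exact ⟨m - single n 1, mode_sub_add fun h0 => hm (by simp [h m h0])⟩

end Modes
end QQ

namespace QQ
open Finset Function MvPowerSeries

section Products
open Finsupp
open scoped MvPowerSeries.WithPiTopology

/-! ## Products of exponentials of oscillators -/

/-- The matrix elements, between occupation numbers, of the normal ordered exponential with modes `c`;
the commutators of the oscillators are `η`. -/
def vop (η : ℕ+ → ℂ) (c : ℤ → ℂ) : Mode → Mode → ℂ :=
  fock (fun _ => 1) (fun n => c n * η n) fun n => c (-n)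

/-- The ordered product of `N` exponentials, with `X_i ^ L₀` to the right of the `i`-th one, applied to
the vector with occupation numbers `d`. -/
def chain (η : ℕ+ → ℂ) (V : ℕ → ℤ → ℂ) (d : Mode) : ℕ → Mode → Ser
  | 0 => fun e => if e = d then 1 else 0
  | N + 1 => fun e => trSum N fun m => C (vop η (V N) e m) * chain η V d N m

variable {R z a : ℕ+ → Ser} {E : Mode → Mode → Ser}

theorem IsFock.trSum_right (hE : IsFock R z a E) (j : ℕ) (W : Mode → ℂ) (d : Mode) (n : ℕ+) :
    trSum j (fun m => C (W m) * E m (d + single n 1))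
      = X j ^ (n : ℕ) * R n
          * trSum j (fun m => C (W (m + single n 1)) * E m d)
        + z n * trSum j (fun m => C (W m) * E m d) := by
  have h1 : (fun m => C (W m) * E m (d + single n 1))
      = fun m => (if m n = 0 then 0 else C (W m) * (R n * E (m - single n 1) d))
        + z n * (C (W m) * E m d) := by
    funext m
    split_ifs with h
    · rw [hE.zero m d n h]
      ring
    · have h2 := hE.succ (m - single n 1) d n
      rw [mode_sub_add h] at h2
      rw [h2]
      ring
  rw [h1, trSum_add, trSum_mul_left, trSum_shift j _ n fun m hm => if_pos hm, mul_assoc,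
    ← trSum_mul_left j (R n)]
  congr 3
  funext m
  rw [if_neg (by simp), add_tsub_cancel_right]
  ring

theorem IsFock.comp (hE : IsFock R z a E) (j : ℕ) (η : ℕ+ → ℂ) (c : ℤ → ℂ) :
    IsFock (fun n => X j ^ (n : ℕ) * R n)
      (fun n => z n + C (c n * η n) * (X j ^ (n : ℕ) * R n))
      (fun n => C (c (-n)) + X j ^ (n : ℕ) * a n)
      (fun e d => trSum j fun m => C (vop η c e m) * E m d) where
  succ e d n := by
    rw [hE.trSum_right]
    have h1 : (fun m => C (vop η c (e + single n 1) (m + single n 1)) * E m d)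
        = fun m => C (vop η c e m) * E m d + C (c n * η n)
          * (C (vop η c (e + single n 1) m) * E m d) := by
      funext m
      rw [vop, (fock_isFock _ _ _).succ, one_mul, map_add, map_mul]
      ring
    rw [h1, trSum_add, trSum_mul_left]
    ring
  zero e d n hn := by
    rw [hE.trSum_right]
    have h1 : (fun m => C (vop η c e (m + single n 1)) * E m d)
        = fun m => C (c n * η n) * (C (vop η c e m) * E m d) := by
      funext m
      rw [vop, (fock_isFock _ _ _).zero e m n hn, map_mul]
      ring
    rw [h1, trSum_mul_left]
    ring
  left e n := by
    rw [← trSum_mul_left]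
    have h1 : (fun m => ((e n : Ser) + 1)
        * (C (vop η c (e + single n 1) m) * E m 0))
        = fun m => C (c (-n)) * (C (vop η c e m) * E m 0)
          + (m n : Ser) * (C (vop η c e (m - single n 1)) * E m 0) := by
      funext m
      have h2 := congrArg (C (σ := ℕ))
        (fock_left (fun _ => (1 : ℂ)) (fun n : ℕ+ => c n * η n) (fun n : ℕ+ => c (-n)) e m n)
      simp only [map_mul, map_add, map_natCast, map_one, one_mul] at h2
      rw [← mul_assoc, vop, h2]
      ring
    rw [h1, trSum_add, trSum_mul_left, trSum_shift j (fun m => (m n : Ser) * _) n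
      fun m hm => by rw [hm, Nat.cast_zero, zero_mul]]
    have h2 : (fun m => ((m + single n 1 : Mode) n : Ser)
        * (C (vop η c e (m + single n 1 - single n 1)) * E (m + single n 1) 0))
        = fun m => a n * (C (vop η c e m) * E m 0) := by
      funext m
      rw [add_tsub_cancel_right, mul_left_comm (a n), ← hE.left]
      simp only [Finsupp.add_apply, single_eq_same]
      grind
    rw [h2, trSum_mul_left]
    ring

theorem IsFock.comp_vacuum (hE : IsFock R z a E) (j : ℕ) (η : ℕ+ → ℂ) (c : ℤ → ℂ) :
    (trSum j fun m => C (vop η c 0 m) * E m 0)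
      = trSum j (fun m => creat (fun n => C (c n * η n) * a n) m) * E 0 0 := by
  rw [mul_comm, ← trSum_mul_left]
  congr 1
  funext m
  rw [hE.eq m 0, mul_comm (E 0 0), ← mul_assoc]
  congr 1
  rw [fock_zero_right]
  induction m using mode_induction with
  | h0 => rw [vop, fock_zero_zero, map_one, one_mul, creat_zero, creat_zero]
  | hs m n ih =>
    refine (isUnit_natCast_add_one (A := Ser) (m n)).mul_left_cancel ?_
    rw [creat_succ, ← ih, vop, (fock_isFock _ _ _).zero 0 m n rfl, mul_left_comm, creat_succ, map_mul]
    ring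

/-! ### Exponentials of power series -/

/-- The exponential of `∑ y_n T^n`, the sum being over `n ≥ 1`. -/
def pexp (y : ℕ → ℂ) : PowerSeries ℂ :=
  (PowerSeries.exp ℂ).subst (PowerSeries.mk fun n => if n = 0 then 0 else y n)

theorem hasSubst_mk (y : ℕ → ℂ) :
    PowerSeries.HasSubst (PowerSeries.mk fun n => if n = 0 then 0 else y n) :=
  PowerSeries.HasSubst.of_constantCoeff_zero' (by
    rw [← PowerSeries.coeff_zero_eq_constantCoeff_apply, PowerSeries.coeff_mk, if_pos rfl])

theorem constantCoeff_pexp (y : ℕ → ℂ) : PowerSeries.constantCoeff (pexp y) = 1 := by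
  rw [pexp, ← PowerSeries.coeff_zero_eq_constantCoeff_apply, PowerSeries.coeff_subst' (hasSubst_mk y),
    finsum_eq_single _ 0]
  · simp
  · intro n hn
    rw [PowerSeries.coeff_zero_eq_constantCoeff_apply, map_pow,
      ← PowerSeries.coeff_zero_eq_constantCoeff_apply, PowerSeries.coeff_mk, if_pos rfl,
      zero_pow hn, smul_zero]

theorem derivative_pexp (y : ℕ → ℂ) : PowerSeries.derivative ℂ (pexp y)
    = PowerSeries.derivative ℂ (PowerSeries.mk fun n => if n = 0 then 0 else y n) * pexp y := by
  rw [pexp, PowerSeries.derivative_subst (hasSubst_mk y), PowerSeries.derivative_exp, mul_comm]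

theorem X_mul_derivative_pexp (y : ℕ → ℂ) : PowerSeries.X * PowerSeries.derivative ℂ (pexp y)
    = PowerSeries.mk (fun n => n * y n) * pexp y := by
  rw [derivative_pexp, ← mul_assoc]
  congr 1
  ext n
  cases n with
  | zero => simp
  | succ n =>
    rw [PowerSeries.coeff_succ_X_mul, PowerSeries.coeff_derivative, PowerSeries.coeff_mk,
      PowerSeries.coeff_mk, if_neg n.succ_ne_zero, mul_comm]
    push_cast
    rfl

theorem eq_pexp {F : PowerSeries ℂ} {y : ℕ → ℂ} (h0 : PowerSeries.constantCoeff F = 1)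
    (h : PowerSeries.derivative ℂ F
      = PowerSeries.derivative ℂ (PowerSeries.mk fun n => if n = 0 then 0 else y n) * F) :
    F = pexp y := by
  have hc : PowerSeries.constantCoeff (pexp y) ≠ 0 := by
    rw [constantCoeff_pexp]
    exact one_ne_zero
  have h1 : F * (pexp y)⁻¹ = 1 := by
    refine PowerSeries.derivative.ext ?_ (by simp [h0, constantCoeff_pexp])
    rw [Derivation.leibniz, PowerSeries.derivative_inv', h, derivative_pexp, PowerSeries.derivative_one]
    have h2 : (pexp y)⁻¹ * pexp y = 1 := PowerSeries.inv_mul_cancel _ hc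
    simp only [smul_eq_mul]
    grind
  rw [← mul_one F, ← PowerSeries.inv_mul_cancel _ hc, ← mul_assoc, h1, one_mul]

theorem pexp_add (y y' : ℕ → ℂ) : pexp (fun n => y n + y' n) = pexp y * pexp y' := by
  refine (eq_pexp (by simp [constantCoeff_pexp]) ?_).symm
  have h1 : (PowerSeries.mk fun n => if n = 0 then 0 else y n + y' n)
      = PowerSeries.mk (fun n => if n = 0 then 0 else y n)
        + PowerSeries.mk (fun n => if n = 0 then 0 else y' n) := by
    ext n
    simp only [map_add, PowerSeries.coeff_mk]
    split_ifs <;> simp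
  rw [h1, map_add, Derivation.leibniz, derivative_pexp, derivative_pexp]
  simp only [smul_eq_mul]
  ring

theorem pexp_zero : pexp (fun _ => 0) = 1 := by
  refine (eq_pexp (map_one _) ?_).symm
  have : (PowerSeries.mk fun n => if n = 0 then 0 else (0 : ℂ)) = 0 := by
    ext n
    simp
  rw [this, map_zero, zero_mul, PowerSeries.derivative_one]

theorem pexp_sum {ι : Type*} (s : Finset ι) (y : ι → ℕ → ℂ) :
    pexp (fun n => ∑ i ∈ s, y i n) = ∏ i ∈ s, pexp (y i) := by
  classical
  induction s using Finset.induction_on with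
  | empty => simpa using pexp_zero
  | insert i s hi ih =>
    rw [prod_insert hi, ← ih, ← pexp_add]
    grind

theorem pexp_neg_log (w : ℂ) : pexp (fun n => -(w ^ n / n)) = 1 - PowerSeries.C w * PowerSeries.X := by
  refine (eq_pexp (by simp) ?_).symm
  have h1 : PowerSeries.derivative ℂ (1 - PowerSeries.C w * PowerSeries.X) = -PowerSeries.C w := by
    rw [map_sub, PowerSeries.derivative_one, Derivation.leibniz, PowerSeries.derivative_C,
      PowerSeries.derivative_X]
    simp
  rw [h1]
  ext n
  rw [mul_sub, mul_one, map_sub, ← mul_assoc, mul_comm _ (PowerSeries.C w), mul_assoc,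
    PowerSeries.coeff_C_mul]
  have h2 : ∀ k : ℕ, PowerSeries.coeff k (PowerSeries.derivative ℂ
      (PowerSeries.mk fun n => if n = 0 then 0 else -(w ^ n / n))) = -w ^ (k + 1) := by
    intro k
    rw [PowerSeries.coeff_derivative, PowerSeries.coeff_mk, if_neg k.succ_ne_zero]
    have : (k : ℂ) + 1 ≠ 0 := Nat.cast_add_one_ne_zero k
    grind
  cases n with
  | zero =>
    rw [h2]
    simp
  | succ n =>
    rw [h2, PowerSeries.coeff_succ_mul_X, h2, map_neg, PowerSeries.coeff_C, if_neg n.succ_ne_zero]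
    ring

/-! ### Vacuum expectation values -/

/-- The product of the variables between two factors. -/
def seg (i j : ℕ) : Ser := ∏ l ∈ Ioc i j, X l

theorem seg_pow_eq (i j d : ℕ) :
    seg i j ^ d = monomial (d • ∑ l ∈ Ioc i j, single l 1) 1 := by
  have : seg i j = monomial (∑ l ∈ Ioc i j, single l 1) 1 := by
    rw [seg]
    induction Finset.Ioc i j using Finset.induction_on with
    | empty => simp
    | insert l s hl ih =>
      rw [prod_insert hl, ih, sum_insert hl, X,
        monomial_mul_monomial, mul_one]
  rw [this, monomial_pow, one_pow]

theorem coeff_seg_pow {i j d : ℕ} (hij : i < j) {g : ℕ →₀ ℕ}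
    (h : coeff g (seg i j ^ d) ≠ 0) : g j = d := by
  rw [seg_pow_eq, coeff_monomial] at h
  split_ifs at h with h1
  · rw [h1, Finsupp.smul_apply, Finsupp.finsetSum_apply, Finset.sum_eq_single j]
    · simp
    · grind
    · grind
  · grind

theorem hasSubst_seg {i j : ℕ} (hij : i < j) : PowerSeries.HasSubst (seg i j) :=
  PowerSeries.HasSubst.of_constantCoeff_zero (by
    by_contra h
    rw [← coeff_zero_eq_constantCoeff_apply, ← pow_one (seg i j)] at h
    exact absurd (coeff_seg_pow hij h) (by simp))

/-- The logarithmic derivative with respect to a variable. -/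
def theta (j : ℕ) : Derivation ℂ Ser Ser := (X j : Ser) • pderiv ℂ j

theorem coeff_theta (j : ℕ) (F : Ser) (g : ℕ →₀ ℕ) :
    coeff g (theta j F) = g j * coeff g F := by
  rw [theta, Derivation.smul_apply, smul_eq_mul, X, coeff_monomial_mul,
    one_mul]
  split_ifs with h
  · have h1 : g j ≠ 0 := Nat.one_le_iff_ne_zero.1 (Finsupp.single_le_iff.1 h)
    rw [coeff_pderiv, tsub_add_cancel_of_le h, Finsupp.tsub_apply, single_eq_same, mul_comm]
    congr 1
    rw [Nat.cast_sub (by omega)]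
    simp
  · rw [Finsupp.single_le_iff, Nat.one_le_iff_ne_zero, not_not] at h
    rw [h, Nat.cast_zero, zero_mul]

theorem theta_subst {i j : ℕ} (hij : i < j) (F : PowerSeries ℂ) : theta j (F.subst (seg i j))
    = (PowerSeries.X * PowerSeries.derivative ℂ F).subst (seg i j) := by
  ext g
  have h1 : ∀ d, PowerSeries.coeff d (PowerSeries.X * PowerSeries.derivative ℂ F)
      = d * PowerSeries.coeff d F := by
    intro d
    cases d with
    | zero => simp
    | succ d =>
      rw [PowerSeries.coeff_succ_X_mul, PowerSeries.coeff_derivative, mul_comm]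
      push_cast
      rfl
  rw [coeff_theta, PowerSeries.coeff_subst (hasSubst_seg hij), PowerSeries.coeff_subst (hasSubst_seg hij),
    mul_finsum]
  refine finsum_congr fun d => ?_
  rw [h1]
  by_cases h : coeff g (seg i j ^ d) = 0
  · simp [h]
  · rw [coeff_seg_pow hij h]
    simp [mul_assoc]

/-- The positive integers up to a bound. -/
def pnatLe (B : ℕ) : Finset ℕ+ := ((Set.finite_Iic B).preimage PNat.coe_injective.injOn).toFinset

theorem mem_pnatLe {B : ℕ} {n : ℕ+} : n ∈ pnatLe B ↔ (n : ℕ) ≤ B := by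
  simp [pnatLe]

theorem coeff_subst_seg {i j B : ℕ} (hij : i < j) (y : ℕ → ℂ) (h0 : y 0 = 0) {g : ℕ →₀ ℕ} (hg : g j ≤ B) :
    coeff g ((PowerSeries.mk y).subst (seg i j))
      = coeff g (∑ n ∈ pnatLe B, C (y n) * seg i j ^ (n : ℕ)) := by
  rw [PowerSeries.coeff_subst (hasSubst_seg hij), map_sum, finsum_eq_sum_of_support_subset
    (s := (pnatLe B).map ⟨fun n : ℕ+ => (n : ℕ), PNat.coe_injective⟩)]
  · rw [sum_map]
    refine sum_congr rfl fun n _ => ?_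
    rw [coeff_C_mul]
    simp
  · intro d hd
    rw [mem_support] at hd
    have h1 : d ≠ 0 := by
      rintro rfl
      simp [h0] at hd
    have h2 := coeff_seg_pow hij (right_ne_zero_of_smul hd)
    simp only [coe_map, Embedding.coeFn_mk, Set.mem_image, mem_coe]
    exact ⟨⟨d, Nat.pos_of_ne_zero h1⟩, mem_pnatLe.2 (by rw [PNat.mk_coe]; omega), rfl⟩

theorem theta_unique {j : ℕ} {S P : Ser} (Y : ℕ → Ser)
    (hY : ∀ B g, g j = 0 → coeff g (Y B) = 0)
    (hS : ∀ g, coeff g (theta j S) = coeff g (Y (g j) * S))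
    (hP : ∀ g, coeff g (theta j P) = coeff g (Y (g j) * P))
    (h0 : ∀ g, g j = 0 → coeff g S = coeff g P) : S = P := by
  ext g
  obtain ⟨K, hK⟩ : ∃ K, g j = K := ⟨_, rfl⟩
  induction K using Nat.strong_induction_on generalizing g with
  | _ K ih =>
    rcases Nat.eq_zero_or_pos K with h | h
    · grind
    · have h1 := hS g
      have h2 := hP g
      rw [coeff_theta] at h1 h2
      have h3 : (g j : ℂ) ≠ 0 := Nat.cast_ne_zero.2 (by omega)
      refine mul_left_cancel₀ h3 ?_
      rw [h1, h2, coeff_mul, coeff_mul]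
      refine sum_congr rfl fun p hp => ?_
      have h4 : p.1 j + p.2 j = g j := by
        rw [← HasAntidiagonal.mem_antidiagonal.1 hp, Finsupp.add_apply]
      grind

theorem theta_creat {j : ℕ} {y : ℕ+ → Ser} (hy : ∀ n, theta j (y n) = 0) (m : Mode) :
    theta j (creat y m) = 0 := by
  rw [creat]
  refine prod_induction _ (fun x => theta j x = 0) ?_ (by simp) ?_
  · intro x y hx hy
    rw [Derivation.leibniz, hx, hy, smul_zero, smul_zero, add_zero]
  · intro n _
    rw [Derivation.leibniz, Derivation.leibniz_pow, hy, Derivation.map_algebraMap]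
    simp

theorem theta_trSum {j : ℕ} {y : ℕ+ → Ser} (hy : ∀ n, theta j (y n) = 0) (g : ℕ →₀ ℕ) :
    MvPowerSeries.coeff g (theta j (trSum j (fun m => creat y m)))
      = MvPowerSeries.coeff g ((∑ n ∈ pnatLe (g j), ((n : ℕ) : Ser) * (y n * MvPowerSeries.X j ^ (n : ℕ)))
        * trSum j (fun m => creat y m)) := by
  have h1 : ∀ n : ℕ+, y n * MvPowerSeries.X j ^ (n : ℕ) * trSum j (fun m => creat y m)
      = trSum j fun m => (m n : Ser) * creat y m := by
    intro n
    rw [trSum_shift j (fun m => (m n : Ser) * creat y m) n fun m hm => by rw [hm, Nat.cast_zero, zero_mul],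
      mul_comm (y n), mul_assoc, ← trSum_mul_left]
    congr 2
    funext m
    rw [← creat_succ]
    simp
  simp only [Finset.sum_mul, mul_assoc] at h1 ⊢
  simp only [h1]
  rw [coeff_theta, coeff_trSum, mul_finsum]
  have h2 : ∀ n ∈ pnatLe (g j), ((n : ℕ) : Ser) * trSum j (fun m => (m n : Ser) * creat y m)
      = trSum j fun m => ((n : ℕ) : Ser) * ((m n : Ser) * creat y m) :=
    fun n _ => (trSum_mul_left j _ _).symm
  rw [sum_congr rfl h2, map_sum]
  simp only [coeff_trSum]
  rw [← finsum_sum_comm _ _ fun n _ => coeff_trSum_support j _ g]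
  refine finsum_congr fun m => ?_
  rw [← map_sum, ← Finset.mul_sum]
  simp only [← mul_assoc]
  rw [← Finset.sum_mul]
  by_cases h3 : en m ≤ g j
  · have h4 : (∑ n ∈ pnatLe (g j), ((n : ℕ) : Ser) * (m n : Ser)) = ((en m : ℕ) : Ser) := by
      rw [en, Finsupp.sum_of_support_subset m _ _ (by simp)]
      · push_cast
        rfl
      · intro n hn
        rw [mem_pnatLe]
        exact ((Nat.le_mul_of_pos_right _ (Nat.pos_of_ne_zero (Finsupp.mem_support_iff.1 hn))).trans
          (mul_le_en m n)).trans h3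
    rw [h4, mul_left_comm, ← nsmul_eq_mul (en m), map_nsmul, coeff_X_pow_mul, if_pos h3, nsmul_eq_mul]
    have h5 := coeff_theta j (creat y m) (g - single j (en m))
    rw [theta_creat hy, map_zero, Finsupp.tsub_apply, single_eq_same, Nat.cast_sub h3] at h5
    grind
  · rw [coeff_X_pow_mul, coeff_X_pow_mul, if_neg h3, if_neg h3, mul_zero]

theorem theta_prod {ι : Type*} (s : Finset ι) (j : ℕ) (F Y : ι → Ser)
    (h : ∀ i ∈ s, theta j (F i) = Y i * F i) :
    theta j (∏ i ∈ s, F i) = (∑ i ∈ s, Y i) * ∏ i ∈ s, F i := by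
  classical
  induction s using Finset.induction_on with
  | empty => simp
  | insert i s hi ih =>
    rw [prod_insert hi, sum_insert hi, Derivation.leibniz, h i (by simp),
      ih fun k hk => h k (by simp [hk])]
    simp only [smul_eq_mul]
    ring

theorem seg_succ {i j : ℕ} (h : i ≤ j) : seg i (j + 1) = seg i j * X (j + 1) := by
  rw [seg, seg, ← insert_Ioc_right_eq_Ioc_add_one h, prod_insert (by simp), mul_comm]

theorem theta_seg {i j k : ℕ} (h : j < k) (n : ℕ) (c : ℂ) :
    theta k (C c * seg i j ^ n) = 0 := by
  ext g
  rw [coeff_theta, coeff_C_mul, seg_pow_eq, coeff_monomial, map_zero]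
  split_ifs with h1
  · have h2 : g k = 0 := by
      rw [h1, Finsupp.smul_apply, Finsupp.finsetSum_apply, sum_eq_zero, smul_zero]
      grind
    rw [h2, Nat.cast_zero, zero_mul]
  · simp

theorem trSum_creat (j : ℕ) (y : ℕ → ℕ → ℂ) :
    trSum (j + 1) (fun m => creat (fun n => ∑ i ∈ range (j + 1),
        C (y i n) * seg i j ^ (n : ℕ)) m)
      = ∏ i ∈ range (j + 1), (pexp (y i)).subst (seg i (j + 1)) := by
  have hlt : ∀ i ∈ range (j + 1), i < j + 1 := fun i hi => mem_range.1 hi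
  have hY : ∀ B, ∑ n ∈ pnatLe B, ((n : ℕ) : Ser) * ((∑ i ∈ range (j + 1),
        C (y i n) * seg i j ^ (n : ℕ)) * X (j + 1) ^ (n : ℕ))
      = ∑ i ∈ range (j + 1), ∑ n ∈ pnatLe B,
        C (((n : ℕ) : ℂ) * y i n) * seg i (j + 1) ^ (n : ℕ) := by
    intro B
    rw [Finset.sum_comm]
    refine sum_congr rfl fun n _ => ?_
    rw [Finset.sum_mul, Finset.mul_sum]
    refine sum_congr rfl fun i hi => ?_
    rw [seg_succ (Nat.le_of_lt_succ (hlt i hi)), mul_pow, map_mul, map_natCast]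
    ring
  refine theta_unique (j := j + 1) (fun B => ∑ n ∈ pnatLe B, ((n : ℕ) : Ser) * ((∑ i ∈ range (j + 1),
    C (y i n) * seg i j ^ (n : ℕ)) * X (j + 1) ^ (n : ℕ))) ?_ ?_ ?_ ?_
  · intro B g hg
    rw [hY, map_sum]
    refine sum_eq_zero fun i hi => ?_
    rw [map_sum]
    refine sum_eq_zero fun n _ => ?_
    rw [coeff_C_mul]
    by_contra h
    have := coeff_seg_pow (hlt i hi) (right_ne_zero_of_mul h)
    have := n.pos
    omega
  · refine theta_trSum fun n => ?_
    rw [map_sum]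
    exact sum_eq_zero fun i _ => theta_seg (Nat.lt_succ_self j) n _
  · intro g
    rw [theta_prod _ _ _ (fun i => (PowerSeries.mk fun n => n * y i n).subst (seg i (j + 1)))]
    · rw [hY, coeff_mul, coeff_mul]
      refine sum_congr rfl fun p hp => ?_
      congr 1
      rw [map_sum, map_sum]
      refine sum_congr rfl fun i hi => ?_
      refine coeff_subst_seg (hlt i hi) _ (by simp) ?_
      rw [← HasAntidiagonal.mem_antidiagonal.1 hp, Finsupp.add_apply]
      omega
    · intro i hi
      rw [theta_subst (hlt i hi), X_mul_derivative_pexp, PowerSeries.subst_mul (hasSubst_seg (hlt i hi))]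
  · intro g hg
    have h1 : coeff g (trSum (j + 1) (fun m => creat (fun n => ∑ i ∈ range (j + 1),
        C (y i n) * seg i j ^ (n : ℕ)) m)) = coeff g (1 : Ser) := by
      rw [coeff_trSum, finsum_eq_single _ 0]
      · rw [en_zero, pow_zero, one_mul, creat_zero]
      · intro m hm
        rw [coeff_X_pow_mul, if_neg]
        obtain ⟨n, hn⟩ := Finsupp.ne_iff.1 hm
        have := mul_le_en m n
        have := Nat.mul_pos n.pos (Nat.pos_of_ne_zero hn)
        omega
    rw [h1]
    refine Eq.symm ?_
    refine prod_induction _ (fun F : Ser => ∀ g : ℕ →₀ ℕ, g (j + 1) = 0 →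
      coeff g F = coeff g (1 : Ser)) ?_ (fun _ _ => rfl) ?_ g hg
    · intro F G hF hG g hg
      rw [← mul_one (1 : Ser), coeff_mul, coeff_mul]
      refine sum_congr rfl fun p hp => ?_
      have h4 : p.1 (j + 1) + p.2 (j + 1) = g (j + 1) := by
        rw [← HasAntidiagonal.mem_antidiagonal.1 hp, Finsupp.add_apply]
      grind
    · intro i hi g hg
      rw [PowerSeries.coeff_subst (hasSubst_seg (hlt i hi)), finsum_eq_single _ 0]
      · rw [pow_zero, PowerSeries.coeff_zero_eq_constantCoeff_apply, constantCoeff_pexp, one_smul]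
      · intro d hd
        by_contra h
        have := coeff_seg_pow (hlt i hi) (right_ne_zero_of_smul h)
        omega

/-! ### Ordered products -/

variable (η : ℕ → ℂ) (V : ℕ → ℤ → ℂ)

/-- The creation modes of an ordered product. -/
def chainLeft (N n : ℕ) : Ser :=
  ∑ i ∈ range N, C (V i (-n)) * seg i (N - 1) ^ n

/-- The annihilation modes of an ordered product, as translations. -/
def chainShift (N n : ℕ) : Ser :=
  ∑ i ∈ range N, C (V i n * η n) * (∏ l ∈ range (i + 1), X l) ^ n

/-- The product of the two-point functions of an ordered product. -/
def chainVac (N : ℕ) : Ser := ∏ j ∈ range N, ∏ i ∈ range j,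
  (pexp fun n => V j n * η n * V i (-n)).subst (seg i j)

theorem trSum_creat_zero (j : ℕ) : trSum j (fun m => creat (fun _ => 0) m) = 1 := by
  rw [trSum, tsum_eq_single 0]
  · rw [en_zero, creat_zero, pow_zero, one_mul]
  · intro m hm
    obtain ⟨n, hn⟩ := Finsupp.ne_iff.1 hm
    rw [creat, Finsupp.prod, prod_eq_zero (Finsupp.mem_support_iff.2 hn), mul_zero]
    rw [zero_pow hn, mul_zero]

theorem chain_succ (η : ℕ+ → ℂ) (d : Mode) (N : ℕ) (e : Mode) : chain η V d (N + 1) e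
    = trSum N fun m => C (vop η (V N) e m) * chain η V d N m := rfl

theorem chain_isFock (N : ℕ) : IsFock
    (fun n => (∏ l ∈ range N, X l) ^ (n : ℕ)) (fun n => chainShift η V N n)
    (fun n => chainLeft V N n) (fun e d => chain (fun n : ℕ+ => η n) V d N e) := by
  induction N with
  | zero =>
    refine ⟨fun e d n => ?_, fun e d n h => ?_, fun e n => ?_⟩
    · simp [chain, chainShift]
    · simp only [chain, chainShift, range_zero, sum_empty, zero_mul, ite_eq_right_iff]
      rintro rfl
      simp at h
    · simp only [chain, chainLeft, range_zero, sum_empty, zero_mul]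
      rw [if_neg, mul_zero]
      intro h
      have := DFunLike.congr_fun h n
      simp at this
  | succ N ih =>
    convert ih.comp N (fun n : ℕ+ => η n) (V N) using 2 with n
    · rw [prod_range_succ, mul_pow, mul_comm]
    · rw [chainShift, sum_range_succ, prod_range_succ, mul_pow, chainShift]
      ring
    · rw [chainLeft, Finset.sum_range_succ, chainLeft, Finset.mul_sum, add_comm]
      congr 1
      · rw [Nat.add_sub_cancel, seg, Ioc_self, prod_empty, one_pow, mul_one]
      · refine sum_congr rfl fun i hi => ?_
        rw [mem_range] at hi
        obtain ⟨N, rfl⟩ : ∃ M, N = M + 1 := ⟨N - 1, by omega⟩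
        rw [Nat.add_sub_cancel, Nat.add_sub_cancel, seg_succ (by omega), mul_pow]
        ring
    · rfl

theorem chain_zero_zero (N : ℕ) : chain (fun n : ℕ+ => η n) V 0 N 0 = chainVac η V N := by
  induction N with
  | zero => simp [chain, chainVac]
  | succ N ih =>
    rw [chain_succ, chainVac, prod_range_succ, ← chainVac, ← ih, mul_comm,
      (chain_isFock η V N).comp_vacuum]
    congr 1
    rcases N with - | N
    · simp only [chainLeft, range_zero, sum_empty, mul_zero, prod_empty]
      exact trSum_creat_zero 0
    · rw [← trSum_creat]
      congr 1
      funext m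
      congr 1
      funext n
      rw [chainLeft, Finset.mul_sum, Nat.add_sub_cancel]
      grind

theorem chain_eq (N : ℕ) (e d : Mode) : chain (fun n : ℕ+ => η n) V d N e
    = fock (fun n => (∏ l ∈ range N, X l) ^ (n : ℕ)) (fun n => chainShift η V N n)
        (fun n => chainLeft V N n) e d * chainVac η V N := by
  rw [(chain_isFock η V N).eq e d, chain_zero_zero]

end Products
end QQ

namespace QQ
open Finset

section Contractions

/-! ## Contractions -/

variable (q : Fin 3 → ℂ) (K z : ℂ)

/-- The product of the three parameters. -/
def qprod : ℂ := q 0 * q 1 * q 2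

/-- Power sums of the weights in a layer. -/
def layPow (B : Finset Bx) (i : ℕ) (n : ℤ) : ℂ := ∑ x ∈ B.filter (fun x => x.2 = i), wt3 q x.1 ^ n

/-- The modes of a highest weight. -/
def topMode (i : ℕ) (n : ℤ) : ℂ :=
  z ^ (-n) * (qprod q ^ (i : ℤ)) ^ n * (1 - K ^ (-n)) / ∏ t, (1 - q t ^ (-n))

/-- The modes of a vertex operator with boxes. -/
def layMode (B : Finset Bx) (i : ℕ) (n : ℤ) : ℂ :=
  topMode q K z i n - z ^ (-n) * layPow q B i (-n)

/-- The commutators of the oscillators. -/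
def comm (n : ℕ) : ℂ := -(1 / (n : ℂ)) * ((∏ t, (1 - q t ^ n)) * (1 - (qprod q)⁻¹ ^ n))

/-- The coefficients of the logarithm of the one-loop factor. -/
def loopCoeff (n : ℕ) : ℂ :=
  -(1 / (n : ℂ)) * ((1 - (qprod q)⁻¹ ^ n) * (1 - qprod q ^ n)
    / ((∏ t, (1 - q t ^ n)) * (1 - (qprod q)⁻¹ ^ n))) * (1 - K ^ n) * (1 - K⁻¹ ^ n)

/-- The factors between two layers. -/
def facPart (B : Finset Bx) (i j : ℕ) : Finset FacIdx :=
  (B.filter (fun x => x.2 = i) ×ˢ B.filter (fun x => x.2 = j) ×ˢ univ).disjSum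
    (B.filter (fun x => x.2 = j) ×ˢ {i} ×ˢ univ)

theorem facPart_eq (B : Finset Bx) {N i : ℕ} (hi : i < N) (j : ℕ) : facPart B i j
    = (facIdx B N).filter fun ω => facSrc Prod.snd ω = i ∧ facTgt Prod.snd ω = j := by
  ext (⟨x, y, T⟩ | ⟨x, l, s⟩)
  · rw [mem_filter]
    simp only [facPart, facIdx, mem_filter, inl_mem_disjSum, mem_product, facSrc,
      facTgt, mem_univ, and_true]
    tauto
  · rw [mem_filter]
    simp only [facPart, facIdx, mem_filter, inr_mem_disjSum, mem_product, facSrc,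
      facTgt, mem_univ, and_true, mem_singleton, mem_range]
    grind

theorem facPart_src {B : Finset Bx} {i j : ℕ} {ω : FacIdx} (h : ω ∈ facPart B i j) :
    facSrc Prod.snd ω = i ∧ facTgt Prod.snd ω = j := by
  rw [facPart_eq B (Nat.lt_succ_self i)] at h
  grind

theorem sum_facPart {M : Type*} [AddCommMonoid M] (B : Finset Bx) (i j : ℕ) (h : FacIdx → M) :
    ∑ ω ∈ facPart B i j, h ω
      = ∑ x ∈ B.filter (fun x => x.2 = i), ∑ y ∈ B.filter (fun x => x.2 = j), ∑ T, h (.inl (x, y, T))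
        + ∑ x ∈ B.filter (fun x => x.2 = j), ∑ s, h (.inr (x, i, s)) := by
  simp only [facPart, sum_disjSum, sum_product, sum_singleton]

theorem prod_range_pairs {M : Type*} [CommMonoid M] (G : ℕ → ℕ → M) (N : ℕ) :
    ∏ i ∈ range N, ∏ j ∈ range N, G i j = (∏ i ∈ range N, G i i)
      * ∏ j ∈ range N, ∏ i ∈ range j, (G i j * G j i) := by
  induction N with
  | zero => simp
  | succ N ih =>
    simp only [prod_range_succ, prod_mul_distrib] at ih ⊢
    rw [ih]
    ac_rfl

theorem prod_facIdx {M : Type*} [CommMonoid M] {B : Finset Bx} {N : ℕ} (hB : ∀ x ∈ B, x.2 < N)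
    (h : FacIdx → M) : ∏ ω ∈ facIdx B N, h ω = (∏ i ∈ range N, ∏ ω ∈ facPart B i i, h ω)
      * ∏ j ∈ range N, ∏ i ∈ range j,
        ((∏ ω ∈ facPart B i j, h ω) * ∏ ω ∈ facPart B j i, h ω) := by
  rw [← prod_range_pairs fun i j => ∏ ω ∈ facPart B i j, h ω, ← prod_product',
    ← prod_fiberwise_of_maps_to (s := facIdx B N) (t := range N ×ˢ range N)
      (g := fun ω => (facSrc Prod.snd ω, facTgt Prod.snd ω))]
  · refine prod_congr rfl fun p hp => ?_
    rw [facPart_eq B (mem_range.1 (mem_product.1 hp).1)]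
    simp only [Prod.ext_iff]
  · intro ω hω
    exact mem_product.2 ⟨mem_range.2 (facSrc_lt hB ω hω),
      mem_range.2 (facTgt_lt hB ω hω)⟩

variable {q K z}

theorem IsGeneric.add (hq : IsGeneric q K) (x y : Pos) : wt3 q (x + y) = wt3 q x * wt3 q y := by
  have h0 := hq.ne_zero 0
  have h1 := hq.ne_zero 1
  have h2 := hq.ne_zero 2
  simp only [wt3, Prod.fst_add, Prod.snd_add]
  rw [zpow_add₀ h0, zpow_add₀ h1, zpow_add₀ (by simp [h0, h1, h2])]
  ring

theorem IsGeneric.sub (hq : IsGeneric q K) (x y : Pos) : wt3 q (x - y) = wt3 q x / wt3 q y := by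
  rw [eq_div_iff (hq.wt_ne_zero y), ← hq.add, sub_add_cancel]

theorem IsGeneric.qprod_ne (hq : IsGeneric q K) : qprod q ≠ 0 :=
  mul_ne_zero (mul_ne_zero (hq.ne_zero 0) (hq.ne_zero 1)) (hq.ne_zero 2)

theorem IsGeneric.wt_disp (hq : IsGeneric q K) (T : Finset (Fin 3)) : wt3 q (disp T) = ∏ t ∈ T, q t := by
  induction T using Finset.induction_on with
  | empty => exact wt3_zero q
  | insert t T ht ih =>
    have h0 := hq.ne_zero 0
    have h1 := hq.ne_zero 1
    rw [disp, sum_insert ht, prod_insert ht, hq.add, ← disp, ih]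
    congr 1
    fin_cases t <;> simp [dir, wt3]
    field_simp

theorem wt_frame (n : ℤ) : wt3 q ((0, 0), n) = qprod q ^ n := by simp [wt3, qprod]

theorem sum_sign_prod (x : Fin 3 → ℂ) :
    ∑ T : Finset (Fin 3), (-1) ^ T.card * ∏ t ∈ T, x t = ∏ t, (1 - x t) := by
  rw [sum_finset_fin_three, Fin.prod_univ_three]
  simp
  ring

theorem IsGeneric.sum_part (hq : IsGeneric q K) (B : Finset Bx) (i j : ℕ) (n : ℤ) :
    ∑ ω ∈ facPart B i j, (facExp ω : ℂ) * facConst q K ω ^ n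
      = layPow q B i n * layPow q B j (-n) * (∏ t, (1 - q t ^ n))
        - layPow q B j (-n) * ((qprod q ^ (-(i : ℤ))) ^ n * (1 - (qprod q)⁻¹ ^ n) * (1 - K ^ n)) := by
  rw [sum_facPart, sub_eq_add_neg]
  congr 1
  · rw [layPow, layPow, sum_mul_sum, sum_mul]
    refine sum_congr rfl fun x _ => ?_
    rw [sum_mul]
    refine sum_congr rfl fun y _ => ?_
    rw [← sum_sign_prod, mul_sum]
    refine sum_congr rfl fun T _ => ?_
    simp only [facExp, facConst]
    rw [hq.sub, hq.add, hq.wt_disp, div_zpow, mul_zpow, prod_zpow, zpow_neg]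
    push_cast
    ring
  · rw [layPow, sum_mul, ← sum_neg_distrib]
    refine sum_congr rfl fun x _ => ?_
    have h1 : qprod q ^ (-(i : ℤ) - 1) = qprod q ^ (-(i : ℤ)) * (qprod q)⁻¹ := by
      rw [sub_eq_add_neg, zpow_add₀ hq.qprod_ne, zpow_neg_one]
    simp only [Fin.sum_univ_four, facExp, facConst, hq.sub, wt_frame, mul_zpow, div_zpow]
    simp [h1, mul_zpow, zpow_neg]
    ring

theorem IsGeneric.contraction (hq : IsGeneric q K) (hK : K ≠ 0) (hz : z ≠ 0) (B : Finset Bx) (i j : ℕ)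
    {n : ℕ} (hn : n ≠ 0) :
    layMode q K z B j n * comm q n * layMode q K z B i (-n)
      = loopCoeff q K n * ((qprod q)⁻¹ ^ ((i : ℤ) - j)) ^ n
        + ∑ ω ∈ facPart B i j, (facExp ω : ℂ) * -(facConst q K ω ^ n / n)
        + ∑ ω ∈ facPart B j i, (facExp ω : ℂ) * -((facConst q K ω)⁻¹ ^ n / n) := by
  have hs : ∀ (i j : ℕ) (m : ℤ), ∑ ω ∈ facPart B i j, (facExp ω : ℂ) * -(facConst q K ω ^ m / n)
      = -(1 / (n : ℂ)) * ∑ ω ∈ facPart B i j, (facExp ω : ℂ) * facConst q K ω ^ m := by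
    intro i j m
    rw [mul_sum]
    grind
  have h1 := hs i j n
  have h2 := hs j i (-n)
  simp only [zpow_natCast, zpow_neg] at h1 h2
  simp only [inv_pow] at h1 h2 ⊢
  rw [h1, h2]
  have h3 := hq.sum_part B i j n
  have h4 := hq.sum_part B j i (-n)
  simp only [zpow_natCast, zpow_neg, neg_neg, inv_pow, inv_inv] at h3 h4
  rw [h3, h4]
  have hqn : ∀ t, q t ≠ 0 := hq.ne_zero
  have hQ := hq.qprod_ne
  have hq1 : ∀ t, 1 - q t ^ n ≠ 0 := by
    intro t h
    have h5 : wt3 q ((n : ℤ) • disp {t}) = 1 := by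
      have : ∀ k : ℕ, wt3 q ((k : ℤ) • disp {t}) = q t ^ k := by
        intro k
        induction k with
        | zero => simpa using wt3_zero q
        | succ k ih =>
          push_cast
          rw [add_smul, one_smul, hq.add, ih, hq.wt_disp, prod_singleton, pow_succ]
      grind
    have h6 := hq.wt_eq_one _ h5
    obtain ⟨-, e1, e2, -, e3, -⟩ := disp_values
    fin_cases t
    · simp [e1, Prod.ext_iff] at h6
      exact hn h6
    · simp [e2, Prod.ext_iff] at h6
      exact hn h6
    · simp [e3, Prod.ext_iff] at h6
      exact hn h6
  have hQ1 : 1 - (qprod q)⁻¹ ^ n ≠ 0 := by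
    intro h
    have h5 : wt3 q ((0, 0), -(n : ℤ)) = 1 := by
      rw [wt_frame, zpow_neg, zpow_natCast, ← inv_pow]
      grind
    have h6 := hq.wt_eq_one _ h5
    simp [Prod.ext_iff] at h6
    exact hn h6
  have hp : ∏ t, (1 - (q t ^ n)⁻¹) = -((qprod q)⁻¹ ^ n) * ∏ t, (1 - q t ^ n) := by
    simp only [Fin.prod_univ_three, qprod, inv_pow, mul_pow]
    have a0 := pow_ne_zero n (hqn 0)
    have a1 := pow_ne_zero n (hqn 1)
    have a2 := pow_ne_zero n (hqn 2)
    field_simp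
    ring
  have hP : ∏ t, (1 - q t ^ n) ≠ 0 := prod_ne_zero_iff.2 fun t _ => hq1 t
  have hzz : z ^ n ≠ 0 := pow_ne_zero n hz
  have e1 : ((qprod q ^ (i : ℤ)) ^ (n : ℤ)) = (qprod q ^ n) ^ i := by
    rw [← zpow_mul, mul_comm, zpow_mul, zpow_natCast, zpow_natCast]
  have e2 : ((qprod q ^ (j : ℤ)) ^ (n : ℤ)) = (qprod q ^ n) ^ j := by
    rw [← zpow_mul, mul_comm, zpow_mul, zpow_natCast, zpow_natCast]
  have e3 : ((qprod q)⁻¹ ^ ((i : ℤ) - j)) ^ n = (qprod q ^ n) ^ j / (qprod q ^ n) ^ i := by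
    rw [← zpow_natCast, ← zpow_mul, mul_comm, zpow_mul, zpow_natCast, inv_pow, zpow_sub₀
      (inv_ne_zero (pow_ne_zero n hQ)), zpow_natCast, zpow_natCast, inv_pow, inv_pow, div_inv_eq_mul,
      mul_comm, div_eq_mul_inv]
  simp only [layMode, topMode, comm, loopCoeff, e3, zpow_neg, neg_neg, zpow_natCast,
    inv_pow, hp] at e1 e2 hQ1 ⊢
  rw [← inv_pow] at hQ1
  simp only [← pow_mul, mul_comm i n, mul_comm j n] at e1 e2 ⊢
  have g0 : qprod q ^ n ≠ 0 := pow_ne_zero n hQ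
  have gK : K ^ n ≠ 0 := pow_ne_zero n hK
  have gn : (n : ℂ) ≠ 0 := Nat.cast_ne_zero.2 hn
  set P := ∏ t, (1 - q t ^ n)
  simp only [pow_mul, inv_pow] at *
  set Q := qprod q ^ n
  have gQ : Q - 1 ≠ 0 := by grind
  generalize layPow q B i _ = p1
  generalize layPow q B j _ = p2
  have gi : Q ^ i ≠ 0 := pow_ne_zero i g0
  have gj : Q ^ j ≠ 0 := pow_ne_zero j g0
  generalize Q ^ i = A1 at *
  generalize Q ^ j = A2 at *
  generalize z ^ n = Z at *
  generalize K ^ n = k at *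
  field_simp
  ring

end Contractions
end QQ

namespace QQ
open Finset MvPowerSeries

section Expansion

/-! ## Expansions of rational functions -/

/-- The field of fractions of power series. -/
abbrev SerField := FractionRing Ser

notation "𝔰" => algebraMap Ser SerField

theorem coe_poly_injective : Function.Injective ((𝔰).comp
    (MvPolynomial.coeToMvPowerSeries.ringHom : Poly →+* Ser)) :=
  (FaithfulSMul.algebraMap_injective Ser SerField).comp (MvPolynomial.coe_injective ℕ ℂ)

/-- The expansion of a rational function. -/
def expand : Rat →+* SerField := IsFractionRing.lift coe_poly_injective

theorem expand_algebraMap (p : Poly) : expand (𝔯 p) = 𝔰 p :=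
  IsFractionRing.lift_algebraMap coe_poly_injective p

theorem expand_const (c : ℂ) :
    expand (algebraMap ℂ Rat c) = 𝔰 (C c) := by
  rw [IsScalarTower.algebraMap_apply ℂ Poly Rat, expand_algebraMap, MvPolynomial.algebraMap_eq,
    MvPolynomial.coe_C]

theorem map_dr {F F' : Type*} [Field F] [Field F'] (φ : F →+* F') (x : F) : φ (dr x) = dr (φ x) := by
  by_cases h : x = 1
  · rw [h, dr_one, map_one, dr_one]
  · rw [dr_of_ne h, map_sub, map_one, dr_of_ne]
    rwa [Ne, ← map_one φ, φ.injective.eq_iff]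

/-- A product of variables in the field of fractions. -/
def segF (i j : ℕ) : SerField := 𝔰 (seg i j)

/-- A constant in the field of fractions. -/
def constF : ℂ →+* SerField := (𝔰).comp C

theorem expand_layVar (l : ℕ) : expand (𝔯 (layVar 0 l)) = segF 0 l := by
  rw [expand_algebraMap, segF, seg, layVar, sqMon, ← MvPolynomial.coeToMvPowerSeries.ringHom_apply,
    map_prod]
  simp

theorem seg_mul {i j k : ℕ} (hij : i ≤ j) (hjk : j ≤ k) : seg i j * seg j k = seg i k := by
  rw [seg, seg, seg, ← prod_union]
  · congr 1
    grind
  · rw [disjoint_left]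
    grind

theorem segF_ne_zero (i j : ℕ) : segF i j ≠ 0 := by
  rw [segF, map_ne_zero_iff _ (FaithfulSMul.algebraMap_injective Ser SerField), seg]
  refine prod_ne_zero_iff.2 fun l _ h => ?_
  have := congrArg (coeff (Finsupp.single l 1)) h
  simp [coeff_index_single_self_X] at this

theorem one_sub_segF_ne_zero {i j : ℕ} (hij : i < j) (w : ℂ) : 1 - constF w * segF i j ≠ 0 := by
  have h1 : 1 - constF w * segF i j = 𝔰 (1 - C w * seg i j) := by
    rw [map_sub, map_one, map_mul]
    rfl
  rw [h1, map_ne_zero_iff _ (FaithfulSMul.algebraMap_injective Ser SerField)]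
  intro h
  have h2 := congrArg constantCoeff h
  rw [map_sub, map_mul, map_one, map_zero] at h2
  have h3 : constantCoeff (seg i j) = 0 := by
    rw [seg, map_prod]
    exact prod_eq_zero (mem_Ioc.2 ⟨hij, le_rfl⟩) (by simp)
  grind

theorem dr_segF {i j : ℕ} (hij : i < j) (w : ℂ) :
    dr (constF w * segF i j) = 1 - constF w * segF i j :=
  dr_of_ne (sub_ne_zero.1 (one_sub_segF_ne_zero hij w)).symm

theorem dr_inv_segF {i j : ℕ} (hij : i < j) {w : ℂ} (hw : w ≠ 0) :
    dr (constF w * (segF i j)⁻¹)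
      = -(constF w * (segF i j)⁻¹) * (1 - constF w⁻¹ * segF i j) := by
  have h1 := segF_ne_zero i j
  have h2 : constF w ≠ 0 := (map_ne_zero constF).2 hw
  have h3 : 1 - constF w * (segF i j)⁻¹
      = -(constF w * (segF i j)⁻¹) * (1 - constF w⁻¹ * segF i j) := by
    rw [map_inv₀]
    field_simp
    ring
  rw [dr_of_ne, h3]
  intro h
  rw [h, sub_self, eq_comm, mul_eq_zero] at h3
  rcases h3 with h3 | h3
  · grind
  · exact one_sub_segF_ne_zero hij _ h3

theorem expand_pexp {i j : ℕ} (hij : i < j) {ι : Type*} (s : Finset ι) (m : ι → ℤ) (w : ι → ℂ) :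
    𝔰
        ((pexp fun n => ∑ k ∈ s, (m k : ℂ) * -(w k ^ n / n)).subst (seg i j))
      = ∏ k ∈ s, (1 - constF (w k) * segF i j) ^ m k := by
  obtain ⟨Φ, hΦ⟩ : ∃ Φ : PowerSeries ℂ →+* SerField,
      ∀ F, 𝔰 (F.subst (seg i j)) = Φ F :=
    ⟨(𝔰).comp (PowerSeries.substAlgHom (R := ℂ) (hasSubst_seg hij)).toRingHom,
      fun F => by
        rw [← PowerSeries.coe_substAlgHom (hasSubst_seg hij)]
        rfl⟩
  rw [hΦ, pexp_sum, map_prod]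
  refine prod_congr rfl fun k _ => ?_
  have h1 : Φ (pexp fun n => -(w k ^ n / n)) = 1 - constF (w k) * segF i j := by
    have h0 : (PowerSeries.C (w k)).subst (seg i j) = C (w k) := PowerSeries.subst_C _
    rw [pexp_neg_log, map_sub, map_one, map_mul, ← hΦ, ← hΦ, PowerSeries.subst_X (hasSubst_seg hij), h0]
    rfl
  have h2 : ∀ (y : ℕ → ℂ) (n : ℕ), Φ (pexp fun l => (n : ℂ) * y l) = Φ (pexp y) ^ n := by
    intro y n
    induction n with
    | zero => simp [pexp_zero]
    | succ n ih =>
      rw [pow_succ, ← ih, ← map_mul, ← pexp_add]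
      grind
  have h3 : ∀ (y : ℕ → ℂ), Φ (pexp fun l => -y l) = (Φ (pexp y))⁻¹ := by
    intro y
    refine eq_inv_of_mul_eq_one_left ?_
    rw [← map_mul, ← pexp_add]
    simp [pexp_zero]
  have h4 : ∀ (y : ℕ → ℂ) (n : ℤ), Φ (pexp fun l => (n : ℂ) * y l) = Φ (pexp y) ^ n := by
    intro y n
    cases n with
    | ofNat n =>
      rw [Int.ofNat_eq_natCast, zpow_natCast, ← h2]
      push_cast
      rfl
    | negSucc n =>
      rw [zpow_negSucc, ← h2, ← h3]
      simp only [Int.cast_negSucc, neg_mul]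
  grind

variable {q : Fin 3 → ℂ} {K z : ℂ}

/-- The one-loop factor of two highest weights. -/
def loopFac (q : Fin 3 → ℂ) (K : ℂ) (i j : ℕ) : Ser :=
  (pexp fun n => loopCoeff q K n * ((qprod q)⁻¹ ^ ((i : ℤ) - j)) ^ n).subst (seg i j)

theorem pexp_congr {y y' : ℕ → ℂ} (h : ∀ n, n ≠ 0 → y n = y' n) : pexp y = pexp y' := by
  rw [pexp, pexp]
  grind

theorem IsGeneric.facConst_ne (hq : IsGeneric q K) (hK : K ≠ 0) (ω : FacIdx) : facConst q K ω ≠ 0 := by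
  rcases ω with (⟨x, y, T⟩ | ⟨x, l, s⟩)
  · exact hq.wt_ne_zero _
  · refine mul_ne_zero ?_ (hq.wt_ne_zero _)
    fin_cases s <;> simp [hK]

theorem IsGeneric.prod_monomials (hq : IsGeneric q K) (hK : K ≠ 0) (B : Finset Bx) (i j : ℕ) {x : SerField}
    (hx : x ≠ 0) : ∏ ω ∈ facPart B i j, (-(constF (facConst q K ω) * x)) ^ facExp ω = 1 := by
  rw [facPart, prod_disjSum, prod_product, prod_product]
  have hc : ∀ {w : ℂ}, w ≠ 0 → constF w ≠ 0 := fun h => (map_ne_zero constF).2 h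
  have h1 : ∀ x' y' : Bx, ∏ T : Finset (Fin 3),
      (-(constF (facConst q K (.inl (x', y', T))) * x)) ^ facExp (.inl (x', y', T)) = 1 := by
    intro x' y'
    have := sum_finset_fin_three (M := Additive SerField) fun T =>
      Additive.ofMul ((-(constF (facConst q K (.inl (x', y', T))) * x)) ^ facExp (.inl (x', y', T)))
    have h2 := congrArg Additive.toMul this
    rw [toMul_sum] at h2
    simp only [toMul_ofMul, toMul_add] at h2
    rw [h2]
    have e0 := hc (hq.ne_zero 0)
    have e1 := hc (hq.ne_zero 1)
    have e2 := hc (hq.ne_zero 2)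
    have e3 := hc (hq.wt_ne_zero x'.1)
    have e4 := hc (hq.wt_ne_zero y'.1)
    simp [facConst, facExp, hq.sub, hq.add, hq.wt_disp, map_mul, map_div₀]
    field_simp
  have h3 : ∀ (x' : Bx) (l : ℕ), ∏ s : Fin 4,
      (-(constF (facConst q K (.inr (x', l, s))) * x)) ^ facExp (.inr (x', l, s)) = 1 := by
    intro x' l
    have e0 := hc hK
    have e1 := hc hq.qprod_ne
    have e3 := hc (hq.wt_ne_zero x'.1)
    have e5 : qprod q ^ (-(l : ℤ) - 1) = qprod q ^ (-(l : ℤ)) * (qprod q)⁻¹ := by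
      rw [sub_eq_add_neg, zpow_add₀ hq.qprod_ne, zpow_neg_one]
    have e6 := hc (zpow_ne_zero (-(l : ℤ)) hq.qprod_ne)
    rw [Fin.prod_univ_four]
    simp only [facConst, facExp, hq.sub, wt_frame, map_mul, map_div₀]
    simp only [Matrix.cons_val_zero, Matrix.cons_val_one, Matrix.cons_val, sub_zero, e5, map_mul, map_inv₀,
      map_one, zpow_one, zpow_neg_one]
    grind
  rw [prod_eq_one fun x' _ => ?_, prod_eq_one fun x' _ => ?_, mul_one]
  · rw [prod_product, prod_singleton]
    exact h3 _ _
  · rw [prod_product]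
    exact prod_eq_one fun y' _ => h1 _ _

theorem IsGeneric.expand_pair (hq : IsGeneric q K) (hK : K ≠ 0) (hz : z ≠ 0) (B : Finset Bx) {i j : ℕ}
    (hij : i < j) :
    𝔰
        ((pexp fun n => layMode q K z B j n * comm q n * layMode q K z B i (-n)).subst (seg i j))
      = 𝔰 (loopFac q K i j) *
        ((∏ ω ∈ facPart B i j, dr (constF (facConst q K ω) * (segF 0 j / segF 0 i)) ^ facExp ω)
          * ∏ ω ∈ facPart B j i, dr (constF (facConst q K ω) * (segF 0 i / segF 0 j)) ^ facExp ω) := by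
  have h1 : segF 0 j / segF 0 i = segF i j := by
    rw [div_eq_iff (segF_ne_zero 0 i), segF, segF, segF, ← map_mul, mul_comm,
      seg_mul (Nat.zero_le i) hij.le]
  have h2 : segF 0 i / segF 0 j = (segF i j)⁻¹ := by rw [← h1, inv_div]
  rw [pexp_congr fun n hn => hq.contraction hK hz B i j hn, pexp_add, pexp_add,
    PowerSeries.subst_mul (hasSubst_seg hij), PowerSeries.subst_mul (hasSubst_seg hij), map_mul, map_mul,
    expand_pexp hij, expand_pexp hij, h1, h2, mul_assoc]
  congr 2
  · exact prod_congr rfl fun ω _ => by rw [dr_segF hij]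
  · refine (one_mul _).symm.trans ?_
    refine (congrArg (· * _) (hq.prod_monomials hK B j i (inv_ne_zero (segF_ne_zero i j))).symm).trans ?_
    rw [← prod_mul_distrib]
    refine prod_congr rfl fun ω _ => ?_
    rw [← mul_zpow, dr_inv_segF hij (hq.facConst_ne hK ω)]

/-- The factors of a set of boxes inside the layers. -/
def diagFac (q : Fin 3 → ℂ) (K : ℂ) (B : Finset Bx) (N : ℕ) : ℂ :=
  ∏ i ∈ range N, ∏ ω ∈ facPart B i i, dr (facConst q K ω) ^ facExp ω

/-- The product of the one-loop factors. -/
def loopProd (q : Fin 3 → ℂ) (K : ℂ) (N : ℕ) : Ser :=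
  ∏ j ∈ range N, ∏ i ∈ range j, loopFac q K i j

theorem IsGeneric.expand_vac (hq : IsGeneric q K) (hK : K ≠ 0) (hz : z ≠ 0) {B : Finset Bx} {N : ℕ}
    (hB : ∀ x ∈ B, x.2 < N) :
    constF (diagFac q K B N) * 𝔰 (chainVac (comm q) (layMode q K z B) N)
      = 𝔰 (loopProd q K N)
        * expand (facProd (fun l => 𝔯 (layVar 0 l)) (facIdx B N) (facConst q K) facExp
          (facSrc Prod.snd) (facTgt Prod.snd)) := by
  have h1 : expand (facProd (fun l => 𝔯 (layVar 0 l)) (facIdx B N) (facConst q K) facExp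
      (facSrc Prod.snd) (facTgt Prod.snd)) = ∏ ω ∈ facIdx B N, dr (constF (facConst q K ω)
        * (segF 0 (facTgt Prod.snd ω) / segF 0 (facSrc Prod.snd ω))) ^ facExp ω := by
    rw [facProd, map_prod]
    refine prod_congr rfl fun ω _ => ?_
    rw [map_zpow₀, map_dr, map_mul, map_div₀, expand_layVar, expand_layVar, expand_const]
    rfl
  have h2 : ∀ i j, ∏ ω ∈ facPart B i j, dr (constF (facConst q K ω)
        * (segF 0 (facTgt Prod.snd ω) / segF 0 (facSrc Prod.snd ω))) ^ facExp ω
      = ∏ ω ∈ facPart B i j, dr (constF (facConst q K ω) * (segF 0 j / segF 0 i)) ^ facExp ω := by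
    intro i j
    refine prod_congr rfl fun ω hω => ?_
    obtain ⟨e1, e2⟩ := facPart_src hω
    rw [e1, e2]
  rw [h1, prod_facIdx hB, diagFac, map_prod, chainVac, map_prod, loopProd, map_prod, mul_left_comm]
  congr 1
  · refine prod_congr rfl fun i _ => ?_
    rw [map_prod]
    refine prod_congr rfl fun ω hω => ?_
    obtain ⟨e1, e2⟩ := facPart_src hω
    rw [e1, e2, div_self (segF_ne_zero 0 i), mul_one, map_zpow₀, map_dr]
  · rw [← prod_mul_distrib]
    refine prod_congr rfl fun j _ => ?_
    rw [map_prod, map_prod, ← prod_mul_distrib]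
    refine prod_congr rfl fun i hi => ?_
    rw [hq.expand_pair hK hz B (mem_range.1 hi), h2 i j, h2 j i]

end Expansion
end QQ

namespace QQ
open Finset Function

section Towers
open Classical

/-! ## Towers of plane partitions -/

/-- The position and the layer of a box, for the direction `a`. -/
def bx (a : Fin 4) (p : Fin 4 → ℕ) : Bx :=
  ((((p (a.succAbove 0) : ℤ) - p (a.succAbove 2), (p (a.succAbove 1) : ℤ) - p (a.succAbove 2)),
    (p (a.succAbove 2) : ℤ) - p a), p a)

/-- The box with a given position and layer. -/
def unbx (a : Fin 4) (x : Bx) : Fin 4 → ℕ := a.insertNth (α := fun _ => ℕ) x.2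
  ![(x.1.2 + x.2 + x.1.1.1).toNat, (x.1.2 + x.2 + x.1.1.2).toNat, (x.1.2 + x.2).toNat]

/-- Finite sets of boxes whose layers in direction `a` are plane partitions. -/
def IsTower (a : Fin 4) (N : ℕ) (ρ : Finset (Fin 4 → ℕ)) : Prop :=
  (∀ p ∈ ρ, p a < N) ∧ ∀ p ∈ ρ, ∀ p' ≤ p, p' a = p a → p' ∈ ρ

/-- The columns of a layer. -/
def column (a : Fin 4) (ρ : Finset (Fin 4 → ℕ)) (k : ℕ) (l : Pt) : Finset (Fin 4 → ℕ) :=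
  ρ.filter fun p => (bx a p).2 = k ∧ (bx a p).1.1 = l

/-- The heights of the layers. -/
def hgt (a : Fin 4) (ρ : Finset (Fin 4 → ℕ)) (k : ℕ) (l : Pt) : ℤ := vac k l + (column a ρ k l).card

variable {a : Fin 4} {N n : ℕ} {ρ : Finset (Fin 4 → ℕ)}

theorem le_iff_succAbove {p p' : Fin 4 → ℕ} : p' ≤ p ↔ p' a ≤ p a ∧
    p' (a.succAbove 0) ≤ p (a.succAbove 0) ∧ p' (a.succAbove 1) ≤ p (a.succAbove 1) ∧
      p' (a.succAbove 2) ≤ p (a.succAbove 2) := by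
  rw [Pi.le_def, Fin.forall_iff_succAbove a, Fin.forall_fin_succ, Fin.forall_fin_two]
  rfl

theorem unbx_bx (a : Fin 4) (p : Fin 4 → ℕ) : unbx a (bx a p) = p := by
  have h : unbx a (bx a p) ≤ p ∧ p ≤ unbx a (bx a p) := by
    rw [le_iff_succAbove (a := a), le_iff_succAbove (a := a)]
    simp only [unbx, Fin.insertNth_apply_same, Fin.insertNth_apply_succAbove, bx]
    simp
  grind

theorem bx_injective (a : Fin 4) : Injective (bx a) :=
  LeftInverse.injective (unbx_bx a)

theorem bx_unbx {x : Bx} (h : vac x.2 x.1.1 ≤ x.1.2) : bx a (unbx a x) = x := by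
  simp only [vac] at h
  obtain ⟨⟨⟨l1, l2⟩, t⟩, k⟩ := x
  simp only [bx, unbx, Fin.insertNth_apply_same, Fin.insertNth_apply_succAbove, Prod.mk.injEq]
  simp at h ⊢
  omega

theorem vac_le_bx (a : Fin 4) (p : Fin 4 → ℕ) : vac (bx a p).2 (bx a p).1.1 ≤ (bx a p).1.2 := by
  simp only [vac, bx]
  omega

/-- The points of the lattice that are below a layer of a tower. -/
def Under (a : Fin 4) (ρ : Finset (Fin 4 → ℕ)) (k : ℕ) (x y z : ℤ) : Prop :=
  x < 0 ∨ y < 0 ∨ z < 0 ∨ ∃ p ∈ ρ, p a = k ∧ (p (a.succAbove 0) : ℤ) = x ∧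
    (p (a.succAbove 1) : ℤ) = y ∧ (p (a.succAbove 2) : ℤ) = z

theorem IsTower.under_mono (h : IsTower a N ρ) {k : ℕ} {x y z x' y' z' : ℤ} (hx : x' ≤ x) (hy : y' ≤ y)
    (hz : z' ≤ z) (hu : Under a ρ k x y z) : Under a ρ k x' y' z' := by
  by_cases h1 : x' < 0
  · exact Or.inl h1
  by_cases h2 : y' < 0
  · exact Or.inr (Or.inl h2)
  by_cases h3 : z' < 0
  · exact Or.inr (Or.inr (Or.inl h3))
  rcases hu with hu | hu | hu | ⟨p, hp, hk, e1, e2, e3⟩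
  · omega
  · omega
  · omega
  · refine Or.inr (Or.inr (Or.inr ⟨a.insertNth (α := fun _ => ℕ) k ![x'.toNat, y'.toNat, z'.toNat],
      h.2 p hp _ ?_ ?_, ?_, ?_⟩))
    · rw [le_iff_succAbove (a := a)]
      simp only [Fin.insertNth_apply_same, Fin.insertNth_apply_succAbove]
      simp
      omega
    · rw [Fin.insertNth_apply_same, hk]
    · rw [Fin.insertNth_apply_same]
    · simp only [Fin.insertNth_apply_succAbove]
      simp
      omega

theorem mem_iff_of_interval {T : Finset ℤ} {v : ℤ} (h1 : ∀ t ∈ T, v ≤ t)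
    (h2 : ∀ t ∈ T, ∀ t', v ≤ t' → t' ≤ t → t' ∈ T) (t : ℤ) : t ∈ T ↔ v ≤ t ∧ t < v + T.card := by
  constructor
  · intro ht
    have h3 : Icc v t ⊆ T := fun s hs => h2 t ht s (mem_Icc.1 hs).1 (mem_Icc.1 hs).2
    have h4 := card_le_card h3
    have := h1 t ht
    rw [Int.card_Icc] at h4
    omega
  · rintro ⟨h3, h4⟩
    by_contra ht
    have h5 : T ⊆ Ico v t := by grind
    have h6 := card_le_card h5
    rw [Int.card_Ico] at h6
    omega

theorem IsTower.lt_hgt (h : IsTower a N ρ) (k : ℕ) (l : Pt) (t : ℤ) :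
    t < hgt a ρ k l ↔ Under a ρ k (t + k + l.1) (t + k + l.2) (t + k) := by
  have hmem : ∀ t, t ∈ (column a ρ k l).image (fun p => (bx a p).1.2)
      ↔ vac k l ≤ t ∧ Under a ρ k (t + k + l.1) (t + k + l.2) (t + k) := by
    intro t
    simp only [column, mem_image, mem_filter, Under]
    constructor
    · rintro ⟨p, ⟨hp, rfl, rfl⟩, rfl⟩
      refine ⟨vac_le_bx a p, Or.inr (Or.inr (Or.inr ⟨p, hp, rfl, ?_⟩))⟩
      simp only [bx]
      omega
    · rintro ⟨h1, h2⟩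
      simp only [vac] at h1
      rcases h2 with h2 | h2 | h2 | ⟨p, hp, rfl, e1, e2, e3⟩
      · omega
      · omega
      · omega
      · refine ⟨p, ⟨hp, rfl, ?_⟩, ?_⟩
        · simp only [bx]
          grind
        · simp only [bx]
          omega
  have hcard : ((column a ρ k l).image (fun p => (bx a p).1.2)).card = (column a ρ k l).card := by
    refine card_image_of_injOn fun p hp p' hp' e => bx_injective a ?_
    simp only [column, coe_filter, Set.mem_ofPred_eq] at hp hp'
    grind
  have h1 := mem_iff_of_interval (fun t ht => ((hmem t).1 ht).1) (fun t ht t' h1 h2 =>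
    (hmem t').2 ⟨h1, h.under_mono (by omega) (by omega) (by omega) ((hmem t).1 ht).2⟩) t
  rw [hcard, hmem] at h1
  rw [hgt]
  by_cases hv : vac k l ≤ t
  · grind
  · refine ⟨fun _ => ?_, fun _ => by omega⟩
    simp only [vac] at hv
    simp only [Under]
    omega

theorem IsTower.mem_iff (h : IsTower a N ρ) (x : Bx) :
    x ∈ ρ.image (bx a) ↔ vac x.2 x.1.1 ≤ x.1.2 ∧ x.1.2 < hgt a ρ x.2 x.1.1 := by
  rw [h.lt_hgt, mem_image]
  constructor
  · rintro ⟨p, hp, rfl⟩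
    refine ⟨vac_le_bx a p, Or.inr (Or.inr (Or.inr ⟨p, hp, rfl, ?_⟩))⟩
    simp only [bx]
    omega
  · rintro ⟨h1, h2⟩
    simp only [vac] at h1
    rcases h2 with h2 | h2 | h2 | ⟨p, hp, hk, e1, e2, e3⟩
    · omega
    · omega
    · omega
    · refine ⟨p, hp, Prod.ext (Prod.ext (Prod.ext ?_ ?_) ?_) hk⟩ <;> simp only [bx] <;> omega

theorem IsTower.lt_card (h : IsTower a N ρ) {p : Fin 4 → ℕ} (hp : p ∈ ρ) {c : Fin 4} (hc : c ≠ a) :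
    p c < ρ.card := by
  have h1 : (range (p c + 1)).image (fun i => update p c i) ⊆ ρ := by
    intro r hr
    obtain ⟨i, hi, rfl⟩ := mem_image.1 hr
    refine h.2 p hp _ ?_ (update_of_ne hc.symm _ _)
    rw [update_le_self_iff]
    grind
  have h2 := card_le_card h1
  rwa [card_image_of_injective _ (update_injective p c), card_range] at h2

theorem le_of_forall_lt_int {x y : ℤ} (h : ∀ t, t < x → t < y) : x ≤ y := by grind

theorem IsTower.isStack (h : IsTower a N ρ) : IsStack N ρ.card (hgt a ρ) where
  height k p d := by
    fin_cases d <;> refine ⟨le_of_forall_lt_int fun t ht => ?_,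
      sub_le_iff_le_add.1 (le_of_forall_lt_int fun t ht => ?_)⟩ <;>
      [skip; rw [lt_sub_iff_add_lt] at ht; skip; rw [lt_sub_iff_add_lt] at ht; skip;
        rw [lt_sub_iff_add_lt] at ht] <;> rw [h.lt_hgt] at ht ⊢ <;>
      refine h.under_mono ?_ ?_ ?_ ht <;> simp [nb] <;> omega
  vac_le k p := by
    rw [hgt]
    omega
  out k p hp := by
    rw [hgt, column, filter_eq_empty_iff.2, card_empty, Nat.cast_zero, add_zero]
    rintro r hr ⟨-, rfl⟩
    have h0 := h.lt_card hr (Fin.succAbove_ne a 0)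
    have h1 := h.lt_card hr (Fin.succAbove_ne a 1)
    have h2 := h.lt_card hr (Fin.succAbove_ne a 2)
    apply hp
    rw [mem_box]
    simp only [bx]
    omega
  top k hk := by
    funext p
    rw [hgt, column, filter_eq_empty_iff.2, card_empty, Nat.cast_zero, add_zero]
    rintro r hr ⟨rfl, -⟩
    exact absurd (h.1 r hr) (not_lt.2 hk)

theorem IsTower.boxes_eq (h : IsTower a N ρ) : boxes N ρ.card (hgt a ρ) = ρ.image (bx a) := by
  ext x
  rw [h.isStack.mem_boxes, h.mem_iff]

theorem IsStack.exists_tower {m : ℕ} {f : ℕ → Pt → ℤ} (hf : IsStack N m f) (a : Fin 4) :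
    ∃ ρ, IsTower a N ρ ∧ hgt a ρ = f ∧ ρ.card = (boxes N m f).card := by
  have hb : ((boxes N m f).image (unbx a)).image (bx a) = boxes N m f := by
    rw [image_image]
    refine (image_congr fun x hx => ?_).trans image_id
    exact bx_unbx ((hf.mem_boxes).1 hx).1
  have hm : ∀ p, p ∈ (boxes N m f).image (unbx a) ↔ (bx a p).1.2 < f (p a) (bx a p).1.1 := by
    intro p
    constructor
    · intro hp
      obtain ⟨x, hx, rfl⟩ := mem_image.1 hp
      have h1 := (hf.mem_boxes).1 hx
      have h2 : unbx a x a = x.2 := by rw [unbx, Fin.insertNth_apply_same]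
      rw [bx_unbx h1.1, h2]
      exact h1.2
    · intro hp
      exact mem_image.2 ⟨bx a p, (hf.mem_boxes).2 ⟨vac_le_bx a p, hp⟩, unbx_bx a p⟩
  have h1 : ∀ k (x y : ℤ) (n : ℕ), f k (x, y) ≤ f k (x - n, y) ∧ f k (x, y) ≤ f k (x, y - n) ∧
      f k (x, y) ≤ f k (x + n, y + n) + n := by
    intro k x y n
    induction n with
    | zero => simp
    | succ n ih =>
      have e1 := (hf.height k (x - (n + 1 : ℕ), y) 0).1
      have e2 := (hf.height k (x, y - (n + 1 : ℕ)) 1).1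
      have e3 := (hf.height k (x + n, y + n) 2).2
      simp only [nb] at e1 e2 e3
      have g1 : x - ((n : ℤ) + 1) + 1 = x - n := by ring
      have g2 : y - ((n : ℤ) + 1) + 1 = y - n := by ring
      simp at e1 e2 e3
      grind
  have ht : IsTower a N ((boxes N m f).image (unbx a)) := by
    refine ⟨fun p hp => ?_, fun p hp p' hle hpa => ?_⟩
    · have := hf.lt (hb ▸ mem_image_of_mem (bx a) hp)
      exact this
    · rw [hm] at hp ⊢
      rw [le_iff_succAbove (a := a)] at hle
      obtain ⟨-, g0, g1, g2⟩ := hle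
      obtain ⟨n0, h0⟩ := Nat.exists_eq_add_of_le g0
      obtain ⟨n1, h1'⟩ := Nat.exists_eq_add_of_le g1
      obtain ⟨n2, h2⟩ := Nat.exists_eq_add_of_le g2
      rw [hpa]
      have s0 := (h1 (p a) (bx a p).1.1.1 (bx a p).1.1.2 n0).1
      have s1 := (h1 (p a) ((bx a p).1.1.1 - n0) (bx a p).1.1.2 n1).2.1
      have s2 := (h1 (p a) ((bx a p).1.1.1 - n0) ((bx a p).1.1.2 - n1) n2).2.2
      have e : (bx a p').1.1 = ((bx a p).1.1.1 - n0 + n2, (bx a p).1.1.2 - n1 + n2) := by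
        simp only [bx, h0, h1', h2]
        grind
      have e' : (bx a p').1.2 = (bx a p).1.2 - n2 := by
        simp only [bx, h2, hpa]
        omega
      grind
  refine ⟨_, ht, ?_, ?_⟩
  · funext k l
    have h2 : ∀ t, vac k l ≤ t → (t < hgt a ((boxes N m f).image (unbx a)) k l ↔ t < f k l) := by
      intro t hv
      have h3 := ht.mem_iff ((l, t), k)
      rw [hb, hf.mem_boxes] at h3
      grind
    have h4 := hf.vac_le k l
    have h5 := ht.isStack.vac_le k l
    refine le_antisymm (le_of_forall_lt_int fun t h => ?_) (le_of_forall_lt_int fun t h => ?_)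
    · grind
    · grind
  · grind

/-- The towers with `n` boxes and at most `N` layers. -/
def towers (a : Fin 4) (N n : ℕ) : Finset (Finset (Fin 4 → ℕ)) :=
  ((Fintype.piFinset fun _ : Fin 4 => range (n + N)).powersetCard n).filter (IsTower a N)

theorem mem_towers : ρ ∈ towers a N n ↔ ρ.card = n ∧ IsTower a N ρ := by
  rw [towers, mem_filter, mem_powersetCard]
  refine ⟨fun h => ⟨h.1.2, h.2⟩, fun h => ⟨⟨fun p hp => ?_, h.1⟩, h.2⟩⟩
  rw [Fintype.mem_piFinset]
  intro c
  rw [mem_range]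
  by_cases hc : c = a
  · have := h.2.1 p hp
    rw [hc]
    omega
  · have := h.2.lt_card hp hc
    omega

theorem mem_image_towers (f : ℕ → Pt → ℤ) :
    f ∈ (towers a N n).image (hgt a) ↔ IsStack N n f ∧ (boxes N n f).card = n := by
  rw [mem_image]
  constructor
  · rintro ⟨ρ, hρ, rfl⟩
    obtain ⟨rfl, h⟩ := mem_towers.1 hρ
    exact ⟨h.isStack, by rw [h.boxes_eq, card_image_of_injective _ (bx_injective a)]⟩
  · rintro ⟨h1, h2⟩
    obtain ⟨ρ, h3, h4, h5⟩ := h1.exists_tower a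
    exact ⟨ρ, mem_towers.2 ⟨h5.trans h2, h3⟩, h4⟩

theorem hgt_injOn : Set.InjOn (hgt a) (towers a N n) := by
  intro ρ hρ ρ' hρ' h
  obtain ⟨h1, h2⟩ := mem_towers.1 hρ
  obtain ⟨h3, h4⟩ := mem_towers.1 hρ'
  have h5 := h2.boxes_eq
  rw [h1, h, ← h3, h4.boxes_eq] at h5
  exact (image_injective (bx_injective a) h5).symm

theorem IsTower.strictOn_iff (h : IsTower a N ρ) :
    StrictOn (range (N - 1 + 1)) (hgt a ρ) ↔ IsSolid ρ := by
  constructor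
  · intro hs p p' hle hp
    have hpN := h.1 p hp
    have hle' := (le_iff_succAbove (a := a)).1 hle
    have hch : ∀ i k, k + i < N → ∀ l, hgt a ρ (k + i) l + i ≤ hgt a ρ k l := by
      intro i
      induction i with
      | zero => simp
      | succ i ih =>
        intro k hk l
        have h1 := ih k (by omega) l
        have h2 := hs (k + i) (mem_range.2 (by omega)) (k + (i + 1))
          (mem_range.2 (by omega)) (by omega) l
        omega
    obtain ⟨i, hi⟩ := Nat.exists_eq_add_of_le hle'.1
    have h1 := ((h.mem_iff _).1 (mem_image_of_mem (bx a) hp)).2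
    have h2 := hch i (p' a) (by omega) (bx a p).1.1
    rw [← hi] at h2
    have h3 : (bx a p).1.2 + i < hgt a ρ (p' a) (bx a p).1.1 := lt_of_lt_of_le (by
      have : (bx a p).2 = p a := rfl
      rw [this] at h1
      omega) h2
    rw [h.lt_hgt] at h3
    have h4 := h.under_mono (x' := p' (a.succAbove 0)) (y' := p' (a.succAbove 1))
      (z' := p' (a.succAbove 2)) (by simp only [bx]; omega) (by simp only [bx]; omega)
      (by simp only [bx]; omega) h3
    rcases h4 with h4 | h4 | h4 | ⟨r, hr, e0, e1, e2, e3⟩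
    · omega
    · omega
    · omega
    · refine h.2 r hr p' ?_ e0.symm
      rw [le_iff_succAbove (a := a)]
      omega
  · intro hs k hk l hl hkl p
    have h1 : ∀ t, t < hgt a ρ l p → t + 1 < hgt a ρ k p := by
      intro t ht
      rw [h.lt_hgt] at ht ⊢
      refine h.under_mono (x := t + l + p.1) (y := t + l + p.2) (z := t + l) (by omega) (by omega)
        (by omega) ?_
      rcases ht with ht | ht | ht | ⟨r, hr, e0, e1, e2, e3⟩
      · exact Or.inl ht
      · exact Or.inr (Or.inl ht)
      · exact Or.inr (Or.inr (Or.inl ht))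
      · refine Or.inr (Or.inr (Or.inr ⟨update r a k, hs (a := r) ?_ hr, ?_, ?_⟩))
        · rw [update_le_self_iff]
          omega
        · simp
        · simp [e1, e2, e3]
    have := h1 (hgt a ρ l p - 1) (by omega)
    omega

end Towers
end QQ

namespace QQ
open Finset Complex Function MvPowerSeries

section Expansion
open Classical

/-! ## The ordered product as a sum over towers -/

variable {a : Fin 4} {N k : ℕ} {ρ : Finset (Fin 4 → ℕ)}

theorem IsSolid.exists_isTower (h : IsSolid ρ) (a : Fin 4) : ∃ N, IsTower a N ρ :=
  ⟨ρ.sup (fun p => p a) + 1, fun _ hp => Nat.lt_succ_of_le (le_sup (f := fun p => p a) hp),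
    fun _ hp _ hle _ => h hle hp⟩

theorem mem_solids : ρ ∈ solids k ↔ ρ.card = k ∧ IsSolid ρ := by
  rw [solids, mem_filter, mem_powersetCard]
  refine ⟨fun h => ⟨h.1.2, h.2⟩, fun h => ⟨⟨fun p hp => ?_, h.1⟩, h.2⟩⟩
  rw [Fintype.mem_piFinset]
  intro c
  obtain ⟨N, hN⟩ := h.2.exists_isTower (c + 1)
  rw [mem_range, ← h.1]
  exact hN.lt_card hp (by fin_cases c <;> decide)

theorem mem_planes {π : Finset (Fin 4 → ℕ)} : π ∈ planes a k ↔ π.card = k ∧ IsPlane a π := by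
  rw [planes, mem_filter, mem_solids, and_assoc]
  exact and_congr_right fun _ => and_iff_right_of_imp fun h => h.1

theorem mem_layer {i : ℕ} {p : Fin 4 → ℕ} :
    p ∈ layer a i ρ ↔ p a = 0 ∧ update p a i ∈ ρ := by
  simp only [layer, mem_image, mem_filter]
  constructor
  · rintro ⟨r, ⟨hr, rfl⟩, rfl⟩
    simpa using hr
  · grind

theorem sum_layer {M : Type*} [AddCommMonoid M] (i : ℕ) (F : (Fin 4 → ℕ) → M) :
    ∑ p ∈ layer a i ρ, F p = ∑ p ∈ ρ.filter (fun p => p a = i), F (update p a 0) := by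
  rw [layer, sum_image]
  intro p hp p' hp' h
  rw [coe_filter] at hp hp'
  have h1 := congrArg (fun r => update r a i) h
  simp only [update_idem] at h1
  rwa [← hp.2, update_eq_self, hp.2, ← hp'.2, update_eq_self] at h1

theorem card_layer (i : ℕ) : (layer a i ρ).card = (ρ.filter fun p => p a = i).card := by
  rw [card_eq_sum_ones, sum_layer, card_eq_sum_ones]

theorem layer_filter {i : ℕ} (hi : i < N) : layer a i (ρ.filter fun p => p a < N) = layer a i ρ := by
  ext p
  rw [mem_layer, mem_layer, mem_filter, update_self]
  grind

theorem IsTower.isPlane (h : IsTower a N ρ) (i : ℕ) : IsPlane a (layer a i ρ) := by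
  refine ⟨fun p p' hle hp => ?_, fun p hp => (mem_layer.1 hp).1⟩
  rw [mem_coe, mem_layer] at hp ⊢
  refine ⟨Nat.le_zero.1 ((hle a).trans hp.1.le), h.2 _ hp.2 _ ?_ (by simp)⟩
  intro j
  by_cases hj : j = a
  · grind
  · simpa [hj] using hle j

theorem sum_towers_succ {M : Type*} [AddCommMonoid M] (a : Fin 4) (N k : ℕ)
    (F : Finset (Fin 4 → ℕ) → Finset (Fin 4 → ℕ) → M) :
    ∑ l ∈ HasAntidiagonal.antidiagonal k, ∑ π ∈ planes a l.1, ∑ ρ ∈ towers a N l.2, F π ρ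
      = ∑ ρ ∈ towers a (N + 1) k, F (layer a N ρ) (ρ.filter fun p => p a < N) := by
  simp only [← sum_product']
  rw [sum_sigma']
  symm
  refine sum_nbij' (fun ρ => ⟨((layer a N ρ).card, (ρ.filter fun p => p a < N).card),
    (layer a N ρ, ρ.filter fun p => p a < N)⟩)
    (fun x => x.2.1.image (fun p => update p a N) ∪ x.2.2) ?_ ?_ ?_ ?_ ?_
  · intro ρ hρ
    obtain ⟨rfl, h⟩ := mem_towers.1 hρ
    simp only [mem_sigma, HasAntidiagonal.mem_antidiagonal, mem_product, mem_planes, mem_towers,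
      true_and]
    refine ⟨?_, h.isPlane N, fun p hp => (mem_filter.1 hp).2, fun p hp p' hle hpa => ?_⟩
    · rw [card_layer, filter_congr (s := ρ) (p := fun p => p a < N) (q := fun p => ¬ p a = N) fun p hp => by
        have := h.1 p hp
        omega]
      exact card_filter_add_card_filter_not (s := ρ) (fun p => p a = N)
    · obtain ⟨h1, h2⟩ := mem_filter.1 hp
      exact mem_filter.2 ⟨h.2 p h1 p' hle hpa, hpa ▸ h2⟩
  · rintro ⟨l, π, ρ⟩ hx
    simp only [mem_sigma, HasAntidiagonal.mem_antidiagonal, mem_product, mem_planes,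
      mem_towers] at hx
    obtain ⟨hl, ⟨hc, hp⟩, hc', ht⟩ := hx
    refine mem_towers.2 ⟨?_, fun p hp' => ?_, fun p hp' p' hle hpa => ?_⟩
    · rw [card_union_of_disjoint, card_image_of_injOn, hc, hc', hl]
      · intro p h1 p' h2 h
        have h3 := congrArg (fun r => update r a 0) h
        simp only [update_idem] at h3
        rwa [← hp.2 p h1, update_eq_self, hp.2 p h1, ← hp.2 p' h2,
          update_eq_self] at h3
      · rw [disjoint_left]
        intro p h1 h2
        obtain ⟨r, -, rfl⟩ := mem_image.1 h1
        simpa using ht.1 _ h2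
    · rcases mem_union.1 hp' with h | h
      · obtain ⟨r, -, rfl⟩ := mem_image.1 h
        simp
      · exact (ht.1 p h).trans (Nat.lt_succ_self N)
    · rcases mem_union.1 hp' with h | h
      · obtain ⟨r, hr, rfl⟩ := mem_image.1 h
        rw [update_self] at hpa
        refine mem_union_left _ (mem_image.2 ⟨update p' a 0, hp.1 ?_ hr, ?_⟩)
        · rw [update_le_iff]
          refine ⟨Nat.zero_le _, fun j hj => ?_⟩
          have := hle j
          grind
        · grind
      · exact mem_union_right _ (ht.2 p h p' hle hpa)
  · intro ρ hρ
    obtain ⟨rfl, h⟩ := mem_towers.1 hρ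
    ext p
    simp only [mem_union, mem_image, mem_layer, mem_filter]
    constructor
    · grind
    · intro hp
      by_cases hN : p a < N
      · grind
      · have h1 : p a = N := by have := h.1 p hp; omega
        exact Or.inl ⟨update p a 0, ⟨by simp, by
          rwa [update_idem, ← h1, update_eq_self]⟩, by
          rw [update_idem, ← h1, update_eq_self]⟩
  · rintro ⟨l, π, ρ⟩ hx
    simp only [mem_sigma, HasAntidiagonal.mem_antidiagonal, mem_product, mem_planes,
      mem_towers] at hx
    obtain ⟨hl, ⟨hc, hp⟩, hc', ht⟩ := hx
    have h1 : layer a N (π.image (fun p => update p a N) ∪ ρ) = π := by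
      ext p
      simp only [mem_layer, mem_union, mem_image]
      constructor
      · rintro ⟨h0, ⟨r, hr, h⟩ | h⟩
        · have h3 := congrArg (fun r => update r a 0) h
          simp only [update_idem] at h3
          rw [← hp.2 r hr, update_eq_self, hp.2 r hr, ← h0, update_eq_self] at h3
          exact h3 ▸ hr
        · simpa using ht.1 _ h
      · exact fun h => ⟨hp.2 p h, Or.inl ⟨p, h, rfl⟩⟩
    have h2 : (π.image (fun p => update p a N) ∪ ρ).filter (fun p => p a < N) = ρ := by
      ext p
      simp only [mem_filter, mem_union, mem_image]
      constructor
      · rintro ⟨⟨r, hr, rfl⟩ | h, h'⟩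
        · simp at h'
        · exact h
      · exact fun h => ⟨Or.inr h, ht.1 p h⟩
    grind
  · grind

variable (ε : Fin 4 → ℂ) (κ τ ξ : ℂ)

theorem vertexOp_eq (V : VExp) (e d : State) : vertexOp ε τ V e d = if e.1 = d.1 + V.2.1 then
    exp (V.2.2.2 * τ) * exp (V.2.2.1 * d.1) * vop (heis ε) V.1 e.2 d.2 else 0 := by
  have h1 : creatExp V.1 = creatSer fun n : ℕ+ => V.1 (-(n : ℕ)) := by
    funext δ
    refine prod_congr rfl fun n _ => ?_
    dsimp only
    rw [Algebra.algebraMap_self_apply, div_eq_inv_mul, one_div]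
  have h2 : ((annihExp ε V.1 (MvPolynomial.monomial d.2 1) : MvPolynomial ℕ+ ℂ) : MvPowerSeries ℕ+ ℂ)
      = affSub (fun _ => 1) (fun n : ℕ+ => V.1 (n : ℕ) * heis ε n) d.2 := by
    rw [annihExp, MvPolynomial.aeval_monomial, map_one, one_mul, affSub, Finsupp.prod, Finsupp.prod,
      ← MvPolynomial.coeToMvPowerSeries.ringHom_apply, map_prod]
    simp
  rw [vertexOp, h1, h2]
  rfl

theorem lambdaD6_zero (π : Finset (Fin 4 → ℕ)) : (LambdaD6 ε κ a π ξ).2 = (-(π.card : ℤ), 0, ε a * κ) := by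
  simp only [LambdaD6, opW, opA, Prod.snd_sub, Prod.snd_sum, sum_const]
  refine Prod.ext ?_ (Prod.ext ?_ ?_)
  · simp
  · simp
  · simp
    ring

/-- The modes of the vertex operators in an ordered product. -/
def modes (a : Fin 4) (ρ : Finset (Fin 4 → ℕ)) (i : ℕ) : ℤ → ℂ :=
  (LambdaD6 ε κ a (layer a i ρ) (ξ + i * ε a)).1

theorem chain_congr {η : ℕ+ → ℂ} {V V' : ℕ → ℤ → ℂ} (d : Mode) (h : ∀ i < N, V i = V' i) (e : Mode) :
    chain η V d N e = chain η V' d N e := by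
  induction N generalizing e with
  | zero => rfl
  | succ N ih =>
    rw [chain_succ, chain_succ, h N (Nat.lt_succ_self N)]
    grind

theorem trSum_sum {ι : Type*} (s : Finset ι) (j : ℕ) (G : ι → Mode → Ser) :
    trSum j (fun m => ∑ i ∈ s, G i m) = ∑ i ∈ s, trSum j (G i) := by
  induction s using Finset.induction_on with
  | empty => simp [trSum]
  | insert i s hi ih =>
    simp only [sum_insert hi]
    rw [trSum_add, ih]

theorem prodSeries_eq (d : State) (N k : ℕ) (e : State) : prodSeries ε κ τ a ξ d N k e
    = if e.1 = d.1 - k then ∑ ρ ∈ towers a N k,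
        C (exp (N * (ε a * κ * τ)) * ∏ i ∈ range N, ZD6 ε κ a (layer a i ρ))
          * chain (heis ε) (modes ε κ ξ a ρ) d.2 N e.2 else 0 := by
  induction N generalizing k e with
  | zero =>
    have h1 : towers a 0 k = if k = 0 then {∅} else ∅ := by
      ext ρ
      rw [mem_towers]
      have h2 : IsTower a 0 ρ ↔ ρ = ∅ :=
        ⟨fun h => eq_empty_of_forall_notMem fun p hp => Nat.not_lt_zero _ (h.1 p hp),
          fun h => by subst h; exact ⟨by simp, by simp⟩⟩
      grind
    rw [h1, prodSeries]
    by_cases hk : k = 0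
    · subst hk
      simp only [true_and, if_true, sum_singleton, chain, Prod.ext_iff]
      by_cases h3 : e.1 = d.1 <;> simp [h3]
    · simp [hk]
  | succ N ih =>
    have h1 : prodSeries ε κ τ a ξ d (N + 1) k e
        = ∑ l ∈ HasAntidiagonal.antidiagonal k, trSum N fun m =>
          C (TD6 ε κ τ a (ξ + N * ε a) l.1 e (d.1 - l.2, m))
            * prodSeries ε κ τ a ξ d N l.2 (d.1 - l.2, m) := by
      ext g
      have h0 : coeff g (prodSeries ε κ τ a ξ d (N + 1) k e)
          = ∑ l ∈ HasAntidiagonal.antidiagonal k, ∑ᶠ m : State,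
            TD6 ε κ τ a (ξ + N * ε a) l.1 e m * coeff g
              (X N ^ energy m * prodSeries ε κ τ a ξ d N l.2 m) := rfl
      rw [h0, map_sum]
      refine sum_congr rfl fun l _ => ?_
      have hinj : Injective fun m : Mode => ((d.1 - l.2, m) : State) :=
        fun m m' h => (Prod.ext_iff.1 h).2
      rw [coeff_trSum, ← finsum_mem_univ, finsum_mem_inter_support_eq _ Set.univ (Set.range
        fun m : Mode => ((d.1 - l.2, m) : State)), finsum_mem_range hinj]
      · refine finsum_congr fun m => ?_
        rw [mul_left_comm, coeff_C_mul]
        rfl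
      · ext m
        simp only [Set.mem_inter_iff, Set.mem_univ, true_and, Set.mem_range, mem_support]
        grind
    have h2 : ∀ (l : ℕ × ℕ), l ∈ HasAntidiagonal.antidiagonal k → trSum N (fun m =>
          C (TD6 ε κ τ a (ξ + N * ε a) l.1 e (d.1 - l.2, m))
            * prodSeries ε κ τ a ξ d N l.2 (d.1 - l.2, m))
        = ∑ π ∈ planes a l.1, ∑ ρ ∈ towers a N l.2, if e.1 = d.1 - k then
          C (exp ((N + 1 : ℕ) * (ε a * κ * τ))
            * (ZD6 ε κ a π * ∏ i ∈ range N, ZD6 ε κ a (layer a i ρ)))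
          * trSum N fun m => C (vop (heis ε) (LambdaD6 ε κ a π (ξ + N * ε a)).1 e.2 m)
            * chain (heis ε) (modes ε κ ξ a ρ) d.2 N m else 0 := by
      intro l hl
      rw [HasAntidiagonal.mem_antidiagonal] at hl
      have hl' : (k : ℤ) = l.1 + l.2 := by exact_mod_cast hl.symm
      have h3 : ∀ m, TD6 ε κ τ a (ξ + N * ε a) l.1 e (d.1 - l.2, m)
          = if e.1 = d.1 - k then ∑ π ∈ planes a l.1, ZD6 ε κ a π * (exp (ε a * κ * τ)
            * vop (heis ε) (LambdaD6 ε κ a π (ξ + N * ε a)).1 e.2 m) else 0 := by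
        intro m
        rw [TD6, ← sum_const_zero (s := planes a l.1), ← sum_ite_irrel]
        refine sum_congr rfl fun π hπ => ?_
        rw [vertexOp_eq, lambdaD6_zero, (mem_planes.1 hπ).1]
        dsimp only
        rw [show d.1 - (l.2 : ℤ) + -(l.1 : ℤ) = d.1 - k by rw [hl']; ring, mul_ite, mul_zero, zero_mul,
          exp_zero, mul_one]
      simp only [h3, ih, if_true, sum_ite_irrel, sum_const_zero]
      split_ifs with hk
      · simp only [map_sum, sum_mul_sum]
        rw [trSum_sum]
        refine sum_congr rfl fun π _ => ?_
        rw [trSum_sum]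
        refine sum_congr rfl fun ρ _ => ?_
        rw [← trSum_mul_left]
        congr 1
        funext m
        rw [Nat.cast_succ, add_mul, one_mul, exp_add]
        grind
      · simp [trSum]
    rw [h1, sum_congr rfl h2, sum_towers_succ]
    rw [sum_ite_irrel, sum_const_zero]
    split_ifs with hk
    · refine sum_congr rfl fun ρ hρ => ?_
      have e1 : ∏ i ∈ range N, ZD6 ε κ a (layer a i (ρ.filter fun p => p a < N))
          = ∏ i ∈ range N, ZD6 ε κ a (layer a i ρ) :=
        prod_congr rfl fun i hi => by rw [layer_filter (mem_range.1 hi)]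
      have e2 : ∀ m, chain (heis ε) (modes ε κ ξ a (ρ.filter fun p => p a < N)) d.2 N m
          = chain (heis ε) (modes ε κ ξ a ρ) d.2 N m :=
        chain_congr _ fun i hi => by rw [modes, layer_filter hi, modes]
      rw [chain_succ, prod_range_succ, e1, mul_comm (ZD6 ε κ a (layer a N ρ))]
      simp only [e2, modes]
    · rfl

end Expansion
end QQ

namespace QQ
open Finset Complex MvPolynomial

section Parameters
open Classical

/-! ## The parameters -/

/-- The parameters of the directions other than `a`. -/
def par (ε : Fin 4 → ℂ) (a : Fin 4) (t : Fin 3) : ℂ := exp (ε (a.succAbove t))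

/-- The parameters satisfy no relations, apart from the one for the product. -/
structure IsGenericLog (ε : Fin 4 → ℂ) (κ : ℂ) : Prop where
  prod : ∏ i, exp (ε i) = 1
  gen : ∀ n : Fin 4 → ℤ, ∏ i, exp (ε i) ^ n i = 1 → ∀ i j, n i = n j
  ne : ∀ n : Fin 4 → ℤ, exp κ ≠ ∏ i, exp (ε i) ^ n i

variable {ε : Fin 4 → ℂ} {κ : ℂ} {a : Fin 4} {N k : ℕ} {ρ : Finset (Fin 4 → ℕ)}

theorem IsGenericLog.qprod_par (h : IsGenericLog ε κ) (a : Fin 4) :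
    qprod (par ε a) = (exp (ε a))⁻¹ := by
  have h1 := h.prod
  rw [Fin.prod_univ_succAbove _ a, Fin.prod_univ_three, mul_comm] at h1
  exact eq_inv_of_mul_eq_one_left h1

theorem IsGenericLog.exp_eq (h : IsGenericLog ε κ) (a : Fin 4) :
    exp (ε a) = (qprod (par ε a))⁻¹ := by
  rw [h.qprod_par, inv_inv]

theorem wt3_par (x : Pos) : wt3 (par ε a) x
    = ∏ i, exp (ε i) ^ (a.insertNth (α := fun _ => ℤ) 0 ![x.1.1 + x.2, x.1.2 + x.2, x.2] i) := by
  rw [Fin.prod_univ_succAbove _ a, Fin.prod_univ_three]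
  simp only [Fin.insertNth_apply_same, Fin.insertNth_apply_succAbove]
  simp only [wt3, par, Matrix.cons_val]
  simp only [zpow_add₀ (exp_ne_zero _), mul_zpow, zpow_zero]
  ring

theorem IsGenericLog.isGeneric (h : IsGenericLog ε κ) (a : Fin 4) :
    IsGeneric (par ε a) (exp κ) where
  ne_zero i := exp_ne_zero _
  wt_eq_one x hx := by
    rw [wt3_par] at hx
    have h1 := fun t => h.gen _ hx (a.succAbove t) a
    simp only [Fin.insertNth_apply_same, Fin.insertNth_apply_succAbove] at h1
    have h2 := h1 0
    have h3 := h1 1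
    have h4 := h1 2
    simp at h2 h3 h4
    exact Prod.ext (Prod.ext (by simpa [h4] using h2) (by simpa [h4] using h3)) h4
  mul_wt_ne x hx := by
    refine h.ne (fun i => -(a.insertNth (α := fun _ => ℤ) 0 ![x.1.1 + x.2, x.1.2 + x.2, x.2] i)) ?_
    simp only [zpow_neg, prod_inv_distrib]
    rw [← wt3_par]
    grind

theorem exp_logBox (p : Fin 4 → ℕ) : exp (logBox ε p) = ∏ i, exp (ε i) ^ p i := by
  rw [logBox, exp_sum]
  exact prod_congr rfl fun i _ => exp_nat_mul _ _

theorem IsGenericLog.wt_bx (h : IsGenericLog ε κ) (a : Fin 4) (p : Fin 4 → ℕ) :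
    wt3 (par ε a) (bx a p).1 = exp (logBox ε p) := by
  have h0 := exp_ne_zero (ε (a.succAbove 0))
  have h1 := exp_ne_zero (ε (a.succAbove 1))
  have h2 := (h.isGeneric a).qprod_ne
  rw [exp_logBox, Fin.prod_univ_succAbove _ a, Fin.prod_univ_three, h.exp_eq]
  rw [wt3, bx, ← qprod]
  simp only [zpow_sub₀ h2, zpow_natCast]
  rw [par, par, zpow_sub₀ h0, zpow_sub₀ h1]
  simp only [zpow_natCast]
  rw [inv_pow, div_eq_mul_inv _ (qprod (par ε a) ^ p a)]
  simp only [qprod, par, mul_pow]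
  field_simp

theorem prod_erase (a : Fin 4) (F : Fin 4 → ℂ) :
    ∏ b ∈ univ.erase a, F b = ∏ t, F (a.succAbove t) := by
  rw [← compl_singleton, ← Fin.image_succAbove_univ,
    prod_image (Fin.succAbove_right_injective.injOn)]

theorem exp_neg_mul (n : ℤ) (x : ℂ) : exp (-(n * x)) = exp x ^ (-n) := by
  rw [← exp_int_mul]
  push_cast
  ring_nf

theorem IsGenericLog.modes_eq (h : IsGenericLog ε κ) (ξ : ℂ) (ρ : Finset (Fin 4 → ℕ)) (i : ℕ) :
    modes ε κ ξ a ρ i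
      = layMode (par ε a) (exp κ) (exp ξ) (ρ.image (bx a)) i := by
  funext n
  have h1 : (ρ.image (bx a)).filter (fun x => x.2 = i) = (ρ.filter fun p => p a = i).image (bx a) := by
    rw [filter_image]
    rfl
  have h2 : ∀ p ∈ ρ.filter (fun p => p a = i), exp (i * ε a)
      * exp (logBox ε (Function.update p a 0)) = exp (logBox ε p) := by
    intro p hp
    rw [← (mem_filter.1 hp).2, exp_logBox, exp_logBox, Fin.prod_univ_succAbove _ a,
      Fin.prod_univ_succAbove _ a, exp_nat_mul]
    simp
  simp only [modes, LambdaD6, opW, opA, Prod.fst_sub, Prod.fst_sum, Pi.sub_apply, Finset.sum_apply,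
    exp_neg_mul, prod_erase, layMode, topMode, layPow]
  rw [h1, sum_image (bx_injective a).injOn, sum_layer, mul_sum]
  congr 1
  · simp only [exp_add, exp_nat_mul, h.exp_eq a, mul_zpow]
    rw [← sub_div, ← zpow_natCast, inv_zpow, inv_zpow', neg_neg]
    simp only [par]
    ring
  · refine Finset.sum_congr rfl fun p hp => ?_
    rw [h.wt_bx, ← h2 p hp, exp_add, exp_add, mul_assoc, mul_zpow]

theorem IsGenericLog.heis_eq (h : IsGenericLog ε κ) (a : Fin 4) :
    heis ε = fun n : ℕ+ => comm (par ε a) n := by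
  funext n
  rw [heis, comm, Fin.prod_univ_succAbove _ a, ← h.exp_eq a]
  simp only [exp_nat_mul, par]
  ring

theorem rescale_pexp (w : ℂ) (y : ℕ → ℂ) :
    PowerSeries.rescale w (pexp y) = pexp fun n => y n * w ^ n := by
  have h1 := PowerSeries.HasSubst.smul_X' (R := ℂ) w
  rw [PowerSeries.rescale_eq_subst, pexp, PowerSeries.subst_comp_subst_apply (hasSubst_mk y) h1,
    ← PowerSeries.rescale_eq_subst, PowerSeries.rescale_mk, pexp]
  grind

theorem subst_C_mul {i j : ℕ} (hij : i < j) (w : ℂ) (F : PowerSeries ℂ) :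
    F.subst (MvPowerSeries.C w * seg i j) = (PowerSeries.rescale w F).subst (seg i j) := by
  rw [PowerSeries.rescale_eq_subst, PowerSeries.subst_comp_subst_apply (PowerSeries.HasSubst.smul_X' w)
    (hasSubst_seg hij), PowerSeries.subst_smul (hasSubst_seg hij), PowerSeries.subst_X (hasSubst_seg hij),
    MvPowerSeries.smul_eq_C_mul]

theorem IsGenericLog.oneLoopProd_eq (h : IsGenericLog ε κ) (a : Fin 4) (N : ℕ) :
    oneLoopProd ε κ a N = loopProd (par ε a) (exp κ) N := by
  refine prod_congr rfl fun j _ => prod_congr rfl fun i hi => ?_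
  have h1 : oneLoop ε κ a = pexp (loopCoeff (par ε a) (exp κ)) := by
    rw [oneLoop, pexp]
    congr 2
    funext n
    congr 1
    rw [loopCoeff, ← h.exp_eq a, h.qprod_par a, Fin.prod_univ_succAbove _ a]
    simp only [exp_neg, exp_nat_mul, par, inv_pow]
    grind
  have h2 : exp (((i : ℂ) - (j : ℂ)) * ε a) = (qprod (par ε a))⁻¹ ^ ((i : ℤ) - j) := by
    rw [← h.exp_eq a, ← exp_int_mul]
    push_cast
    rfl
  rw [h1, ← seg, subst_C_mul (mem_range.1 hi), rescale_pexp, h2, loopFac]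

end Parameters

section Continuation
open Classical

/-! ## The rational continuation -/

variable {q : Fin 3 → ℂ} {K z : ℂ} {B : Finset Bx} {N : ℕ}

/-- The creation modes of an ordered product, as polynomials in the power sums of the boxes. -/
def polLeft (q : Fin 3 → ℂ) (K z : ℂ) (N : ℕ) (n : ℕ) : MvPolynomial ℤ Poly :=
  C (∑ i ∈ range N,
    C (topMode q K z i (-n)) * sqMon (Ioc i (N - 1)) ^ n)
  - C (C (z ^ n) * layVar 0 (N - 1) ^ n) * X (n : ℤ)

/-- The annihilation modes of an ordered product, as polynomials in the power sums of the boxes. -/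
def polShift (q : Fin 3 → ℂ) (K z : ℂ) (N : ℕ) (n : ℕ) : MvPolynomial ℤ Poly :=
  C (∑ i ∈ range N,
    C (topMode q K z i n * comm q n) * sqMon (range (i + 1)) ^ n)
  - C (C (z ^ (-n : ℤ) * comm q n) * X 0 ^ n)
    * X (-n : ℤ)

/-- The matrix elements of an ordered product, as polynomials in the power sums of the boxes. -/
def polFock (q : Fin 3 → ℂ) (K z : ℂ) (N : ℕ) (e d : Mode) : MvPolynomial ℤ Poly :=
  fock (fun n : ℕ+ => C (sqMon (range N) ^ (n : ℕ))) (fun n => polShift q K z N n)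
    (fun n => polLeft q K z N n) e d

theorem coe_sqMon (M : Finset ℕ) : (sqMon M : Ser) = ∏ l ∈ M, MvPowerSeries.X l := by
  rw [sqMon, ← coeToMvPowerSeries.ringHom_apply, map_prod]
  simp

theorem sum_layers {M : Type*} [AddCommMonoid M] (hB : ∀ x ∈ B, x.2 < N) (F : Bx → M) :
    ∑ x ∈ B, F x = ∑ i ∈ range N, ∑ x ∈ B.filter (fun x => x.2 = i), F x :=
  (sum_fiberwise_of_maps_to (fun x hx => mem_range.2 (hB x hx)) F).symm

theorem expand_polFock (hB : ∀ x ∈ B, x.2 < N) (e d : Mode) :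
    𝔰 (fock (fun n => (∏ l ∈ range N, MvPowerSeries.X l) ^ (n : ℕ))
      (fun n => chainShift (comm q) (layMode q K z B) N n) (fun n => chainLeft (layMode q K z B) N n) e d)
    = expand (eval₂ 𝔯
        (boxPow q (fun l => 𝔯 (layVar 0 l)) B Prod.snd) (polFock q K z N e d)) := by
  set φ : MvPolynomial ℤ Poly →+* SerField := expand.comp (eval₂Hom 𝔯
    (boxPow q (fun l => 𝔯 (layVar 0 l)) B Prod.snd)) with hφ
  have hC : ∀ p : Poly, φ (C p) = 𝔰 p := by
    intro p
    rw [hφ, RingHom.comp_apply, coe_eval₂Hom, eval₂_C, expand_algebraMap]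
  have hX : ∀ n : ℤ, φ (X n)
      = ∑ i ∈ range N, constF (layPow q B i n) * (segF 0 i) ^ (-n) := by
    intro n
    rw [hφ, RingHom.comp_apply, coe_eval₂Hom, eval₂_X, boxPow,
      sum_layers hB, map_sum]
    refine sum_congr rfl fun i _ => ?_
    rw [layPow, map_sum, map_sum, sum_mul]
    refine sum_congr rfl fun x hx => ?_
    rw [(mem_filter.1 hx).2, map_zpow₀, map_div₀, expand_const, expand_layVar, div_zpow, zpow_neg,
      map_zpow₀, div_eq_mul_inv]
    rfl
  change _ = φ (polFock q K z N e d)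
  rw [map_fock, polFock, map_fock]
  congr 1
  · funext n
    rw [hC, MvPolynomial.coe_pow, coe_sqMon]
  · funext n
    have h1 : φ (polShift q K z N n) = ∑ i ∈ range N, (constF (topMode q K z i n * comm q n)
        * 𝔰 (∏ l ∈ range (i + 1), MvPowerSeries.X l) ^ (n : ℕ)
        - constF (z ^ (-n : ℤ) * comm q n) * 𝔰 (MvPowerSeries.X 0) ^ (n : ℕ)
          * (constF (layPow q B i (-n)) * (segF 0 i) ^ (n : ℕ))) := by
      rw [polShift, map_sub, map_mul, hC, hC, hX, sum_sub_distrib, ← mul_sum,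
        ← coeToMvPowerSeries.ringHom_apply, map_sum, map_sum]
      congr 1
      · refine sum_congr rfl fun i _ => ?_
        simp [coe_sqMon, constF]
      · simp [constF]
    rw [h1, chainShift, map_sum]
    refine sum_congr rfl fun i _ => ?_
    have h2 : ∏ l ∈ range (i + 1), (MvPowerSeries.X l : Ser) = MvPowerSeries.X 0 * seg 0 i := by
      rw [prod_range_succ', mul_comm, seg, range_eq_Ico,
        prod_Ico_add' (fun l => (MvPowerSeries.X l : Ser)) 0 i 1]
      rfl
    rw [layMode, h2, segF, constF]
    simp only [RingHom.comp_apply, map_mul, map_sub, map_pow, mul_pow]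
    ring
  · funext n
    have h1 : φ (polLeft q K z N n) = ∑ i ∈ range N, (constF (topMode q K z i (-n))
        * 𝔰 (seg i (N - 1)) ^ (n : ℕ)
        - constF (z ^ (n : ℕ)) * segF 0 (N - 1) ^ (n : ℕ)
          * (constF (layPow q B i n) * (segF 0 i) ^ (-n : ℤ))) := by
      rw [polLeft, map_sub, map_mul, hC, hC, hX, sum_sub_distrib, ← mul_sum,
        ← coeToMvPowerSeries.ringHom_apply, map_sum, map_sum]
      congr 1
      · refine sum_congr rfl fun i _ => ?_
        simp [coe_sqMon, constF, seg]
      · simp [constF, segF, layVar, coe_sqMon, seg]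
    rw [h1, chainLeft, map_sum]
    refine sum_congr rfl fun i hi => ?_
    have h2 : segF 0 (N - 1) = segF 0 i * segF i (N - 1) := by
      rw [segF, segF, segF, ← map_mul, seg_mul (Nat.zero_le i)]
      grind
    have h3 : segF 0 i ^ (n : ℕ) * segF 0 i ^ (-n : ℤ) = 1 := by
      rw [zpow_neg, zpow_natCast, mul_inv_cancel₀ (pow_ne_zero _ (segF_ne_zero 0 i))]
    rw [layMode, h2, mul_pow, ← segF]
    simp only [map_mul, map_sub, map_pow, neg_neg, zpow_natCast]
    rw [← segF]
    change (constF _ - constF _ ^ (n : ℕ) * constF _) * _ = _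
    grind

theorem eval_polFock (hB : ∀ x ∈ B, x.2 < N) (e d : Mode) :
    eval₂ evOne (boxPow q (fun _ => 1) B Prod.snd) (polFock q K z N e d)
      = vop (fun n => comm q n) (∑ i ∈ range N, layMode q K z B i) e d := by
  set φ : MvPolynomial ℤ Poly →+* ℂ :=
    eval₂Hom evOne (boxPow q (fun _ => (1 : ℂ)) B Prod.snd) with hφ
  have hX : ∀ n : ℤ, φ (X n) = ∑ i ∈ range N, layPow q B i n := by
    intro n
    rw [hφ, coe_eval₂Hom, eval₂_X, boxPow, sum_layers hB]
    simp [layPow]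
  have hC : ∀ p : Poly, φ (C p) = evOne p := by
    intro p
    rw [hφ, coe_eval₂Hom, eval₂_C]
  have hc : ∀ c : ℂ, evOne (C c) = c := evOne_algebraMap
  change φ (polFock q K z N e d) = _
  rw [polFock, map_fock, vop]
  congr 1
  · funext n
    rw [hC, map_pow, evOne_sqMon, one_pow]
  · funext n
    rw [polShift, map_sub, map_mul, hC, hC, hX]
    simp only [map_sum, map_mul, map_pow, evOne_sqMon, hc, one_pow, mul_one]
    simp only [Finset.sum_apply, layMode, Finset.sum_sub_distrib, ← Finset.mul_sum, ← Finset.sum_mul]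
    simp [evOne]
    ring
  · funext n
    rw [polLeft, map_sub, map_mul, hC, hC, hX]
    simp only [map_sum, map_mul, map_pow, evOne_sqMon, hc, one_pow, mul_one, layVar]
    simp only [Finset.sum_apply, layMode, Finset.sum_sub_distrib, ← Finset.mul_sum, neg_neg]
    simp

end Continuation
end QQ

namespace QQ
open Finset Complex

section Index
open Classical

/-! ## The index -/

/-- The index with the trivial weight left out. -/
def redIndex (X : Character) : ℂ := X.coeff.prod fun w n => dr ((w : ℂ)⁻¹) ^ n

theorem redIndex_add (X Y : Character) : redIndex (X + Y) = redIndex X * redIndex Y := by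
  rw [redIndex, MonoidAlgebra.coeff_add]
  exact Finsupp.prod_add_index' (fun _ => zpow_zero _) fun _ _ _ => zpow_add₀ (dr_ne_zero _) _ _

theorem redIndex_zero : redIndex 0 = 1 := Finsupp.prod_zero_index

theorem redIndex_ne_zero (X : Character) : redIndex X ≠ 0 :=
  prod_ne_zero_iff.2 fun _ _ => zpow_ne_zero _ (dr_ne_zero _)

theorem redIndex_neg (X : Character) : redIndex (-X) = (redIndex X)⁻¹ := by
  exact eq_inv_of_mul_eq_one_left (by rw [← redIndex_add, neg_add_cancel, redIndex_zero])

theorem redIndex_sub (X Y : Character) : redIndex (X - Y) = redIndex X / redIndex Y := by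
  rw [sub_eq_add_neg, redIndex_add, redIndex_neg, div_eq_mul_inv]

theorem redIndex_sum {ι : Type*} (s : Finset ι) (X : ι → Character) :
    redIndex (∑ i ∈ s, X i) = ∏ i ∈ s, redIndex (X i) := by
  induction s using Finset.induction_on with
  | empty => simp [redIndex_zero]
  | insert i s hi ih => rw [sum_insert hi, prod_insert hi, redIndex_add, ih]

theorem redIndex_single (w : ℂˣ) (n : ℤ) :
    redIndex (MonoidAlgebra.single w n) = dr ((w : ℂ)⁻¹) ^ n := by
  rw [redIndex, MonoidAlgebra.coeff_single]
  exact Finsupp.prod_single_index (zpow_zero _)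

/-- The multiplicity of the trivial weight. -/
def trivMult : Character →+ ℤ where
  toFun X := X.coeff 1
  map_zero' := rfl
  map_add' _ _ := rfl

theorem trivMult_single (w : ℂˣ) (n : ℤ) : trivMult (MonoidAlgebra.single w n) = n * ind (w = 1) := by
  change (MonoidAlgebra.single w n).coeff 1 = _
  rw [MonoidAlgebra.coeff_single, Finsupp.single_apply]
  split_ifs with h
  · rw [ind_true h, mul_one]
  · rw [ind_false h, mul_zero]

theorem index_eq {X : Character} (h : trivMult X = 0) : index X = redIndex X := by
  refine prod_congr rfl fun w hw => ?_
  dsimp only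
  rw [dr_of_ne]
  intro h1
  rw [inv_eq_one, Units.val_eq_one] at h1
  exact Finsupp.mem_support_iff.1 hw (h1 ▸ h)

variable (ε : Fin 4 → ℂ)

/-- The monomials in the parameters. -/
def mono (v : Fin 4 → ℤ) : ℂˣ := expU (∑ i, (v i : ℂ) * ε i)

theorem expU_add (x y : ℂ) : expU (x + y) = expU x * expU y := Units.ext (exp_add x y)

theorem mono_add (v w : Fin 4 → ℤ) : mono ε (v + w) = mono ε v * mono ε w := by
  rw [mono, mono, mono, ← expU_add, ← sum_add_distrib]
  congr 1
  refine sum_congr rfl fun i _ => ?_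
  rw [Pi.add_apply]
  push_cast
  ring

theorem mono_zero : mono ε 0 = 1 := by
  have h := mono_add ε 0 0
  rw [add_zero] at h
  exact (right_eq_mul₀ (Units.ne_zero _)).1 (congrArg Units.val h) |> Units.ext

theorem mono_neg (v : Fin 4 → ℤ) : mono ε (-v) = (mono ε v)⁻¹ := by
  rw [eq_inv_iff_mul_eq_one, ← mono_add, neg_add_cancel, mono_zero]

theorem mono_coe (v : Fin 4 → ℤ) : (mono ε v : ℂ) = ∏ i, exp (ε i) ^ v i := by
  change exp _ = _
  rw [exp_sum]
  exact prod_congr rfl fun i _ => exp_int_mul _ _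

/-- The coordinates of a box, as integers. -/
def crd (p : Fin 4 → ℕ) (i : Fin 4) : ℤ := p i

/-- The indicator function of a set of directions. -/
def dirs (S : Finset (Fin 4)) (i : Fin 4) : ℤ := if i ∈ S then 1 else 0

theorem expU_logBox (p : Fin 4 → ℕ) : expU (logBox ε p) = mono ε (crd p) := by
  simp [mono, crd, logBox]

theorem expU_neg (x : ℂ) : expU (-x) = (expU x)⁻¹ := Units.ext (exp_neg x)

theorem expU_dir (c : Fin 4) : expU (ε c) = mono ε (dirs {c}) := by
  simp [mono, dirs]

theorem dirs_insert {c : Fin 4} {S : Finset (Fin 4)} (h : c ∉ S) : dirs (insert c S) = dirs {c} + dirs S := by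
  funext i
  simp only [dirs, mem_insert, mem_singleton, Pi.add_apply]
  grind

theorem PDual_eq (D : Finset (Fin 4)) : PDual ε D
    = ∑ S ∈ D.powerset, MonoidAlgebra.single (mono ε (-dirs S)) ((-1) ^ S.card) := by
  have h : ∀ S : Finset (Fin 4), ∏ c ∈ S, (-wt (expU (-(ε c))))
      = MonoidAlgebra.single (mono ε (-dirs S)) ((-1) ^ S.card) := by
    intro S
    induction S using Finset.induction_on with
    | empty =>
      have : -dirs ∅ = 0 := by
        funext i
        simp [dirs]
      rw [this, mono_zero]
      rfl
    | insert c S hc ih =>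
      rw [prod_insert hc, ih, dirs_insert hc, neg_add, mono_add, card_insert_of_notMem hc,
        wt, ← MonoidAlgebra.single_neg, MonoidAlgebra.single_mul_single, expU_neg, expU_dir, ← mono_neg,
        pow_succ']
  simp only [PDual, sub_eq_add_neg, prod_one_add, h]

theorem pairChar_eq (D : Finset (Fin 4)) (ρ : Finset (Fin 4 → ℕ)) (v : Fin 4 → ℤ) :
    MonoidAlgebra.single (mono ε (-v)) 1 * (PDual ε D * boxCharDual ε ρ * boxChar ε ρ)
      = ∑ S ∈ D.powerset, ∑ p ∈ ρ, ∑ p' ∈ ρ,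
        MonoidAlgebra.single (mono ε (crd p' - crd p - dirs S - v)) ((-1) ^ S.card) := by
  rw [PDual_eq, boxCharDual, boxChar, sum_mul_sum, sum_mul, mul_sum]
  refine sum_congr rfl fun S _ => ?_
  rw [sum_mul_sum, mul_sum]
  refine sum_congr rfl fun p _ => ?_
  rw [mul_sum]
  refine sum_congr rfl fun p' _ => ?_
  rw [wt, wt, MonoidAlgebra.single_mul_single, MonoidAlgebra.single_mul_single,
    MonoidAlgebra.single_mul_single, expU_neg, expU_logBox, expU_logBox, ← mono_neg, ← mono_add,
    ← mono_add, ← mono_add, one_mul, mul_one, mul_one]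
  congr 2
  abel

variable {ε} {κ : ℂ}

theorem IsGenericLog.mono_eq_one (h : IsGenericLog ε κ) (v : Fin 4 → ℤ) :
    mono ε v = 1 ↔ ∃ s, ∀ i, v i = s := by
  rw [← Units.val_eq_one, mono_coe]
  refine ⟨fun h1 => ⟨v 0, fun i => h.gen v h1 i 0⟩, ?_⟩
  rintro ⟨s, hs⟩
  simp only [hs]
  rw [prod_zpow, h.prod, one_zpow]

variable {ρ : Finset (Fin 4 → ℕ)} {M : ℕ}

theorem prod_ind {ι : Type*} (s : Finset ι) (P : ι → Prop) : ∏ i ∈ s, ind (P i) = ind (∀ i ∈ s, P i) := by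
  by_cases h : ∀ i ∈ s, P i
  · rw [ind_true h]
    exact prod_eq_one fun i hi => ind_true (h i hi)
  · rw [ind_false h]
    push Not at h
    obtain ⟨i, hi, hP⟩ := h
    exact prod_eq_zero hi (ind_false hP)

theorem IsSolid.sum_pairs (h : IsSolid ρ) (D : Finset (Fin 4)) (u : Fin 4 → ℕ) :
    ∑ S ∈ D.powerset, (-1) ^ S.card * ∑ x ∈ ρ, ∑ y ∈ ρ, ind (∀ c, crd y c = crd x c + u c + dirs S c)
      = ∑ y ∈ ρ, ind (u ≤ y ∧ ∀ c ∈ D, y c = u c) := by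
  have h1 : ∀ S, ∑ x ∈ ρ, ∑ y ∈ ρ, ind (∀ c, crd y c = crd x c + u c + dirs S c)
      = ∑ y ∈ ρ, ind (∀ c, u c + dirs S c ≤ y c) := by
    intro S
    rw [sum_comm]
    refine sum_congr rfl fun y hy => ?_
    by_cases hc : ∀ c, u c + dirs S c ≤ y c
    · have hx : (fun c => y c - u c - (dirs S c).toNat) ∈ ρ := h (fun c => by
        dsimp only
        omega) hy
      have h0 : ∀ c, 0 ≤ dirs S c := fun c => by
        unfold dirs
        split_ifs <;> simp
      rw [sum_eq_single_of_mem _ hx, ind_true, ind_true hc]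
      · intro c
        have := hc c
        have := h0 c
        simp only [crd]
        omega
      · intro x _ hne
        refine ind_false fun hx' => hne (funext fun c => ?_)
        have := hx' c
        have := h0 c
        simp only [crd] at *
        omega
    · rw [ind_false hc]
      refine sum_eq_zero fun x _ => ind_false fun hx => hc fun c => ?_
      have := hx c
      simp only [crd] at this
      omega
  simp only [h1, mul_sum]
  rw [sum_comm]
  refine sum_congr rfl fun y _ => ?_
  by_cases hu : u ≤ y
  · have h2 : ∀ S : Finset (Fin 4), (-1) ^ S.card * ind (∀ c, u c + dirs S c ≤ y c)
        = ∏ c ∈ S, -ind (u c + 1 ≤ y c) := by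
      intro S
      rw [prod_neg, prod_ind]
      congr 1
      refine ind_congr (forall_congr' fun c => ?_)
      have : u c ≤ y c := hu c
      by_cases hc : c ∈ S
      · simp only [dirs, hc, if_true, forall_const]
        omega
      · simp only [dirs, hc, if_false, false_imp_iff, iff_true]
        omega
    simp only [h2]
    rw [← prod_one_add, ind_congr (and_iff_right hu), ← prod_ind]
    refine prod_congr rfl fun c _ => ?_
    have : u c ≤ y c := hu c
    by_cases hc : y c = u c
    · rw [ind_true hc, ind_false (by omega), neg_zero, add_zero]
    · rw [ind_false hc, ind_true (by omega)]
      rfl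
  · rw [ind_false fun h => hu h.1]
    refine sum_eq_zero fun S _ => ?_
    rw [ind_false, mul_zero]
    intro hc
    refine hu fun c => ?_
    change u c ≤ y c
    have h3 : 0 ≤ dirs S c := by
      unfold dirs
      split_ifs <;> simp
    grind

theorem IsSolid.sum_weights (h : IsSolid ρ) (hM : ∀ p ∈ ρ, ∀ c, p c < M) {D : Finset (Fin 4)}
    {v r : Fin 4 → ℕ} (hv : ∀ c, v c + r c + dirs D c = 1) :
    ∑ S ∈ D.powerset, (-1) ^ S.card * ∑ x ∈ ρ, ∑ y ∈ ρ,
        ind (∃ s, ∀ c, (crd y - crd x - dirs S - crd v) c = s)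
      = ∑ s ∈ range M, (∑ y ∈ ρ, ind ((fun c => v c + s) ≤ y ∧ ∀ c ∈ D, y c = v c + s)
        + (-1) ^ D.card * ∑ y ∈ ρ, ind ((fun c => r c + s) ≤ y ∧ ∀ c ∈ D, y c = r c + s)) := by
  have h1 : ∀ S ∈ D.powerset, ∀ x ∈ ρ, ∀ y ∈ ρ, ind (∃ s, ∀ c, (crd y - crd x - dirs S - crd v) c = s)
      = ∑ s ∈ range M, (ind (∀ c, crd y c = crd x c + (v c + s : ℕ) + dirs S c)
        + ind (∀ c, crd x c = crd y c + (r c + s : ℕ) + dirs (D \ S) c)) := by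
    intro S hS x hx y hy
    have hchi : ∀ c, 0 ≤ dirs S c ∧ dirs D c = dirs S c + dirs (D \ S) c := by
      intro c
      have h2 : c ∈ S → c ∈ D := fun h => mem_powerset.1 hS h
      simp only [dirs, mem_sdiff]
      grind
    simp only [Pi.sub_apply, crd]
    rw [sum_add_distrib]
    have hneg : ∀ s : ℕ, (∀ c, (x c : ℤ) = y c + (r c + s : ℕ) + dirs (D \ S) c)
        ↔ ∀ c, (y c : ℤ) - x c - dirs S c - v c = -(s + 1 : ℤ) := by grind
    have hpos : ∀ s : ℕ, (∀ c, (y c : ℤ) = x c + (v c + s : ℕ) + dirs S c)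
        ↔ ∀ c, (y c : ℤ) - x c - dirs S c - v c = s := by grind
    simp only [hneg, hpos]
    by_cases hs : ∃ s, ∀ c, (y c : ℤ) - x c - dirs S c - v c = s
    · rw [ind_true hs]
      obtain ⟨s, hs⟩ := hs
      have hy := hM y hy 0
      have hx := hM x hx 0
      have h2 := hs 0
      have h3 := hv 0
      have h4 := hchi 0
      have h5 : 0 ≤ dirs (D \ S) 0 := by
        unfold dirs
        split_ifs <;> simp
      rcases le_or_gt 0 s with h0 | h0
      · obtain ⟨t, rfl⟩ := Int.eq_ofNat_of_zero_le h0
        rw [sum_eq_single_of_mem t (mem_range.2 (by omega)), ind_true hs,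
          sum_eq_zero, add_zero]
        · exact fun m _ => ind_false fun hm => by have := hm 0; omega
        · exact fun m _ hm => ind_false fun h => hm (by have := h 0; omega)
      · obtain ⟨t, ht⟩ : ∃ t : ℕ, s = -(t + 1 : ℤ) := ⟨(-s - 1).toNat, by omega⟩
        rw [ht] at hs
        rw [sum_eq_zero, sum_eq_single_of_mem t (mem_range.2 (by omega)),
          ind_true hs, zero_add]
        · exact fun m _ hm => ind_false fun h => hm (by have := h 0; have := hs 0; omega)
        · exact fun m _ => ind_false fun hm => by have := hm 0; omega
    · rw [ind_false hs, sum_eq_zero fun m _ => ind_false fun h => hs ⟨_, h⟩,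
        sum_eq_zero fun m _ => ind_false fun h => hs ⟨_, h⟩, add_zero]
  have h2 : ∀ S ∈ D.powerset, (-1) ^ S.card * ∑ x ∈ ρ, ∑ y ∈ ρ,
        ind (∃ s, ∀ c, (crd y - crd x - dirs S - crd v) c = s)
      = ∑ s ∈ range M, ((-1) ^ S.card * ∑ x ∈ ρ, ∑ y ∈ ρ,
          ind (∀ c, crd y c = crd x c + (v c + s : ℕ) + dirs S c)
        + (-1) ^ D.card * ((-1) ^ (D \ S).card * ∑ x ∈ ρ, ∑ y ∈ ρ,
          ind (∀ c, crd y c = crd x c + (r c + s : ℕ) + dirs (D \ S) c))) := by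
    intro S hS
    have h3 : ((-1) ^ D.card * (-1) ^ (D \ S).card : ℤ) = (-1) ^ S.card := by
      rw [← card_sdiff_add_card_eq_card (mem_powerset.1 hS), pow_add, mul_right_comm,
        ← mul_pow]
      simp
    rw [sum_congr rfl fun x hx => sum_congr rfl fun y hy => h1 S hS x hx y hy]
    simp only [← mul_assoc, h3, sum_comm (s := ρ) (t := range M), ← mul_add,
      ← mul_sum, sum_add_distrib]
    congr 2
    refine sum_congr rfl fun s _ => sum_comm
  rw [sum_congr rfl h2, sum_comm]
  refine sum_congr rfl fun s _ => ?_
  rw [sum_add_distrib, ← mul_sum, h.sum_pairs, ← h.sum_pairs D fun c => r c + s]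
  congr 2
  exact sum_nbij' (fun S => D \ S) (fun S => D \ S) (by simp) (by simp)
    (fun S hS => Finset.sdiff_sdiff_eq_self (Finset.mem_powerset.1 hS))
    (fun S hS => Finset.sdiff_sdiff_eq_self (Finset.mem_powerset.1 hS)) fun S _ => rfl

end Index
end QQ

namespace QQ
open Finset Complex Function Polynomial

section Coefficients
open Classical

/-! ## The coefficients -/

variable {ε : Fin 4 → ℂ} {κ : ℂ} {a b : Fin 4} {N M : ℕ} {ρ : Finset (Fin 4 → ℕ)}

/-- The character of pairs of boxes. -/
def pairChar (ε : Fin 4 → ℂ) (D : Finset (Fin 4)) (ρ : Finset (Fin 4 → ℕ)) : Character :=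
  PDual ε D * boxCharDual ε ρ * boxChar ε ρ

theorem IsGenericLog.trivMult_pair (h : IsGenericLog ε κ) (hs : IsSolid ρ) (hM : ∀ p ∈ ρ, ∀ c, p c < M)
    {D : Finset (Fin 4)} {v r : Fin 4 → ℕ} (hv : ∀ c, v c + r c + dirs D c = 1) :
    trivMult (MonoidAlgebra.single (mono ε (-crd v)) 1 * pairChar ε D ρ)
      = ∑ s ∈ range M, ∑ y ∈ ρ, (ind ((fun c => v c + s) ≤ y ∧ ∀ c ∈ D, y c = v c + s)
        + (-1) ^ D.card * ind ((fun c => r c + s) ≤ y ∧ ∀ c ∈ D, y c = r c + s)) := by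
  simp only [sum_add_distrib (s := ρ), ← mul_sum]
  rw [← hs.sum_weights hM hv, pairChar, pairChar_eq]
  simp only [map_sum, trivMult_single, h.mono_eq_one, mul_sum]

theorem exists_bound (ρ : Finset (Fin 4 → ℕ)) : ∃ M, ∀ p ∈ ρ, ∀ c, p c < M :=
  ⟨ρ.sup (fun p => univ.sup p) + 1, fun _ hp c => Nat.lt_succ_of_le
    ((le_sup (mem_univ c)).trans (le_sup (f := fun p => univ.sup p) hp))⟩

theorem sum_ind_unique {P : ℕ → Prop} {t : ℕ} (ht : t < M) (hP : ∀ s, P s → s = t) :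
    ∑ s ∈ range M, ind (P s) = ind (P t) :=
  sum_eq_single_of_mem t (mem_range.2 ht) fun s _ hs => ind_false fun h => hs (hP s h)

theorem IsGenericLog.trivMult_erase (h : IsGenericLog ε κ) (hs : IsSolid ρ) (b : Fin 4) :
    trivMult (pairChar ε (univ.erase b) ρ) = trivMult (boxChar ε ρ) := by
  obtain ⟨M, hM⟩ := exists_bound ρ
  have h1 := h.trivMult_pair hs hM (D := univ.erase b) (v := 0) (r := fun c => if c = b then 1 else 0)
    (fun c => by by_cases hc : c = b <;> simp [dirs, hc])
  have h0 : crd 0 = 0 := rfl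
  rw [h0, neg_zero, mono_zero, ← MonoidAlgebra.one_def, one_mul] at h1
  rw [h1, sum_comm, boxChar, map_sum]
  refine sum_congr rfl fun y hy => ?_
  rw [wt, expU_logBox, trivMult_single, one_mul, ind_congr (h.mono_eq_one _),
    card_erase_of_mem (mem_univ b), card_univ, Fintype.card_fin]
  have h2 : ∀ s, ind ((fun c => (0 : Fin 4 → ℕ) c + s) ≤ y ∧ ∀ c ∈ univ.erase b,
      y c = (0 : Fin 4 → ℕ) c + s) + (-1) ^ (4 - 1) * ind ((fun c => (if c = b then 1 else 0) + s) ≤ y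
        ∧ ∀ c ∈ univ.erase b, y c = (if c = b then 1 else 0) + s) = ind (∀ c, y c = s) := by
    intro s
    simp only [Pi.le_def, mem_erase, mem_univ, and_true, Pi.zero_apply, zero_add]
    by_cases hc : ∀ c, c ≠ b → y c = s
    · have e1 : (∀ c, y c = s) ↔ y b = s := ⟨fun h => h b, fun h c => by
        by_cases hcb : c = b
        exacts [hcb ▸ h, hc c hcb]⟩
      have e2 : ((∀ c, s ≤ y c) ∧ ∀ c, c ≠ b → y c = s) ↔ s ≤ y b := ⟨fun h => h.1 b, fun h => ⟨fun c => by
        by_cases hcb : c = b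
        exacts [hcb ▸ h, (hc c hcb).ge], hc⟩⟩
      have e3 : ((∀ c, (if c = b then 1 else 0) + s ≤ y c) ∧ ∀ c, c ≠ b → y c = (if c = b then 1 else 0) + s)
          ↔ s < y b := ⟨fun h => by simpa [Nat.add_comm] using h.1 b, fun h => ⟨fun c => by
        by_cases hcb : c = b
        · grind
        · simpa [hcb] using (hc c hcb).ge, fun c hcb => by simpa [hcb] using hc c hcb⟩⟩
      rw [ind_congr e1, ind_congr e2, ind_congr e3]
      unfold ind
      omega
    · rw [ind_false fun h => hc h.2, ind_false, ind_false fun h => hc fun c _ => h c]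
      · rfl
      · grind
  simp only [h2]
  rw [sum_ind_unique (hM y hy b) fun s hs => (hs b).symm]
  exact ind_congr ⟨fun h => ⟨y b, fun c => by rw [crd, h c]⟩, fun ⟨s, hs⟩ c => by
    have := hs c
    have := hs b
    simp only [crd] at *
    omega⟩

theorem IsGenericLog.trivMult_K (h : IsGenericLog ε κ) (v : Fin 4 → ℤ) (n : ℤ) :
    trivMult (wt (expU (-κ)) * MonoidAlgebra.single (mono ε v) n) = 0 := by
  rw [wt, MonoidAlgebra.single_mul_single, trivMult_single, ind_false, mul_zero]
  intro h1
  rw [expU_neg, inv_mul_eq_one] at h1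
  exact h.ne v (by rw [← mono_coe, ← h1]; rfl)

theorem boxChar_eq (ρ : Finset (Fin 4 → ℕ)) :
    boxChar ε ρ = ∑ p ∈ ρ, MonoidAlgebra.single (mono ε (crd p)) 1 := by
  simp only [boxChar, wt, expU_logBox]

theorem mono_crd (p : Fin 4 → ℕ) : (mono ε (crd p) : ℂ) = exp (logBox ε p) := by
  rw [← expU_logBox]
  rfl

/-- The contribution of the framing to the index. -/
def frame (ε : Fin 4 → ℂ) (κ : ℂ) (w : ℂ) (ρ : Finset (Fin 4 → ℕ)) : ℂ :=
  ∏ p ∈ ρ, dr (exp κ * (w / exp (logBox ε p))) / dr (w / exp (logBox ε p))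

theorem redIndex_frame (v : Fin 4 → ℤ) (ρ : Finset (Fin 4 → ℕ)) :
    redIndex (MonoidAlgebra.single (mono ε (-v)) 1 * ((1 - wt (expU (-κ))) * boxChar ε ρ))
      = (frame ε κ (mono ε v) ρ)⁻¹ := by
  rw [sub_mul, one_mul, mul_sub, redIndex_sub, boxChar_eq, mul_sum, mul_sum, mul_sum,
    redIndex_sum, redIndex_sum, frame, ← prod_div_distrib, ← prod_inv_distrib]
  refine prod_congr rfl fun p _ => ?_
  have e1 : (expU κ : ℂ) = exp κ := rfl
  simp only [wt, MonoidAlgebra.single_mul_single, redIndex_single, expU_neg, mono_neg, Units.val_mul,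
    mul_inv_rev, Units.val_inv_eq_inv_val, inv_inv, mul_one, zpow_one, mono_crd, e1, inv_div]
  congr 2 <;> ring

theorem IsGenericLog.ZD8_eq (h : IsGenericLog ε κ) (hs : IsSolid ρ) (b : Fin 4) :
    ZD8 ε κ b ρ = frame ε κ 1 ρ * redIndex (pairChar ε (univ.erase b) ρ) := by
  have h1 := redIndex_frame (ε := ε) (κ := κ) 0 ρ
  rw [neg_zero, mono_zero, ← MonoidAlgebra.one_def, one_mul, Units.val_one] at h1
  rw [ZD8, index_eq, redIndex_add, redIndex_neg, h1, inv_inv, pairChar]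
  rw [map_add, ← pairChar, h.trivMult_erase hs, map_neg, sub_mul, one_mul, map_sub]
  have h2 : trivMult (wt (expU (-κ)) * boxChar ε ρ) = 0 := by
    rw [boxChar_eq, mul_sum, map_sum]
    exact sum_eq_zero fun p _ => h.trivMult_K _ _
  omega

theorem IsGenericLog.ZD6_eq (h : IsGenericLog ε κ) (hs : IsPlane a ρ) :
    ZD6 ε κ a ρ = frame ε κ 1 ρ / frame ε κ (exp (ε a)) ρ
      * redIndex (pairChar ε (univ.erase a) ρ) := by
  have h0 : PDual ε {a} = 1 - MonoidAlgebra.single (mono ε (-dirs {a})) 1 := by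
    rw [PDual, prod_singleton, wt, expU_neg, expU_dir, mono_neg]
  have h1 := redIndex_frame (ε := ε) (κ := κ) 0 ρ
  have h2 := redIndex_frame (ε := ε) (κ := κ) (dirs {a}) ρ
  rw [neg_zero, mono_zero, ← MonoidAlgebra.one_def, one_mul, Units.val_one] at h1
  have h4 : ((mono ε (dirs {a}) : ℂˣ) : ℂ) = exp (ε a) := by
    rw [← expU_dir]
    rfl
  rw [ZD6, h0, mul_assoc (_ - _), index_eq, redIndex_add, redIndex_neg, sub_mul, one_mul, redIndex_sub, h1, h2,
    h4, inv_div, div_inv_eq_mul, inv_mul_eq_div, pairChar]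
  rw [map_add, ← pairChar, h.trivMult_erase hs.1, map_neg, sub_mul, one_mul, map_sub, sub_mul, one_mul, map_sub,
    mul_sub, map_sub, boxChar_eq]
  simp only [mul_sum, map_sum]
  rw [sum_eq_zero fun p _ => h.trivMult_K (crd p) 1,
    sum_eq_zero (f := fun p => trivMult (MonoidAlgebra.single (mono ε (-dirs {a})) 1 * _)) fun p hp => ?_,
    sum_eq_zero (f := fun p => trivMult (_ * (_ * _))) fun p hp => ?_]
  · ring
  · rw [mul_left_comm, MonoidAlgebra.single_mul_single, ← mono_add]
    exact h.trivMult_K _ _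
  · rw [MonoidAlgebra.single_mul_single, ← mono_add, trivMult_single, ind_congr (h.mono_eq_one _), ind_false,
      mul_zero]
    rintro ⟨s, hs'⟩
    have h5 := hs' a
    have h6 := hs' (a + 1)
    have h7 : a + 1 ≠ a := by fin_cases a <;> decide
    have h8 := hs.2 p hp
    simp [dirs, crd, h7, h8] at h5 h6
    omega

theorem mono_dirs (S : Finset (Fin 4)) : (mono ε (dirs S) : ℂ) = ∏ c ∈ S, exp (ε c) := by
  rw [mono_coe, ← univ_inter S, ← prod_ite_mem]
  refine prod_congr rfl fun c _ => ?_
  rw [univ_inter, dirs]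
  split_ifs <;> simp

theorem IsGenericLog.redIndex_pair (h : IsGenericLog ε κ) (a : Fin 4) (ρ : Finset (Fin 4 → ℕ)) :
    redIndex (pairChar ε (univ.erase a) ρ) = ∏ p ∈ ρ, ∏ p' ∈ ρ, ∏ T : Finset (Fin 3),
      dr (wt3 (par ε a) ((bx a p).1 + disp T - (bx a p').1)) ^ ((-1) ^ T.card : ℤ) := by
  have h0 := pairChar_eq ε (univ.erase a) ρ 0
  rw [neg_zero, mono_zero, ← MonoidAlgebra.one_def, one_mul] at h0
  have h1 : (univ.erase a).powerset
      = (univ : Finset (Finset (Fin 3))).image fun T => T.image a.succAbove := by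
    ext S
    rw [mem_powerset, ← compl_singleton, ← Fin.image_succAbove_univ, subset_image_iff,
      mem_image]
    simp
  have hq := h.isGeneric a
  rw [pairChar, h0, redIndex_sum, h1, prod_image
    ((image_injective Fin.succAbove_right_injective).injOn)]
  simp only [redIndex_sum, redIndex_single]
  rw [prod_comm]
  refine prod_congr rfl fun p _ => ?_
  rw [prod_comm]
  refine prod_congr rfl fun p' _ => prod_congr rfl fun T _ => ?_
  rw [card_image_of_injective _ Fin.succAbove_right_injective, sub_zero, sub_eq_add_neg, mono_add,
    sub_eq_add_neg, mono_add, mono_neg, mono_neg, hq.sub, hq.add, hq.wt_disp, h.wt_bx, h.wt_bx]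
  simp only [Units.val_mul, Units.val_inv_eq_inv_val, mono_crd, mono_dirs, mul_inv_rev, inv_inv]
  rw [prod_image Fin.succAbove_right_injective.injOn]
  congr 2
  simp only [par]
  ring

theorem IsGenericLog.prod_frame (h : IsGenericLog ε κ) (a : Fin 4) (l : ℕ) (ρ : Finset (Fin 4 → ℕ)) :
    ∏ x ∈ ρ.image (bx a), ∏ s : Fin 4,
        dr (facConst (par ε a) (exp κ) (.inr (x, l, s))) ^ facExp (.inr (x, l, s))
      = frame ε κ (exp (ε a) ^ l) ρ / frame ε κ (exp (ε a) ^ (l + 1)) ρ := by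
  rw [prod_image (bx_injective a).injOn, frame, frame, ← prod_div_distrib]
  refine prod_congr rfl fun p _ => ?_
  have e1 : qprod (par ε a) ^ (-(l : ℤ)) = exp (ε a) ^ l := by
    rw [h.exp_eq, inv_pow, zpow_neg, zpow_natCast]
  have e2 : qprod (par ε a) ^ (-(l : ℤ) - 1) = exp (ε a) ^ (l + 1) := by
    rw [h.exp_eq, inv_pow, ← zpow_natCast, ← zpow_neg]
    grind
  rw [Fin.prod_univ_four]
  simp only [facConst, facExp, (h.isGeneric a).sub, wt_frame, h.wt_bx, Matrix.cons_val, sub_zero, e1, e2,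
    one_mul, zpow_neg, zpow_one]
  grind

theorem exp_update (p : Fin 4 → ℕ) :
    exp (logBox ε (update p a 0)) = exp (logBox ε p) / exp (ε a) ^ p a := by
  rw [exp_logBox, exp_logBox, Fin.prod_univ_succAbove _ a, Fin.prod_univ_succAbove _ a]
  simp [exp_ne_zero]

theorem prod_layer (i : ℕ) (F : (Fin 4 → ℕ) → ℂ) :
    ∏ p ∈ layer a i ρ, F p = ∏ p ∈ ρ.filter (fun p => p a = i), F (update p a 0) :=
  sum_layer (M := Additive ℂ) i F

theorem frame_layer (w : ℂ) (i : ℕ) (ρ : Finset (Fin 4 → ℕ)) :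
    frame ε κ w (layer a i ρ) = frame ε κ (exp (ε a) ^ i * w) (ρ.filter fun p => p a = i) := by
  rw [frame, prod_layer, frame]
  refine prod_congr rfl fun p hp => ?_
  rw [exp_update, (mem_filter.1 hp).2, div_div_eq_mul_div, mul_comm w]

theorem IsGenericLog.diagFac_eq (h : IsGenericLog ε κ) (ht : IsTower a N ρ) :
    diagFac (par ε a) (exp κ) (ρ.image (bx a)) N = ∏ i ∈ range N, ZD6 ε κ a (layer a i ρ) := by
  refine prod_congr rfl fun i _ => ?_
  have h1 : (ρ.image (bx a)).filter (fun x => x.2 = i) = (ρ.filter fun p => p a = i).image (bx a) := by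
    rw [filter_image]
    rfl
  rw [h.ZD6_eq (ht.isPlane i), frame_layer, frame_layer, mul_one, ← pow_succ, ← h.prod_frame,
    h.redIndex_pair, facPart, prod_disjSum, prod_product, prod_product, h1, mul_comm]
  congr 1
  rw [prod_image (bx_injective a).injOn, prod_layer]
  refine prod_congr rfl fun p hp => ?_
  rw [prod_product, prod_image (bx_injective a).injOn, prod_layer]
  refine prod_congr rfl fun p' hp' => prod_congr rfl fun T _ => ?_
  have e : ∀ p, (bx a (update p a 0)).1 = (bx a p).1 + ((0, 0), (p a : ℤ)) := fun p => by
    ext <;> simp [bx]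
  rw [facConst, facExp, e, e, (mem_filter.1 hp).2, (mem_filter.1 hp').2,
    add_right_comm, add_sub_add_right_eq_sub]

/-- The coefficients in the product of finitely many `qq`-characters. -/
def stackCoeff (ε : Fin 4 → ℂ) (κ : ℂ) (a : Fin 4) (N : ℕ) (ρ : Finset (Fin 4 → ℕ)) : ℂ :=
  (-1) ^ vacCount (hgt a ρ) (range (N - 1 + 1)) * facProd (fun _ => (1 : ℂ))
    (facIdx (ρ.image (bx a)) N) (facConst (par ε a) (exp κ)) facExp (facSrc Prod.snd) (facTgt Prod.snd)

theorem IsGenericLog.facProd_one (h : IsGenericLog ε κ) (N : ℕ) (ρ : Finset (Fin 4 → ℕ)) :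
    facProd (fun _ => (1 : ℂ)) (facIdx (ρ.image (bx a)) N) (facConst (par ε a) (exp κ)) facExp
        (facSrc Prod.snd) (facTgt Prod.snd)
      = frame ε κ 1 ρ * redIndex (pairChar ε (univ.erase a) ρ) / frame ε κ (exp (ε a) ^ N) ρ := by
  have h0 : ∀ w, frame ε κ w ρ ≠ 0 := fun w =>
    prod_ne_zero_iff.2 fun p _ => div_ne_zero (dr_ne_zero _) (dr_ne_zero _)
  have h1 : ∏ l ∈ range N, (∏ x ∈ ρ.image (bx a), ∏ s : Fin 4,
      dr (facConst (par ε a) (exp κ) (.inr (x, l, s))) ^ facExp (.inr (x, l, s)))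
      = frame ε κ 1 ρ / frame ε κ (exp (ε a) ^ N) ρ := by
    induction N with
    | zero => simp [h0]
    | succ N ih => rw [prod_range_succ, ih, h.prod_frame, div_mul_div_cancel₀ (h0 _)]
  rw [mul_div_right_comm, ← h1, facProd, facIdx, prod_disjSum, mul_comm]
  simp only [prod_product, div_one, mul_one, Algebra.algebraMap_self_apply]
  congr 1
  · exact prod_comm
  · rw [h.redIndex_pair, prod_image (bx_injective a).injOn]
    refine prod_congr rfl fun p _ => ?_
    rw [prod_image (bx_injective a).injOn]
    rfl

theorem IsGenericLog.isRegLimit_frame (h : IsGenericLog ε κ) (a : Fin 4) (ρ : Finset (Fin 4 → ℕ)) :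
    IsRegLimit (exp (ε a)) (fun N => (frame ε κ (exp (ε a) ^ N) ρ)⁻¹) 1 := by
  obtain ⟨M, hM⟩ := exists_bound ρ
  refine ⟨∏ p ∈ ρ, (1 - C (exp (logBox ε p))⁻¹ * X),
    ∏ p ∈ ρ, (1 - C (exp κ * (exp (logBox ε p))⁻¹) * X), ?_,
    Filter.eventually_atTop.2 ⟨M, fun N hN => ?_⟩, ?_⟩
  · simp [eval_prod]
  · have h1 : ∀ p ∈ ρ, exp (ε a) ^ N / exp (logBox ε p) ≠ 1 := by
      intro p hp he
      rw [div_eq_one_iff_eq (exp_ne_zero _), ← mono_crd, ← exp_nat_mul] at he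
      have h2 : mono ε (crd p - crd (update 0 a N)) = 1 := by
        rw [sub_eq_add_neg, mono_add, mono_neg, mul_inv_eq_one]
        refine Units.ext (he.symm.trans ?_)
        rw [mono_crd, logBox, sum_eq_single a]
        · simp
        · intro c _ hc
          simp [hc]
        · simp
      obtain ⟨s, hs⟩ := (h.mono_eq_one _).1 h2
      have h3 := hs a
      have h4 := hs (a + 1)
      have h5 : a + 1 ≠ a := by fin_cases a <;> decide
      have h6 := hM p hp a
      simp [crd, h5] at h3 h4
      omega
    have h2 : ∀ p, exp κ * (exp (ε a) ^ N / exp (logBox ε p)) ≠ 1 := by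
      intro p he
      have h3 := (h.isGeneric a).mul_wt_ne (((0, 0), -(N : ℤ)) - (bx a p).1)
      rw [(h.isGeneric a).sub, wt_frame, h.wt_bx, zpow_neg, zpow_natCast, ← inv_pow, ← h.exp_eq] at h3
      exact h3 he
    simp only [eval_prod, eval_sub, eval_one, eval_mul,
      eval_C, eval_X]
    constructor
    · refine prod_ne_zero_iff.2 fun p _ => ?_
      grind
    · rw [frame, ← prod_inv_distrib, ← prod_div_distrib]
      refine prod_congr rfl fun p hp => ?_
      rw [dr_of_ne (h1 p hp), dr_of_ne (h2 p), inv_div, mul_assoc, inv_mul_eq_div]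
  · simp [eval_prod]

theorem IsRegLimit.congr {q v : ℂ} {s t : ℕ → ℂ} (h : IsRegLimit q s v)
    (hst : ∀ᶠ N in Filter.atTop, s N = t N) : IsRegLimit q t v := by
  obtain ⟨P, Q, hQ, hs, hv⟩ := h
  exact ⟨P, Q, hQ, (hs.and hst).mono fun N hN => ⟨hN.1.1, hN.2 ▸ hN.1.2⟩, hv⟩

theorem IsRegLimit.mul {q v w : ℂ} {s t : ℕ → ℂ} (h : IsRegLimit q s v) (h' : IsRegLimit q t w) :
    IsRegLimit q (fun N => s N * t N) (v * w) := by
  obtain ⟨P, Q, hQ, hs, rfl⟩ := h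
  obtain ⟨P', Q', hQ', hs', rfl⟩ := h'
  refine ⟨P * P', Q * Q', by simp [hQ, hQ'], (hs.and hs').mono fun N hN => ?_, by
    simp [div_mul_div_comm]⟩
  dsimp only
  rw [hN.1.2, hN.2.2, div_mul_div_comm, eval_mul, eval_mul]
  grind

theorem isRegLimit_const (q v : ℂ) : IsRegLimit q (fun _ => v) v :=
  ⟨C v, 1, by simp, by simp, by simp⟩

theorem signExp_eq (hM : ∀ p ∈ ρ, ∀ c, p c < M) (b : Fin 4) :
    (signExp b ρ : ℤ) = ∑ y ∈ ρ, ∑ s ∈ range M, ind ((∀ c, c ≠ b → y c = s) ∧ s < y b) := by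
  rw [signExp, card_filter, Nat.cast_sum]
  refine sum_congr rfl fun y hy => ?_
  have h5 : b + 1 ≠ b := by fin_cases b <;> decide
  rw [sum_ind_unique (hM y hy (b + 1)) fun s hs => (hs.1 _ h5).symm, Nat.cast_ite]
  rw [Nat.cast_one, Nat.cast_zero]
  exact ind_congr (P := ∃ i : ℕ, (∀ c, c ≠ b → y c = i) ∧ i < y b) ⟨fun ⟨i, h1, h2⟩ => by
    rw [h1 _ h5]
    exact ⟨h1, h2⟩, fun h => ⟨_, h⟩⟩

theorem IsTower.vacCount_eq (ht : IsTower a N ρ) (hM : ∀ p ∈ ρ, ∀ c, p c < M) :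
    vacCount (hgt a ρ) (range M) = signExp a ρ := by
  rw [signExp_eq hM]
  have h1 : ∀ l k : ℕ, (k < l ∧ -(k : ℤ) ≤ hgt a ρ l (0, 0))
      ↔ ∃ y ∈ ρ, y a = l ∧ ∃ s, (∀ c, c ≠ a → y c = s) ∧ s + k + 1 = l := by
    intro l k
    rw [show -(k : ℤ) ≤ hgt a ρ l (0, 0) ↔ -(k : ℤ) - 1 < hgt a ρ l (0, 0) by omega, ht.lt_hgt, Under]
    constructor
    · rintro ⟨hk, h | h | h | ⟨p, hp, e, e0, e1, e2⟩⟩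
      · omega
      · omega
      · omega
      · refine ⟨p, hp, e, l - k - 1, fun c hc => ?_, by omega⟩
        obtain ⟨t, rfl⟩ := Fin.exists_succAbove_eq hc
        fin_cases t
        · grind
        · grind
        · grind
    · rintro ⟨p, hp, e, s, hs, hl⟩
      have h0 := hs _ (Fin.succAbove_ne a 0)
      have h1 := hs _ (Fin.succAbove_ne a 1)
      have h2 := hs _ (Fin.succAbove_ne a 2)
      grind
  have h2 : ∀ l k : ℕ, ind (k < l ∧ -(k : ℤ) ≤ hgt a ρ l (0, 0))
      = ∑ y ∈ ρ, ind (y a = l ∧ ∃ s, (∀ c, c ≠ a → y c = s) ∧ s + k + 1 = l) := by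
    intro l k
    by_cases hc : ∃ y ∈ ρ, y a = l ∧ ∃ s, (∀ c, c ≠ a → y c = s) ∧ s + k + 1 = l
    · rw [ind_true ((h1 l k).2 hc)]
      obtain ⟨y, hy, hyl, s, hs, e⟩ := hc
      rw [sum_eq_single_of_mem y hy, ind_true ⟨hyl, s, hs, e⟩]
      rintro y' - hne
      refine ind_false fun ⟨hyl', s', hs', e'⟩ => hne (funext fun c => ?_)
      grind
    · rw [ind_false fun h => hc ((h1 l k).1 h)]
      exact (sum_eq_zero fun y hy => ind_false fun h => hc ⟨y, hy, h⟩).symm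
  simp only [vacCount, h2, sum_comm (t := ρ)]
  refine sum_congr rfl fun y hy => ?_
  have hya := hM y hy a
  rw [sum_eq_single_of_mem (y a) (mem_range.2 hya)]
  · by_cases hc : ∃ s, (∀ c, c ≠ a → y c = s) ∧ s < y a
    · obtain ⟨s, hs, hl⟩ := hc
      have h5 : a + 1 ≠ a := by fin_cases a <;> decide
      rw [sum_ind_unique (t := y a - 1 - s) (by omega) fun k ⟨_, s', hs', e⟩ => by
        rw [← hs _ h5, hs' _ h5]
        omega, sum_ind_unique (t := s) (by omega) fun s' hs' => by rw [← hs _ h5, hs'.1 _ h5],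
        ind_true ⟨rfl, s, hs, by omega⟩, ind_true ⟨hs, hl⟩]
    · rw [sum_eq_zero fun s _ => ind_false fun h => hc ⟨s, h⟩,
        sum_eq_zero fun k _ => ind_false fun ⟨_, s, hs, e⟩ => hc ⟨s, hs, by omega⟩]
  · exact fun l _ hl => sum_eq_zero fun k _ => ind_false fun h => hl h.1.symm

end Coefficients
end QQ

namespace QQ
open Finset Complex

section Signs
open Classical

/-! ## Independence of the special direction -/

variable {ε : Fin 4 → ℂ} {κ : ℂ} {a b : Fin 4} {N M : ℕ} {ρ : Finset (Fin 4 → ℕ)}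

theorem dr_inv {w : ℂ} (hw : w ≠ 0) : dr w⁻¹ = dr w * (-w⁻¹ * (-1) ^ ind (w = 1)) := by
  by_cases h : w = 1
  · simp [h, dr_one, ind_true]
  · rw [ind_false h, dr_of_ne h, dr_of_ne (by rwa [Ne, inv_eq_one])]
    field_simp
    ring

theorem exists_complement (h : a ≠ b) : ∃ c d : Fin 4, c ≠ d ∧ a ≠ c ∧ a ≠ d ∧ b ≠ c ∧ b ≠ d ∧
    univ.erase a = insert b {c, d} ∧ univ.erase b = insert a {c, d} ∧
    univ = {a, b, c, d} := by
  revert a b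
  decide

theorem pairChar_insert {D : Finset (Fin 4)} {c : Fin 4} (hc : c ∉ D) : pairChar ε (insert c D) ρ
    = pairChar ε D ρ - MonoidAlgebra.single (mono ε (-dirs {c})) 1 * pairChar ε D ρ := by
  rw [pairChar, PDual, prod_insert hc, ← PDual, wt, expU_neg, expU_dir, ← mono_neg, pairChar]
  ring

theorem redIndex_shift {c d : Fin 4} (h : IsGenericLog ε κ) (hab : a ≠ b) (hcd : c ≠ d)
    (hu : univ = ({a, b, c, d} : Finset (Fin 4))) (hac : a ≠ c) (had : a ≠ d) (hbc : b ≠ c)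
    (hbd : b ≠ d) :
    redIndex (MonoidAlgebra.single (mono ε (-dirs {a})) 1 * pairChar ε {c, d} ρ)
      = redIndex (MonoidAlgebra.single (mono ε (-dirs {b})) 1 * pairChar ε {c, d} ρ)
        * (-1) ^ trivMult (MonoidAlgebra.single (mono ε (-dirs {a})) 1 * pairChar ε {c, d} ρ) := by
  set D : Finset (Fin 4) := {c, d} with hD
  set m : (Fin 4 → ℕ) → (Fin 4 → ℕ) → Finset (Fin 4) → ℂˣ :=
    fun p p' S => mono ε (crd p' - crd p - dirs S - dirs {a}) with hm
  have e1 : redIndex (MonoidAlgebra.single (mono ε (-dirs {b})) 1 * pairChar ε D ρ)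
      = ∏ S ∈ D.powerset, ∏ p ∈ ρ, ∏ p' ∈ ρ, dr (m p p' S : ℂ) ^ ((-1) ^ S.card : ℤ) := by
    rw [pairChar, pairChar_eq]
    simp only [redIndex_sum, redIndex_single]
    refine prod_nbij' (fun S => D \ S) (fun S => D \ S) (by simp) (by simp)
      (fun S hS => Finset.sdiff_sdiff_eq_self (Finset.mem_powerset.1 hS))
      (fun S hS => Finset.sdiff_sdiff_eq_self (Finset.mem_powerset.1 hS)) fun S hS => ?_
    rw [prod_comm]
    refine prod_congr rfl fun p _ => prod_congr rfl fun p' _ => ?_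
    have h1 : mono ε (crd p - crd p' - dirs S - dirs {b}) = (m p p' (D \ S))⁻¹ := by
      rw [hm, ← mono_neg, ← div_eq_one, div_eq_mul_inv, ← mono_neg, ← mono_add, h.mono_eq_one]
      have hS' := mem_powerset.1 hS
      refine ⟨-1, fun i => ?_⟩
      have hi : i ∈ ({a, b, c, d} : Finset (Fin 4)) := hu ▸ mem_univ i
      have ha : a ∉ S := fun h => by simpa [hD, hac, had] using hS' h
      have hb : b ∉ S := fun h => by simpa [hD, hbc, hbd] using hS' h
      simp only [mem_insert, mem_singleton] at hi
      rcases hi with rfl | rfl | rfl | rfl <;>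
        simp [dirs, crd, hD, hab, hab.symm, hac, had, hbc, hbd, hac.symm, had.symm, hbc.symm, hbd.symm, hcd,
          ha, hb, mem_sdiff] <;> (try split_ifs) <;> ring
    have h2 : ((-1) ^ S.card : ℤ) = (-1) ^ (D \ S).card := by
      have h3 := card_sdiff_add_card_eq_card (mem_powerset.1 hS)
      grind
    rw [h1, h2, Units.val_inv_eq_inv_val, inv_inv]
  rw [e1, pairChar, pairChar_eq, map_sum]
  simp only [redIndex_sum, redIndex_single, map_sum, trivMult_single]
  have h3 : ∀ {ι : Type} (s : Finset ι) (n : ι → ℤ), (-1 : ℂ) ^ ∑ i ∈ s, n i = ∏ i ∈ s, (-1) ^ n i :=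
    fun s n => by
      induction s using Finset.induction_on with
      | empty => simp
      | insert i s hi ih => rw [sum_insert hi, prod_insert hi, zpow_add₀ (by simp), ih]
  simp only [h3, ← prod_mul_distrib]
  rw [prod_comm, prod_comm (s := D.powerset)]
  refine prod_congr rfl fun p _ => ?_
  rw [prod_comm, prod_comm (s := D.powerset)]
  refine prod_congr rfl fun p' _ => ?_
  have h4 : ∀ S, dr ((m p p' S : ℂ)⁻¹) ^ ((-1) ^ S.card : ℤ) = (dr (m p p' S : ℂ) ^ ((-1) ^ S.card : ℤ)
      * (-1) ^ ((-1) ^ S.card * ind (m p p' S = 1))) * (-(m p p' S : ℂ)⁻¹) ^ ((-1) ^ S.card : ℤ) := by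
    intro S
    rw [dr_inv (Units.ne_zero _), mul_zpow, mul_zpow, ← zpow_mul, mul_comm (ind _),
      ind_congr (Units.val_eq_one)]
    ring
  change ∏ S ∈ D.powerset, dr ((m p p' S : ℂ)⁻¹) ^ ((-1) ^ S.card : ℤ) = _
  simp only [h4]
  rw [prod_mul_distrib, mul_eq_left₀ (prod_ne_zero_iff.2 fun S _ =>
    mul_ne_zero (zpow_ne_zero _ (dr_ne_zero _)) (zpow_ne_zero _ (by simp)))]
  have h5 : ∀ S, (m p p' S : ℂ)⁻¹ = (m p p' ∅ : ℂ)⁻¹ * ∏ i ∈ S, exp (ε i) := by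
    intro S
    have h6 : crd p' - crd p - dirs ∅ - dirs {a} = crd p' - crd p - dirs S - dirs {a} + dirs S := by
      have : dirs ∅ = 0 := by
        funext i
        simp [dirs]
      grind
    rw [hm]
    dsimp only
    rw [h6, mono_add, Units.val_mul, mono_dirs, mul_inv, inv_mul_cancel_right₀
      (prod_ne_zero_iff.2 fun _ _ => exp_ne_zero _)]
  obtain ⟨x, hx, h5⟩ : ∃ x : ℂ, x ≠ 0 ∧ ∀ S, (m p p' S : ℂ)⁻¹ = x * ∏ i ∈ S, exp (ε i) :=
    ⟨_, inv_ne_zero (Units.ne_zero (m p p' ∅)), h5⟩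
  simp only [h5]
  rw [hD, prod_powerset_insert (by simpa using hcd)]
  have h7 : (powerset {d} : Finset (Finset (Fin 4))) = {∅, {d}} := rfl
  rw [h7, prod_pair (singleton_ne_empty d).symm, prod_pair
    (singleton_ne_empty d).symm, insert_empty_eq, card_pair hcd, prod_pair hcd,
    card_empty, card_singleton, card_singleton, prod_empty,
    prod_singleton, prod_singleton]
  have h8 := exp_ne_zero (ε c)
  have h9 := exp_ne_zero (ε d)
  norm_num
  field_simp

theorem IsGenericLog.even_trivMult (h : IsGenericLog ε κ) (hs : IsSolid ρ) {c d : Fin 4} (hab : a ≠ b)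
    (hcd : c ≠ d) (hu : univ = ({a, b, c, d} : Finset (Fin 4))) (hac : a ≠ c) (had : a ≠ d)
    (hbc : b ≠ c) (hbd : b ≠ d) :
    Even (trivMult (MonoidAlgebra.single (mono ε (-dirs {a})) 1 * pairChar ε {c, d} ρ)
      + signExp a ρ + signExp b ρ) := by
  obtain ⟨M, hM⟩ := exists_bound ρ
  have hall : ∀ P : Fin 4 → Prop, (∀ i, P i) ↔ P a ∧ P b ∧ P c ∧ P d := by
    intro P
    have : (∀ i, P i) ↔ ∀ i ∈ (univ : Finset (Fin 4)), P i := by simp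
    grind
  have h1 := h.trivMult_pair hs hM (D := {c, d}) (v := fun i => if i = a then 1 else 0)
    (r := fun i => if i = b then 1 else 0) ((hall _).2 (by
      simp [dirs, hab, hab.symm, hac, had, hbc, hbd, hac.symm, had.symm, hbc.symm, hbd.symm]))
  have h2 : crd (fun i => if i = a then 1 else 0) = dirs {a} := by
    funext i
    simp [crd, dirs]
  rw [h2] at h1
  rw [h1, signExp_eq hM, signExp_eq hM, sum_comm, ← sum_add_distrib, ← sum_add_distrib]
  refine even_sum _ fun y _ => ?_
  rw [← sum_add_distrib, ← sum_add_distrib]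
  refine even_sum _ fun s _ => ?_
  simp only [Pi.le_def, hall, card_pair hcd, mem_insert, mem_singleton, forall_eq_or_imp,
    forall_eq, hab, hab.symm, hac.symm, had.symm, hbc.symm, hbd.symm, if_true, if_false,
    ne_eq, not_true, not_false_eq_true, true_implies, false_implies, true_and]
  rw [Int.even_iff]
  unfold ind
  split_ifs <;> omega

theorem IsGenericLog.sign_ZD8 (h : IsGenericLog ε κ) (hs : IsSolid ρ) (a b : Fin 4) :
    (-1) ^ signExp a ρ * ZD8 ε κ a ρ = (-1) ^ signExp b ρ * ZD8 ε κ b ρ := by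
  by_cases hab : a = b
  · rw [hab]
  obtain ⟨c, d, hcd, hac, had, hbc, hbd, e1, e2, hu⟩ := exists_complement hab
  have h1 := redIndex_shift (ρ := ρ) h hab hcd hu hac had hbc hbd
  have h2 := h.even_trivMult hs hab hcd hu hac had hbc hbd
  have h3 := redIndex_ne_zero (MonoidAlgebra.single (mono ε (-dirs {b})) 1 * pairChar ε {c, d} ρ)
  have h4 : (-1 : ℂ) ^ (trivMult (MonoidAlgebra.single (mono ε (-dirs {a})) 1 * pairChar ε {c, d} ρ))
      * ((-1) ^ signExp a ρ * (-1) ^ signExp b ρ) = 1 := by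
    rw [← zpow_natCast, ← zpow_natCast, ← mul_assoc, ← zpow_add₀ (by simp), ← zpow_add₀ (by simp)]
    exact h2.neg_one_zpow
  have h5 : ((-1 : ℂ) ^ signExp b ρ) * (-1) ^ signExp b ρ = 1 := by
    rw [← mul_pow]
    simp
  rw [h.ZD8_eq hs, h.ZD8_eq hs, e1, e2, pairChar_insert (c := b) (D := {c, d}) (by simp [hbc, hbd]),
    pairChar_insert (c := a) (D := {c, d}) (by simp [hac, had]), redIndex_sub, redIndex_sub, h1]
  grind

theorem IsGenericLog.isRegLimit_stackCoeff (h : IsGenericLog ε κ) (hs : IsSolid ρ) (a b : Fin 4) :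
    IsRegLimit (exp (ε a)) (fun N => stackCoeff ε κ a N ρ) ((-1) ^ signExp b ρ * ZD8 ε κ b ρ) := by
  obtain ⟨M, hM⟩ := exists_bound ρ
  have h1 := (isRegLimit_const _ ((-1) ^ signExp a ρ * ZD8 ε κ a ρ)).mul (h.isRegLimit_frame a ρ)
  rw [mul_one, h.sign_ZD8 hs a b] at h1
  refine h1.congr (Filter.eventually_atTop.2 ⟨M + 1, fun N hN => ?_⟩)
  have ht : IsTower a N ρ := ⟨fun p hp => (hM p hp a).trans hN, fun p hp p' hle _ => hs hle hp⟩
  rw [stackCoeff, ht.vacCount_eq (fun p hp c => (hM p hp c).trans_le (by omega)), h.facProd_one,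
    ← h.ZD8_eq hs, h.sign_ZD8 hs b a, zpow_natCast, mul_div_assoc', div_eq_mul_inv]

end Signs
end QQ

namespace QQ
open Finset Complex

section Stripped
open Classical

/-! ## The ordered product -/

variable {ε : Fin 4 → ℂ} {κ ξ τ : ℂ} {a : Fin 4} {N k : ℕ} {ρ : Finset (Fin 4 → ℕ)}

/-- The ordered product at `r = 1`, with the one-loop factor removed. -/
def ordProd (ε : Fin 4 → ℂ) (κ ξ τ : ℂ) (a : Fin 4) (N k : ℕ) : Op := fun e d =>
  ∑ ρ ∈ (solids k).filter (fun ρ => ∀ p ∈ ρ, p a < N), stackCoeff ε κ a N ρ * vertexOp ε τ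
    (∑ i ∈ range N, LambdaD6 ε κ a (layer a i ρ) (ξ + i * ε a)) e d

theorem isStrippedValue_of_hasRes {G L : Ser} {F : Rat} {v : ℂ}
    (h : 𝔰 G = 𝔰 L * expand F) (hF : HasRes evOne F v) :
    IsStrippedValue G L v := by
  obtain ⟨P, Q, hQ, h1, h2⟩ := hF
  refine ⟨P, Q, hQ, FaithfulSMul.algebraMap_injective Ser SerField ?_, (eq_div_iff hQ).2 h2.symm⟩
  rw [map_mul, map_mul, h, ← expand_algebraMap, ← expand_algebraMap, ← h1, map_mul]
  ring

theorem sum_lambdaD6 (hρ : ∀ p ∈ ρ, p a < N) :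
    ∑ i ∈ range N, LambdaD6 ε κ a (layer a i ρ) (ξ + i * ε a)
      = (∑ i ∈ range N, modes ε κ ξ a ρ i, -(ρ.card : ℤ), 0, N * (ε a * κ)) := by
  refine Prod.ext (Prod.fst_sum ..) ((Prod.snd_sum ..).trans ?_)
  simp only [lambdaD6_zero, card_layer]
  rw [card_eq_sum_card_fiberwise (f := fun p => p a) (t := range N)
    fun p hp => mem_range.2 (hρ p hp)]
  refine Prod.ext ?_ (Prod.ext ?_ ?_) <;> simp [Prod.fst_sum, Prod.snd_sum]

theorem image_bx_lt (hρ : IsTower a N ρ) : ∀ x ∈ ρ.image (bx a), x.2 < N := by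
  intro x hx
  obtain ⟨p, hp, rfl⟩ := mem_image.1 hx
  exact hρ.1 p hp

theorem IsGenericLog.sum_chain (h : IsGenericLog ε κ) (c : ℂ) (e d : Mode) :
    𝔰 (∑ ρ ∈ towers a N k, MvPowerSeries.C (c * ∏ i ∈ range N,
      ZD6 ε κ a (layer a i ρ)) * chain (heis ε) (modes ε κ ξ a ρ) d N e)
    = 𝔰 (loopProd (par ε a) (exp κ) N) * expand (algebraMap ℂ Rat c *
      ∑ f ∈ (towers a N k).image (hgt a), stackVal (par ε a) (exp κ) N 𝔯
        (fun l => 𝔯 (layVar 0 l))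
        (polFock (par ε a) (exp κ) (exp ξ) N e d) (boxes N k f) Prod.snd) := by
  rw [sum_image hgt_injOn, map_sum, map_mul, map_sum, mul_sum, mul_sum]
  refine sum_congr rfl fun ρ hρ => ?_
  obtain ⟨rfl, ht⟩ := mem_towers.1 hρ
  have h1 := (h.isGeneric a).expand_vac (exp_ne_zero κ) (exp_ne_zero ξ) (image_bx_lt ht)
  rw [h.diagFac_eq ht] at h1
  rw [ht.boxes_eq, stackVal, chain_congr d (fun i _ => h.modes_eq ξ ρ i), h.heis_eq a, chain_eq, map_mul,
    map_mul, map_mul, map_mul expand, map_mul, expand_polFock (image_bx_lt ht), expand_const]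
  change _ = _ * (_ * (_ * _))
  rw [constF, RingHom.comp_apply] at h1
  grind

theorem IsGenericLog.ordProd_eq (h : IsGenericLog ε κ) (e d : State) :
    ordProd ε κ ξ τ a N k e d = if e.1 = d.1 - k then exp (N * (ε a * κ * τ)) *
      stackSum (par ε a) (exp κ) N k ((towers a N k).image (hgt a)) (range (N - 1 + 1)) evOne
        (fun _ => 1) (polFock (par ε a) (exp κ) (exp ξ) N e.2 d.2) else 0 := by
  have h1 : (solids k).filter (fun ρ => ∀ p ∈ ρ, p a < N) = (towers a N k).filter
      fun ρ => StrictOn (range (N - 1 + 1)) (hgt a ρ) := by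
    ext ρ
    rw [mem_filter, mem_filter, mem_solids, mem_towers]
    constructor
    · rintro ⟨⟨h1, h2⟩, h3⟩
      have ht : IsTower a N ρ := ⟨h3, fun _ hp _ hle _ => h2 hle hp⟩
      exact ⟨⟨h1, ht⟩, ht.strictOn_iff.2 h2⟩
    · rintro ⟨⟨h1, ht⟩, h3⟩
      exact ⟨⟨h1, ht.strictOn_iff.1 h3⟩, ht.1⟩
  rw [ordProd, h1, stackSum, filter_image, sum_image (hgt_injOn.mono fun _ h => (mem_filter.1 h).1),
    mul_sum, ← (sum_const_zero : ∑ ρ ∈ (towers a N k).filter fun ρ =>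
    StrictOn (range (N - 1 + 1)) (hgt a ρ), (0 : ℂ) = 0), ← sum_ite_irrel]
  refine sum_congr rfl fun ρ hρ => ?_
  obtain ⟨rfl, ht⟩ := mem_towers.1 (mem_filter.1 hρ).1
  rw [vertexOp_eq, sum_lambdaD6 ht.1, ← sub_eq_add_neg, mul_ite, mul_zero]
  refine if_congr Iff.rfl ?_ rfl
  rw [stackVal, ht.boxes_eq, eval_polFock (image_bx_lt ht), stackCoeff, h.heis_eq a,
    sum_congr rfl fun i _ => h.modes_eq ξ ρ i]
  simp only [zero_mul, exp_zero, ← mul_assoc]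
  ring

theorem IsGenericLog.isStrippedValue (h : IsGenericLog ε κ) (e d : State) :
    IsStrippedValue (prodSeries ε κ τ a ξ d N k e) (oneLoopProd ε κ a N) (ordProd ε κ ξ τ a N k e d) := by
  rw [h.ordProd_eq, prodSeries_eq, h.oneLoopProd_eq]
  split_ifs with he
  · refine isStrippedValue_of_hasRes (h.sum_chain _ e.2 d.2) (HasRes.mul ?_
      (stackSum_value (h.isGeneric a) mem_image_towers _))
    have h1 := hasRes_algebraMap (𝕂 := Rat) evOne (algebraMap ℂ Poly (exp (N * (ε a * κ * τ))))
    rwa [evOne_algebraMap, ← IsScalarTower.algebraMap_apply] at h1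
  · exact ⟨0, 1, by simp, by simp, by simp⟩

end Stripped
end QQ

namespace QQ
open Finset Complex Function MvPolynomial

section Limit
open Classical

/-! ## The limit of infinitely many factors -/

variable {ε : Fin 4 → ℂ} {κ ξ τ : ℂ} {a : Fin 4} {N k : ℕ} {ρ : Finset (Fin 4 → ℕ)}

theorem isRegLimit_pow (q : ℂ) {n : ℕ} (hn : n ≠ 0) : IsRegLimit q (fun N => (q ^ N) ^ n) 0 :=
  ⟨Polynomial.X ^ n, 1, by simp, by simp, by simp [hn]⟩

theorem IsRegLimit.add {q v w : ℂ} {s t : ℕ → ℂ} (h : IsRegLimit q s v) (h' : IsRegLimit q t w) :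
    IsRegLimit q (fun N => s N + t N) (v + w) := by
  obtain ⟨P, Q, hQ, hs, rfl⟩ := h
  obtain ⟨P', Q', hQ', hs', rfl⟩ := h'
  refine ⟨P * Q' + Q * P', Q * Q', by simp [hQ, hQ'], (hs.and hs').mono fun N hN => ?_, by
    simp [div_add_div _ _ hQ hQ']⟩
  dsimp only
  rw [hN.1.2, hN.2.2, div_add_div _ _ hN.1.1 hN.2.1]
  simpa using And.imp And.left And.left hN

theorem IsRegLimit.sum {ι : Type*} {q : ℂ} {s : Finset ι} {f : ι → ℕ → ℂ} {v : ι → ℂ}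
    (h : ∀ i ∈ s, IsRegLimit q (f i) (v i)) : IsRegLimit q (fun N => ∑ i ∈ s, f i N) (∑ i ∈ s, v i) := by
  induction s using Finset.induction_on with
  | empty => simpa using isRegLimit_const q 0
  | insert i s hi ih =>
    simp only [sum_insert hi]
    exact (h i (s.mem_insert_self i)).add (ih fun j hj => h j (mem_insert_of_mem hj))

theorem IsRegLimit.prod {ι : Type*} {q : ℂ} {s : Finset ι} {f : ι → ℕ → ℂ} {v : ι → ℂ}
    (h : ∀ i ∈ s, IsRegLimit q (f i) (v i)) : IsRegLimit q (fun N => ∏ i ∈ s, f i N) (∏ i ∈ s, v i) := by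
  induction s using Finset.induction_on with
  | empty => simpa using isRegLimit_const q 1
  | insert i s hi ih =>
    simp only [prod_insert hi]
    exact (h i (s.mem_insert_self i)).mul (ih fun j hj => h j (mem_insert_of_mem hj))

theorem IsRegLimit.pow {q v : ℂ} {s : ℕ → ℂ} (h : IsRegLimit q s v) (n : ℕ) :
    IsRegLimit q (fun N => s N ^ n) (v ^ n) := by
  simpa using IsRegLimit.prod (s := range n) fun _ _ => h

theorem annihExp_add (c c' : ℤ → ℂ) (P : MvPolynomial ℕ+ ℂ) :
    annihExp ε c (annihExp ε c' P) = annihExp ε (c + c') P := by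
  refine DFunLike.congr_fun (algHom_ext (f := (annihExp ε c).comp (annihExp ε c')) fun n => ?_) P
  simp [annihExp, algHom_C, add_mul, add_assoc]

theorem creatExp_zero {c : ℤ → ℂ} (hc : ∀ n : ℕ+, c (-((n : ℕ) : ℤ)) = 0) : creatExp c = 1 := by
  ext δ
  rw [MvPowerSeries.coeff_one]
  change δ.prod (fun n k => c (-((n : ℕ) : ℤ)) ^ k / (k.factorial : ℂ)) = _
  split_ifs with h
  · rw [h, Finsupp.prod_zero_index]
  · obtain ⟨n, hn⟩ := Finsupp.ne_iff.1 h
    exact prod_eq_zero (Finsupp.mem_support_iff.2 hn) (by simp [hc, zero_pow hn])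

theorem creatExp_congr {c c' : ℤ → ℂ} (h : ∀ n : ℕ+, c (-((n : ℕ) : ℤ)) = c' (-((n : ℕ) : ℤ))) :
    creatExp c = creatExp c' := by
  funext δ
  simp only [creatExp, h]

theorem annihExp_congr {c c' : ℤ → ℂ} (h : ∀ n : ℕ+, c ((n : ℕ) : ℤ) = c' ((n : ℕ) : ℤ)) :
    annihExp ε c = annihExp ε c' := by
  unfold annihExp
  simp only [h]

/-- The basis vectors that occur in the image of `d` under the annihilation modes `W`. -/
def annihSupp (ε : Fin 4 → ℂ) (W : VExp) (d : State) : Finset State :=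
  {d.1} ×ˢ (annihExp ε W.1 (monomial d.2 1)).support

theorem vertexOp_annih {W : VExp} (hW : ∀ n : ℕ+, W.1 (-((n : ℕ) : ℤ)) = 0) (ht : W.2.1 = 0) (m d : State) :
    vertexOp ε τ W m d = if m.1 = d.1 then exp (W.2.2.2 * τ) * exp (W.2.2.1 * d.1) *
      coeff m.2 (annihExp ε W.1 (monomial d.2 1)) else 0 := by
  rw [vertexOp, creatExp_zero hW, ht, add_zero, one_mul, coeff_coe]

theorem finsum_vertexOp_annih {W : VExp} (hW : ∀ n : ℕ+, W.1 (-((n : ℕ) : ℤ)) = 0) (ht : W.2.1 = 0)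
    (F : State → ℂ) (d : State) : ∑ᶠ m, F m * vertexOp ε τ W m d
      = ∑ m ∈ annihSupp ε W d, F m * vertexOp ε τ W m d := by
  refine finsum_eq_sum_of_support_subset _ fun m hm => ?_
  rw [mem_support, vertexOp_annih hW ht] at hm
  have h1 := right_ne_zero_of_mul hm
  rw [ne_eq, ite_eq_right_iff, Classical.not_imp] at h1
  rw [mem_coe, annihSupp, mem_product, mem_singleton, mem_support_iff]
  grind

theorem vertexOp_comp (V : VExp) {W : VExp} (hW : ∀ n : ℕ+, W.1 (-((n : ℕ) : ℤ)) = 0) (ht : W.2.1 = 0)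
    (e d : State) : ∑ m ∈ annihSupp ε W d, vertexOp ε τ V e m * vertexOp ε τ W m d
      = vertexOp ε τ (V + W) e d := by
  set P := annihExp ε W.1 (monomial d.2 1) with hP
  have h1 : creatExp (V + W).1 = creatExp V.1 := creatExp_congr fun n => by
    rw [Prod.fst_add, Pi.add_apply, hW, add_zero]
  have h2 : annihExp ε (V + W).1 (monomial d.2 1)
      = ∑ m ∈ P.support, C (P.coeff m) * annihExp ε V.1 (monomial m 1) := by
    rw [Prod.fst_add, ← annihExp_add, ← hP]
    conv_lhs => rw [P.as_sum, map_sum]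
    refine sum_congr rfl fun m _ => ?_
    rw [← algebraMap_eq, ← Algebra.smul_def, ← map_smul, smul_monomial, smul_eq_mul,
      mul_one]
  rw [annihSupp, sum_product, sum_singleton, ← hP]
  simp only [vertexOp_annih hW ht, if_true]
  rw [← hP, vertexOp, h1, h2]
  have h3 : (V + W).2.1 = V.2.1 := (congrArg (V.2.1 + ·) ht).trans (add_zero _)
  have h4 : (V + W).2.2.1 = V.2.2.1 + W.2.2.1 := rfl
  have h5 : (V + W).2.2.2 = V.2.2.2 + W.2.2.2 := rfl
  rw [h3, h4, h5]
  unfold vertexOp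
  split_ifs with h
  · rw [← coeToMvPowerSeries.ringHom_apply, map_sum, mul_sum, map_sum, mul_sum]
    refine sum_congr rfl fun m _ => ?_
    rw [MvPolynomial.coeToMvPowerSeries.ringHom_apply, MvPolynomial.coe_mul, MvPolynomial.coe_C,
      mul_left_comm (creatExp _), MvPowerSeries.coeff_C_mul, add_mul, add_mul, exp_add, exp_add]
    ring
  · simp

theorem IsGenericLog.exp_ne_one (h : IsGenericLog ε κ) {n : ℤ} (hn : n ≠ 0) (a : Fin 4) :
    1 - exp (-(n * ε a)) ≠ 0 := by
  intro h1
  have h2 := h.gen (Pi.single a n) (by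
    rw [Fintype.prod_eq_single a (fun c hc => by rw [Pi.single_eq_of_ne hc, zpow_zero]), Pi.single_eq_same,
      ← exp_int_mul, ← inv_eq_one, ← exp_neg]
    exact (sub_eq_zero.1 h1).symm) a (a + 1)
  grind

theorem IsGenericLog.opW_sub (h : IsGenericLog ε κ) (ξ : ℂ) {n : ℤ} (hn : n ≠ 0) :
    (opW ε a ξ).1 n - (opW ε a (ξ + κ)).1 n = (opZ ε κ ξ).1 n - (opZ ε κ (ξ + ε a)).1 n := by
  simp only [opW, opZ, ← mul_prod_erase univ (fun b => 1 - exp (-(n * ε b)))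
    (mem_univ a), mul_add, neg_add, exp_add]
  have h1 := h.exp_ne_one hn a
  grind

theorem logBox_update (p : Fin 4 → ℕ) : p a * ε a + logBox ε (update p a 0) = logBox ε p := by
  rw [logBox, logBox, ← add_sum_erase _ _ (mem_univ a),
    ← add_sum_erase _ (fun i => (p i : ℂ) * ε i) (mem_univ a), update_self, Nat.cast_zero,
    zero_mul, zero_add]
  congr 1
  refine sum_congr rfl fun i hi => ?_
  grind

theorem IsGenericLog.sum_modes (h : IsGenericLog ε κ) (hρ : ∀ p ∈ ρ, p a < N) {n : ℤ} (hn : n ≠ 0) :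
    ∑ i ∈ Finset.range N, modes ε κ ξ a ρ i n = (LambdaD8 ε κ ρ ξ).1 n - (opZ ε κ (ξ + N * ε a)).1 n := by
  have h1 : ∀ i, modes ε κ ξ a ρ i n = ((opZ ε κ (ξ + i * ε a)).1 n - (opZ ε κ (ξ + (i + 1 : ℕ) * ε a)).1 n)
      - ∑ p ∈ ρ.filter (fun p => p a = i), (opA (ξ + logBox ε p)).1 n := by
    intro i
    rw [modes, LambdaD6, Prod.fst_sub, Prod.fst_sub, Pi.sub_apply, Pi.sub_apply, h.opW_sub _ hn, Prod.fst_sum,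
      Finset.sum_apply, sum_layer i fun p => (opA (ξ + i * ε a + logBox ε p)).1 n, Nat.cast_succ, add_one_mul,
      add_assoc]
    congr 1
    refine sum_congr rfl fun p hp => ?_
    rw [add_assoc, ← (mem_filter.1 hp).2, logBox_update]
  simp only [h1]
  rw [sum_sub_distrib, sum_range_sub' (fun i : ℕ => (opZ ε κ (ξ + i * ε a)).1 n),
    sum_fiberwise_of_maps_to (g := fun p => p a) fun p hp => mem_range.2 (hρ p hp), LambdaD8,
    Prod.fst_sub, Pi.sub_apply, Prod.fst_sum, Finset.sum_apply, Nat.cast_zero, zero_mul, add_zero]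
  ring

theorem IsGenericLog.isRegLimit_vertexOp (h : IsGenericLog ε κ) (ρ : Finset (Fin 4 → ℕ)) (e d : State) :
    IsRegLimit (exp (ε a)) (fun N => vertexOp ε τ (∑ i ∈ range N,
      LambdaD6 ε κ a (layer a i ρ) (ξ + i * ε a) + opZPlus ε κ (ξ + N * ε a)) e d)
      (vertexOp ε τ (LambdaD8 ε κ ρ ξ) e d) := by
  obtain ⟨M, hM⟩ := exists_bound ρ
  set P := annihExp ε (LambdaD8 ε κ ρ ξ).1 (monomial d.2 1) with hP
  have h0 : (LambdaD8 ε κ ρ ξ).2 = (-(ρ.card : ℤ), -κ, (opZ ε κ ξ).2.2.2) := by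
    rw [LambdaD8, Prod.snd_sub, Prod.snd_sum]
    refine Prod.ext ?_ (Prod.ext ?_ ?_) <;> simp [opZ, opA]
  have h1 : ∀ N ≥ M, vertexOp ε τ (∑ i ∈ range N, LambdaD6 ε κ a (layer a i ρ) (ξ + i * ε a)
      + opZPlus ε κ (ξ + N * ε a)) e d = if e.1 = d.1 + -(ρ.card : ℤ) then exp ((opZ ε κ ξ).2.2.2 * τ) *
        exp (-κ * d.1) * MvPowerSeries.coeff e.2 (creatExp (fun n => (LambdaD8 ε κ ρ ξ).1 n
          - (opZ ε κ (ξ + N * ε a)).1 n) * (P : MvPowerSeries ℕ+ ℂ)) else 0 := by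
    intro N hN
    have hρ : ∀ p ∈ ρ, p a < N := fun p hp => (hM p hp a).trans_le hN
    rw [sum_lambdaD6 hρ, vertexOp]
    have h2 : (N * (ε a * κ) + (opZPlus ε κ (ξ + N * ε a)).2.2.2) = (opZ ε κ ξ).2.2.2 := by
      simp only [opZPlus, opZ]
      ring
    simp only [Prod.fst_add, Prod.snd_add, h2]
    rw [creatExp_congr (c' := fun n => (LambdaD8 ε κ ρ ξ).1 n - (opZ ε κ (ξ + N * ε a)).1 n) fun n => ?_,
      annihExp_congr (c' := (LambdaD8 ε κ ρ ξ).1) fun n => ?_]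
    · simp only [opZPlus, opZ, add_zero, zero_add]
      rfl
    · rw [Pi.add_apply, Finset.sum_apply, h.sum_modes hρ (by simp), opZPlus]
      simp
    · rw [Pi.add_apply, Finset.sum_apply, h.sum_modes hρ (by simp), opZPlus]
      simp
  refine IsRegLimit.congr ?_ (Filter.eventually_atTop.2 ⟨M, fun N hN => (h1 N hN).symm⟩)
  rw [vertexOp, h0, ← hP]
  dsimp only
  split_ifs with he
  · refine (isRegLimit_const _ _).mul ?_
    simp only [MvPowerSeries.coeff_mul]
    refine IsRegLimit.sum fun p _ => IsRegLimit.mul (IsRegLimit.prod fun n _ => ?_) (isRegLimit_const _ _)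
    simp only [div_eq_mul_inv]
    refine IsRegLimit.mul (IsRegLimit.pow ?_ _) (isRegLimit_const _ _)
    have h2 := (isRegLimit_const (exp (ε a)) ((LambdaD8 ε κ ρ ξ).1 (-((n : ℕ) : ℤ)))).add
      ((isRegLimit_const _ (-(opZ ε κ ξ).1 (-((n : ℕ) : ℤ)))).mul (isRegLimit_pow (exp (ε a)) n.ne_zero))
    rw [mul_zero, add_zero] at h2
    refine h2.congr (Filter.Eventually.of_forall fun N => ?_)
    have h3 : exp (-((-((n : ℕ) : ℤ) : ℤ) * (ξ + N * ε a)))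
        = exp (-((-((n : ℕ) : ℤ) : ℤ) * ξ)) * (exp (ε a) ^ N) ^ (n : ℕ) := by
      rw [← exp_nat_mul, ← exp_nat_mul, ← exp_add]
      congr 1
      push_cast
      ring
    simp only [opZ, h3]
    ring
  · exact isRegLimit_const _ _

theorem IsGenericLog.isRegLimit_ordProd (h : IsGenericLog ε κ) (b : Fin 4) (e d : State) :
    IsRegLimit (exp (ε a)) (fun N => ∑ᶠ m : State, ordProd ε κ ξ τ a N k e m *
      vertexOp ε τ (opZPlus ε κ (ξ + N * ε a)) m d) (TD8 ε κ τ b ξ k e d) := by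
  have h1 : ∀ ρ ∈ solids k, IsRegLimit (exp (ε a)) (fun N => stackCoeff ε κ a N ρ *
      vertexOp ε τ (∑ i ∈ range N, LambdaD6 ε κ a (layer a i ρ) (ξ + i * ε a)
        + opZPlus ε κ (ξ + N * ε a)) e d)
      ((-1) ^ signExp b ρ * ZD8 ε κ b ρ * vertexOp ε τ (LambdaD8 ε κ ρ ξ) e d) := fun ρ hρ =>
    (h.isRegLimit_stackCoeff (mem_solids.1 hρ).2 a b).mul (h.isRegLimit_vertexOp ρ e d)
  obtain ⟨M, hM⟩ := exists_bound ((solids k).biUnion fun ρ => ρ)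
  refine (IsRegLimit.sum h1).congr (Filter.eventually_atTop.2 ⟨M, fun N hN => ?_⟩)
  have hW : ∀ n : ℕ+, (opZPlus ε κ (ξ + N * ε a)).1 (-((n : ℕ) : ℤ)) = 0 := fun n => if_neg (by simp)
  rw [finsum_vertexOp_annih hW rfl]
  simp only [ordProd, sum_mul]
  rw [sum_comm, filter_true_of_mem fun ρ hρ p hp =>
    (hM p (mem_biUnion.2 ⟨ρ, hρ, hp⟩) a).trans_le hN]
  refine sum_congr rfl fun ρ _ => ?_
  simp only [mul_assoc, ← mul_sum]
  rw [vertexOp_comp _ hW rfl]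

end Limit
end QQ

theorem mainTheorem1 (ε : Fin 4 → ℂ) (κ ξ τ : ℂ)
    (hprod : ∏ i, Complex.exp (ε i) = 1)
    (hgen : ∀ n : Fin 4 → ℤ, ∏ i, Complex.exp (ε i) ^ n i = 1 → ∀ i j, n i = n j)
    (hK : ∀ n : Fin 4 → ℤ, Complex.exp κ ≠ ∏ i, Complex.exp (ε i) ^ n i)
    (a b : Fin 4) :
    ∃ M : ℕ → ℕ → QQ.Op,
      (∀ (N k : ℕ) (e d : QQ.State),
        QQ.IsStrippedValue (QQ.prodSeries ε κ τ a ξ d N k e) (QQ.oneLoopProd ε κ a N)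
          (M N k e d)) ∧
      (∃ c : ℕ → Finset (Fin 4 → ℕ) → ℂ,
        (∀ (N k : ℕ) (e d : QQ.State),
          M N k e d = ∑ ρ ∈ (QQ.solids k).filter (fun ρ => ∀ p ∈ ρ, p a < N),
            c N ρ * QQ.vertexOp ε τ
              (∑ i ∈ Finset.range N, QQ.LambdaD6 ε κ a (QQ.layer a i ρ) (ξ + i * ε a)) e d) ∧
        ∀ ρ, QQ.IsSolid ρ → QQ.IsRegLimit (Complex.exp (ε a)) (fun N => c N ρ)
          ((-1) ^ QQ.signExp b ρ * QQ.ZD8 ε κ b ρ)) ∧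
      (∀ (k : ℕ) (e d : QQ.State),
        QQ.IsRegLimit (Complex.exp (ε a))
          (fun N => ∑ᶠ m : QQ.State,
            M N k e m * QQ.vertexOp ε τ (QQ.opZPlus ε κ (ξ + N * ε a)) m d)
          (QQ.TD8 ε κ τ b ξ k e d)) := by
  have h : QQ.IsGenericLog ε κ := ⟨hprod, hgen, hK⟩
  refine ⟨QQ.ordProd ε κ ξ τ a, fun N k => h.isStrippedValue, ⟨QQ.stackCoeff ε κ a, fun N k e d => ?_,
    fun ρ hρ => h.isRegLimit_stackCoeff hρ a b⟩, fun k => h.isRegLimit_ordProd b⟩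
  rw [QQ.ordProd]

end
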